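/- **Setting.** Let $\Gamma\subset\mathbb R^3$ be a smooth closed surface, the boundary of a bounded open set, with signed distance function $\rho$ (negative inside), exterior unit normal $n=\nabla\rho$, curvature tensor $\kappa=\nabla\otimes\nabla\rho$, and closest point map $p$, single valued on the tube $U_{\delta_0}(\Gamma)=\{|\rho|<\delta_0\}$, $\delta_0>0$. Let $\alpha:\Gamma\to\mathbb R$ and the tangential field $\beta:\Gamma\to\mathbb R^3$, $\beta\not\equiv0$, be smooth with $\inf_\Gamma(\alpha-\frac12\mathrm{div}_\Gamma\beta)>0$, and let $\beta_\infty=\sup_\Gamma|\beta|$. Let $\Omega_0\supset U_{\delta_0}(\Gamma)$ be a domain with, for each $h\in(0,\bar h]$, a conforming partition into tetrahedra; the partitions are uniformly shape regular and quasiuniform with mesh parameter $h$. For each $h$ let $\Gamma_h$ be a compact connected surface whose intersection with each open tetrahedron lies in a plane. The active mesh $\mathcal T_h$ consists of the tetrahedra whose closure meets $\Gamma_h$. The surface elements $\mathcal K_h$ are the sets $T\cap\Gamma_h$ with $T\in\mathcal T_h$ open, together with the (relatively open) triangular faces shared by two tetrahedra in $\mathcal T_h$ that are contained in $\Gamma_h$;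 their closures cover $\Gamma_h$. The edges $\mathcal E_h$ are the nondegenerate intersections $\partial K_1\cap\partial K_2$ of boundaries of distinct surface elements. Let $n_h$ be the piecewise constant unit normal of $\Gamma_h$, extended as a constant to each $T\in\mathcal T_h$ (if the open $T$ does not meet $\Gamma_h$, one takes the normal of a surface element touching $\overline T$), and let $P_{\Gamma_h}=I-n_h\otimes n_h$, $P_\Gamma=I-n\otimes n$, $\nabla_{\Gamma_h}v=P_{\Gamma_h}\nabla v$. Let $\alpha_h,\beta_h$ be functions on $\Gamma_h$ which are $C^1$ up to the boundary on each $K\in\mathcal K_h$. Assume, with constants independent of $h\in(0,\bar h]$: * (A) $\Gamma_h\subset U_{\delta_0}(\Gamma)$, $p:\Gamma_h\to\Gamma$ is a bijection, $|\rho|\lesssim h^2$ and $|n-n_h|\lesssim h$ on $\Gamma_h$; * (B) $0<\alpha_{h_0,0}\le\alpha_h-\frac12\mathrm{div}_{\Gamma_h}\beta_h$ on $\Gamma_h$, and $|\nu_{h,K_1}\cdot\beta_h|_{K_1}+\nu_{h,K_2}\cdot\beta_h|_{K_2}|\lesssim h^2$ on every edge $\partial K_1\cap\partial K_2\in\mathcal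 E_h$, where $\nu_{h,K_i}$ is the exterior unit conormal of $K_i$; * (C) $\beta_h=P_{\Gamma_h}\beta_h$, $|\alpha_h|+|\beta_h|\lesssim1$, $|\beta\circ p-|B|^{-1}B\beta_h|\lesssim h^2$ and $|\alpha\circ p-|B|^{-1}\alpha_h|\lesssim h^2$ on $\Gamma_h$, where $B=P_\Gamma(I-\rho\kappa)P_{\Gamma_h}$ and $|B|$ is the absolute value of the determinant of $B$ as a map between the tangent planes of $\Gamma_h$ and $\Gamma$. Let $V_h$ be the space of continuous piecewise linear functions on $\mathcal T_h$. For $\epsilon\ge0$, $c_\tau>0$, $\gamma\in\mathbb R$, $\tau_2>0$ let $\tau_1=c_\tau\min(\beta_\infty^{-1},h\epsilon^{-1})$ and $$\begin{aligned}A_h(v,w)={}&(\beta_h\cdot\nabla_{\Gamma_h}v,w)_{\mathcal K_h}+(\alpha_hv,w)_{\mathcal K_h}+\epsilon(\nabla_{\Gamma_h}v,\nabla_{\Gamma_h}w)_{\mathcal K_h}\\&+\tau_1h(\beta_h\cdot\nabla_{\Gamma_h}v+\alpha_hv,\beta_h\cdot\nabla_{\Gamma_h}w)_{\mathcal K_h}+\tau_2h^\gamma(n_h\cdot\nabla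 v,n_h\cdot\nabla w)_{\mathcal T_h},\\ |||v|||_h^2={}&\|v\|_{\mathcal K_h}^2+\epsilon\|\nabla_{\Gamma_h}v\|_{\mathcal K_h}^2+\tau_1h\|\beta_h\cdot\nabla_{\Gamma_h}v\|_{\mathcal K_h}^2+\tau_2h^\gamma\|n_h\cdot\nabla v\|_{\mathcal T_h}^2,\end{aligned}$$ and $L_h(v)=(f\circ p,v)_{\mathcal K_h}+\tau_1h(f\circ p,\beta_h\cdot\nabla_{\Gamma_h}v)_{\mathcal K_h}$ for $f\in L^2(\Gamma)$, where the inner products are those of $L^2$ over the surface elements and the active tetrahedra, respectively. **Lemma (coercivity).** Let $\gamma<2$, $c_\tau>0$ and $t_0>0$. There are constants $C,D,c>0$ such that for all $h_0\in(0,\bar h]$, $h\in(0,h_0]$, $\epsilon\ge0$, $\tau_2\ge t_0$ (for instance $\tau_2=\tau_1^{-1}$, with $t_0=\beta_\infty/c_\tau$) and $v\in V_h$, $$c\,\min\big(1,\ \alpha_{h_0,0}-Ch_0,\ 1-Dh_0^{2-\gamma}\big)\,|||v|||_h^2\le A_h(v,v).$$ Moreover there is $h_1\in(0,\bar h]$ such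 that $c_{coer}=\min(1,\alpha_{h_0,0}-Ch_0,1-Dh_0^{2-\gamma})>0$ for all $h_0\in(0,h_1]$, and such that for all $h\in(0,h_1]$, $\epsilon\ge0$, $\tau_2\ge t_0$ and $f\in L^2(\Gamma)$ there is exactly one $u_h\in V_h$ with $A_h(u_h,w)=L_h(w)$ for all $w\in V_h$. -/

import Mathlib

open Set Filter Topology MeasureTheory
open scoped ContDiff

noncomputable section

namespace SurfaceFEM

/-- Three dimensional Euclidean space. -/
abbrev E3 : Type := EuclideanSpace ℝ (Fin 3)

/-- The map `y ↦ y - (m · y) m`, i.e. `I - m ⊗ m`; for a unit vector `m` it is the orthogonal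
projection onto the plane orthogonal to `m`. -/
def tangentProj (m : E3) : E3 →L[ℝ] E3 :=
  ContinuousLinearMap.id ℝ E3 - (innerSL ℝ m).smulRight m

/-! ### The smooth surface -/

/-- A bounded open set with smooth boundary: near each boundary point the set is the sublevel
set `{φ < 0}` of a smooth function with nonvanishing differential. Its boundary is a smooth closed
surface embedded in three dimensional space. -/
structure SmoothClosedSurface where
  inside : Set E3
  isOpen_inside : IsOpen inside
  isBounded_inside : Bornology.IsBounded inside
  nonempty_inside : inside.Nonempty
  smooth : ∀ x ∈ frontier inside, ∃ (U : Set E3) (φ : E3 → ℝ), IsOpen U ∧ x ∈ U ∧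
    ContDiffOn ℝ ∞ φ U ∧ fderiv ℝ φ x ≠ 0 ∧ inside ∩ U = {y ∈ U | φ y < 0}

namespace SmoothClosedSurface

variable (S : SmoothClosedSurface)

/-- The surface `Γ`. -/
def surf : Set E3 := frontier S.inside

open Classical in
/-- The signed distance function `ρ`, negative inside and positive outside. -/
def sdist (x : E3) : ℝ :=
  if x ∈ S.inside then -Metric.infDist x S.surf else Metric.infDist x S.surf

/-- The open tubular neighbourhood `U_δ(Γ)`. -/
def tube (δ : ℝ) : Set E3 := {x | |S.sdist x| < δ}

/-- The closest point mapping `p`. -/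
def proj (x : E3) : E3 :=
  Classical.epsilon fun y => y ∈ S.surf ∧ dist x y = Metric.infDist x S.surf

/-- Every point of `U_δ(Γ)` has exactly one closest point on `Γ`. -/
def UniqueProj (δ : ℝ) : Prop :=
  ∀ x ∈ S.tube δ, ∃! y, y ∈ S.surf ∧ dist x y = Metric.infDist x S.surf

/-- The exterior unit normal `n = ∇ρ`. -/
def normal (x : E3) : E3 := gradient S.sdist x

/-- The curvature tensor `κ = ∇ ⊗ ∇ρ`. -/
def curv (x : E3) : E3 →L[ℝ] E3 := fderiv ℝ S.normal x

/-- The surface divergence `div_Γ b = div (b^e) - n · (b^e ⊗ ∇) n` with `b^e = b ∘ p`. -/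
def surfDiv (b : E3 → E3) (x : E3) : ℝ :=
  LinearMap.trace ℝ E3 (fderiv ℝ (b ∘ S.proj) x : E3 →ₗ[ℝ] E3)
    - inner ℝ (S.normal x) (fderiv ℝ (b ∘ S.proj) x (S.normal x))

/-- The supremum of `|b|` over `Γ`. -/
def supNorm (b : E3 → E3) : ℝ := sSup ((fun x => ‖b x‖) '' S.surf)

/-- The map `B = P_Γ (I - ρ κ) P_{Γ_h}` at a point at which the discrete unit normal is `m`. -/
def mapB (m x : E3) : E3 →L[ℝ] E3 :=
  (tangentProj (S.normal x)).comp
    ((ContinuousLinearMap.id ℝ E3 - S.sdist x • S.curv x).comp (tangentProj m))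

/-- `|B|`, the absolute value of the determinant of `B` as a map from the plane orthogonal to `m`
to the plane orthogonal to `n`. It is computed as a determinant on the whole space, by letting the
unit vector `m` be mapped to the unit vector `n`. -/
def absDetB (m x : E3) : ℝ :=
  |LinearMap.det ((S.mapB m x + (innerSL ℝ m).smulRight (S.normal x) : E3 →L[ℝ] E3) :
    E3 →ₗ[ℝ] E3)|

end SmoothClosedSurface

/-- The coefficients `α`, `β` on `Γ`: smooth (i.e. their extensions `α ∘ p`, `β ∘ p` are smooth in
the tubular neighbourhood), `β` tangential and not identically zero, and
`α - (1/2) div_Γ β ≥ α₀ > 0`. -/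
structure IsCoefficients (S : SmoothClosedSurface) (δ : ℝ) (α : E3 → ℝ) (β : E3 → E3) : Prop where
  smooth_α : ContDiffOn ℝ ∞ (α ∘ S.proj) (S.tube δ)
  smooth_β : ContDiffOn ℝ ∞ (β ∘ S.proj) (S.tube δ)
  tangential : ∀ x ∈ S.surf, inner ℝ (S.normal x) (β x) = 0
  nonzero : ∃ x ∈ S.surf, β x ≠ 0
  coercive : ∃ α₀ : ℝ, 0 < α₀ ∧ ∀ x ∈ S.surf, α₀ ≤ α x - 1 / 2 * S.surfDiv β x

/-! ### Meshes and discrete surfaces -/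

/-- The closed simplex with the given vertices. -/
def closedCell (s : Finset E3) : Set E3 := convexHull ℝ (s : Set E3)

/-- The open tetrahedron with the given vertices. -/
def openCell (s : Finset E3) : Set E3 := interior (closedCell s)

/-- A finite conforming mesh of nondegenerate tetrahedra, given by their vertex sets. -/
structure TetMesh where
  cells : Finset (Finset E3)
  card_eq : ∀ s ∈ cells, s.card = 4
  affineIndep : ∀ s ∈ cells, AffineIndependent ℝ ((↑) : s → E3)
  conforming : ∀ s ∈ cells, ∀ t ∈ cells,
    closedCell s ∩ closedCell t = convexHull ℝ ((s : Set E3) ∩ (t : Set E3))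

/-- The mesh is a partition of (the closure of) `Ω`. -/
def TetMesh.Partitions (M : TetMesh) (Ω : Set E3) : Prop :=
  ⋃ s ∈ M.cells, closedCell s = closure Ω

/-- The tetrahedra of a family of meshes are uniformly shape regular for `h ∈ (0, hmax]`. -/
def ShapeRegular (M : ℝ → TetMesh) (hmax : ℝ) : Prop :=
  ∃ σ : ℝ, 0 < σ ∧ ∀ h ∈ Ioc 0 hmax, ∀ s ∈ (M h).cells,
    ∃ z, Metric.ball z (σ * Metric.diam (closedCell s)) ⊆ closedCell s

/-- The meshes are quasiuniform with mesh parameter `h ∈ (0, hmax]`. -/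
def QuasiUniform (M : ℝ → TetMesh) (hmax : ℝ) : Prop :=
  ∃ c₁ c₂ : ℝ, 0 < c₁ ∧ 0 < c₂ ∧ ∀ h ∈ Ioc 0 hmax, ∀ s ∈ (M h).cells,
    c₁ * h ≤ Metric.diam (closedCell s) ∧ Metric.diam (closedCell s) ≤ c₂ * h

/-- The data entering the method for one mesh size: the mesh, the discrete surface `Γ_h`, its
piecewise constant normal `n_h`, and the discrete coefficients `α_h`, `β_h`. -/
structure DiscreteData where
  mesh : TetMesh
  surf : Set E3
  normal : E3 → E3
  α : E3 → ℝ
  β : E3 → E3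

namespace DiscreteData

variable (d : DiscreteData)

/-- The active mesh `T_h`: the tetrahedra whose closure meets `Γ_h`. -/
def active : Set (Finset E3) := {s | s ∈ d.mesh.cells ∧ (closedCell s ∩ d.surf).Nonempty}

/-- The set `F_h` of (relatively open) triangular faces shared by two tetrahedra in `T_h`. -/
def faces : Set (Set E3) :=
  {F | ∃ s ∈ d.active, ∃ t ∈ d.active, ((s : Set E3) ∩ (t : Set E3)).ncard = 3 ∧
    F = intrinsicInterior ℝ (closedCell s ∩ closedCell t)}

/-- The set `K_h` of surface elements: the intersections of `Γ_h` with the open tetrahedra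
in `T_h`, and the faces contained in `Γ_h`. -/
def elements : Set (Set E3) :=
  {K | ∃ s ∈ d.active, K = openCell s ∩ d.surf} ∪ {F | F ∈ d.faces ∧ F ⊆ d.surf}

/-- The (relative) boundary of a surface element, which is relatively open in its plane. -/
def bdry (K : Set E3) : Set E3 := closure K \ K

/-- The union of the surface elements; it is all of `Γ_h` up to the element boundaries. -/
def elementSet : Set E3 := ⋃₀ d.elements

/-- The union of the open tetrahedra in the active mesh. -/
def bulk : Set E3 := ⋃ s ∈ d.active, openCell s

/-- The union of the closed tetrahedra in the active mesh. -/
def closedBulk : Set E3 := ⋃ s ∈ d.active, closedCell s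

/-- `Γ_h` is a compact connected surface which is covered by the (closures of the) surface elements,
its intersection with each open tetrahedron is contained in a plane, and `n_h` is its piecewise
constant unit normal. On a tetrahedron of the active mesh which meets `Γ_h` only in its
boundary, `n_h` is the normal of a surface element touching that tetrahedron. -/
structure IsDiscreteSurface : Prop where
  isCompact : IsCompact d.surf
  isConnected : IsConnected d.surf
  covered : d.surf ⊆ ⋃ K ∈ d.elements, closure K
  normal_cell : ∀ s ∈ d.active, ∃ m : E3, ‖m‖ = 1 ∧ (∀ x ∈ openCell s, d.normal x = m) ∧
    (∀ x ∈ openCell s ∩ d.surf, ∀ y ∈ openCell s ∩ d.surf, inner ℝ m (x - y) = 0) ∧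
    (openCell s ∩ d.surf = ∅ → ∃ K ∈ d.elements, (closure K ∩ closedCell s).Nonempty ∧
      ∃ y ∈ K, d.normal y = m)
  normal_face : ∀ F ∈ d.faces, F ⊆ d.surf → ∃ m : E3, ‖m‖ = 1 ∧ (∀ x ∈ F, d.normal x = m) ∧
    ∀ x ∈ F, ∀ y ∈ F, inner ℝ m (x - y) = 0

/-- `ν` is the exterior conormal of the surface element `K` along the edge `E`: a unit vector
tangent to `K`, orthogonal to `E` and pointing out of the (convex) element `K`. -/
def IsConormal (K E : Set E3) (ν : E3) : Prop :=
  ‖ν‖ = 1 ∧ (∀ y ∈ K, inner ℝ ν (d.normal y) = 0) ∧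
  (∀ x ∈ E, ∀ y ∈ E, inner ℝ ν (x - y) = 0) ∧ ∀ x ∈ E, ∀ y ∈ K, inner ℝ ν (y - x) ≤ 0

/-- The jump `[ν_h · β_h]` is bounded by `c` on all edges `E = ∂K₁ ∩ ∂K₂` of the surface elements,
where the values of `β_h` are the traces from `K₁` and `K₂`, respectively. Intersections which
consist of at most one point are not edges. -/
def JumpBound (c : ℝ) : Prop :=
  ∀ K₁ ∈ d.elements, ∀ K₂ ∈ d.elements, K₁ ≠ K₂ → (bdry K₁ ∩ bdry K₂).Nontrivial →
    ∀ ν₁ ν₂ : E3, d.IsConormal K₁ (bdry K₁ ∩ bdry K₂) ν₁ →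
      d.IsConormal K₂ (bdry K₁ ∩ bdry K₂) ν₂ →
      ∀ x ∈ bdry K₁ ∩ bdry K₂, ∀ b₁ b₂ : E3,
        Tendsto d.β (𝓝[K₁] x) (𝓝 b₁) → Tendsto d.β (𝓝[K₂] x) (𝓝 b₂) →
        |inner ℝ ν₁ b₁ + inner ℝ ν₂ b₂| ≤ c

/-- The tangential gradient `∇_{Γ_h} v` at a point of a surface element, that is, the gradient of
the extension of `v` which is constant in the direction of `n_h`. If `v` is differentiable
at `x`, it equals `(I - n_h ⊗ n_h) ∇v`; it is also defined for the continuous piecewise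
linear functions on elements which are faces of the mesh, where only the tangential part of `∇v` is
single valued. -/
def tgrad (v : E3 → ℝ) (x : E3) : E3 :=
  gradient (fun y => v (x + tangentProj (d.normal x) (y - x))) x

/-- The surface divergence `div_{Γ_h} b` at a point of a surface element, that is, the divergence of
the extension of `b` which is constant in the direction of `n_h`. -/
def tdiv (b : E3 → E3) (x : E3) : ℝ :=
  LinearMap.trace ℝ E3
    (fderiv ℝ (fun y => b (x + tangentProj (d.normal x) (y - x))) x : E3 →ₗ[ℝ] E3)

/-- `α_h` and `β_h` are elementwise `C¹` up to the element boundaries (for instance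
elementwise polynomial), and `β_h` is tangential. -/
structure IsCoefficients : Prop where
  regular_α : ∀ K ∈ d.elements, ∃ a : E3 → ℝ, ContDiff ℝ 1 a ∧ EqOn d.α a K
  regular_β : ∀ K ∈ d.elements, ∃ b : E3 → E3, ContDiff ℝ 1 b ∧ EqOn d.β b K
  tangential : ∀ x ∈ d.elementSet, tangentProj (d.normal x) (d.β x) = d.β x

/-- The space `V_h` of continuous piecewise linear functions on the active mesh. A function
on the union of the closed active tetrahedra is represented by its extension by zero. -/
def space : Set (E3 → ℝ) :=
  {v | ContinuousOn v d.closedBulk ∧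
    (∀ s ∈ d.active, ∃ (g : E3) (c : ℝ), ∀ x ∈ closedCell s, v x = inner ℝ g x + c) ∧
    ∀ x ∉ d.closedBulk, v x = 0}

/-- The integral over the surface elements `K_h` with respect to surface area. -/
def intK (φ : E3 → ℝ) : ℝ := ∫ x in d.elementSet, φ x ∂μHE[2]

/-- The integral over the tetrahedra of the active mesh. -/
def intT (φ : E3 → ℝ) : ℝ := ∫ x in d.bulk, φ x

/-- The streamline derivative `β_h · ∇_{Γ_h} v`. -/
def stream (v : E3 → ℝ) (x : E3) : ℝ := inner ℝ (d.β x) (d.tgrad v x)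

/-- The normal derivative `n_h · ∇v` in the active mesh. -/
def nderiv (v : E3 → ℝ) (x : E3) : ℝ := inner ℝ (d.normal x) (gradient v x)

/-- The form `a_h`. -/
def formA (ε : ℝ) (v w : E3 → ℝ) : ℝ :=
  d.intK (fun x => d.stream v x * w x) + d.intK (fun x => d.α x * v x * w x)
    + ε * d.intK (fun x => inner ℝ (d.tgrad v x) (d.tgrad w x))

/-- The streamline diffusion stabilization `s_{h,1}`. -/
def formS1 (h τ₁ : ℝ) (v w : E3 → ℝ) : ℝ :=
  τ₁ * h * d.intK (fun x => (d.stream v x + d.α x * v x) * d.stream w x)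

/-- The normal gradient stabilization `s_{h,2}`. -/
def formS2 (h γ τ₂ : ℝ) (v w : E3 → ℝ) : ℝ :=
  τ₂ * h ^ γ * d.intT (fun x => d.nderiv v x * d.nderiv w x)

/-- The form `A_h = a_h + s_{h,1} + s_{h,2}`. -/
def form (h γ ε τ₁ τ₂ : ℝ) (v w : E3 → ℝ) : ℝ :=
  d.formA ε v w + d.formS1 h τ₁ v w + d.formS2 h γ τ₂ v w

/-- The right hand side `L_h` for a function `fe` on `Γ_h`. -/
def rhs (h τ₁ : ℝ) (fe : E3 → ℝ) (v : E3 → ℝ) : ℝ :=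
  d.intK (fun x => fe x * v x) + τ₁ * h * d.intK (fun x => fe x * d.stream v x)

/-- The square of the mesh dependent norm. -/
def normSq (h γ ε τ₁ τ₂ : ℝ) (v : E3 → ℝ) : ℝ :=
  d.intK (fun x => v x ^ 2) + ε * d.intK (fun x => ‖d.tgrad v x‖ ^ 2)
    + τ₁ * h * d.intK (fun x => d.stream v x ^ 2)
    + τ₂ * h ^ γ * d.intT (fun x => d.nderiv v x ^ 2)

end DiscreteData

/-! ### Assumptions on the discrete family, for `h ∈ (0, hmax]` -/

/-- Geometric approximation: `Γ_h ⊆ U_δ(Γ)`, `p : Γ_h → Γ` is a bijection, `|ρ| ≲ h²` on `Γ_h`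
and `|n - n_h| ≲ h` on `Γ_h`. -/
structure AssumptionA (S : SmoothClosedSurface) (δ : ℝ) (d : ℝ → DiscreteData) (hmax : ℝ) :
    Prop where
  subset_tube : ∀ h ∈ Ioc 0 hmax, (d h).surf ⊆ S.tube δ
  bijOn : ∀ h ∈ Ioc 0 hmax, BijOn S.proj (d h).surf S.surf
  dist_le : ∃ c : ℝ, ∀ h ∈ Ioc 0 hmax, ∀ x ∈ (d h).surf, |S.sdist x| ≤ c * h ^ 2
  normal_le : ∃ c : ℝ, ∀ h ∈ Ioc 0 hmax, ∀ x ∈ (d h).elementSet,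
    ‖S.normal x - (d h).normal x‖ ≤ c * h

/-- Stability of the discrete coefficients: `0 < a ≤ α_h - (1/2) div_{Γ_h} β_h` on `Γ_h`, and
`|[ν_h · β_h]| ≲ h²` on the edges. -/
structure AssumptionB (d : ℝ → DiscreteData) (hmax a : ℝ) : Prop where
  pos : 0 < a
  lower : ∀ h ∈ Ioc 0 hmax, ∀ x ∈ (d h).elementSet,
    a ≤ (d h).α x - 1 / 2 * (d h).tdiv (d h).β x
  jump : ∃ c : ℝ, ∀ h ∈ Ioc 0 hmax, (d h).JumpBound (c * h ^ 2)

/-- Approximation of the coefficients: `α_h`, `β_h` are elementwise regular, `β_h` is tangential,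
both are bounded uniformly in `h`, and
`|β - |B|⁻¹ B β_h| ≲ h²`, `|α - |B|⁻¹ α_h| ≲ h²`. -/
structure AssumptionC (S : SmoothClosedSurface) (α : E3 → ℝ) (β : E3 → E3)
    (d : ℝ → DiscreteData) (hmax : ℝ) : Prop where
  coeff : ∀ h ∈ Ioc 0 hmax, (d h).IsCoefficients
  stable : ∃ c : ℝ, ∀ h ∈ Ioc 0 hmax, ∀ x ∈ (d h).elementSet,
    |(d h).α x| ≤ c ∧ ‖(d h).β x‖ ≤ c
  approx_β : ∃ c : ℝ, ∀ h ∈ Ioc 0 hmax, ∀ x ∈ (d h).elementSet,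
    ‖β (S.proj x) - (S.absDetB ((d h).normal x) x)⁻¹ • S.mapB ((d h).normal x) x ((d h).β x)‖
      ≤ c * h ^ 2
  approx_α : ∃ c : ℝ, ∀ h ∈ Ioc 0 hmax, ∀ x ∈ (d h).elementSet,
    |α (S.proj x) - (S.absDetB ((d h).normal x) x)⁻¹ * (d h).α x| ≤ c * h ^ 2

/-- The parameter `τ₁ = c_τ min (1 / β_∞) (h / ε)`, with `h / ε = ∞` for `ε = 0`. -/
def tauOne (cτ βinf ε h : ℝ) : ℝ :=
  if ε ≤ βinf * h then cτ * βinf⁻¹ else cτ * h * ε⁻¹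

end SurfaceFEM

end

open SurfaceFEM

open scoped ENNReal

noncomputable section
namespace SurfaceFEM

/-! ### The tubular neighbourhood -/

/-! The delicate term is the convection term (β_h · ∇v, v) on the polyhedral surface Γ_h.
Integrating it by parts element by element would produce conormal terms on every edge. Here the
integration by parts takes place in the three dimensional tube around Γ, and its result is pushed
down to Γ_h.

Write points of the tube as x = p(y) + t n(y) with y in Γ_h. In these coordinates jac(x) dx = |B|(y)
dσ(y) dt with jac = det(I - ρκ), so a function that factorises in (y, t) has a product integral
(`Approx.integral_shell_mul`). Extend β to Y = jac (β∘p + ρ κ(p) β(p)), which is tangent to the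
parallel surfaces. On Γ its divergence is div_Γ β, so by continuity the strict inequality for α - ½
div_Γ β on Γ gives div Y ≤ jac (2 α∘p - α₀) in a thin tube (`exists_transportField`). For v in V_h
let f be v² extended constantly along the normals of Γ and cut off in ρ. Since v is continuous
across edges, f is Lipschitz, and ∫ Df(Y) = -∫ f div Y holds without any interface term. In normal
coordinates this reads 0 ≤ ∫ |B| (2 v ∇v·w + (2 α∘p - α₀) v²) over Γ_h, where w is the tangential
lift of β to Γ_h (`Approx.integral_lift_nonneg`). Because |B| w = β_h + O(h²) and |B| α∘p = α_h +
O(h²), convection plus reaction is at least (α₀/4) ‖v‖², up to multiples of h² ∫ |v| |∇v| and h²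
‖v‖² (`Approx.le_convection_add_reaction`).

The first error needs the inverse estimate h² ‖∇_{Γ_h} v‖² ≲ ‖v‖² + h ‖n_h·∇v‖² over the active mesh
(`Approx.intK_tgrad_le`). It is not local to one tetrahedron, since Γ_h may cut a tetrahedron in an
arbitrarily small piece or only touch it. Instead, each active tetrahedron contains a ball of radius
comparable to h whose points are joined to Γ_h by normal segments inside active tetrahedra
(`Approx.exists_ball`). On that ball v differs from its value at the foot by a normal derivative,
and an affine function on a ball controls its gradient. Summing with finite overlap, and absorbing
the O(h) difference between n and n_h, bounds all cell gradients (`Approx.gradSum_le`). Since γ < 2,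
h² is a small multiple of h^γ, so the stabilization absorbs what remains.

This yields coercivity with a fixed constant c for h below a threshold H. For h > H also h₀ > H; the
constant C is so large that the asserted lower bound is then a large negative multiple of the
squared norm, and a crude estimate suffices (`neg_mul_normSq_le_form`). Unique solvability follows
because V_h is finite dimensional and the squared norm vanishes only at zero: the inverse estimate
makes all cell gradients vanish, and v vanishes on Γ_h, which meets every active tetrahedron. -/

lemma inner_gradient_apply (f : E3 → ℝ) (x h : E3) : inner ℝ (gradient f x) h = fderiv ℝ f x h := by
  simp [gradient, InnerProductSpace.toDual_symm_apply]

lemma gradient_eq_zero_iff {f : E3 → ℝ} {x : E3} : gradient f x = 0 ↔ fderiv ℝ f x = 0 := by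
  simp [gradient]

lemma contDiffAt_gradient {f : E3 → ℝ} {x : E3} {n m : WithTop ℕ∞} (hf : ContDiffAt ℝ n f x)
    (hmn : m + 1 ≤ n) : ContDiffAt ℝ m (gradient f) x := by
  have h := hf.fderiv_right hmn
  exact ((InnerProductSpace.toDual ℝ E3).symm.contDiff (n := m)).contDiffAt.comp x h

namespace SmoothClosedSurface
variable (S : SmoothClosedSurface)

lemma isCompact_surf : IsCompact S.surf := by
  refine Metric.isCompact_of_isClosed_isBounded isClosed_frontier ?_
  exact S.isBounded_inside.closure.subset frontier_subset_closure

lemma surf_nonempty : S.surf.Nonempty := by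
  refine nonempty_frontier_iff.2 ⟨S.nonempty_inside, fun h => ?_⟩
  have := S.isBounded_inside
  rw [h] at this
  exact NormedSpace.unbounded_univ ℝ E3 this

lemma abs_sdist (x : E3) : |S.sdist x| = Metric.infDist x S.surf := by
  unfold sdist; split_ifs <;> simp [abs_of_nonneg Metric.infDist_nonneg]

lemma isOpen_tube (δ : ℝ) : IsOpen (S.tube δ) := by
  simp only [tube, abs_sdist]
  exact isOpen_lt (Metric.continuous_infDist_pt _) continuous_const

lemma proj_spec (x : E3) : S.proj x ∈ S.surf ∧ dist x (S.proj x) = Metric.infDist x S.surf := by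
  refine Classical.epsilon_spec
    (p := fun y => y ∈ S.surf ∧ dist x y = Metric.infDist x S.surf) ?_
  obtain ⟨y, hy, h⟩ := S.isCompact_surf.exists_infDist_eq_dist S.surf_nonempty x
  exact ⟨y, hy, h.symm⟩

lemma proj_of_mem {y : E3} (hy : y ∈ S.surf) : S.proj y = y := by
  have := (S.proj_spec y).2
  rw [Metric.infDist_zero_of_mem hy] at this
  exact (dist_eq_zero.1 this).symm

lemma sdist_of_mem {y : E3} (hy : y ∈ S.surf) : S.sdist y = 0 := by
  rw [← abs_eq_zero, abs_sdist, Metric.infDist_zero_of_mem hy]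

lemma surf_subset_tube {δ : ℝ} (hδ : 0 < δ) : S.surf ⊆ S.tube δ := fun y hy => by
  simpa [tube, S.sdist_of_mem hy] using hδ

/-- Regularity of the signed distance function in the tube of radius `δ`. -/
structure TubeReg (δ : ℝ) : Prop where
  pos : 0 < δ
  smooth : ∀ x ∈ S.tube δ, ContDiffAt ℝ 4 S.sdist x
  norm_normal : ∀ x ∈ S.tube δ, ‖S.normal x‖ = 1
  proj_eq : ∀ x ∈ S.tube δ, S.proj x = x - S.sdist x • S.normal x
  normal_proj : ∀ x ∈ S.tube δ, S.normal (S.proj x) = S.normal x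
  sdist_add : ∀ y ∈ S.surf, ∀ t : ℝ, |t| < δ → S.sdist (y + t • S.normal y) = t
  proj_add : ∀ y ∈ S.surf, ∀ t : ℝ, |t| < δ → S.proj (y + t • S.normal y) = y

variable {S}

lemma eq_zero_of_mem_surf {U : Set E3} {φ : E3 → ℝ} (hU : IsOpen U) (hφ : ContDiffOn ℝ ∞ φ U)
    (hin : S.inside ∩ U = {y ∈ U | φ y < 0}) {y : E3} (hy : y ∈ U) (hyS : y ∈ S.surf) :
    φ y = 0 := by
  have hcont : ContinuousAt φ y := hφ.continuousOn.continuousAt (hU.mem_nhds hy)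
  apply le_antisymm
  · by_contra! h
    have h1 : ∀ᶠ z in 𝓝 y, 0 < φ z := hcont.eventually (lt_mem_nhds h)
    have h2 : ∀ᶠ z in 𝓝 y, z ∈ U := hU.mem_nhds hy
    obtain ⟨z, ⟨hz1, hz2⟩, hz3⟩ := mem_closure_iff_nhds.1 (frontier_subset_closure hyS) _ (h1.and h2)
    have : z ∈ {y ∈ U | φ y < 0} := hin ▸ ⟨hz3, hz2⟩
    exact absurd this.2 (not_lt.2 hz1.le)
  · by_contra! h
    have : y ∈ S.inside ∩ U := hin ▸ ⟨hy, h⟩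
    rw [surf, S.isOpen_inside.frontier_eq] at hyS
    exact hyS.2 this.1

/-- The nonvanishing differential is essential: off the closure of the inside φ would be nonnegative
nearby, so a zero of φ would be a local minimum and hence critical. -/
lemma mem_surf_of_eq_zero {U : Set E3} {φ : E3 → ℝ} (hU : IsOpen U)
    (hin : S.inside ∩ U = {y ∈ U | φ y < 0}) {y : E3} (hy : y ∈ U) (h0 : φ y = 0)
    (hd : fderiv ℝ φ y ≠ 0) : y ∈ S.surf := by
  rw [surf, S.isOpen_inside.frontier_eq]
  constructor
  · by_contra hcl
    refine hd (IsLocalMin.fderiv_eq_zero ?_)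
    have h1 : ∀ᶠ z in 𝓝 y, z ∈ (closure S.inside)ᶜ := isClosed_closure.isOpen_compl.mem_nhds hcl
    filter_upwards [h1, hU.mem_nhds hy] with z hz hzU
    rw [h0]
    by_contra! h
    have : z ∈ S.inside ∩ U := hin ▸ ⟨hzU, h⟩
    exact hz (subset_closure this.1)
  · intro h
    have : y ∈ {y ∈ U | φ y < 0} := hin ▸ ⟨h, hy⟩
    exact absurd this.2 (by simp [h0])

/-- A closest point satisfies the Lagrange condition. -/
lemma exists_lagrange {U : Set E3} {φ : E3 → ℝ} (hU : IsOpen U) (hφ : ContDiffOn ℝ ∞ φ U)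
    (hin : S.inside ∩ U = {y ∈ U | φ y < 0}) (hd : ∀ y ∈ U, fderiv ℝ φ y ≠ 0) {x : E3}
    (hp : S.proj x ∈ U) : ∃ l : ℝ, x = S.proj x + l • gradient φ (S.proj x) := by
  set p := S.proj x with hpdef
  have hφp : φ p = 0 := eq_zero_of_mem_surf hU hφ hin hp (S.proj_spec x).1
  -- The level set of φ near p lies in Γ, and p is a nearest point of Γ to x; hence p minimises the
  -- distance to x along the level set and the multiplier rule applies.
  have hext : IsLocalExtrOn (fun y => ‖y - x‖ ^ 2) {y | φ y = φ p} p := by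
    left
    rw [IsMinFilter]
    filter_upwards [self_mem_nhdsWithin, mem_nhdsWithin_of_mem_nhds (hU.mem_nhds hp)] with y hy hyU
    have hyS : y ∈ S.surf := mem_surf_of_eq_zero hU hin hyU (by rw [hy, hφp]) (hd y hyU)
    have h1 := Metric.infDist_le_dist_of_mem (x := x) hyS
    rw [← (S.proj_spec x).2, ← hpdef, dist_comm x p, dist_comm x y, dist_eq_norm, dist_eq_norm] at h1
    gcongr
  have hsφ : HasStrictFDerivAt φ (fderiv ℝ φ p) p :=
    (hφ.contDiffAt (hU.mem_nhds hp)).hasStrictFDerivAt (by simp)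
  have hsq : HasStrictFDerivAt (fun y : E3 => ‖y - x‖ ^ 2) (2 • (innerSL ℝ (p - x))) p := by
    have := (hasStrictFDerivAt_norm_sq (p - x)).comp p ((hasStrictFDerivAt_id p).sub_const x)
    simpa using this
  obtain ⟨a, b, hab, h⟩ := hext.exists_multipliers_of_hasStrictFDerivAt_1d hsφ hsq
  have key : ∀ v, a * inner ℝ (gradient φ p) v + b * (2 * inner ℝ (p - x) v) = 0 := by
    intro v
    have := congrArg (fun L => L v) h
    simpa [inner_gradient_apply, inner_sub_left] using this
  have key2 : a • gradient φ p + (2 * b) • (p - x) = 0 := by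
    rw [← inner_self_eq_zero (𝕜 := ℝ)]
    have := key (a • gradient φ p + (2 * b) • (p - x))
    simp only [inner_add_left, inner_smul_left] at this ⊢
    simp only [RCLike.conj_to_real]
    linarith
  have hg : gradient φ p ≠ 0 := fun h => hd p hp (gradient_eq_zero_iff.1 h)
  -- The multiplier of the squared distance cannot vanish, as otherwise a nonzero multiple of ∇φ(p)
  -- would be zero.
  have hb : b ≠ 0 := by
    rintro rfl
    have : a ≠ 0 := by simpa using hab
    simp [this, hg] at key2
  refine ⟨a / (2 * b), ?_⟩
  have h3 : x - p = (a / (2 * b)) • gradient φ p := by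
    have : (2 * b) • (x - p) = a • gradient φ p := by
      have : a • gradient φ p = - ((2 * b) • (p - x)) := eq_neg_of_add_eq_zero_left key2
      rw [this, ← smul_neg, neg_sub]
    rw [div_eq_inv_mul, mul_smul, ← this, smul_smul, inv_mul_cancel₀ (by simpa using hb), one_smul]
  rw [← h3]; abel

/-- The derivative of `(y, l) ↦ (y + l ∇φ(y), φ y)` at a point `(y, 0)`. -/
def levelEquiv (g : E3) (hg : g ≠ 0) : (E3 × ℝ) ≃L[ℝ] (E3 × ℝ) :=
  ContinuousLinearEquiv.equivOfInverse
    ((ContinuousLinearMap.fst ℝ E3 ℝ + (ContinuousLinearMap.snd ℝ E3 ℝ).smulRight g).prod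
      ((innerSL ℝ g).comp (ContinuousLinearMap.fst ℝ E3 ℝ)))
    ((ContinuousLinearMap.fst ℝ E3 ℝ - ((‖g‖ ^ 2)⁻¹ • ((innerSL ℝ g).comp
        (ContinuousLinearMap.fst ℝ E3 ℝ) - ContinuousLinearMap.snd ℝ E3 ℝ)).smulRight g).prod
      ((‖g‖ ^ 2)⁻¹ • ((innerSL ℝ g).comp (ContinuousLinearMap.fst ℝ E3 ℝ)
        - ContinuousLinearMap.snd ℝ E3 ℝ)))
    (by
      rintro ⟨y, l⟩
      have : ‖g‖ ^ 2 ≠ 0 := by simpa using hg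
      have h2 : (‖g‖ ^ 2)⁻¹ * (l * ‖g‖ ^ 2) = l := by field_simp
      simp [inner_add_right, inner_smul_right, h2])
    (by
      rintro ⟨y, l⟩
      have : ‖g‖ ^ 2 ≠ 0 := by simpa using hg
      have h2 : inner ℝ g y - (‖g‖ ^ 2)⁻¹ * (inner ℝ g y - l) * ‖g‖ ^ 2 = l := by
        field_simp; ring
      simp [inner_sub_right, inner_smul_right, h2])


/-- The map H(y, l) = (y + l ∇φ(y), φ(y)) is locally invertible at (y₀, 0). By the Lagrange
condition any nearest point p of a point x near y₀ satisfies H(p, l) = (x, 0) for some l, so p and l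
are the components of the smooth local inverse at (x, 0), whichever nearest point was selected. Then
ρ = l |∇φ(p)| is smooth, and its gradient is the normalised ∇φ(p). -/
lemma exists_local_tubeReg {y₀ : E3} (hy₀ : y₀ ∈ S.surf) : ∃ r > 0,
    (∀ x ∈ Metric.ball y₀ r, ContDiffAt ℝ 4 S.sdist x ∧ ‖S.normal x‖ = 1 ∧
      S.proj x = x - S.sdist x • S.normal x ∧ S.normal (S.proj x) = S.normal x) ∧
    ∀ y ∈ S.surf, y ∈ Metric.ball y₀ r → ∀ t : ℝ, |t| < r →
      S.sdist (y + t • S.normal y) = t ∧ S.proj (y + t • S.normal y) = y := by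
  obtain ⟨U₀, φ, hU₀, hyU₀, hφ₀, hd₀, hin₀⟩ := S.smooth y₀ hy₀
  have hdc : ContinuousOn (fderiv ℝ φ) U₀ := hφ₀.continuousOn_fderiv_of_isOpen hU₀ (by simp)
  -- Shrinks the chart to where ∇φ has no zeros, as the Lagrange condition and the identification of
  -- Γ with the zero set of φ require.
  set U := U₀ ∩ (fderiv ℝ φ) ⁻¹' {0}ᶜ with hUdef
  have hU : IsOpen U := hdc.isOpen_inter_preimage hU₀ isOpen_compl_singleton
  have hyU : y₀ ∈ U := ⟨hyU₀, hd₀⟩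
  have hφ : ContDiffOn ℝ ∞ φ U := hφ₀.mono inter_subset_left
  have hin : S.inside ∩ U = {y ∈ U | φ y < 0} := by
    ext z
    have := Set.ext_iff.1 hin₀ z
    simp only [mem_inter_iff, mem_ofPred_eq, hUdef] at this ⊢
    tauto
  have hd : ∀ y ∈ U, fderiv ℝ φ y ≠ 0 := fun y hy => hy.2
  clear hin₀ hdc hφ₀ hd₀
  set g : E3 → E3 := gradient φ with hgdef
  have hφU : ∀ y ∈ U, ContDiffAt ℝ ∞ φ y := fun y hy => hφ.contDiffAt (hU.mem_nhds hy)
  have hgU : ∀ y ∈ U, ContDiffAt ℝ ∞ g y := fun y hy => contDiffAt_gradient (hφU y hy) (by simp)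
  have hg0 : ∀ y ∈ U, g y ≠ 0 := fun y hy h => hd y hy (gradient_eq_zero_iff.1 h)
  have hφ0 : ∀ y ∈ U, y ∈ S.surf → φ y = 0 := fun y hy => eq_zero_of_mem_surf hU hφ hin hy
  set H : E3 × ℝ → E3 × ℝ := fun z => (z.1 + z.2 • g z.1, φ z.1) with hHdef
  have hHs : ContDiffAt ℝ ∞ H (y₀, 0) := by
    have h1 : ContDiffAt ℝ ∞ (fun z : E3 × ℝ => g z.1) (y₀, 0) :=
      ContDiffAt.comp (y₀, (0 : ℝ)) (f := Prod.fst) (g := g) (hgU y₀ hyU) contDiffAt_fst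
    have h2 : ContDiffAt ℝ ∞ (fun z : E3 × ℝ => φ z.1) (y₀, 0) :=
      ContDiffAt.comp (y₀, (0 : ℝ)) (f := Prod.fst) (g := φ) (hφU y₀ hyU) contDiffAt_fst
    exact (contDiffAt_fst.add (contDiffAt_snd.smul h1)).prodMk h2
  have hHd : HasFDerivAt H (levelEquiv (g y₀) (hg0 y₀ hyU) : (E3 × ℝ) →L[ℝ] (E3 × ℝ)) (y₀, 0) := by
    have hg' : HasFDerivAt (fun z : E3 × ℝ => g z.1)
        ((fderiv ℝ g y₀).comp (ContinuousLinearMap.fst ℝ E3 ℝ)) (y₀, 0) :=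
      HasFDerivAt.comp (y₀, (0 : ℝ)) (f := Prod.fst) (g := g)
        ((hgU y₀ hyU).differentiableAt (by simp)).hasFDerivAt hasFDerivAt_fst
    have hφ' : HasFDerivAt (fun z : E3 × ℝ => φ z.1)
        ((fderiv ℝ φ y₀).comp (ContinuousLinearMap.fst ℝ E3 ℝ)) (y₀, 0) :=
      HasFDerivAt.comp (y₀, (0 : ℝ)) (f := Prod.fst) (g := φ)
        ((hφU y₀ hyU).differentiableAt (by simp)).hasFDerivAt hasFDerivAt_fst
    have h := (hasFDerivAt_fst.add (hasFDerivAt_snd.smul hg')).prodMk hφ'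
    refine HasFDerivAt.congr_fderiv (f := H) h ?_
    ext z <;> simp [levelEquiv, hgdef]
  have hH0 : H (y₀, 0) = (y₀, 0) := by simp [hHdef, hφ0 y₀ hyU hy₀]
  set L := hHs.localInverse hHd (by simp) with hLdef
  have hL1 : ∀ᶠ z in 𝓝 (y₀, (0 : ℝ)), L (H z) = z :=
    (hHs.hasStrictFDerivAt' hHd (by simp)).eventually_left_inverse
  have hLs : ContDiffAt ℝ (5 : ℕ) L (y₀, 0) := by
    have := contDiffAt_infty.1 (hHs.to_localInverse hHd (by simp)) 5
    rwa [hH0] at this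
  have htp : Tendsto S.proj (𝓝 y₀) (𝓝 y₀) := by
    rw [tendsto_iff_dist_tendsto_zero]
    have h2 : Tendsto (fun x => 2 * dist x y₀) (𝓝 y₀) (𝓝 0) := by
      have : Continuous fun x : E3 => 2 * dist x y₀ := by fun_prop
      simpa using this.tendsto y₀
    refine squeeze_zero (fun _ => dist_nonneg) (fun x => ?_) h2
    have h3 := dist_triangle (S.proj x) x y₀
    have h4 := Metric.infDist_le_dist_of_mem (x := x) hy₀
    rw [← (S.proj_spec x).2, dist_comm] at h4
    linarith
  have hgc : Tendsto (fun x => g (S.proj x)) (𝓝 y₀) (𝓝 (g y₀)) :=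
    (hgU y₀ hyU).continuousAt.tendsto.comp htp
  -- The multiplier, recovered from x - p = l ∇φ(p) by pairing with ∇φ(p); the explicit formula
  -- shows that l tends to 0 at y₀.
  set l : E3 → ℝ := fun x => inner ℝ (x - S.proj x) (g (S.proj x)) / ‖g (S.proj x)‖ ^ 2 with hldef
  have hl0 : Tendsto l (𝓝 y₀) (𝓝 0) := by
    have h1 : Tendsto l (𝓝 y₀) (𝓝 (inner ℝ (y₀ - y₀) (g y₀) / ‖g y₀‖ ^ 2)) :=
      ((tendsto_id.sub htp).inner hgc).div (hgc.norm.pow 2) (by simpa using hg0 y₀ hyU)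
    simpa using h1
  have hpU : ∀ᶠ x in 𝓝 y₀, S.proj x ∈ U := htp.eventually (hU.mem_nhds hyU)
  have hlag : ∀ᶠ x in 𝓝 y₀, x = S.proj x + l x • g (S.proj x) := by
    filter_upwards [hpU] with x hx
    obtain ⟨c, hc⟩ := exists_lagrange hU hφ hin hd hx
    have : l x = c := by
      have h1 : x - S.proj x = c • g (S.proj x) := by
        nth_rewrite 1 [hc]; simp [hgdef]
      have h2 : ‖g (S.proj x)‖ ^ 2 ≠ 0 := by simpa using hg0 _ hx
      simp only [hldef, h1, inner_smul_left, real_inner_self_eq_norm_sq]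
      simp [h2]
    rw [this]; exact hc
  have hL2 : ∀ᶠ x in 𝓝 y₀, L (x, 0) = (S.proj x, l x) := by
    have h1 : Tendsto (fun x => (S.proj x, l x)) (𝓝 y₀) (𝓝 (y₀, 0)) := htp.prodMk_nhds hl0
    filter_upwards [h1.eventually hL1, hlag, hpU] with x hx hx2 hx3
    have : H (S.proj x, l x) = (x, 0) := by
      simp only [hHdef]
      rw [← hx2, hφ0 _ hx3 (S.proj_spec x).1]
    rw [← this, hx]
  have hLs' : ∀ᶠ x in 𝓝 y₀, ContDiffAt ℝ (5 : ℕ) (fun x : E3 => L (x, 0)) x := by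
    have h1 := hLs.eventually (by simp)
    have h2 : Tendsto (fun x : E3 => (x, (0 : ℝ))) (𝓝 y₀) (𝓝 (y₀, 0)) :=
      tendsto_id.prodMk_nhds tendsto_const_nhds
    filter_upwards [h2.eventually h1] with x hx
    exact hx.comp x (contDiffAt_id.prodMk contDiffAt_const)
  have hL2' : ∀ᶠ x in 𝓝 y₀, (fun x => (S.proj x, l x)) =ᶠ[𝓝 x] fun x => L (x, 0) := by
    filter_upwards [hL2.eventually_nhds] with x hx
    filter_upwards [hx] with z hz using hz.symm
  have hps : ∀ᶠ x in 𝓝 y₀, ContDiffAt ℝ (5 : ℕ) S.proj x := by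
    filter_upwards [hLs', hL2'] with x h1 h2
    exact contDiffAt_fst.comp x (h1.congr_of_eventuallyEq h2)
  have hls : ∀ᶠ x in 𝓝 y₀, ContDiffAt ℝ (5 : ℕ) l x := by
    filter_upwards [hLs', hL2'] with x h1 h2
    exact contDiffAt_snd.comp x (h1.congr_of_eventuallyEq h2)
  have hgs : ∀ᶠ x in 𝓝 y₀, ContDiffAt ℝ (5 : ℕ) (fun x => g (S.proj x)) x := by
    filter_upwards [hps, hpU] with x h1 h2
    exact (contDiffAt_infty.1 (hgU _ h2) 5).comp x h1
  -- the sign of the distance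
  have hsign : ∀ᶠ x in 𝓝 y₀, S.sdist x = l x * ‖g (S.proj x)‖ := by
    have hG : 0 < ‖g y₀‖ := norm_pos_iff.2 (hg0 y₀ hyU)
    -- Strict differentiability compares φ(x) - φ(p) with Dφ(y₀)(x - p) although both points move.
    -- The error is at most 5/16 |l| |∇φ(y₀)|², the main term at least 3/4 |l| |∇φ(y₀)|², so φ(x)
    -- has the sign of l.
    have hst : HasStrictFDerivAt φ (fderiv ℝ φ y₀) y₀ := (hφU y₀ hyU).hasStrictFDerivAt (by simp)
    have h1 := hst.isLittleO.def (c := ‖g y₀‖ / 4) (by positivity)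
    have h2 : Tendsto (fun x => (x, S.proj x)) (𝓝 y₀) (𝓝 (y₀, y₀)) := tendsto_id.prodMk_nhds htp
    have h3 : ∀ᶠ x in 𝓝 y₀, ‖g (S.proj x) - g y₀‖ < ‖g y₀‖ / 4 := by
      have := hgc.eventually (Metric.ball_mem_nhds (g y₀) (ε := ‖g y₀‖ / 4) (by positivity))
      filter_upwards [this] with x hx
      rwa [← dist_eq_norm]
    filter_upwards [h2.eventually h1, h3, hlag, hpU, hU.mem_nhds hyU] with x hx1 hx2 hx3 hx4 hxU
    have e1 : x - S.proj x = l x • g (S.proj x) := by nth_rewrite 1 [hx3]; simp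
    have e2 : Metric.infDist x S.surf = |l x| * ‖g (S.proj x)‖ := by
      rw [← (S.proj_spec x).2, dist_eq_norm, e1, norm_smul, Real.norm_eq_abs]
    simp only [e1, map_smul, ← inner_gradient_apply, ← hgdef, hφ0 _ hx4 (S.proj_spec x).1, norm_smul,
      sub_zero, smul_eq_mul, Real.norm_eq_abs] at hx1
    have e3 : ‖g (S.proj x)‖ ≤ 5 / 4 * ‖g y₀‖ := by
      have := norm_le_norm_add_norm_sub' (g (S.proj x)) (g y₀)
      linarith
    have e4 : 3 / 4 * ‖g y₀‖ ^ 2 ≤ inner ℝ (g y₀) (g (S.proj x)) := by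
      have := real_inner_le_norm (g y₀) (g y₀ - g (S.proj x))
      rw [inner_sub_right, real_inner_self_eq_norm_sq, norm_sub_rev] at this
      nlinarith
    have e5 : ‖g y₀‖ / 4 * (|l x| * ‖g (S.proj x)‖) ≤ |l x| * (5 / 16 * ‖g y₀‖ ^ 2) := by
      have := mul_le_mul_of_nonneg_left e3 (mul_nonneg (abs_nonneg (l x)) hG.le)
      nlinarith
    have e6 := abs_le.1 (hx1.trans e5)
    have hmem : x ∈ S.inside ↔ l x < 0 := by
      have : x ∈ S.inside ↔ φ x < 0 := by
        have := Set.ext_iff.1 hin x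
        simp only [mem_inter_iff, hxU, and_true, mem_ofPred_eq, true_and] at this
        exact this
      rw [this]
      constructor
      · intro h
        by_contra! h'
        rw [abs_of_nonneg h'] at e6
        nlinarith [mul_le_mul_of_nonneg_left e4 h', mul_nonneg h' (sq_nonneg ‖g y₀‖)]
      · intro h
        rw [abs_of_neg h] at e6
        nlinarith [mul_le_mul_of_nonneg_left e4 (neg_pos.2 h).le,
          mul_pos (neg_pos.2 h) (pow_pos hG 2)]
    unfold sdist
    rw [e2]
    split_ifs with h
    · rw [abs_of_neg (hmem.1 h)]; ring
    · rw [abs_of_nonneg (not_lt.1 (fun h' => h (hmem.2 h')))]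
  have hds : ∀ᶠ x in 𝓝 y₀, ContDiffAt ℝ (5 : ℕ) S.sdist x := by
    filter_upwards [hls, hgs, hsign.eventually_nhds, hpU] with x h1 h2 h3 h4
    exact (h1.mul (h2.norm ℝ (hg0 _ h4))).congr_of_eventuallyEq h3
  set ν : E3 → E3 := fun x => ‖g (S.proj x)‖⁻¹ • g (S.proj x) with hνdef
  have hν1 : ∀ᶠ x in 𝓝 y₀, ‖ν x‖ = 1 := by
    filter_upwards [hpU] with x hx
    simp only [hνdef]
    rw [norm_smul, norm_inv, norm_norm, inv_mul_cancel₀ (by simpa using hg0 _ hx)]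
  have hνeq : ∀ᶠ x in 𝓝 y₀, x - S.proj x = S.sdist x • ν x := by
    filter_upwards [hpU, hsign, hlag] with x h1 h2 h3
    have : ‖g (S.proj x)‖ ≠ 0 := by simpa using hg0 _ h1
    rw [h2, hνdef]
    simp only [smul_smul]
    rw [mul_assoc, mul_inv_cancel₀ this, mul_one]
    nth_rewrite 1 [h3]; simp
  have hνs : ∀ᶠ x in 𝓝 y₀, ContDiffAt ℝ (5 : ℕ) ν x := by
    filter_upwards [hgs, hpU] with x h2 h4
    exact ((h2.norm ℝ (hg0 _ h4)).inv (by simpa using hg0 _ h4)).smul h2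
  have hνn : ∀ᶠ x in 𝓝 y₀, S.normal x = ν x := by
    filter_upwards [hνs, hps, hν1.eventually_nhds, hνeq.eventually_nhds, hpU.eventually_nhds]
      with x h1 h2 h3 h4 h5
    have hD1 : DifferentiableAt ℝ ν x := h1.differentiableAt (by simp)
    have hD2 : DifferentiableAt ℝ S.proj x := h2.differentiableAt (by simp)
    -- From ρ = ⟨x - p, ν⟩ the gradient is ν itself: ν is orthogonal to the range of Dν because it
    -- has unit length, and to the range of Dp because p stays on the level set.
    have hs : S.sdist =ᶠ[𝓝 x] fun z => inner ℝ (z - S.proj z) (ν z) := by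
      filter_upwards [h3, h4] with z hz1 hz2
      rw [hz2, inner_smul_left, real_inner_self_eq_norm_sq, hz1]; simp
    have hA : ∀ h, inner ℝ (ν x) (fderiv ℝ ν x h) = 0 := by
      intro h
      have e : (fun z => inner ℝ (ν z) (ν z)) =ᶠ[𝓝 x] fun _ => (1 : ℝ) := by
        filter_upwards [h3] with z hz
        rw [real_inner_self_eq_norm_sq, hz]; simp
      have e1 := congrArg (fun L => L h) (e.fderiv_eq (𝕜 := ℝ))
      simp only [fderiv_fun_const, Pi.zero_apply, zero_apply] at e1
      rw [fderiv_inner_apply ℝ hD1 hD1, real_inner_comm] at e1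
      linarith [real_inner_comm (ν x) (fderiv ℝ ν x h)]
    have hB : ∀ h, inner ℝ (ν x) (fderiv ℝ S.proj x h) = 0 := by
      intro h
      have e : (fun z => φ (S.proj z)) =ᶠ[𝓝 x] fun _ => (0 : ℝ) := by
        filter_upwards [h5] with z hz using hφ0 _ hz (S.proj_spec z).1
      have e1 := congrArg (fun L => L h) (e.fderiv_eq (𝕜 := ℝ))
      have hφd : DifferentiableAt ℝ φ (S.proj x) := (hφU _ h5.self_of_nhds).differentiableAt (by simp)
      have e2 : fderiv ℝ (fun z => φ (S.proj z)) x = (fderiv ℝ φ (S.proj x)).comp (fderiv ℝ S.proj x) :=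
        fderiv_comp x hφd hD2
      rw [e2] at e1
      simp only [fderiv_fun_const, Pi.zero_apply, zero_apply,
        ContinuousLinearMap.comp_apply] at e1
      rw [← inner_gradient_apply] at e1
      simp only [hνdef, inner_smul_left, ← hgdef] at e1 ⊢
      rw [e1]; simp
    refine ext_inner_right ℝ fun h => ?_
    rw [normal, inner_gradient_apply, hs.fderiv_eq, fderiv_inner_apply ℝ (f := fun z => z - S.proj z)
      (differentiableAt_id.sub hD2) hD1]
    rw [h4.self_of_nhds, inner_smul_left, hA]
    have : fderiv ℝ (fun z => z - S.proj z) x h = h - fderiv ℝ S.proj x h := by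
      rw [fderiv_fun_sub (f := fun z => z) differentiableAt_id hD2]; simp
    rw [this, inner_sub_left, real_inner_comm (ν x) (fderiv ℝ S.proj x h), hB]
    simp [real_inner_comm]
  have hall : ∀ᶠ x in 𝓝 y₀, ContDiffAt ℝ 4 S.sdist x ∧ ‖S.normal x‖ = 1 ∧
      S.proj x = x - S.sdist x • S.normal x ∧ S.normal (S.proj x) = S.normal x := by
    filter_upwards [hds, hν1, hνeq, hνn, htp.eventually hνn] with x h1 h2 h3 h4 h5
    refine ⟨h1.of_le (by norm_cast), by rw [h4, h2], by rw [h4, ← h3]; abel, ?_⟩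
    rw [h5, h4, hνdef]
    simp only [S.proj_of_mem (S.proj_spec x).1]
  have hνc : Tendsto ν (𝓝 y₀) (𝓝 (ν y₀)) := hνs.self_of_nhds.continuousAt
  -- Conversely, for y on Γ the pair (y, t/|∇φ(y)|) is mapped by H to (y + tν(y), 0), so local
  -- injectivity of H identifies y as the closest point and t as the signed distance.
  have hadd : ∀ᶠ z in 𝓝 (y₀, (0 : ℝ)), z.1 ∈ S.surf →
      S.sdist (z.1 + z.2 • S.normal z.1) = z.2 ∧ S.proj (z.1 + z.2 • S.normal z.1) = z.1 := by
    have hf : Tendsto (Prod.fst : E3 × ℝ → E3) (𝓝 (y₀, (0 : ℝ))) (𝓝 y₀) :=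
      continuous_fst.tendsto _
    have hs : Tendsto (Prod.snd : E3 × ℝ → ℝ) (𝓝 (y₀, (0 : ℝ))) (𝓝 0) :=
      continuous_snd.tendsto (y₀, (0 : ℝ))
    have hg1 : Tendsto (fun z : E3 × ℝ => g z.1) (𝓝 (y₀, 0)) (𝓝 (g y₀)) :=
      (hgU y₀ hyU).continuousAt.tendsto.comp hf
    have ht : Tendsto (fun z : E3 × ℝ => z.1 + z.2 • ν z.1) (𝓝 (y₀, 0)) (𝓝 y₀) := by
      simpa using hf.add (hs.smul (hνc.comp hf))
    have ht2 : Tendsto (fun z : E3 × ℝ => (z.1, z.2 * ‖g z.1‖⁻¹)) (𝓝 (y₀, 0)) (𝓝 (y₀, 0)) := by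
      refine hf.prodMk_nhds ?_
      simpa using hs.mul (hg1.norm.inv₀ (by simpa using hg0 y₀ hyU))
    filter_upwards [ht.eventually hL2, ht2.eventually hL1, hf.eventually hνn,
      ht.eventually hsign, hf.eventually (hU.mem_nhds hyU)] with z h1 h2 h3 h4 h5 hz
    have hgz : ‖g z.1‖ ≠ 0 := by simpa using hg0 _ h5
    have hνz : ν z.1 = ‖g z.1‖⁻¹ • g z.1 := by simp only [hνdef, S.proj_of_mem hz]
    have e : H (z.1, z.2 * ‖g z.1‖⁻¹) = (z.1 + z.2 • ν z.1, 0) := by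
      simp only [hHdef, hφ0 _ h5 hz, hνz, smul_smul]
    rw [e, h1] at h2
    simp only [Prod.mk.injEq] at h2
    rw [h3]
    refine ⟨?_, h2.1⟩
    rw [h4, h2.1, h2.2, mul_assoc, inv_mul_cancel₀ hgz, mul_one]
  obtain ⟨r₁, hr₁, h1⟩ := Metric.eventually_nhds_iff_ball.1 hall
  obtain ⟨r₂, hr₂, h2⟩ := Metric.eventually_nhds_iff_ball.1 hadd
  refine ⟨min r₁ r₂, lt_min hr₁ hr₂, fun x hx => h1 x (Metric.ball_subset_ball (min_le_left _ _) hx),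
    fun y hyS hy t ht => h2 (y, t) ?_ hyS⟩
  rw [Metric.mem_ball, Prod.dist_eq]
  refine max_lt (lt_of_lt_of_le hy (min_le_right _ _)) ?_
  rw [Real.dist_eq, sub_zero]
  exact lt_of_lt_of_le ht (min_le_right _ _)

variable (S)

/-- A smooth closed surface has a tubular neighbourhood. -/
theorem exists_tubeReg (δ₀ : ℝ) (hδ₀ : 0 < δ₀) : ∃ δ, δ ≤ δ₀ ∧ S.TubeReg δ := by
  choose! r hr h1 h2 using fun y (hy : y ∈ S.surf) => exists_local_tubeReg hy
  -- Halved radii leave room: a point at distance less than δ from its closest point still lies in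
  -- one of the full balls.
  obtain ⟨t, ht, hcov⟩ := S.isCompact_surf.elim_nhds_subcover (fun y => Metric.ball y (r y / 2))
    (fun y hy => Metric.ball_mem_nhds y (half_pos (hr y hy)))
  have hpos : ∃ δ, 0 < δ ∧ δ ≤ δ₀ ∧ ∀ y ∈ t, δ ≤ r y / 2 := by
    clear hcov
    induction t using Finset.induction_on with
    | empty => exact ⟨δ₀, hδ₀, le_rfl, by simp⟩
    | insert y t _ ih =>
      obtain ⟨δ, hδ, hδ', h⟩ := ih (fun z hz => ht z (Finset.mem_insert_of_mem hz))
      refine ⟨min δ (r y / 2), lt_min hδ (half_pos (hr y (ht y (Finset.mem_insert_self _ _)))),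
        (min_le_left _ _).trans hδ', fun z hz => ?_⟩
      rcases Finset.mem_insert.1 hz with rfl | hz
      · exact min_le_right _ _
      · exact (min_le_left _ _).trans (h z hz)
  obtain ⟨δ, hδ, hδ', hδr⟩ := hpos
  have hloc : ∀ x ∈ S.tube δ, ∃ y ∈ S.surf, x ∈ Metric.ball y (r y) := by
    intro x hx
    obtain ⟨y, hy, hxy⟩ := mem_iUnion₂.1 (hcov (S.proj_spec x).1)
    refine ⟨y, ht y hy, ?_⟩
    have h3 : dist x (S.proj x) < δ := by
      rw [(S.proj_spec x).2, ← abs_sdist]; exact hx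
    have := dist_triangle x (S.proj x) y
    have h5 := hδr y hy
    rw [Metric.mem_ball] at hxy ⊢
    linarith
  have hloc2 : ∀ y ∈ S.surf, ∃ z ∈ S.surf, y ∈ Metric.ball z (r z) ∧ δ ≤ r z := by
    intro y hy
    obtain ⟨z, hz, hyz⟩ := mem_iUnion₂.1 (hcov hy)
    have := hr z (ht z hz)
    exact ⟨z, ht z hz, Metric.ball_subset_ball (by linarith) hyz, by linarith [hδr z hz]⟩
  refine ⟨δ, hδ', hδ, ?_, ?_, ?_, ?_, ?_, ?_⟩
  · intro x hx; obtain ⟨y, hy, hxy⟩ := hloc x hx; exact (h1 y hy x hxy).1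
  · intro x hx; obtain ⟨y, hy, hxy⟩ := hloc x hx; exact (h1 y hy x hxy).2.1
  · intro x hx; obtain ⟨y, hy, hxy⟩ := hloc x hx; exact (h1 y hy x hxy).2.2.1
  · intro x hx; obtain ⟨y, hy, hxy⟩ := hloc x hx; exact (h1 y hy x hxy).2.2.2
  · intro y hy t ht; obtain ⟨z, hz, hyz, hδz⟩ := hloc2 y hy
    exact (h2 z hz y hy hyz t (ht.trans_le hδz)).1
  · intro y hy t ht; obtain ⟨z, hz, hyz, hδz⟩ := hloc2 y hy
    exact (h2 z hz y hy hyz t (ht.trans_le hδz)).2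

end SmoothClosedSurface
end SurfaceFEM
end

/-! ### Derivatives of the closest point map and the Jacobian of normal coordinates -/

noncomputable section
namespace SurfaceFEM

lemma tangentProj_apply (m y : E3) : tangentProj m y = y - inner ℝ m y • m := by
  simp [tangentProj]

lemma inner_tangentProj {m : E3} (hm : ‖m‖ = 1) (y : E3) : inner ℝ m (tangentProj m y) = 0 := by
  rw [tangentProj_apply, inner_sub_right, inner_smul_right, real_inner_self_eq_norm_sq, hm]; ring

lemma tangentProj_of_inner {m y : E3} (h : inner ℝ m y = 0) : tangentProj m y = y := by
  rw [tangentProj_apply, h]; simp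

lemma norm_tangentProj_le {m : E3} (hm : ‖m‖ = 1) (y : E3) : ‖tangentProj m y‖ ≤ ‖y‖ := by
  have h : ‖tangentProj m y‖ ^ 2 ≤ ‖y‖ ^ 2 := by
    rw [tangentProj_apply, norm_sub_sq_real, inner_smul_right, norm_smul, hm, real_inner_comm]
    rw [Real.norm_eq_abs, mul_one, sq_abs]
    nlinarith [sq_nonneg (inner ℝ m y)]
  exact (sq_le_sq₀ (norm_nonneg _) (norm_nonneg _)).1 h

lemma contDiff_det {n : WithTop ℕ∞} :
    ContDiff ℝ n (fun A : E3 →L[ℝ] E3 => LinearMap.det (A : E3 →ₗ[ℝ] E3)) := by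
  have : (fun A : E3 →L[ℝ] E3 => LinearMap.det (A : E3 →ₗ[ℝ] E3)) = fun A =>
      ∑ σ : Equiv.Perm (Fin 3), ((Equiv.Perm.sign σ : ℤ) : ℝ) *
        ∏ i, (A (EuclideanSpace.basisFun (Fin 3) ℝ i)) (σ i) := by
    ext A
    rw [← LinearMap.det_toMatrix (EuclideanSpace.basisFun (Fin 3) ℝ).toBasis, Matrix.det_apply']
    simp [LinearMap.toMatrix_apply]
  rw [this]
  refine ContDiff.sum fun σ _ => contDiff_const.mul (contDiff_prod fun i _ => ?_)
  exact (contDiff_piLp_apply (p := 2)).comp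
    (ContinuousLinearMap.apply ℝ E3 (EuclideanSpace.basisFun (Fin 3) ℝ i)).contDiff

lemma det_mul_det (A B : E3 →L[ℝ] E3) :
    LinearMap.det ((A.comp B : E3 →L[ℝ] E3) : E3 →ₗ[ℝ] E3)
      = LinearMap.det (A : E3 →ₗ[ℝ] E3) * LinearMap.det (B : E3 →ₗ[ℝ] E3) := by
  rw [← LinearMap.det_comp]; rfl

namespace SmoothClosedSurface
variable {S : SmoothClosedSurface} {δ : ℝ}

/-- The normal extension `(y, t) ↦ p(y) + t n(y)`. -/
def fiber (S : SmoothClosedSurface) (y : E3) (t : ℝ) : E3 := S.proj y + t • S.normal y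

/-- `I - ρ κ`, the derivative of the closest point map completed in the normal direction. -/
def shape (S : SmoothClosedSurface) (x : E3) : E3 →L[ℝ] E3 :=
  ContinuousLinearMap.id ℝ E3 - S.sdist x • S.curv x

/-- The Jacobian of the closest point map between parallel surfaces. -/
def jac (S : SmoothClosedSurface) (x : E3) : ℝ := LinearMap.det (S.shape x : E3 →ₗ[ℝ] E3)

lemma proj_mem_surf (S : SmoothClosedSurface) (x : E3) : S.proj x ∈ S.surf := (S.proj_spec x).1

lemma tube_mono (S : SmoothClosedSurface) {δ δ' : ℝ} (h : δ' ≤ δ) : S.tube δ' ⊆ S.tube δ :=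
  fun _ hx => lt_of_lt_of_le hx h

lemma exists_tube_subset (S : SmoothClosedSurface) {W : Set E3} (hW : IsOpen W)
    (h : S.surf ⊆ W) : ∃ δ > 0, S.tube δ ⊆ W := by
  obtain ⟨δ, hδ, hsub⟩ := S.isCompact_surf.exists_thickening_subset_open hW h
  refine ⟨δ, hδ, fun x hx => hsub ?_⟩
  rw [Metric.mem_thickening_iff_infDist_lt S.surf_nonempty, ← abs_sdist]
  exact hx

lemma isCompact_closedTube (S : SmoothClosedSurface) (r : ℝ) : IsCompact {x | |S.sdist x| ≤ r} := by
  have : {x | |S.sdist x| ≤ r} = Metric.cthickening r S.surf ∨ {x | |S.sdist x| ≤ r} = ∅ := by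
    rcases lt_or_ge r 0 with h | h
    · right
      ext x
      simp only [mem_ofPred_eq, mem_empty_iff_false, iff_false, not_le]
      exact h.trans_le (abs_nonneg _)
    · left
      ext x
      simp only [mem_ofPred_eq, abs_sdist]
      rw [Metric.cthickening_eq_preimage_infEDist, mem_preimage, mem_Iic,
        ← ENNReal.ofReal_toReal (Metric.infEDist_ne_top S.surf_nonempty)]
      rw [ENNReal.ofReal_le_ofReal_iff h]
      rfl
  rcases this with h | h
  · rw [h]; exact S.isCompact_surf.cthickening
  · rw [h]; exact isCompact_empty

namespace TubeReg

lemma mono {δ' : ℝ} (hT : S.TubeReg δ) (h0 : 0 < δ') (h : δ' ≤ δ) : S.TubeReg δ' where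
  pos := h0
  smooth x hx := hT.smooth x (S.tube_mono h hx)
  norm_normal x hx := hT.norm_normal x (S.tube_mono h hx)
  proj_eq x hx := hT.proj_eq x (S.tube_mono h hx)
  normal_proj x hx := hT.normal_proj x (S.tube_mono h hx)
  sdist_add y hy t ht := hT.sdist_add y hy t (ht.trans_le h)
  proj_add y hy t ht := hT.proj_add y hy t (ht.trans_le h)

variable (hT : S.TubeReg δ)
include hT

lemma proj_mem_tube (x : E3) : S.proj x ∈ S.tube δ := S.surf_subset_tube hT.pos (S.proj_mem_surf x)

lemma contDiffAt_normal {x : E3} (hx : x ∈ S.tube δ) : ContDiffAt ℝ 3 S.normal x :=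
  contDiffAt_gradient (hT.smooth x hx) (by norm_num)

lemma contDiffAt_curv {x : E3} (hx : x ∈ S.tube δ) : ContDiffAt ℝ 2 S.curv x :=
  (hT.contDiffAt_normal hx).fderiv_right (by norm_num)

lemma differentiableAt_sdist {x : E3} (hx : x ∈ S.tube δ) : DifferentiableAt ℝ S.sdist x :=
  (hT.smooth x hx).differentiableAt (by norm_num)

lemma differentiableAt_normal {x : E3} (hx : x ∈ S.tube δ) : DifferentiableAt ℝ S.normal x :=
  (hT.contDiffAt_normal hx).differentiableAt (by norm_num)

lemma proj_eventuallyEq {x : E3} (hx : x ∈ S.tube δ) :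
    S.proj =ᶠ[𝓝 x] fun z => z - S.sdist z • S.normal z := by
  filter_upwards [(S.isOpen_tube δ).mem_nhds hx] with z hz using hT.proj_eq z hz

lemma contDiffAt_proj {x : E3} (hx : x ∈ S.tube δ) : ContDiffAt ℝ 3 S.proj x := by
  refine ContDiffAt.congr_of_eventuallyEq ?_ (hT.proj_eventuallyEq hx)
  exact contDiffAt_id.sub (((hT.smooth x hx).of_le (by norm_num)).smul (hT.contDiffAt_normal hx))

lemma differentiableAt_proj {x : E3} (hx : x ∈ S.tube δ) : DifferentiableAt ℝ S.proj x :=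
  (hT.contDiffAt_proj hx).differentiableAt (by norm_num)

lemma contDiffAt_shape {x : E3} (hx : x ∈ S.tube δ) : ContDiffAt ℝ 2 S.shape x :=
  contDiffAt_const.sub (((hT.smooth x hx).of_le (by norm_num)).smul (hT.contDiffAt_curv hx))

lemma contDiffAt_jac {x : E3} (hx : x ∈ S.tube δ) : ContDiffAt ℝ 2 S.jac x :=
  contDiff_det.contDiffAt.comp x (hT.contDiffAt_shape hx)

omit hT in
lemma fderiv_sdist_apply {x : E3} (h : E3) : fderiv ℝ S.sdist x h = inner ℝ (S.normal x) h :=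
  (inner_gradient_apply _ _ _).symm

lemma fderiv_proj {x : E3} (hx : x ∈ S.tube δ) (h : E3) :
    fderiv ℝ S.proj x h = h - inner ℝ (S.normal x) h • S.normal x - S.sdist x • S.curv x h := by
  rw [(hT.proj_eventuallyEq hx).fderiv_eq]
  have h1 := (hasFDerivAt_id (𝕜 := ℝ) x).sub
    ((hT.differentiableAt_sdist hx).hasFDerivAt.smul (hT.differentiableAt_normal hx).hasFDerivAt)
  have h2 : HasFDerivAt (fun z => z - S.sdist z • S.normal z) _ x := h1
  rw [h2.fderiv]
  simp only [← inner_gradient_apply, sub_apply, ContinuousLinearMap.id_apply,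
    add_apply, ContinuousLinearMap.smulRight_apply,
    smul_apply]
  simp only [curv, normal]
  abel

/-- I - ρκ is Dp completed by n ⊗ n in the normal direction, which lets Jacobians of p be computed
as determinants on the whole space. -/
lemma shape_apply {x : E3} (hx : x ∈ S.tube δ) (h : E3) :
    S.shape x h = fderiv ℝ S.proj x h + inner ℝ (S.normal x) h • S.normal x := by
  rw [hT.fderiv_proj hx]
  simp only [shape, sub_apply, ContinuousLinearMap.id_apply, smul_apply]
  abel

lemma inner_normal_curv {x : E3} (hx : x ∈ S.tube δ) (h : E3) :
    inner ℝ (S.normal x) (S.curv x h) = 0 := by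
  have e : (fun z => inner ℝ (S.normal z) (S.normal z)) =ᶠ[𝓝 x] fun _ => (1 : ℝ) := by
    filter_upwards [(S.isOpen_tube δ).mem_nhds hx] with z hz
    rw [real_inner_self_eq_norm_sq, hT.norm_normal z hz]; simp
  have e1 := congrArg (fun L => L h) (e.fderiv_eq (𝕜 := ℝ))
  have hD := hT.differentiableAt_normal hx
  simp only [fderiv_fun_const, Pi.zero_apply, zero_apply] at e1
  rw [fderiv_inner_apply ℝ hD hD] at e1
  have := real_inner_comm (S.normal x) (fderiv ℝ S.normal x h)
  simp only [curv]
  linarith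

/-- Since κ has range orthogonal to n, the outer projection turns I - ρκ into Dp; so B is the
derivative of p restricted to the discrete tangent plane. -/
lemma mapB_apply {x : E3} (hx : x ∈ S.tube δ) (m h : E3) :
    S.mapB m x h = fderiv ℝ S.proj x (tangentProj m h) := by
  simp only [mapB, ContinuousLinearMap.comp_apply, sub_apply,
    ContinuousLinearMap.id_apply, smul_apply]
  rw [hT.fderiv_proj hx, tangentProj_apply (S.normal x), inner_sub_right, inner_smul_right,
    hT.inner_normal_curv hx]
  simp only [mul_zero, sub_zero]
  abel

lemma fiber_mem {y : E3} {t : ℝ} (hy : y ∈ S.tube δ) (ht : |t| < δ) :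
    S.sdist (S.fiber y t) = t ∧ S.proj (S.fiber y t) = S.proj y ∧
      S.normal (S.fiber y t) = S.normal y ∧ S.fiber y t ∈ S.tube δ := by
  have h0 : S.fiber y t = S.proj y + t • S.normal (S.proj y) := by rw [fiber, hT.normal_proj y hy]
  have h1 : S.sdist (S.fiber y t) = t := by
    rw [h0]; exact hT.sdist_add _ (S.proj_mem_surf y) t ht
  have h2 : S.proj (S.fiber y t) = S.proj y := by
    rw [h0]; exact hT.proj_add _ (S.proj_mem_surf y) t ht
  have h3 : S.fiber y t ∈ S.tube δ := by
    change |S.sdist _| < δ; rwa [h1]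
  exact ⟨h1, h2, by rw [← hT.normal_proj _ h3, h2, hT.normal_proj y hy], h3⟩

lemma fiber_sdist {x : E3} (hx : x ∈ S.tube δ) : S.fiber x (S.sdist x) = x := by
  rw [fiber, hT.proj_eq x hx]; abel

omit hT in
lemma proj_proj (x : E3) : S.proj (S.proj x) = S.proj x := S.proj_of_mem (S.proj_mem_surf x)

end TubeReg

/-- The map `z = a + t m ↦ p(a) + t n(a)`, where `a` is in the plane through `x₀` orthogonal
to `m`. -/
def prism (S : SmoothClosedSurface) (m x₀ : E3) (z : E3) : E3 :=
  S.fiber (x₀ + tangentProj m (z - x₀)) (inner ℝ m (z - x₀))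

/-- The derivative of `prism`. -/
def prismDeriv (S : SmoothClosedSurface) (m : E3) (a : E3) (t : ℝ) : E3 →L[ℝ] E3 :=
  (fderiv ℝ S.proj a).comp (tangentProj m) + (t • (S.curv a).comp (tangentProj m)
    + (innerSL ℝ m).smulRight (S.normal a))

/-- The completed map `B + n ⊗ m`. -/
def fullB (S : SmoothClosedSurface) (m x : E3) : E3 →L[ℝ] E3 :=
  S.mapB m x + (innerSL ℝ m).smulRight (S.normal x)

lemma absDetB_eq (m x : E3) : S.absDetB m x = |LinearMap.det (S.fullB m x : E3 →ₗ[ℝ] E3)| := rfl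

lemma fullB_apply (m x h : E3) : S.fullB m x h = S.mapB m x h + inner ℝ m h • S.normal x := by
  simp [fullB]

namespace TubeReg
variable (hT : S.TubeReg δ)
include hT

lemma hasFDerivAt_prism {m x₀ z : E3} (hz : x₀ + tangentProj m (z - x₀) ∈ S.tube δ) :
    HasFDerivAt (S.prism m x₀)
      (S.prismDeriv m (x₀ + tangentProj m (z - x₀)) (inner ℝ m (z - x₀))) z := by
  have ha : HasFDerivAt (fun z => x₀ + tangentProj m (z - x₀)) (tangentProj m) z := by
    have := ((tangentProj m).hasFDerivAt (x := z - x₀)).comp z ((hasFDerivAt_id z).sub_const x₀)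
    exact (this.const_add x₀).congr_fderiv (by ext; simp)
  have ht : HasFDerivAt (fun z => inner ℝ m (z - x₀)) (innerSL ℝ m) z := by
    have := ((innerSL ℝ m).hasFDerivAt (x := z - x₀)).comp z ((hasFDerivAt_id z).sub_const x₀)
    exact this.congr_fderiv (by ext; simp)
  have h1 := (hT.differentiableAt_proj hz).hasFDerivAt.comp z ha
  have h2 := (hT.differentiableAt_normal hz).hasFDerivAt.comp z ha
  exact (h1.add (ht.smul h2)).congr_fderiv (by ext; simp [prismDeriv, curv])

/-- Along a + τm ↦ p(a) + τ n(a) the closest point is p(a) and the signed distance is τ.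
Differentiating these two identities determines the compositions of Dp and of Dρ with the derivative
of the prism map, and I - ρκ = Dp + n ⊗ n assembles them into B + n ⊗ m. No relation between the
curvatures of parallel surfaces has to be computed. -/
lemma shape_comp_prismDeriv {m a : E3} {t : ℝ} (hm : ‖m‖ = 1) (ha : a ∈ S.tube δ) (ht : |t| < δ) :
    (S.shape (S.fiber a t)).comp (S.prismDeriv m a t) = S.fullB m a := by
  obtain ⟨h1, h2, h3, h4⟩ := hT.fiber_mem ha ht
  -- work at the point `z = a + t m`
  set z := a + t • m with hz
  have hmm : inner ℝ m m = (1 : ℝ) := by rw [real_inner_self_eq_norm_sq, hm]; norm_num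
  have hza : a + tangentProj m (z - a) = a := by
    rw [hz, add_sub_cancel_left, tangentProj_apply, inner_smul_right, hmm]; simp
  have hzt : inner ℝ m (z - a) = t := by
    rw [hz, add_sub_cancel_left, inner_smul_right, hmm]; simp
  have hd := hT.hasFDerivAt_prism (m := m) (x₀ := a) (z := z) (by rwa [hza])
  rw [hza, hzt] at hd
  have hpz : S.prism m a z = S.fiber a t := by rw [prism, hza, hzt]
  have hev : ∀ᶠ w in 𝓝 z, a + tangentProj m (w - a) ∈ S.tube δ ∧ |inner ℝ m (w - a)| < δ := by
    have c1 : Continuous fun w => a + tangentProj m (w - a) := by fun_prop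
    have c2 : Continuous fun w => |inner ℝ m (w - a)| := by fun_prop
    refine (c1.continuousAt.eventually_mem (s := S.tube δ) ?_).and
      (c2.continuousAt.eventually_mem (s := Iio δ) ?_)
    · rw [hza]; exact (S.isOpen_tube δ).mem_nhds ha
    · rw [hzt]; exact Iio_mem_nhds ht
  have ha' : HasFDerivAt (fun z => a + tangentProj m (z - a)) (tangentProj m) z := by
    have := ((tangentProj m).hasFDerivAt (x := z - a)).comp z ((hasFDerivAt_id z).sub_const a)
    exact (this.const_add a).congr_fderiv (by ext; simp)
  have ht' : HasFDerivAt (fun z => inner ℝ m (z - a)) (innerSL ℝ m) z := by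
    have := ((innerSL ℝ m).hasFDerivAt (x := z - a)).comp z ((hasFDerivAt_id z).sub_const a)
    exact this.congr_fderiv (by ext; simp)
  have k1 : (fderiv ℝ S.proj (S.fiber a t)).comp (S.prismDeriv m a t)
      = (fderiv ℝ S.proj a).comp (tangentProj m) := by
    have e1 : HasFDerivAt (S.proj ∘ S.prism m a) _ z :=
      HasFDerivAt.comp z (by rw [hpz]; exact (hT.differentiableAt_proj h4).hasFDerivAt) hd
    have e2 : HasFDerivAt (S.proj ∘ fun z => a + tangentProj m (z - a)) _ z :=
      HasFDerivAt.comp z (by rw [hza]; exact (hT.differentiableAt_proj ha).hasFDerivAt) ha'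
    have e3 : (S.proj ∘ S.prism m a) =ᶠ[𝓝 z] (S.proj ∘ fun z => a + tangentProj m (z - a)) := by
      filter_upwards [hev] with w hw
      exact (hT.fiber_mem hw.1 hw.2).2.1
    exact e1.unique (e2.congr_of_eventuallyEq e3)
  have k2 : (fderiv ℝ S.sdist (S.fiber a t)).comp (S.prismDeriv m a t) = innerSL ℝ m := by
    have e1 : HasFDerivAt (S.sdist ∘ S.prism m a) _ z :=
      HasFDerivAt.comp z (by rw [hpz]; exact (hT.differentiableAt_sdist h4).hasFDerivAt) hd
    have e3 : (S.sdist ∘ S.prism m a) =ᶠ[𝓝 z] fun z => inner ℝ m (z - a) := by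
      filter_upwards [hev] with w hw
      exact (hT.fiber_mem hw.1 hw.2).1
    exact e1.unique (ht'.congr_of_eventuallyEq e3)
  ext1 h
  have k1h := congrArg (fun L => L h) k1
  have k2h := congrArg (fun L => L h) k2
  simp only [ContinuousLinearMap.comp_apply, innerSL_apply_apply] at k1h k2h
  rw [fderiv_sdist_apply] at k2h
  rw [ContinuousLinearMap.comp_apply, hT.shape_apply h4, k1h, k2h, fullB_apply, hT.mapB_apply ha, h3]

/-- The right side does not depend on t. Weighting the volume with `jac` therefore makes it a
product measure in normal coordinates. -/
lemma jac_mul_det {m a : E3} {t : ℝ} (hm : ‖m‖ = 1) (ha : a ∈ S.tube δ) (ht : |t| < δ) :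
    |S.jac (S.fiber a t)| * |LinearMap.det (S.prismDeriv m a t : E3 →ₗ[ℝ] E3)| = S.absDetB m a := by
  rw [absDetB_eq, ← hT.shape_comp_prismDeriv hm ha ht, det_mul_det, abs_mul]; rfl

end TubeReg

/-- Uniform bounds in the tube. -/
structure TubeBound (S : SmoothClosedSurface) (δ M : ℝ) : Prop extends S.TubeReg δ where
  one_le : 1 ≤ M
  normal_lip : ∀ x ∈ S.tube δ, ∀ y ∈ S.tube δ, ‖S.normal x - S.normal y‖ ≤ M * ‖x - y‖
  curv_le : ∀ x ∈ S.tube δ, ‖S.curv x‖ ≤ M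
  jac_ge : ∀ x ∈ S.tube δ, 1 / 2 ≤ S.jac x
  jac_le : ∀ x ∈ S.tube δ, S.jac x ≤ 2

lemma TubeBound.mono {M δ' : ℝ} (hT : S.TubeBound δ M) (h0 : 0 < δ') (h : δ' ≤ δ) :
    S.TubeBound δ' M where
  toTubeReg := hT.toTubeReg.mono h0 h
  one_le := hT.one_le
  normal_lip x hx y hy := hT.normal_lip x (S.tube_mono h hx) y (S.tube_mono h hy)
  curv_le x hx := hT.curv_le x (S.tube_mono h hx)
  jac_ge x hx := hT.jac_ge x (S.tube_mono h hx)
  jac_le x hx := hT.jac_le x (S.tube_mono h hx)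

lemma jac_of_mem {y : E3} (hy : y ∈ S.surf) : S.jac y = 1 := by
  simp [jac, shape, S.sdist_of_mem hy]

/-- The Lipschitz and curvature bounds come from compactness of the closed tube of half the radius,
and the bounds on the Jacobian from its value 1 on Γ. -/
lemma TubeReg.exists_bound (hT : S.TubeReg δ) : ∃ δ' M, δ' ≤ δ ∧ S.TubeBound δ' M := by
  have hc : IsCompact {x | |S.sdist x| ≤ δ / 2} := S.isCompact_closedTube _
  have hsub : {x | |S.sdist x| ≤ δ / 2} ⊆ S.tube δ := fun x hx =>
    lt_of_le_of_lt hx (half_lt_self hT.pos)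
  obtain ⟨K, hK⟩ := LocallyLipschitzOn.exists_lipschitzOnWith_of_compact (f := S.normal) hc (by
    intro x hx
    obtain ⟨K, t, ht, h⟩ := ((hT.contDiffAt_normal (hsub hx)).of_le (by norm_num)
      : ContDiffAt ℝ 1 S.normal x).exists_lipschitzOnWith
    exact ⟨K, t, mem_nhdsWithin_of_mem_nhds ht, h⟩)
  obtain ⟨M, hM⟩ := hc.exists_bound_of_continuousOn (f := S.curv)
    (fun x hx => (hT.contDiffAt_curv (hsub hx)).continuousAt.continuousWithinAt)
  have hW : IsOpen (S.tube δ ∩ S.jac ⁻¹' Ioo (1 / 2) 2) := by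
    refine ContinuousOn.isOpen_inter_preimage (fun x hx => ?_) (S.isOpen_tube δ) isOpen_Ioo
    exact (hT.contDiffAt_jac hx).continuousAt.continuousWithinAt
  obtain ⟨r, hr, hrs⟩ := S.exists_tube_subset hW (fun y hy => ⟨S.surf_subset_tube hT.pos hy, by
    rw [mem_preimage, jac_of_mem hy]; norm_num⟩)
  have hd0 : 0 < min (δ / 2) r := lt_min (half_pos hT.pos) hr
  have hle : min (δ / 2) r ≤ δ := (min_le_left _ _).trans (half_le_self hT.pos.le)
  have hin : ∀ x ∈ S.tube (min (δ / 2) r), x ∈ {x | |S.sdist x| ≤ δ / 2} := fun x hx => by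
    have : |S.sdist x| < δ / 2 := S.tube_mono (min_le_left _ _) hx
    exact this.le
  refine ⟨min (δ / 2) r, max (max 1 K) M, hle, ⟨hT.mono hd0 hle, ?_, ?_, ?_, ?_, ?_⟩⟩
  · exact (le_max_left _ _).trans (le_max_left _ _)
  · intro x hx y hy
    have := hK.norm_sub_le (hin x hx) (hin y hy)
    refine this.trans (mul_le_mul_of_nonneg_right ?_ (norm_nonneg _))
    exact (le_max_right _ _).trans (le_max_left _ _)
  · exact fun x hx => (hM x (hin x hx)).trans (le_max_right _ _)
  · exact fun x hx => (hrs (S.tube_mono (min_le_right _ _) hx)).2.1.le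
  · exact fun x hx => (hrs (S.tube_mono (min_le_right _ _) hx)).2.2.le

end SmoothClosedSurface
end SurfaceFEM
end

noncomputable section
namespace SurfaceFEM

/-! ### Change of variables between planar pieces and the tube -/

/-- Coordinates adapted to a plane: `(t, w) ↦ x₀ + w + t m` preserves volume. -/
lemma lintegral_plane_prod {m : E3} (hm : ‖m‖ = 1) (x₀ : E3) (F : E3 → ℝ≥0∞) (hF : AEMeasurable F) :
    ∫⁻ x, F x = ∫⁻ w : (ℝ ∙ m)ᗮ, ∫⁻ t : ℝ, F (x₀ + (w : E3) + t • m) := by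
  have hf : Module.finrank ℝ E3 = 3 := by simp
  have e1 : MeasurePreserving ((ℝ ∙ m).measurableEquivProd x₀) (volume : Measure E3) volume := by
    have := (ℝ ∙ m).measurePreserving_measurableEquivProd x₀
    rwa [InnerProductSpace.euclideanHausdorffMeasure_eq_volume] at this
  have e2 : MeasurePreserving (LinearIsometryEquiv.toSpanUnitSingleton (𝕜 := ℝ) m hm)
      (volume : Measure ℝ) volume := LinearIsometryEquiv.measurePreserving _
  have e3 : MeasurePreserving (Prod.map (LinearIsometryEquiv.toSpanUnitSingleton (𝕜 := ℝ) m hm)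
      (id : (ℝ ∙ m)ᗮ → (ℝ ∙ m)ᗮ)) ((volume : Measure ℝ).prod volume) (volume.prod volume) :=
    e2.prod (MeasurePreserving.id _)
  have e4 := e1.symm.comp e3
  have e5 : MeasurePreserving (fun z : ℝ × (ℝ ∙ m)ᗮ => x₀ + (z.2 : E3) + z.1 • m)
      ((volume : Measure ℝ).prod volume) (volume : Measure E3) := by
    convert e4 using 1
    ext z : 1
    simp [Submodule.measurableEquivProd_symm_apply]
    abel
  rw [← e5.map_eq] at hF
  conv_lhs => rw [← e5.map_eq]
  rw [lintegral_map' hF e5.measurable.aemeasurable]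
  exact lintegral_prod_symm _ (hF.comp_aemeasurable e5.measurable.aemeasurable)

/-- The surface measure of a plane. -/
lemma lintegral_plane (m x₀ : E3) (hm : ‖m‖ = 1) (F : E3 → ℝ≥0∞)
    {A : Set E3} (hA : MeasurableSet A) (hAp : ∀ y ∈ A, inner ℝ m (y - x₀) = 0) :
    ∫⁻ y in A, F y ∂μHE[2] = ∫⁻ w : (ℝ ∙ m)ᗮ, A.indicator F (x₀ + (w : E3)) := by
  have hf : Module.finrank ℝ (ℝ ∙ m)ᗮ = 2 := by
    have h0 : m ≠ 0 := by rintro rfl; simp at hm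
    have h := (ℝ ∙ m).finrank_add_finrank_orthogonal
    rw [finrank_span_singleton h0] at h
    have : Module.finrank ℝ E3 = 3 := by simp
    omega
  have hi : Isometry (fun w : (ℝ ∙ m)ᗮ => x₀ + (w : E3)) :=
    (IsometryEquiv.addLeft x₀).isometry.comp isometry_subtype_coe
  have hmap : Measure.map (fun w : (ℝ ∙ m)ᗮ => x₀ + (w : E3)) volume
      = (μHE[2] : Measure E3).restrict (range fun w : (ℝ ∙ m)ᗮ => x₀ + (w : E3)) := by
    rw [← hi.map_euclideanHausdorffMeasure, ← hf, InnerProductSpace.euclideanHausdorffMeasure_eq_volume]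
  have hr : A ⊆ range fun w : (ℝ ∙ m)ᗮ => x₀ + (w : E3) := by
    intro y hy
    refine ⟨⟨y - x₀, ?_⟩, by simp⟩
    rw [Submodule.mem_orthogonal_singleton_iff_inner_right]
    exact hAp y hy
  have hemb : MeasurableEmbedding (fun w : (ℝ ∙ m)ᗮ => x₀ + (w : E3)) :=
    hi.isClosedEmbedding.measurableEmbedding
  rw [← lintegral_indicator hA]
  rw [← setLIntegral_eq_of_support_subset (s := range fun w : (ℝ ∙ m)ᗮ => x₀ + (w : E3)), ← hmap,
    hemb.lintegral_map]
  exact (Function.support_subset_iff'.2 fun x hx => indicator_of_notMem (fun h => hx (hr h)) _)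

/-- Null sets of a plane. -/
lemma plane_measure_eq_volume (m x₀ : E3) (hm : ‖m‖ = 1) {A : Set E3} (hA : MeasurableSet A)
    (hAp : ∀ y ∈ A, inner ℝ m (y - x₀) = 0) :
    μHE[2] A = volume ((fun w : (ℝ ∙ m)ᗮ => x₀ + (w : E3)) ⁻¹' A) := by
  have h := lintegral_plane m x₀ hm (fun _ => 1) hA hAp
  rw [setLIntegral_one] at h
  rw [h, ← lintegral_indicator_one]
  · rfl
  · exact (Continuous.measurable (by fun_prop)) hA

namespace SmoothClosedSurface
variable {S : SmoothClosedSurface} {δ M : ℝ}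

/-- The points of the tube above `A` at signed distances in `J`. -/
def layer (S : SmoothClosedSurface) (A : Set E3) (J : Set ℝ) : Set E3 :=
  (fun z : E3 × ℝ => S.fiber z.1 z.2) '' (A ×ˢ J)

lemma TubeReg.fiber_injOn (hT : S.TubeReg δ) {A : Set E3} (hA : A ⊆ S.tube δ) (hinj : InjOn S.proj A)
    {J : Set ℝ} (hJ : J ⊆ Ioo (-δ) δ) :
    InjOn (fun z : E3 × ℝ => S.fiber z.1 z.2) (A ×ˢ J) := by
  rintro ⟨y, t⟩ ⟨hy, ht⟩ ⟨y', t'⟩ ⟨hy', ht'⟩ h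
  have h1 := hT.fiber_mem (hA hy) (abs_lt.2 (hJ ht))
  have h2 := hT.fiber_mem (hA hy') (abs_lt.2 (hJ ht'))
  simp only at h h1 h2
  rw [h] at h1
  have e1 : t = t' := h1.1.symm.trans h2.1
  have e2 : y = y' := hinj hy hy' (h1.2.1.symm.trans h2.2.1)
  rw [e1, e2]

lemma TubeReg.continuousOn_proj (hT : S.TubeReg δ) : ContinuousOn S.proj (S.tube δ) :=
  fun _ hx => (hT.contDiffAt_proj hx).continuousAt.continuousWithinAt

lemma TubeReg.continuousOn_normal (hT : S.TubeReg δ) : ContinuousOn S.normal (S.tube δ) :=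
  fun _ hx => (hT.contDiffAt_normal hx).continuousAt.continuousWithinAt

lemma TubeReg.continuousOn_fullB (hT : S.TubeReg δ) (m : E3) :
    ContinuousOn (S.fullB m) (S.tube δ) := by
  have h1 : ContinuousOn (fun x => tangentProj (S.normal x)) (S.tube δ) := by
    have : Continuous tangentProj := by
      have : tangentProj = fun m => ContinuousLinearMap.id ℝ E3
        - ContinuousLinearMap.smulRightL ℝ E3 E3 (innerSL ℝ m) m := by
        ext; simp [tangentProj]
      rw [this]; fun_prop
    exact this.comp_continuousOn hT.continuousOn_normal
  have h2 : ContinuousOn (fun x => (innerSL ℝ m).smulRight (S.normal x)) (S.tube δ) :=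
    (ContinuousLinearMap.smulRightL ℝ E3 E3 (innerSL ℝ m)).continuous.comp_continuousOn
      hT.continuousOn_normal
  have h3 : ContinuousOn S.shape (S.tube δ) :=
    fun x hx => (hT.contDiffAt_shape hx).continuousAt.continuousWithinAt
  exact (h1.clm_comp (h3.clm_comp continuousOn_const)).add h2

lemma TubeReg.continuousOn_absDetB (hT : S.TubeReg δ) (m : E3) :
    ContinuousOn (S.absDetB m) (S.tube δ) :=
  ((contDiff_det (n := 0)).continuous.comp_continuousOn (hT.continuousOn_fullB m)).abs

/-- Change of variables for the prism map over A × J, followed by Tonelli in coordinates adapted to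
the plane. The weight `jac` cancels the dependence of the Jacobian on t, leaving |B|. -/
lemma TubeBound.lintegral_layer_piece (hT : S.TubeBound δ M) {m x₀ : E3} (hm : ‖m‖ = 1) {A : Set E3}
    (hA : MeasurableSet A) (hAp : ∀ y ∈ A, inner ℝ m (y - x₀) = 0) (hAt : A ⊆ S.tube δ)
    (hinj : InjOn S.proj A) {J : Set ℝ} (hJm : MeasurableSet J) (hJ : J ⊆ Ioo (-δ) δ) :
    MeasurableSet (S.layer A J) ∧ ∀ G : E3 → ℝ≥0∞, Measurable G →
      ∫⁻ x in S.layer A J, ENNReal.ofReal (S.jac x) * G x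
        = ∫⁻ y in A, (ENNReal.ofReal (S.absDetB m y) * ∫⁻ t in J, G (S.fiber y t)) ∂μHE[2] := by
  set a : E3 → E3 := fun z => x₀ + tangentProj m (z - x₀) with ha
  set τ : E3 → ℝ := fun z => inner ℝ m (z - x₀) with hτ
  have hac : Continuous a := by fun_prop
  have hτc : Continuous τ := by fun_prop
  set D : Set E3 := a ⁻¹' A ∩ τ ⁻¹' J with hD
  have hDm : MeasurableSet D := (hac.measurable hA).inter (hτc.measurable hJm)
  have hmm : inner ℝ m m = (1 : ℝ) := by rw [real_inner_self_eq_norm_sq, hm]; norm_num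
  have hdec : ∀ z, a z + τ z • m = z := by
    intro z; simp only [ha, hτ, tangentProj_apply]; abel
  have haw : ∀ y, inner ℝ m (y - x₀) = 0 → ∀ t : ℝ, a (y + t • m) = y ∧ τ (y + t • m) = t := by
    intro y hy t
    have e : y + t • m - x₀ = (y - x₀) + t • m := by abel
    have e2 : τ (y + t • m) = t := by
      simp only [hτ]; rw [e, inner_add_right, hy, inner_smul_right, hmm]; ring
    refine ⟨?_, e2⟩
    have := hdec (y + t • m)
    rw [e2] at this
    exact add_right_cancel this
  have himg : S.layer A J = S.prism m x₀ '' D := by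
    ext x; constructor
    · rintro ⟨⟨y, t⟩, ⟨hy, ht⟩, rfl⟩
      obtain ⟨e1, e2⟩ := haw y (hAp y hy) t
      refine ⟨y + t • m, ⟨by rw [mem_preimage, e1]; exact hy, by rw [mem_preimage, e2]; exact ht⟩, ?_⟩
      change S.fiber (a (y + t • m)) (τ (y + t • m)) = _
      rw [e1, e2]
    · rintro ⟨z, ⟨hz1, hz2⟩, rfl⟩
      exact ⟨(a z, τ z), ⟨hz1, hz2⟩, rfl⟩
  have hder : ∀ z ∈ D, HasFDerivWithinAt (S.prism m x₀) (S.prismDeriv m (a z) (τ z)) D z :=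
    fun z hz => (hT.hasFDerivAt_prism (hAt hz.1)).hasFDerivWithinAt
  have hDinj : InjOn (S.prism m x₀) D := by
    intro z hz z' hz' h
    have h1 : (a z, τ z) ∈ A ×ˢ J := mk_mem_prod hz.1 hz.2
    have h2 : (a z', τ z') ∈ A ×ˢ J := mk_mem_prod hz'.1 hz'.2
    have := hT.fiber_injOn hAt hinj hJ h1 h2 h
    rw [← hdec z, ← hdec z']
    simp only [Prod.mk.injEq] at this
    rw [this.1, this.2]
  rw [himg]
  refine ⟨measurable_image_of_fderivWithin hDm hder hDinj, fun G hG => ?_⟩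
  rw [lintegral_image_eq_lintegral_abs_det_fderiv_mul volume hDm hder hDinj]
  have hcontp : ContinuousOn (S.prism m x₀) D := fun z hz => (hder z hz).continuousWithinAt
  have hint : ∀ z ∈ D, ENNReal.ofReal |(S.prismDeriv m (a z) (τ z)).det|
      * (ENNReal.ofReal (S.jac (S.prism m x₀ z)) * G (S.prism m x₀ z))
      = ENNReal.ofReal (S.absDetB m (a z)) * G (S.prism m x₀ z) := by
    intro z hz
    have htz := abs_lt.2 (hJ hz.2)
    rw [← hT.jac_mul_det hm (hAt hz.1) htz, ← mul_assoc, ← ENNReal.ofReal_mul (abs_nonneg _)]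
    have h4 := (hT.fiber_mem (hAt hz.1) htz).2.2.2
    rw [abs_of_nonneg (le_trans (by norm_num) (hT.jac_ge _ h4))]
    rw [mul_comm |(S.prismDeriv m (a z) (τ z)).det|]
    rfl
  rw [setLIntegral_congr_fun hDm hint]
  rw [← lintegral_indicator hDm, lintegral_plane_prod hm x₀]
  · rw [lintegral_plane m x₀ hm _ hA hAp]
    refine lintegral_congr fun w => ?_
    have hw : inner ℝ m (x₀ + (w : E3) - x₀) = 0 := by
      rw [add_sub_cancel_left]
      exact (Submodule.mem_orthogonal_singleton_iff_inner_right).1 w.2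
    by_cases hwA : x₀ + (w : E3) ∈ A
    · rw [indicator_of_mem hwA, ← lintegral_const_mul', ← lintegral_indicator hJm]
      · refine lintegral_congr fun t => ?_
        obtain ⟨e1, e2⟩ := haw _ hw t
        by_cases htJ : t ∈ J
        · rw [indicator_of_mem htJ, indicator_of_mem]
          · change _ * G (S.fiber (a _) (τ _)) = _
            rw [e1, e2]
          · exact ⟨by rw [mem_preimage, e1]; exact hwA, by rw [mem_preimage, e2]; exact htJ⟩
        · rw [indicator_of_notMem htJ, indicator_of_notMem]
          intro h; apply htJ; have := h.2; rwa [mem_preimage, e2] at this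
      · exact ENNReal.ofReal_ne_top
    · rw [indicator_of_notMem hwA]
      refine (lintegral_congr (g := fun _ => 0) fun t => ?_).trans lintegral_zero
      rw [indicator_of_notMem]
      intro h; apply hwA; have := h.1; rwa [mem_preimage, (haw _ hw t).1] at this
  · rw [aemeasurable_indicator_iff hDm]
    refine AEMeasurable.mul ?_ (hG.comp_aemeasurable (hcontp.aemeasurable hDm))
    refine ENNReal.measurable_ofReal.comp_aemeasurable (ContinuousOn.aemeasurable ?_ hDm)
    exact (hT.continuousOn_absDetB m).comp hac.continuousOn fun z hz => hAt hz.1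

/-- `A` is contained in a plane on which the discrete normal `N` is constant. -/
def IsPlanar (N : E3 → E3) (A : Set E3) : Prop :=
  ∃ m x₀ : E3, ‖m‖ = 1 ∧ (∀ y ∈ A, inner ℝ m (y - x₀) = 0) ∧ ∀ y ∈ A, N y = m

lemma IsPlanar.mono {N : E3 → E3} {A B : Set E3} (h : IsPlanar N A) (hB : B ⊆ A) : IsPlanar N B := by
  obtain ⟨m, x₀, h1, h2, h3⟩ := h
  exact ⟨m, x₀, h1, fun y hy => h2 y (hB hy), fun y hy => h3 y (hB hy)⟩

/-- The pieces may overlap, so the induction adds only the part of the new piece outside the earlier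
ones. Injectivity of p on the union makes the corresponding layers disjoint. -/
lemma TubeBound.lintegral_layer (hT : S.TubeBound δ M) {N : E3 → E3} {ι : Type*} (s : Finset ι)
    (K : ι → Set E3) (hK : ∀ i ∈ s, MeasurableSet (K i)) (hKp : ∀ i ∈ s, IsPlanar N (K i))
    (hKt : ∀ i ∈ s, K i ⊆ S.tube δ) (hinj : InjOn S.proj (⋃ i ∈ s, K i))
    {J : Set ℝ} (hJm : MeasurableSet J) (hJ : J ⊆ Ioo (-δ) δ) :
    MeasurableSet (S.layer (⋃ i ∈ s, K i) J) ∧ ∀ G : E3 → ℝ≥0∞, Measurable G →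
      ∫⁻ x in S.layer (⋃ i ∈ s, K i) J, ENNReal.ofReal (S.jac x) * G x
        = ∫⁻ y in ⋃ i ∈ s, K i,
          (ENNReal.ofReal (S.absDetB (N y) y) * ∫⁻ t in J, G (S.fiber y t)) ∂μHE[2] := by
  classical
  induction s using Finset.induction_on with
  | empty => simp [layer]
  | insert i s hi ih =>
    have hsub : (⋃ j ∈ s, K j) ⊆ ⋃ j ∈ insert i s, K j :=
      biUnion_subset_biUnion_left fun j hj => Finset.mem_insert_of_mem hj
    obtain ⟨h1, h2⟩ := ih (fun j hj => hK j (Finset.mem_insert_of_mem hj))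
      (fun j hj => hKp j (Finset.mem_insert_of_mem hj))
      (fun j hj => hKt j (Finset.mem_insert_of_mem hj)) (hinj.mono hsub)
    set U := ⋃ j ∈ s, K j with hU
    have hUm : MeasurableSet U :=
      Finset.measurableSet_biUnion s fun j hj => hK j (Finset.mem_insert_of_mem hj)
    have hUt : U ⊆ S.tube δ := iUnion₂_subset fun j hj => hKt j (Finset.mem_insert_of_mem hj)
    set A := K i \ U with hA
    have hAm : MeasurableSet A := (hK i (Finset.mem_insert_self _ _)).diff hUm
    have hAt : A ⊆ S.tube δ := sdiff_subset.trans (hKt i (Finset.mem_insert_self _ _))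
    have hun : (⋃ j ∈ insert i s, K j) = U ∪ A := by
      rw [Finset.set_biUnion_insert, ← hU, hA, union_sdiff_self, union_comm]
    rw [hun] at hinj ⊢
    obtain ⟨m, x₀, hm, hAp, hN⟩ := (hKp i (Finset.mem_insert_self _ _)).mono (B := A) sdiff_subset
    obtain ⟨h3, h4⟩ := hT.lintegral_layer_piece hm hAm hAp hAt (hinj.mono subset_union_right) hJm hJ
    have hdis : Disjoint (S.layer U J) (S.layer A J) := by
      rw [Set.disjoint_left]
      rintro _ ⟨⟨y, t⟩, ⟨hy, ht⟩, rfl⟩ ⟨⟨y', t'⟩, ⟨hy', ht'⟩, h⟩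
      have e1 : (y', t') ∈ (U ∪ A) ×ˢ J := mk_mem_prod (Or.inr hy') ht'
      have e2 : (y, t) ∈ (U ∪ A) ×ˢ J := mk_mem_prod (Or.inl hy) ht
      have := hT.fiber_injOn (union_subset hUt hAt) hinj hJ e1 e2 h
      simp only [Prod.mk.injEq] at this
      simp only at hy hy'
      exact hy'.2 (this.1 ▸ hy)
    have hlay : S.layer (U ∪ A) J = S.layer U J ∪ S.layer A J := by
      simp only [layer, union_prod, image_union]
    rw [hlay]
    refine ⟨h1.union h3, fun G hG => ?_⟩
    rw [lintegral_union h3 hdis, lintegral_union hAm disjoint_sdiff_right, h2 G hG, h4 G hG]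
    congr 1
    exact setLIntegral_congr_fun hAm fun y hy => by rw [hN y hy]


/-- The weight `jac` is at least 1/2 on the layer, so vanishing of the weighted volume forces
vanishing of the volume. This discards the relative boundaries of the elements. -/
lemma TubeBound.volume_layer_eq_zero (hT : S.TubeBound δ M) {m x₀ : E3} (hm : ‖m‖ = 1) {A : Set E3}
    (hA : MeasurableSet A) (hAp : ∀ y ∈ A, inner ℝ m (y - x₀) = 0) (hAt : A ⊆ S.tube δ)
    (hinj : InjOn S.proj A) {J : Set ℝ} (hJm : MeasurableSet J) (hJ : J ⊆ Ioo (-δ) δ)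
    (hA0 : μHE[2] A = 0) : volume (S.layer A J) = 0 := by
  obtain ⟨h1, h2⟩ := hT.lintegral_layer_piece hm hA hAp hAt hinj hJm hJ
  have h3 := h2 1 measurable_one
  rw [Measure.restrict_eq_zero.2 hA0, lintegral_zero_measure] at h3
  have h4 : ENNReal.ofReal (1 / 2) * volume (S.layer A J) ≤ 0 := by
    rw [← h3, ← setLIntegral_const]
    refine setLIntegral_mono' h1 fun x hx => ?_
    obtain ⟨⟨y, t⟩, ⟨hy, ht⟩, rfl⟩ := hx
    simp only [Pi.one_apply, mul_one]
    exact ENNReal.ofReal_le_ofReal (hT.jac_ge _ (hT.fiber_mem (hAt hy) (abs_lt.2 (hJ ht))).2.2.2)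
  have h5 := le_antisymm h4 bot_le
  simpa using h5

lemma measurable_sdist (S : SmoothClosedSurface) : Measurable S.sdist := by
  unfold sdist
  exact Measurable.ite S.isOpen_inside.measurableSet
    (Metric.continuous_infDist_pt _).measurable.neg (Metric.continuous_infDist_pt _).measurable

/-- The surface measure weighted with the Jacobian of the closest point map. -/
def weighted (S : SmoothClosedSurface) (N : E3 → E3) (A : Set E3) : Measure E3 :=
  (μHE[2].restrict A).withDensity fun y => ENNReal.ofReal (S.absDetB (N y) y)

lemma TubeReg.aemeasurable_absDetB (hT : S.TubeReg δ) {N : E3 → E3} {ι : Type*} (s : Finset ι)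
    (K : ι → Set E3) (hK : ∀ i ∈ s, MeasurableSet (K i)) (hKp : ∀ i ∈ s, IsPlanar N (K i))
    (hKt : ∀ i ∈ s, K i ⊆ S.tube δ) :
    AEMeasurable (fun y => S.absDetB (N y) y) (μHE[2].restrict (⋃ i ∈ s, K i)) := by
  rw [show (⋃ i ∈ s, K i) = ⋃ i : s, K i by ext; simp]
  refine AEMeasurable.iUnion fun i => ?_
  obtain ⟨m, x₀, h1, h2, h3⟩ := hKp i i.2
  refine (((hT.continuousOn_absDetB m).mono (hKt i i.2)).aemeasurable (hK i i.2)).congr ?_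
  filter_upwards [ae_restrict_mem (hK i i.2)] with y hy
  rw [h3 y hy]

lemma TubeReg.aemeasurable_fiber (hT : S.TubeReg δ) {μ : Measure E3} {ν : Measure ℝ} [SFinite μ]
    [SFinite ν] {A : Set E3} (hA : MeasurableSet A) (hAt : A ⊆ S.tube δ) (hμ : ∀ᵐ y ∂μ, y ∈ A) :
    AEMeasurable (fun z : E3 × ℝ => S.fiber z.1 z.2) (μ.prod ν) := by
  have hr : μ = μ.restrict A := (Measure.restrict_eq_self_of_ae_mem hμ).symm
  have h1 : AEMeasurable S.proj μ := by
    rw [hr]; exact (hT.continuousOn_proj.mono hAt).aemeasurable hA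
  have h2 : AEMeasurable S.normal μ := by
    rw [hr]; exact (hT.continuousOn_normal.mono hAt).aemeasurable hA
  have h3 : AEMeasurable (fun z : E3 × ℝ => S.proj z.1) (μ.prod ν) :=
    h1.comp_quasiMeasurePreserving Measure.quasiMeasurePreserving_fst
  have h4 : AEMeasurable (fun z : E3 × ℝ => S.normal z.1) (μ.prod ν) :=
    h2.comp_quasiMeasurePreserving Measure.quasiMeasurePreserving_fst
  exact h3.add (measurable_snd.aemeasurable.smul h4)

/-- Change of variables between the discrete surface and the tube, as an identity of measures. -/
theorem TubeBound.map_fiber (hT : S.TubeBound δ M) {N : E3 → E3} {ι : Type*} (s : Finset ι)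
    (K : ι → Set E3) (hK : ∀ i ∈ s, MeasurableSet (K i)) (hKp : ∀ i ∈ s, IsPlanar N (K i))
    (hKt : ∀ i ∈ s, K i ⊆ S.tube δ) (hinj : InjOn S.proj (⋃ i ∈ s, K i))
    (hfin : μHE[2] (⋃ i ∈ s, K i) ≠ ⊤)
    {J : Set ℝ} (hJm : MeasurableSet J) (hJ : J ⊆ Ioo (-δ) δ) :
    Measure.map (fun z : E3 × ℝ => S.fiber z.1 z.2)
        ((S.weighted N (⋃ i ∈ s, K i)).prod (volume.restrict J))
      = (volume.restrict (S.layer (⋃ i ∈ s, K i) J)).withDensity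
        fun x => ENNReal.ofReal (S.jac x) := by
  obtain ⟨h1, h2⟩ := hT.lintegral_layer s K hK hKp hKt hinj hJm hJ
  have hB := hT.aemeasurable_absDetB s K hK hKp hKt
  set U := ⋃ i ∈ s, K i with hU
  have hUm : MeasurableSet U := Finset.measurableSet_biUnion s hK
  have hUt : U ⊆ S.tube δ := iUnion₂_subset hKt
  have : IsFiniteMeasure ((μHE[2] : Measure E3).restrict U) := ⟨by
    rw [Measure.restrict_apply_univ]; exact hfin.lt_top⟩
  have hmem : ∀ᵐ y ∂(S.weighted N U), y ∈ U :=
    (withDensity_absolutelyContinuous _ _).ae_le (ae_restrict_mem hUm)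
  have : SFinite (S.weighted N U) := by unfold weighted; infer_instance
  have hfib := hT.aemeasurable_fiber (ν := volume.restrict J) hUm hUt hmem
  ext E hE
  rw [withDensity_apply _ hE, ← lintegral_indicator_one hE,
    lintegral_map' (measurable_one.indicator hE).aemeasurable hfib, lintegral_prod]
  · unfold weighted
    rw [lintegral_withDensity_eq_lintegral_mul₀' hB.ennreal_ofReal]
    · have h3 := h2 (E.indicator 1) (measurable_one.indicator hE)
      rw [Measure.restrict_restrict hE,
      ← setLIntegral_indicator hE (fun x => ENNReal.ofReal (S.jac x))]
      simp only [Pi.mul_apply]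
      rw [← h3]
      refine lintegral_congr fun x => ?_
      by_cases hx : x ∈ E <;> simp [hx]
    · exact ((measurable_one.indicator hE).comp_aemeasurable hfib).lintegral_prod_right'
  · exact (measurable_one.indicator hE).comp_aemeasurable hfib

end SmoothClosedSurface
end SurfaceFEM
end

noncomputable section
namespace SurfaceFEM

/-! ### Geometry of the discrete surface -/

namespace SmoothClosedSurface
variable (S : SmoothClosedSurface) {δ M : ℝ}

/-- Only points on different sides need an argument beyond the triangle inequality: the segment
between them meets Γ, and splitting it there bounds the sum of the two unsigned distances. -/
lemma abs_sdist_sub_le (x y : E3) : |S.sdist x - S.sdist y| ≤ dist x y := by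
  have key : ∀ x y, x ∈ S.inside → y ∉ S.inside → |S.sdist x - S.sdist y| ≤ dist x y := by
    intro x y hx hy
    have : ∃ z ∈ segment ℝ x y, z ∈ S.surf := by
      by_contra! h
      have hc : IsPreconnected (segment ℝ x y) := (convex_segment x y).isPreconnected
      have hsub : segment ℝ x y ⊆ S.inside ∪ (closure S.inside)ᶜ := by
        intro z hz
        have h1 := h z hz
        rw [surf, S.isOpen_inside.frontier_eq] at h1
        by_cases hzi : z ∈ S.inside
        · exact Or.inl hzi
        · exact Or.inr fun hcl => h1 ⟨hcl, hzi⟩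
      have hy' : y ∈ (closure S.inside)ᶜ := (hsub (right_mem_segment ℝ x y)).resolve_left hy
      obtain ⟨z, -, hz1, hz2⟩ := hc _ _ S.isOpen_inside isClosed_closure.isOpen_compl hsub
        ⟨x, left_mem_segment ℝ x y, hx⟩ ⟨y, right_mem_segment ℝ x y, hy'⟩
      exact hz2 (subset_closure hz1)
    obtain ⟨z, hz, hzS⟩ := this
    have h1 := Metric.infDist_le_dist_of_mem (x := x) hzS
    have h2 := Metric.infDist_le_dist_of_mem (x := y) hzS
    have h3 := dist_add_dist_of_mem_segment hz
    rw [dist_comm y z] at h2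
    simp only [sdist, hx, hy, if_true, if_false]
    rw [abs_le]
    have h4 := Metric.infDist_nonneg (x := x) (s := S.surf)
    have h5 := Metric.infDist_nonneg (x := y) (s := S.surf)
    constructor <;> linarith
  by_cases hx : x ∈ S.inside <;> by_cases hy : y ∈ S.inside
  · simp only [sdist, hx, hy, if_true]
    have h1 := Metric.infDist_le_infDist_add_dist (s := S.surf) (x := x) (y := y)
    have h2 := Metric.infDist_le_infDist_add_dist (s := S.surf) (x := y) (y := x)
    rw [dist_comm] at h2
    rw [abs_le]; constructor <;> linarith
  · exact key x y hx hy
  · rw [abs_sub_comm, dist_comm]; exact key y x hy hx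
  · simp only [sdist, hx, hy, if_false]
    have h1 := Metric.infDist_le_infDist_add_dist (s := S.surf) (x := x) (y := y)
    have h2 := Metric.infDist_le_infDist_add_dist (s := S.surf) (x := y) (y := x)
    rw [dist_comm] at h2
    rw [abs_le]; constructor <;> linarith

lemma continuous_sdist : Continuous S.sdist := by
  refine LipschitzWith.continuous (K := 1) (LipschitzWith.of_dist_le_mul fun x y => ?_)
  rw [Real.dist_eq]; simpa using S.abs_sdist_sub_le x y

lemma ball_subset_tube {x : E3} {r : ℝ} (h : |S.sdist x| + r ≤ δ) : Metric.ball x r ⊆ S.tube δ := by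
  intro y hy
  have h1 := S.abs_sdist_sub_le y x
  have h2 : |S.sdist y| ≤ |S.sdist x| + |S.sdist y - S.sdist x| := by
    have := abs_add_le (S.sdist x) (S.sdist y - S.sdist x); simpa using this
  have h3 : dist y x < r := hy
  change |S.sdist y| < δ
  linarith

variable {S}

/-- In directions orthogonal to m the derivative of ρ is ⟨n - m, ·⟩, and |n - m| ≤ M r + ε
throughout the ball; the mean value inequality on the segment finishes. -/
lemma TubeBound.abs_sdist_sub_le_of_plane (hT : S.TubeBound δ M) {m x a b : E3} {r ε : ℝ}
    (hr : Metric.ball x r ⊆ S.tube δ) (ha : a ∈ Metric.ball x r) (hb : b ∈ Metric.ball x r)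
    (hn : ‖S.normal x - m‖ ≤ ε) (hab : inner ℝ m (a - b) = 0) :
    |S.sdist a - S.sdist b| ≤ (M * r + ε) * ‖a - b‖ := by
  have hr0 : 0 < r := dist_nonneg.trans_lt ha
  set c : ℝ → E3 := fun θ => b + θ • (a - b) with hc
  have hcball : ∀ θ ∈ Icc (0 : ℝ) 1, c θ ∈ Metric.ball x r := by
    intro θ hθ
    have := (convex_ball x r).add_smul_sub_mem hb ha hθ
    exact this
  have hder : ∀ θ ∈ Icc (0 : ℝ) 1, HasDerivWithinAt (fun θ => S.sdist (c θ))
      (inner ℝ (S.normal (c θ)) (a - b)) (Icc 0 1) θ := by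
    intro θ hθ
    have h1 : HasDerivAt c (a - b) θ := by
      have := ((hasDerivAt_id θ).smul_const (a - b)).const_add b
      rwa [one_smul] at this
    have h2 := (hT.differentiableAt_sdist (hr (hcball θ hθ))).hasFDerivAt.comp_hasDerivAt θ h1
    rw [TubeReg.fderiv_sdist_apply] at h2
    exact h2.hasDerivWithinAt
  have hx : x ∈ S.tube δ := hr (Metric.mem_ball_self hr0)
  have hb' : ∀ θ ∈ Ico (0 : ℝ) 1, ‖inner ℝ (S.normal (c θ)) (a - b)‖ ≤ (M * r + ε) * ‖a - b‖ := by
    intro θ hθ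
    have hθ' := hcball θ (Ico_subset_Icc_self hθ)
    have e : inner ℝ (S.normal (c θ)) (a - b) = inner ℝ (S.normal (c θ) - m) (a - b) := by
      rw [inner_sub_left, hab, sub_zero]
    rw [e]
    refine (norm_inner_le_norm _ _).trans (mul_le_mul_of_nonneg_right ?_ (norm_nonneg _))
    have h3 := hT.normal_lip _ (hr hθ') _ hx
    have h4 : ‖c θ - x‖ ≤ r := by rw [← dist_eq_norm]; exact hθ'.le
    have h5 : ‖S.normal (c θ) - m‖ ≤ ‖S.normal (c θ) - S.normal x‖ + ‖S.normal x - m‖ :=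
      norm_sub_le_norm_sub_add_norm_sub _ _ _
    have h6 := mul_le_mul_of_nonneg_left h4 (zero_le_one.trans hT.one_le)
    linarith
  have := norm_image_sub_le_of_norm_deriv_le_segment_01' hder hb'
  simpa [hc] using this

/-- Since p = id - ρ n, the deviation of p from the identity consists of the increment of ρ, which
is small along the plane, and of ρ times the increment of n. -/
lemma TubeBound.norm_proj_sub_le_of_plane (hT : S.TubeBound δ M) {m x a b : E3} {r ε : ℝ}
    (hr : Metric.ball x r ⊆ S.tube δ) (ha : a ∈ Metric.ball x r) (hb : b ∈ Metric.ball x r)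
    (hn : ‖S.normal x - m‖ ≤ ε) (hab : inner ℝ m (a - b) = 0) :
    ‖S.proj a - S.proj b - (a - b)‖ ≤ (M * r + ε + M * |S.sdist b|) * ‖a - b‖ := by
  have h1 := hT.abs_sdist_sub_le_of_plane hr ha hb hn hab
  have e : S.proj a - S.proj b - (a - b)
      = -((S.sdist a - S.sdist b) • S.normal a + S.sdist b • (S.normal a - S.normal b)) := by
    rw [hT.proj_eq _ (hr ha), hT.proj_eq _ (hr hb)]; module
  rw [e, norm_neg]
  refine (norm_add_le _ _).trans ?_
  rw [norm_smul, norm_smul, hT.norm_normal _ (hr ha), Real.norm_eq_abs, Real.norm_eq_abs]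
  have h2 := mul_le_mul_of_nonneg_left (hT.normal_lip _ (hr ha) _ (hr hb)) (abs_nonneg (S.sdist b))
  nlinarith

end SmoothClosedSurface

/-- The assumptions on the geometry at a fixed mesh size, with constant `M`. -/
structure Approx (S : SmoothClosedSurface) (δ M : ℝ) (d : DiscreteData) (h : ℝ) : Prop where
  tube : S.TubeBound δ M
  delta_le : δ ≤ 1
  h_pos : 0 < h
  -- A generous margin; the absorption in `gradSum_le` uses it through the smallness of M⁷h, other
  -- estimates through lower powers of M.
  small : 1000000000 * M ^ 8 * h ≤ δ
  surface : d.IsDiscreteSurface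
  subset_tube : d.surf ⊆ S.tube δ
  bijOn : BijOn S.proj d.surf S.surf
  dist_le : ∀ x ∈ d.surf, |S.sdist x| ≤ M * h ^ 2
  normal_le : ∀ x ∈ d.elementSet, ‖S.normal x - d.normal x‖ ≤ M * h
  diam_le : ∀ s ∈ d.mesh.cells, ∀ x ∈ closedCell s, ∀ y ∈ closedCell s, dist x y ≤ M * h
  ball : ∀ s ∈ d.mesh.cells, ∃ z, Metric.ball z (h / M) ⊆ closedCell s
  cover : S.tube δ ⊆ ⋃ s ∈ d.mesh.cells, closedCell s

/-- The point of the discrete surface with the same closest point on the surface as `x`. -/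
def DiscreteData.foot (d : DiscreteData) (S : SmoothClosedSurface) (x : E3) : E3 :=
  Function.invFunOn S.proj d.surf (S.proj x)

/-- The signed distance to the discrete surface along the normals of the smooth surface. -/
def DiscreteData.gap (d : DiscreteData) (S : SmoothClosedSurface) (x : E3) : ℝ :=
  S.sdist x - S.sdist (d.foot S x)

namespace Approx
variable {S : SmoothClosedSurface} {δ M h : ℝ} {d : DiscreteData} (A : Approx S δ M d h)
include A

lemma M_pos : 0 < M := zero_lt_one.trans_le A.tube.one_le

lemma pow_mul_le' {k : ℕ} (hk : k ≤ 8) : M ^ k * h ≤ δ / 1000000000 := by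
  have h1 : M ^ k ≤ M ^ 8 := pow_le_pow_right₀ A.tube.one_le hk
  have h2 := mul_le_mul_of_nonneg_right h1 A.h_pos.le
  have := A.small
  linarith

lemma pow_mul_le {k : ℕ} (hk : k ≤ 8) : M ^ k * h ≤ δ / 1000 := by
  have := A.pow_mul_le' hk
  have := A.tube.pos
  linarith

lemma h_le : h ≤ δ / 1000 := by simpa using A.pow_mul_le (k := 0) (by norm_num)

lemma mul_le : M * h ≤ δ / 1000 := by simpa using A.pow_mul_le (k := 1) (by norm_num)

lemma h_le_mul : h ≤ M * h := le_mul_of_one_le_left A.h_pos.le A.tube.one_le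

lemma sq_le_mul : M * h ^ 2 ≤ M * h / 1000 := by
  have h1 := A.h_le
  have h2 := A.delta_le
  have := A.h_pos
  have := A.M_pos
  have : M * h * h ≤ M * h * (1 / 1000) := by
    apply mul_le_mul_of_nonneg_left _ (by positivity); linarith
  linarith [this, sq h]

lemma abs_sdist_le {x : E3} (hx : x ∈ d.surf) : |S.sdist x| ≤ M * h / 1000 :=
  (A.dist_le x hx).trans A.sq_le_mul

lemma foot_mem (x : E3) : d.foot S x ∈ d.surf :=
  Function.invFunOn_mem (A.bijOn.surjOn (S.proj_mem_surf x))

lemma proj_foot (x : E3) : S.proj (d.foot S x) = S.proj x :=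
  Function.invFunOn_eq (A.bijOn.surjOn (S.proj_mem_surf x))

lemma foot_eq_of_mem {x y : E3} (hy : y ∈ d.surf) (h : S.proj y = S.proj x) : d.foot S x = y :=
  A.bijOn.injOn (A.foot_mem x) hy ((A.proj_foot x).trans h.symm)

lemma foot_of_mem {y : E3} (hy : y ∈ d.surf) : d.foot S y = y := A.foot_eq_of_mem hy rfl

lemma normal_foot {x : E3} (hx : x ∈ S.tube δ) : S.normal (d.foot S x) = S.normal x := by
  rw [← A.tube.normal_proj _ (A.subset_tube (A.foot_mem x)), A.proj_foot, A.tube.normal_proj _ hx]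

/-- A point and its foot lie on the same normal line of Γ, so they differ by the difference of their
signed distances. -/
lemma sub_foot {x : E3} (hx : x ∈ S.tube δ) : x - d.foot S x = d.gap S x • S.normal x := by
  have h1 := A.tube.fiber_sdist hx
  have h2 := A.tube.fiber_sdist (A.subset_tube (A.foot_mem x))
  rw [SmoothClosedSurface.fiber, A.proj_foot, A.normal_foot hx] at h2
  rw [SmoothClosedSurface.fiber] at h1
  rw [DiscreteData.gap]
  nth_rewrite 1 [← h1]
  nth_rewrite 1 [← h2]
  module

lemma norm_sub_foot {x : E3} (hx : x ∈ S.tube δ) : ‖x - d.foot S x‖ = |d.gap S x| := by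
  rw [A.sub_foot hx, norm_smul, A.tube.norm_normal x hx, mul_one, Real.norm_eq_abs]

lemma gap_of_mem {y : E3} (hy : y ∈ d.surf) : d.gap S y = 0 := by
  rw [DiscreteData.gap, A.foot_of_mem hy, sub_self]

lemma mem_of_gap {x : E3} (hx : x ∈ S.tube δ) (h : d.gap S x = 0) : x ∈ d.surf := by
  have := A.sub_foot hx
  rw [h, zero_smul, sub_eq_zero] at this
  rw [this]; exact A.foot_mem x

lemma shift {x : E3} {t : ℝ} (hx : x ∈ S.tube δ) (ht : |S.sdist x + t| < δ) :
    x + t • S.normal x ∈ S.tube δ ∧ d.foot S (x + t • S.normal x) = d.foot S x ∧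
      S.normal (x + t • S.normal x) = S.normal x ∧
      d.gap S (x + t • S.normal x) = d.gap S x + t := by
  have h1 := A.tube.fiber_sdist hx
  have e : x + t • S.normal x = S.fiber x (S.sdist x + t) := by
    nth_rewrite 1 [← h1]; simp only [SmoothClosedSurface.fiber]; module
  obtain ⟨h2, h3, h4, h5⟩ := A.tube.fiber_mem hx ht
  have h6 : d.foot S (S.fiber x (S.sdist x + t)) = d.foot S x := by
    rw [DiscreteData.foot, h3]; rfl
  rw [e]
  refine ⟨h5, h6, h4, ?_⟩
  rw [DiscreteData.gap, DiscreteData.gap, h6, h2]; ring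

/-- The inverse of the continuous bijection p from the compact set Γ_h onto Γ is continuous, because
closed subsets of Γ_h have compact images. -/
lemma continuousOn_foot : ContinuousOn (d.foot S) (S.tube δ) := by
  have h1 : ContinuousOn (Function.invFunOn S.proj d.surf) S.surf := by
    rw [continuousOn_iff_isClosed]
    intro t ht
    refine ⟨S.proj '' (d.surf ∩ t), ?_, ?_⟩
    · refine IsCompact.isClosed (IsCompact.image_of_continuousOn (A.surface.isCompact.inter_right ht)
        (A.tube.continuousOn_proj.mono (inter_subset_left.trans A.subset_tube)))
    · ext y; constructor
      · rintro ⟨hy, hyS⟩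
        exact ⟨⟨_, ⟨Function.invFunOn_mem (A.bijOn.surjOn hyS), hy⟩,
          Function.invFunOn_eq (A.bijOn.surjOn hyS)⟩, hyS⟩
      · rintro ⟨⟨z, ⟨hz, hzt⟩, rfl⟩, hyS⟩
        refine ⟨?_, hyS⟩
        rw [mem_preimage]
        have : Function.invFunOn S.proj d.surf (S.proj z) = z := A.foot_of_mem hz
        rwa [this]
  exact h1.comp A.tube.continuousOn_proj fun x _ => S.proj_mem_surf x

lemma continuousOn_gap : ContinuousOn (d.gap S) (S.tube δ) :=
  S.continuous_sdist.continuousOn.sub (S.continuous_sdist.comp_continuousOn A.continuousOn_foot)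

/-- The signed distances of the feet are O(h²), so the gap is 1-Lipschitz up to that error, without
any Lipschitz bound for the foot. -/
lemma abs_gap_sub_le (x y : E3) : |d.gap S x - d.gap S y| ≤ dist x y + 2 * (M * h ^ 2) := by
  have h1 := S.abs_sdist_sub_le x y
  have h2 := A.dist_le _ (A.foot_mem x)
  have h3 := A.dist_le _ (A.foot_mem y)
  rw [abs_le] at *
  simp only [DiscreteData.gap]
  constructor <;> linarith

/-- A connected set on which the gap changes sign meets the discrete surface. -/
lemma exists_mem_of_sign {C : Set E3} (hC : IsPreconnected C) (hCt : C ⊆ S.tube δ) {a b : E3}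
    (ha : a ∈ C) (hb : b ∈ C) {e : ℝ} (he : e ≠ 0) (h1 : e * d.gap S a ≤ 0) (h2 : 0 ≤ e * d.gap S b) :
    ∃ x ∈ C, x ∈ d.surf := by
  obtain ⟨x, hx, h0⟩ := hC.intermediate_value ha hb
    ((A.continuousOn_gap.mono hCt).const_smul e) (show (0 : ℝ) ∈ _ from ⟨h1, h2⟩)
  refine ⟨x, hx, A.mem_of_gap (hCt hx) ?_⟩
  have : e * d.gap S x = 0 := h0
  simpa [he] using this

lemma ball_subset {x : E3} (hx : x ∈ d.surf) : Metric.ball x (δ / 2) ⊆ S.tube δ := by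
  apply S.ball_subset_tube
  have := A.abs_sdist_le hx
  have := A.mul_le
  have := A.tube.pos
  linarith

lemma cell_subset {s : Finset E3} (hs : s ∈ d.active) : closedCell s ⊆ S.tube δ := by
  obtain ⟨hs1, x, hxs, hx⟩ := hs
  intro y hy
  refine A.ball_subset hx ?_
  have h1 := A.diam_le s hs1 y hy x hxs
  have := A.mul_le
  have := A.tube.pos
  rw [Metric.mem_ball]
  linarith

/-- On a plane orthogonal to the discrete normal of a nearby element, the closest point map is
close to the identity. -/
lemma norm_proj_sub_le {m x a b : E3} (hx : x ∈ d.surf) (hn : ‖S.normal x - m‖ ≤ M * h)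
    (ha : dist a x ≤ 2 * (M * h)) (hb : dist b x ≤ 2 * (M * h)) (hab : inner ℝ m (a - b) = 0) :
    ‖S.proj a - S.proj b - (a - b)‖ ≤ 1 / 2 * ‖a - b‖ := by
  have h0 := A.M_pos
  have hh := A.h_pos
  have hr : Metric.ball x (3 * (M * h)) ⊆ S.tube δ := by
    refine (Metric.ball_subset_ball ?_).trans (A.ball_subset hx)
    have := A.mul_le; have := A.tube.pos; linarith
  have hpos : 0 < M * h := by positivity
  have hb' : b ∈ Metric.ball x (3 * (M * h)) := by rw [Metric.mem_ball]; linarith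
  refine (A.tube.norm_proj_sub_le_of_plane hr (by rw [Metric.mem_ball]; linarith) hb' hn hab).trans
    (mul_le_mul_of_nonneg_right ?_ (norm_nonneg _))
  have h2 := A.pow_mul_le (k := 2) (by norm_num)
  have h3 := A.delta_le
  have h4 := A.mul_le
  have h5 : |S.sdist b| ≤ 3 * (M * h) := by
    have e1 := S.abs_sdist_sub_le b x
    have e2 := A.abs_sdist_le hx
    have e3 : |S.sdist b| ≤ |S.sdist x| + |S.sdist b - S.sdist x| := by
      have := abs_add_le (S.sdist x) (S.sdist b - S.sdist x); simpa using this
    linarith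
  have h6 := mul_le_mul_of_nonneg_left h5 h0.le
  nlinarith

lemma half_le_inner {x m : E3} (hx : x ∈ S.tube δ) (hn : ‖S.normal x - m‖ ≤ M * h) :
    1 / 2 ≤ inner ℝ m (S.normal x) := by
  have e1 : inner ℝ m (S.normal x) = 1 - inner ℝ (S.normal x - m) (S.normal x) := by
    rw [inner_sub_left, real_inner_self_eq_norm_sq, A.tube.norm_normal x hx]; ring
  have e2 := real_inner_le_norm (S.normal x - m) (S.normal x)
  rw [A.tube.norm_normal x hx, mul_one] at e2
  have := A.mul_le
  have := A.delta_le
  linarith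

end Approx

lemma convex_closedCell (s : Finset E3) : Convex ℝ (closedCell s) := convex_convexHull ℝ _

lemma isClosed_closedCell (s : Finset E3) : IsClosed (closedCell s) :=
  (s.finite_toSet.isCompact_convexHull ℝ).isClosed

lemma openCell_subset (s : Finset E3) : openCell s ⊆ closedCell s := interior_subset

lemma convex_openCell (s : Finset E3) : Convex ℝ (openCell s) := (convex_closedCell s).interior

lemma isOpen_openCell (s : Finset E3) : IsOpen (openCell s) := isOpen_interior

/-- The surface element `K` has closure `C`, contained in the plane orthogonal to `m` and in
the active tetrahedron `s`. -/
structure Piece (d : DiscreteData) (K C : Set E3) (m : E3) (s : Finset E3) : Prop where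
  mem : s ∈ d.active
  norm_eq : ‖m‖ = 1
  sub : K ⊆ C
  convex : Convex ℝ C
  closed : IsClosed C
  cell : C ⊆ closedCell s
  closure : C ⊆ closure K
  surf : K ⊆ d.surf
  planar : ∀ y ∈ C, ∀ z ∈ C, inner ℝ m (y - z) = 0
  normal : ∀ y ∈ K, d.normal y = m
  rel_open : ∀ y ∈ K, ∃ ε > 0, ∀ z ∈ Metric.ball y ε, inner ℝ m (z - y) = 0 → z ∈ K
  of_rel_int : ∀ y ∈ C, (∃ ε > 0, ∀ z ∈ Metric.ball y ε, inner ℝ m (z - y) = 0 → z ∈ C) → y ∈ K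

namespace Approx
variable {S : SmoothClosedSurface} {δ M h : ℝ} {d : DiscreteData} (A : Approx S δ M d h)
include A

/-- A cut of an open tetrahedron by the discrete surface is its cut by a plane. -/
lemma cut_eq {s : Finset E3} (hs : s ∈ d.active) {x m : E3} (hx : x ∈ openCell s ∩ d.surf)
    (hn : ‖S.normal x - m‖ ≤ M * h)
    (hpl : ∀ x ∈ openCell s ∩ d.surf, ∀ y ∈ openCell s ∩ d.surf, inner ℝ m (x - y) = 0) :
    openCell s ∩ d.surf = openCell s ∩ {y | inner ℝ m (y - x) = 0} := by
  refine Subset.antisymm (fun y hy => ⟨hy.1, hpl y hy x hx⟩) ?_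
  set V := openCell s ∩ {y | inner ℝ m (y - x) = 0} with hV
  have hVc : Convex ℝ V := by
    refine (convex_openCell s).inter ?_
    intro y hy z hz a b ha hb hab
    simp only [mem_ofPred_eq] at *
    have : a • y + b • z - x = a • (y - x) + b • (z - x) := by
      rw [smul_sub, smul_sub, sub_add_sub_comm, ← add_smul, hab, one_smul]
    rw [this, inner_add_right, inner_smul_right, inner_smul_right, hy, hz]; ring
  -- Γ_h is relatively open in the planar section V. For z in V near a point of Γ_h the foot of z
  -- lies in the same open cell, hence in the same plane. There p is close to the identity, so two
  -- points with equal images coincide and z is its own foot. As Γ_h is closed and V is connected, V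
  -- lies in Γ_h.
  have hloc : ∀ y ∈ V ∩ d.surf, ∃ ε > 0, V ∩ Metric.ball y ε ⊆ d.surf := by
    rintro y ⟨hyV, hy⟩
    have hyt := A.subset_tube hy
    have hca : ContinuousAt (d.foot S) y :=
      A.continuousOn_foot.continuousAt ((S.isOpen_tube δ).mem_nhds hyt)
    have h1 : ∀ᶠ z in 𝓝 y, d.foot S z ∈ openCell s := by
      apply hca.eventually_mem
      rw [A.foot_of_mem hy]; exact (isOpen_openCell s).mem_nhds hyV.1
    obtain ⟨ε, hε, hb⟩ := Metric.eventually_nhds_iff_ball.1 h1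
    refine ⟨ε, hε, fun z hz => ?_⟩
    have hf := hb z hz.2
    have hdist : ∀ w ∈ openCell s, dist w x ≤ 2 * (M * h) := by
      intro w hw
      have := A.diam_le s hs.1 w (openCell_subset s hw) x (openCell_subset s hx.1)
      have := mul_pos A.M_pos A.h_pos
      linarith
    have hzf : inner ℝ m (z - d.foot S z) = 0 := by
      have e1 : inner ℝ m (z - x) = 0 := hz.1.2
      have e2 := hpl _ ⟨hf, A.foot_mem z⟩ x hx
      have : z - d.foot S z = (z - x) - (d.foot S z - x) := by abel
      rw [this, inner_sub_right, e1, e2, sub_zero]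
    have h2 := A.norm_proj_sub_le hx.2 hn (hdist z hz.1.1) (hdist _ hf) hzf
    rw [A.proj_foot, sub_self, zero_sub, norm_neg] at h2
    have h3 : ‖z - d.foot S z‖ = 0 := by
      have := norm_nonneg (z - d.foot S z); linarith
    rw [norm_eq_zero, sub_eq_zero] at h3
    rw [h3]; exact A.foot_mem z
  choose! ε hε hball using hloc
  set u := ⋃ y ∈ V ∩ d.surf, Metric.ball y (ε y) with hu
  have huo : IsOpen u := isOpen_biUnion fun y _ => Metric.isOpen_ball
  have hVu : ∀ y ∈ V, y ∈ u ↔ y ∈ d.surf := by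
    intro y hy
    constructor
    · intro hyu
      obtain ⟨z, hz, hyz⟩ := mem_iUnion₂.1 hyu
      exact hball z hz ⟨hy, hyz⟩
    · intro hyS
      exact mem_iUnion₂.2 ⟨y, ⟨hy, hyS⟩, Metric.mem_ball_self (hε y ⟨hy, hyS⟩)⟩
  have hxV : x ∈ V := ⟨hx.1, by simp⟩
  intro y hy
  refine ⟨hy.1, ?_⟩
  by_contra hyS
  obtain ⟨z, hzV, hzu, hzS⟩ := hVc.isPreconnected u d.surfᶜ huo A.surface.isCompact.isClosed.isOpen_compl
    (fun z hz => by
      by_cases h : z ∈ d.surf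
      · exact Or.inl ((hVu z hz).2 h)
      · exact Or.inr h)
    ⟨x, hxV, (hVu x hxV).2 hx.2⟩ ⟨y, hy, hyS⟩
  exact hzS ((hVu z hzV).1 hzu)

/-- The point x is interior to the tetrahedron. Moving a point of the closed planar section towards
x enters the open cell, which gives density of the element, and prolonging the segment from x beyond
a relatively interior point shows that this point was in the open cell already. -/
lemma cut_piece {s : Finset E3} (hs : s ∈ d.active) {x : E3} (hx : x ∈ openCell s ∩ d.surf) :
    ∃ m, ‖S.normal x - m‖ ≤ M * h ∧
      openCell s ∩ d.surf = openCell s ∩ {y | inner ℝ m (y - x) = 0} ∧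
      Piece d (openCell s ∩ d.surf) (closedCell s ∩ {y | inner ℝ m (y - x) = 0}) m s := by
  obtain ⟨m, hm1, hm2, hm3, -⟩ := A.surface.normal_cell s hs
  have hxe : x ∈ d.elementSet := ⟨_, Or.inl ⟨s, hs, rfl⟩, hx⟩
  have hn : ‖S.normal x - m‖ ≤ M * h := by
    have := A.normal_le x hxe
    rwa [hm2 x hx.1] at this
  have heq := A.cut_eq hs hx hn hm3
  have hcl : IsClosed {y : E3 | inner ℝ m (y - x) = 0} :=
    isClosed_eq (by fun_prop) continuous_const
  have hcv : Convex ℝ {y : E3 | inner ℝ m (y - x) = 0} := by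
    intro y hy z hz a b ha hb hab
    simp only [mem_ofPred_eq] at *
    have : a • y + b • z - x = a • (y - x) + b • (z - x) := by
      rw [smul_sub, smul_sub, sub_add_sub_comm, ← add_smul, hab, one_smul]
    rw [this, inner_add_right, inner_smul_right, inner_smul_right, hy, hz]; ring
  -- points of the open segment towards `x` are in the element
  have hseg : ∀ y ∈ closedCell s ∩ {y | inner ℝ m (y - x) = 0}, ∀ θ ∈ Ioc (0 : ℝ) 1,
      y + θ • (x - y) ∈ openCell s ∩ {y | inner ℝ m (y - x) = 0} := by
    intro y hy θ hθ
    refine ⟨(convex_closedCell s).add_smul_sub_mem_interior hy.1 hx.1 hθ, ?_⟩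
    exact hcv.add_smul_sub_mem hy.2 (by simp) ⟨hθ.1.le, hθ.2⟩
  refine ⟨m, hn, heq, ⟨hs, hm1, ?_, (convex_closedCell s).inter hcv, (isClosed_closedCell s).inter hcl,
    inter_subset_left, ?_, inter_subset_right, ?_, fun y hy => hm2 y hy.1, ?_, ?_⟩⟩
  · rw [heq]; exact inter_subset_inter_left _ (openCell_subset s)
  · intro y hy
    rw [heq]
    have ht : Tendsto (fun θ : ℝ => y + θ • (x - y)) (𝓝[>] 0) (𝓝 y) := by
      have : Continuous fun θ : ℝ => y + θ • (x - y) := by fun_prop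
      have := this.tendsto 0
      simp only [zero_smul, add_zero] at this
      exact this.mono_left nhdsWithin_le_nhds
    refine mem_closure_of_tendsto ht ?_
    filter_upwards [Ioc_mem_nhdsGT (zero_lt_one' ℝ)] with θ hθ using hseg y hy θ hθ
  · intro y hy z hz
    have e1 : inner ℝ m (y - x) = 0 := hy.2
    have e2 : inner ℝ m (z - x) = 0 := hz.2
    have : y - z = (y - x) - (z - x) := by abel
    rw [this, inner_sub_right, e1, e2, sub_zero]
  · intro y hy
    have hy' := hy
    rw [heq] at hy'
    obtain ⟨ε, hε, hb⟩ := Metric.isOpen_iff.1 (isOpen_openCell s) y hy.1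
    refine ⟨ε, hε, fun z hz hzy => ?_⟩
    rw [heq]
    refine ⟨hb hz, ?_⟩
    have e1 : inner ℝ m (y - x) = 0 := hy'.2
    have : z - x = (z - y) + (y - x) := by abel
    change inner ℝ m (z - x) = 0
    rw [this, inner_add_right, hzy, e1, add_zero]
  · rintro y hy ⟨ε, hε, hb⟩
    rw [heq]
    refine ⟨?_, hy.2⟩
    have e1 : inner ℝ m (y - x) = 0 := hy.2
    -- prolong the segment from `x` to `y`
    set η : ℝ := ε / (2 * (‖y - x‖ + 1)) with hη
    have hη0 : 0 < η := by positivity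
    have hz : y + η • (y - x) ∈ closedCell s := by
      refine (hb _ ?_ ?_).1
      · rw [Metric.mem_ball, dist_eq_norm, add_sub_cancel_left, norm_smul, Real.norm_eq_abs,
          abs_of_pos hη0, hη, div_mul_eq_mul_div, div_lt_iff₀ (by positivity)]
        nlinarith [norm_nonneg (y - x)]
      · rw [add_sub_cancel_left, inner_smul_right, e1, mul_zero]
    have := (convex_closedCell s).add_smul_sub_mem_interior hz hx.1 (t := η / (1 + η))
      ⟨by positivity, by rw [div_le_one (by positivity)]; linarith⟩
    have h1 : (1 : ℝ) + η ≠ 0 := by positivity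
    have e : y + η • (y - x) + (η / (1 + η)) • (x - (y + η • (y - x))) = y := by
      have : x - (y + η • (y - x)) = (1 + η) • (x - y) := by module
      rw [this, smul_smul, div_mul_cancel₀ _ h1]; module
    rw [e] at this
    exact this

end Approx
end SurfaceFEM
end

noncomputable section
namespace SurfaceFEM

/-! ### Surface elements -/

lemma mem_intrinsicInterior_iff {C : Set E3} {y : E3} (hy : y ∈ C) :
    y ∈ intrinsicInterior ℝ C ↔ ∃ ε > 0, ∀ z ∈ Metric.ball y ε, z ∈ affineSpan ℝ C → z ∈ C := by
  rw [mem_intrinsicInterior]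
  constructor
  · rintro ⟨⟨y', hy'⟩, h, rfl⟩
    obtain ⟨ε, hε, hb⟩ := Metric.mem_nhds_iff.1 (mem_interior_iff_mem_nhds.1 h)
    exact ⟨ε, hε, fun z hz hzs => @hb ⟨z, hzs⟩ hz⟩
  · rintro ⟨ε, hε, hb⟩
    refine ⟨⟨y, subset_affineSpan ℝ C hy⟩, mem_interior_iff_mem_nhds.2 ?_, rfl⟩
    exact Metric.mem_nhds_iff.2 ⟨ε, hε, fun z hz => hb z hz z.2⟩

/-- Contracting a relative neighbourhood of a relatively interior point y towards x gives one of
every point of the segment from x to y other than x. -/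
lemma subset_closure_intrinsicInterior {C : Set E3} (hC : Convex ℝ C) :
    C ⊆ closure (intrinsicInterior ℝ C) := by
  intro x hx
  obtain ⟨y, hy⟩ := Set.Nonempty.intrinsicInterior hC ⟨x, hx⟩
  have hyC := intrinsicInterior_subset hy
  obtain ⟨ε, hε, hb⟩ := (mem_intrinsicInterior_iff hyC).1 hy
  -- points of the segment towards `y`
  have hseg : ∀ θ ∈ Ioc (0 : ℝ) 1, x + θ • (y - x) ∈ intrinsicInterior ℝ C := by
    intro θ hθ
    refine (mem_intrinsicInterior_iff (hC.add_smul_sub_mem hx hyC ⟨hθ.1.le, hθ.2⟩)).2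
      ⟨θ * ε, mul_pos hθ.1 hε, fun z hz hzs => ?_⟩
    -- `z = x + θ (w - x)`
    have hθ0 := hθ.1.ne'
    have hw : x + θ⁻¹ • (z - x) ∈ C := by
      apply hb
      · rw [Metric.mem_ball, dist_eq_norm] at hz ⊢
        have : x + θ⁻¹ • (z - x) - y = θ⁻¹ • (z - (x + θ • (y - x))) := by
          rw [smul_sub θ⁻¹ z (x + θ • (y - x)), smul_add, smul_smul, inv_mul_cancel₀ hθ0]; module
        rw [this, norm_smul, norm_inv, Real.norm_eq_abs, abs_of_pos hθ.1, inv_mul_lt_iff₀ hθ.1]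
        exact hz
      · have := AffineMap.lineMap_mem (Q := affineSpan ℝ C) θ⁻¹ (subset_affineSpan ℝ C hx) hzs
        rwa [AffineMap.lineMap_apply, vsub_eq_sub, vadd_eq_add, add_comm] at this
    have := hC.add_smul_sub_mem hx hw ⟨hθ.1.le, hθ.2⟩
    rwa [add_sub_cancel_left, smul_smul, mul_inv_cancel₀ hθ0, one_smul, add_sub_cancel] at this
  have ht : Tendsto (fun θ : ℝ => x + θ • (y - x)) (𝓝[>] 0) (𝓝 x) := by
    have : Continuous fun θ : ℝ => x + θ • (y - x) := by fun_prop
    have := this.tendsto 0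
    simp only [zero_smul, add_zero] at this
    exact this.mono_left nhdsWithin_le_nhds
  refine mem_closure_of_tendsto ht ?_
  filter_upwards [Ioc_mem_nhdsGT (zero_lt_one' ℝ)] with θ hθ using hseg θ hθ

lemma finrank_orthogonal {m : E3} (hm : ‖m‖ = 1) : Module.finrank ℝ (ℝ ∙ m)ᗮ = 2 := by
  have h0 : m ≠ 0 := by rintro rfl; simp at hm
  have h := (ℝ ∙ m).finrank_add_finrank_orthogonal
  rw [finrank_span_singleton h0] at h
  have hf : Module.finrank ℝ E3 = 3 := by simp
  omega

namespace DiscreteData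
variable {d : DiscreteData}

/-- The three common vertices are affinely independent, so the face spans the full plane orthogonal
to m and its intrinsic interior is its interior in that plane. -/
lemma face_piece (hd : d.IsDiscreteSurface) {s t : Finset E3} (hs : s ∈ d.active) (ht : t ∈ d.active)
    (hcard : ((s : Set E3) ∩ (t : Set E3)).ncard = 3)
    (hF : intrinsicInterior ℝ (closedCell s ∩ closedCell t) ⊆ d.surf) :
    ∃ m, Piece d (intrinsicInterior ℝ (closedCell s ∩ closedCell t))
      (closedCell s ∩ closedCell t) m s := by
  classical
  set C := closedCell s ∩ closedCell t with hC
  have hCc : Convex ℝ C := (convex_closedCell s).inter (convex_closedCell t)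
  have hCe : C = convexHull ℝ ((s : Set E3) ∩ (t : Set E3)) := d.mesh.conforming s hs.1 t ht.1
  obtain ⟨m, hm1, hm2, hm3⟩ := hd.normal_face _ ⟨s, hs, t, ht, hcard, rfl⟩ hF
  have hcl := subset_closure_intrinsicInterior hCc
  have hpl : ∀ y ∈ C, ∀ z ∈ C, inner ℝ m (y - z) = 0 := by
    have h1 : C ×ˢ C ⊆ {q : E3 × E3 | inner ℝ m (q.1 - q.2) = 0} := by
      refine (prod_mono hcl hcl).trans ?_
      rw [← closure_prod_eq]
      refine closure_minimal ?_ (isClosed_eq (by fun_prop) continuous_const)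
      rintro ⟨y, z⟩ ⟨hy, hz⟩
      exact hm3 y hy z hz
    intro y hy z hz
    exact h1 (show (y, z) ∈ C ×ˢ C from ⟨hy, hz⟩)
  -- the affine span of the face is the plane
  have hspan : ∀ y ∈ C, ∀ z, inner ℝ m (z - y) = 0 → z ∈ affineSpan ℝ C := by
    intro y hy z hz
    have hdir : (affineSpan ℝ C).direction = (ℝ ∙ m)ᗮ := by
      apply Submodule.eq_of_le_of_finrank_eq
      · rw [direction_affineSpan, vectorSpan_def, Submodule.span_le]
        rintro _ ⟨y, hy, z, hz, rfl⟩
        rw [SetLike.mem_coe, Submodule.mem_orthogonal_singleton_iff_inner_right]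
        exact hpl y hy z hz
      · rw [finrank_orthogonal hm1, hCe, affineSpan_convexHull, direction_affineSpan]
        have hai := (d.mesh.affineIndep s hs.1).mono (inter_subset_left (t := (t : Set E3)))
        have hcard' : Fintype.card ↥((s : Set E3) ∩ (t : Set E3)) = 2 + 1 := by
          rw [← Nat.card_eq_fintype_card]; exact hcard
        have := hai.finrank_vectorSpan hcard'
        rwa [Subtype.range_coe] at this
    have h1 : z - y ∈ (affineSpan ℝ C).direction := by
      rw [hdir, Submodule.mem_orthogonal_singleton_iff_inner_right]; exact hz
    have := AffineSubspace.vadd_mem_of_mem_direction h1 (subset_affineSpan ℝ C hy)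
    simpa using this
  have hspan' : ∀ y ∈ C, ∀ z ∈ affineSpan ℝ C, inner ℝ m (z - y) = 0 := by
    intro y hy z hz
    have h1 := AffineSubspace.vsub_mem_direction hz (subset_affineSpan ℝ C hy)
    rw [direction_affineSpan, vectorSpan_def] at h1
    have h2 : Submodule.span ℝ (C -ᵥ C) ≤ (ℝ ∙ m)ᗮ := by
      rw [Submodule.span_le]
      rintro _ ⟨y, hy, z, hz, rfl⟩
      rw [SetLike.mem_coe, Submodule.mem_orthogonal_singleton_iff_inner_right]
      exact hpl y hy z hz
    exact Submodule.mem_orthogonal_singleton_iff_inner_right.1 (h2 h1)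
  refine ⟨m, hs, hm1, intrinsicInterior_subset, hCc,
    (isClosed_closedCell s).inter (isClosed_closedCell t), inter_subset_left, hcl, hF, hpl, hm2, ?_, ?_⟩
  · intro y hy
    have hyC := intrinsicInterior_subset hy
    obtain ⟨ε, hε, hb⟩ := (mem_intrinsicInterior_iff hyC).1 hy
    refine ⟨ε, hε, fun z hz hzy => ?_⟩
    have hzC := hb z hz (hspan y hyC z hzy)
    refine (mem_intrinsicInterior_iff hzC).2 ⟨ε - dist z y, sub_pos.2 hz, fun w hw hws => hb w ?_ hws⟩
    rw [Metric.mem_ball] at hw ⊢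
    linarith [dist_triangle w z y]
  · rintro y hy ⟨ε, hε, hb⟩
    exact (mem_intrinsicInterior_iff hy).2 ⟨ε, hε, fun z hz hzs => hb z hz (hspan' y hy z hzs)⟩

/-- The surface element `K` is contained in the plane orthogonal to `m` and, with its
planar neighbourhood, in the closed tetrahedron `s`. -/
structure Elem (d : DiscreteData) (K : Set E3) (m : E3) (s : Finset E3) : Prop where
  mem : s ∈ d.active
  norm_eq : ‖m‖ = 1
  cell : K ⊆ closedCell s
  surf : K ⊆ d.surf
  measurable : MeasurableSet K
  planar : ∀ y ∈ K, ∀ z ∈ K, inner ℝ m (y - z) = 0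
  normal : ∀ y ∈ K, d.normal y = m
  nhds : ∀ y ∈ K, ∀ᶠ z in 𝓝 y, y + tangentProj m (z - y) ∈ closedCell s

end DiscreteData

lemma measurableSet_of_relOpen {K C : Set E3} {m : E3} (hKC : K ⊆ C) (hC : IsClosed C)
    (hpl : ∀ y ∈ C, ∀ z ∈ C, inner ℝ m (y - z) = 0)
    (ho : ∀ y ∈ K, ∃ ε > 0, ∀ z ∈ Metric.ball y ε, inner ℝ m (z - y) = 0 → z ∈ K) :
    MeasurableSet K := by
  choose! ε hε hb using ho
  have : K = (⋃ y ∈ K, Metric.ball y (ε y)) ∩ C := by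
    ext z; constructor
    · intro hz; exact ⟨mem_iUnion₂.2 ⟨z, hz, Metric.mem_ball_self (hε z hz)⟩, hKC hz⟩
    · rintro ⟨hz, hzC⟩
      obtain ⟨y, hy, hzy⟩ := mem_iUnion₂.1 hz
      exact hb y hy z hzy (hpl z hzC y (hKC hy))
  rw [this]
  exact (isOpen_biUnion fun y _ => Metric.isOpen_ball).measurableSet.inter hC.measurableSet

lemma inner_tangentProj_comm (m x y : E3) :
    inner ℝ x (tangentProj m y) = inner ℝ (tangentProj m x) y := by
  simp only [tangentProj_apply, inner_sub_right, inner_sub_left, inner_smul_right, inner_smul_left]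
  rw [real_inner_comm x m]; simp; ring

lemma Piece.elem {d : DiscreteData} {K C : Set E3} {m : E3} {s : Finset E3} (hP : Piece d K C m s) :
    d.Elem K m s where
  mem := hP.mem
  norm_eq := hP.norm_eq
  cell := hP.sub.trans hP.cell
  surf := hP.surf
  measurable := measurableSet_of_relOpen hP.sub hP.closed hP.planar hP.rel_open
  planar y hy z hz := hP.planar y (hP.sub hy) z (hP.sub hz)
  normal := hP.normal
  nhds y hy := by
    obtain ⟨ε, hε, hb⟩ := hP.rel_open y hy
    filter_upwards [Metric.ball_mem_nhds y hε] with z hz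
    refine hP.cell (hP.sub (hb _ ?_ ?_))
    · rw [Metric.mem_ball, dist_eq_norm, add_sub_cancel_left]
      exact (norm_tangentProj_le hP.norm_eq _).trans_lt (by rwa [← dist_eq_norm])
    · rw [add_sub_cancel_left, inner_tangentProj hP.norm_eq]

namespace DiscreteData
variable {d : DiscreteData}

/-- In contrast to `exists_piece` this needs neither a small mesh size nor a nonempty element, so
the estimates built on it are available for all h. -/
lemma exists_elem (hd : d.IsDiscreteSurface) {K : Set E3} (hK : K ∈ d.elements) :
    ∃ m s, d.Elem K m s := by
  rcases hK with ⟨s, hs, rfl⟩ | ⟨⟨s, hs, t, ht, hcard, rfl⟩, hF⟩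
  · obtain ⟨m, hm1, hm2, hm3, -⟩ := hd.normal_cell s hs
    refine ⟨m, s, hs, hm1, inter_subset_left.trans (openCell_subset s), inter_subset_right,
      (isOpen_openCell s).measurableSet.inter hd.isCompact.isClosed.measurableSet, hm3,
      fun y hy => hm2 y hy.1, fun y hy => ?_⟩
    have hc : Continuous fun z => y + tangentProj m (z - y) := by fun_prop
    have := hc.continuousAt.eventually_mem (x := y) (s := openCell s)
      (by simpa using (isOpen_openCell s).mem_nhds hy.1)
    exact this.mono fun z hz => openCell_subset s hz
  · obtain ⟨m, hm⟩ := face_piece hd hs ht hcard hF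
    exact ⟨m, s, hm.elem⟩

lemma finite_active : d.active.Finite := d.mesh.cells.finite_toSet.subset fun _ h => h.1

lemma finite_elements : d.elements.Finite := by
  refine Finite.union ?_ ?_
  · refine (d.finite_active.image fun s => openCell s ∩ d.surf).subset ?_
    rintro K ⟨s, hs, rfl⟩; exact ⟨s, hs, rfl⟩
  · refine ((d.finite_active.prod d.finite_active).image
      fun q => intrinsicInterior ℝ (closedCell q.1 ∩ closedCell q.2)).subset ?_
    rintro K ⟨⟨s, hs, t, ht, -, rfl⟩, -⟩; exact ⟨(s, t), ⟨hs, ht⟩, rfl⟩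

lemma elementSet_eq : d.elementSet = ⋃ K ∈ d.finite_elements.toFinset, K := by
  rw [elementSet, sUnion_eq_biUnion]; simp

lemma elementSet_subset (hd : d.IsDiscreteSurface) : d.elementSet ⊆ d.surf := by
  rintro x ⟨K, hK, hx⟩
  obtain ⟨m, s, h⟩ := exists_elem hd hK
  exact h.surf hx

lemma measurableSet_elementSet (hd : d.IsDiscreteSurface) : MeasurableSet d.elementSet :=
  MeasurableSet.sUnion d.finite_elements.countable fun K hK => by
    obtain ⟨m, s, h⟩ := exists_elem hd hK
    exact h.measurable

lemma Elem.measure_lt_top {K : Set E3} {m : E3} {s : Finset E3} (h : d.Elem K m s) :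
    μHE[2] K < ⊤ := by
  rcases K.eq_empty_or_nonempty with rfl | ⟨x, hx⟩
  · simp
  rw [plane_measure_eq_volume m x h.norm_eq h.measurable fun y hy => h.planar y hy x hx]
  refine Bornology.IsBounded.measure_lt_top ?_
  have hb : Bornology.IsBounded K :=
    (s.finite_toSet.isCompact_convexHull ℝ).isBounded.subset h.cell
  obtain ⟨r, hr⟩ := hb.subset_closedBall x
  refine (Metric.isBounded_closedBall (x := (0 : (ℝ ∙ m)ᗮ)) (r := r)).subset fun w hw => ?_
  have := hr hw
  rw [Metric.mem_closedBall, dist_eq_norm, add_sub_cancel_left] at this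
  simpa using this

lemma measure_elementSet_lt_top (hd : d.IsDiscreteSurface) : μHE[2] d.elementSet < ⊤ := by
  rw [elementSet_eq]
  refine measure_biUnion_lt_top (Finset.finite_toSet _) fun K hK => ?_
  obtain ⟨m, s, h⟩ := exists_elem hd (d.finite_elements.mem_toFinset.1 hK)
  exact h.measure_lt_top

lemma isPlanar_of_mem (hd : d.IsDiscreteSurface) {K : Set E3} (hK : K ∈ d.elements) :
    SmoothClosedSurface.IsPlanar d.normal K := by
  obtain ⟨m, s, h⟩ := exists_elem hd hK
  rcases K.eq_empty_or_nonempty with rfl | ⟨x, hx⟩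
  · exact ⟨m, 0, h.norm_eq, by simp, by simp⟩
  · exact ⟨m, x, h.norm_eq, fun y hy => h.planar y hy x hx, h.normal⟩

/-- The planar neighbourhood of y stays in s, so only the affine expression of v on s enters, even
if the element is a face across which ∇v jumps. -/
lemma Elem.tgrad_eq {K : Set E3} {m : E3} {s : Finset E3} (h : d.Elem K m s) {v : E3 → ℝ} {g : E3}
    {c : ℝ} (hv : ∀ x ∈ closedCell s, v x = inner ℝ g x + c) {y : E3} (hy : y ∈ K) :
    d.tgrad v y = tangentProj m g := by
  rw [tgrad, h.normal y hy]
  have h1 : (fun z => v (y + tangentProj m (z - y))) =ᶠ[𝓝 y]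
      fun z => inner ℝ (tangentProj m g) z + (inner ℝ g y + c - inner ℝ (tangentProj m g) y) := by
    filter_upwards [h.nhds y hy] with z hz
    rw [hv _ hz, inner_add_right, inner_tangentProj_comm, inner_sub_right]; ring
  have h2 : HasGradientAt (fun z => inner ℝ (tangentProj m g) z
      + (inner ℝ g y + c - inner ℝ (tangentProj m g) y)) (tangentProj m g) y := by
    rw [hasGradientAt_iff_hasFDerivAt]
    exact ((InnerProductSpace.toDual ℝ E3 (tangentProj m g)).hasFDerivAt).add_const _
  rw [h1.gradient_eq, h2.gradient]

lemma gradient_eq_of_mem_openCell {s : Finset E3} {v : E3 → ℝ} {g : E3} {c : ℝ}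
    (hv : ∀ x ∈ closedCell s, v x = inner ℝ g x + c) {y : E3} (hy : y ∈ openCell s) :
    gradient v y = g := by
  have h1 : v =ᶠ[𝓝 y] fun z => inner ℝ g z + c := by
    filter_upwards [(isOpen_openCell s).mem_nhds hy] with z hz using hv z (openCell_subset s hz)
  have h2 : HasGradientAt (fun z => inner ℝ g z + c) g y := by
    rw [hasGradientAt_iff_hasFDerivAt]
    exact ((InnerProductSpace.toDual ℝ E3 g).hasFDerivAt).add_const _
  rw [h1.gradient_eq, h2.gradient]

end DiscreteData

namespace Approx
variable {S : SmoothClosedSurface} {δ M h : ℝ} {d : DiscreteData} (A : Approx S δ M d h)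
include A

lemma exists_piece {K : Set E3} (hK : K ∈ d.elements) (hne : K.Nonempty) :
    ∃ C m s, Piece d K C m s := by
  rcases hK with ⟨s, hs, rfl⟩ | ⟨⟨s, hs, t, ht, hcard, rfl⟩, hF⟩
  · obtain ⟨x, hx⟩ := hne
    obtain ⟨m, -, -, h⟩ := A.cut_piece hs hx
    exact ⟨_, m, s, h⟩
  · obtain ⟨m, hm⟩ := DiscreteData.face_piece A.surface hs ht hcard hF
    exact ⟨_, m, s, hm⟩

end Approx
end SurfaceFEM
end

noncomputable section
namespace SurfaceFEM

/-! ### Integration over the layers around the discrete surface -/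

/-- The difference lies in the frontier of C relative to its plane, and frontiers of convex sets are
null sets. -/
lemma Piece.measure_sdiff {d : DiscreteData} {K C : Set E3} {m : E3} {s : Finset E3}
    (hP : Piece d K C m s) : μHE[2] (C \ K) = 0 := by
  rcases (C \ K).eq_empty_or_nonempty with h | ⟨x, hx⟩
  · rw [h]; simp
  have hm : MeasurableSet (C \ K) := hP.closed.measurableSet.diff hP.elem.measurable
  rw [plane_measure_eq_volume m x hP.norm_eq hm fun y hy => hP.planar y hy.1 x hx.1]
  set j : (ℝ ∙ m)ᗮ → E3 := fun w => x + (w : E3) with hj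
  have hjc : Continuous j := by fun_prop
  have hconv : Convex ℝ (j ⁻¹' C) := by
    intro w hw z hz a b ha hb hab
    have := hP.convex hw hz ha hb hab
    have e : a • j w + b • j z = j (a • w + b • z) := by
      simp only [hj, Submodule.coe_add, Submodule.coe_smul]
      rw [smul_add, smul_add, add_add_add_comm, ← add_smul, hab, one_smul]
    rwa [e] at this
  refine measure_mono_null ?_ (hconv.addHaar_frontier volume)
  rintro w ⟨hwC, hwK⟩
  refine ⟨subset_closure hwC, fun hint => hwK ?_⟩
  obtain ⟨ε, hε, hb⟩ := Metric.mem_nhds_iff.1 (mem_interior_iff_mem_nhds.1 hint)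
  refine hP.of_rel_int _ hwC ⟨ε, hε, fun z hz hzw => ?_⟩
  have h1 : inner ℝ m ((w : E3)) = 0 := Submodule.mem_orthogonal_singleton_iff_inner_right.1 w.2
  have h2 : z - x ∈ (ℝ ∙ m)ᗮ := by
    rw [Submodule.mem_orthogonal_singleton_iff_inner_right]
    have : z - x = (z - (x + (w : E3))) + w := by abel
    rw [this, inner_add_right, hzw, h1, add_zero]
  have h3 : (⟨z - x, h2⟩ : (ℝ ∙ m)ᗮ) ∈ Metric.ball w ε := by
    rw [Metric.mem_ball, Subtype.dist_eq, dist_eq_norm]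
    rw [Metric.mem_ball, dist_eq_norm] at hz
    have : z - x - (w : E3) = z - (x + w) := by abel
    simpa [this] using hz
  have h4 := hb h3
  simpa [hj] using h4

namespace Approx
variable {S : SmoothClosedSurface} {δ M h : ℝ} {d : DiscreteData} (A : Approx S δ M d h)
include A

lemma closure_subset_surf {K : Set E3} (hK : K ∈ d.elements) : closure K ⊆ d.surf := by
  obtain ⟨m, s, h⟩ := DiscreteData.exists_elem A.surface hK
  exact closure_minimal h.surf A.surface.isCompact.isClosed

lemma elementSet_subset_tube : d.elementSet ⊆ S.tube δ :=
  (DiscreteData.elementSet_subset A.surface).trans A.subset_tube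

omit A in
lemma shell_subset_tube {J : Set ℝ} (hJ : J ⊆ Ioo (-δ) δ) : S.sdist ⁻¹' J ⊆ S.tube δ :=
  fun _ hx => abs_lt.2 (hJ hx)

lemma layer_subset {J : Set ℝ} (hJ : J ⊆ Ioo (-δ) δ) : S.layer d.elementSet J ⊆ S.sdist ⁻¹' J := by
  rintro _ ⟨⟨y, t⟩, ⟨hy, ht⟩, rfl⟩
  have := (A.tube.fiber_mem (A.elementSet_subset_tube hy) (abs_lt.2 (hJ ht))).1
  change S.sdist (S.fiber y t) ∈ J
  rw [this]; exact ht

/-- Every point of the shell lies over its foot, and the foot is in the closure of some element. So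
the layer misses only fibres over relative boundaries of elements, which form a null set. -/
lemma shell_ae_eq_layer {J : Set ℝ} (hJm : MeasurableSet J) (hJ : J ⊆ Ioo (-δ) δ) :
    (S.sdist ⁻¹' J : Set E3) =ᵐ[volume] S.layer d.elementSet J := by
  have hnull : volume (S.sdist ⁻¹' J \ S.layer d.elementSet J) = 0 := by
    have hsub : S.sdist ⁻¹' J \ S.layer d.elementSet J
        ⊆ ⋃ K ∈ d.elements, S.layer (closure K \ K) J := by
      rintro x ⟨hx, hxl⟩
      have hxt := shell_subset_tube hJ hx
      have hf := A.foot_mem x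
      have hfx : S.fiber (d.foot S x) (S.sdist x) = x := by
        rw [SmoothClosedSurface.fiber, A.proj_foot, A.normal_foot hxt]
        exact A.tube.fiber_sdist hxt
      obtain ⟨K, hK, hfK⟩ := mem_iUnion₂.1 (A.surface.covered hf)
      refine mem_iUnion₂.2 ⟨K, hK, ⟨(d.foot S x, S.sdist x), ⟨⟨hfK, fun hk => hxl ?_⟩, hx⟩, hfx⟩⟩
      exact ⟨(d.foot S x, S.sdist x), ⟨⟨K, hK, hk⟩, hx⟩, hfx⟩
    refine measure_mono_null hsub ?_
    rw [measure_biUnion_null_iff d.finite_elements.countable]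
    intro K hK
    rcases K.eq_empty_or_nonempty with rfl | hne
    · simp [SmoothClosedSurface.layer]
    obtain ⟨C, m, s, hP⟩ := A.exists_piece hK hne
    obtain ⟨x, hx⟩ := hne
    have hCK : closure K \ K ⊆ C \ K := sdiff_subset_sdiff_left (closure_minimal hP.sub hP.closed)
    have hs := A.closure_subset_surf hK
    exact A.tube.volume_layer_eq_zero hP.norm_eq (x₀ := x)
      (isClosed_closure.measurableSet.diff hP.elem.measurable)
      (fun y hy => hP.planar y (hCK hy).1 x (hP.sub hx))
      (sdiff_subset.trans (hs.trans A.subset_tube))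
      (A.bijOn.injOn.mono (sdiff_subset.trans hs)) hJm hJ (measure_mono_null hCK hP.measure_sdiff)
  exact (ae_eq_set.2 ⟨hnull, by rw [sdiff_eq_empty.2 (A.layer_subset hJ)]; simp⟩)

lemma map_fiber {J : Set ℝ} (hJm : MeasurableSet J) (hJ : J ⊆ Ioo (-δ) δ) :
    Measure.map (fun z : E3 × ℝ => S.fiber z.1 z.2)
        ((S.weighted d.normal d.elementSet).prod (volume.restrict J))
      = (volume.restrict (S.sdist ⁻¹' J)).withDensity fun x => ENNReal.ofReal (S.jac x) := by
  rw [Measure.restrict_congr_set (A.shell_ae_eq_layer hJm hJ), DiscreteData.elementSet_eq]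
  refine A.tube.map_fiber d.finite_elements.toFinset id ?_ ?_ ?_ ?_ ?_ hJm hJ
  · intro K hK
    obtain ⟨m, s, h⟩ := DiscreteData.exists_elem A.surface (d.finite_elements.mem_toFinset.1 hK)
    exact h.measurable
  · exact fun K hK => DiscreteData.isPlanar_of_mem A.surface (d.finite_elements.mem_toFinset.1 hK)
  · intro K hK
    exact (subset_sUnion_of_mem (d.finite_elements.mem_toFinset.1 hK)).trans A.elementSet_subset_tube
  · have : (⋃ K ∈ d.finite_elements.toFinset, id K) = d.elementSet := d.elementSet_eq.symm
    rw [this]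
    exact A.bijOn.injOn.mono (DiscreteData.elementSet_subset A.surface)
  · have : (⋃ K ∈ d.finite_elements.toFinset, id K) = d.elementSet := d.elementSet_eq.symm
    rw [this]
    exact (DiscreteData.measure_elementSet_lt_top A.surface).ne

end Approx
end SurfaceFEM
end

noncomputable section
namespace SurfaceFEM

/-! ### The geometry of the active mesh -/

/-- The function is the barycentric coordinate of a, extended affinely to the whole space. -/
lemma TetMesh.exists_coord (T : TetMesh) {s : Finset E3} (hs : s ∈ T.cells) {a : E3} (ha : a ∈ s) :
    ∃ l : E3 →ᵃ[ℝ] ℝ, l a = 1 ∧ (∀ b ∈ s, b ≠ a → l b = 0) ∧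
      ∀ x ∈ closedCell s, 0 ≤ l x ∧ l x ≤ 1 := by
  have hai := T.affineIndep s hs
  have hspan : affineSpan ℝ (range ((↑) : s → E3)) = ⊤ := by
    rw [hai.affineSpan_eq_top_iff_card_eq_finrank_add_one]
    simp [T.card_eq s hs]
  let b : AffineBasis s ℝ E3 := ⟨fun i => i, hai, hspan⟩
  have h1 : b.coord ⟨a, ha⟩ a = 1 := b.coord_apply_eq ⟨a, ha⟩
  have h2 : ∀ c ∈ s, c ≠ a → b.coord ⟨a, ha⟩ c = 0 := fun c hc hca =>
    b.coord_apply_ne (i := ⟨a, ha⟩) (j := ⟨c, hc⟩) fun h => hca (congrArg Subtype.val h).symm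
  refine ⟨b.coord ⟨a, ha⟩, h1, h2, fun x hx => ?_⟩
  have : closedCell s ⊆ b.coord ⟨a, ha⟩ ⁻¹' Icc 0 1 := by
    refine convexHull_min ?_ ((convex_Icc 0 1).affine_preimage _)
    intro c hc
    by_cases hca : c = a
    · subst hca; simp [h1]
    · simp [h2 c hc hca]
  exact this hx

/-- The linear part of the barycentric coordinate of a is 1 on a - x. If |a - x| < r, the coordinate
would differ by 2 between z + (a - x) and z - (a - x), both in the tetrahedron, where it takes
values in [0, 1]. -/
lemma TetMesh.le_dist_of_mem (T : TetMesh) {s : Finset E3} (hs : s ∈ T.cells) {a : E3} (ha : a ∈ s)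
    {z : E3} {r : ℝ} (hr : Metric.ball z r ⊆ closedCell s) {u : Set E3} (hu : u ⊆ s) (hau : a ∉ u)
    {x : E3} (hx : x ∈ convexHull ℝ u) : r ≤ dist x a := by
  by_contra! hlt
  obtain ⟨l, h1, h2, h3⟩ := T.exists_coord hs ha
  have hlx : l x = 0 := by
    have : convexHull ℝ u ⊆ l ⁻¹' {0} := by
      refine convexHull_min (fun c hc => h2 c (hu hc) ?_) ((convex_singleton 0).affine_preimage _)
      rintro rfl; exact hau hc
    exact this hx
  have hz1 : z + (a - x) ∈ closedCell s := by
    apply hr; rw [Metric.mem_ball, dist_eq_norm, add_sub_cancel_left, ← dist_eq_norm, dist_comm]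
    exact hlt
  have hz2 : z - (a - x) ∈ closedCell s := by
    apply hr
    rw [Metric.mem_ball, dist_eq_norm, sub_sub_cancel_left, norm_neg, ← dist_eq_norm, dist_comm]
    exact hlt
  have e1 : l.linear (a - x) = 1 := by
    have := l.linearMap_vsub a x
    simpa [h1, hlx] using this
  have e2 : l (z + (a - x)) = 1 + l z := by
    have := l.map_vadd z (a - x)
    simp only [vadd_eq_add, e1] at this
    rw [add_comm z]; exact this
  have e3 : l (z - (a - x)) = -1 + l z := by
    have := l.map_vadd z (-(a - x))
    simp only [vadd_eq_add, map_neg, e1] at this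
    rw [sub_eq_neg_add]; exact this
  have := h3 _ hz1; have := h3 _ hz2
  linarith

/-- If a vertex a of s were not a vertex of t, its barycentric coordinate would vanish on the common
face of the two cells; but near x both cells contain a full neighbourhood, and the coordinate
increases towards a. -/
lemma TetMesh.eq_of_ball (T : TetMesh) {s t : Finset E3} (hs : s ∈ T.cells) (ht : t ∈ T.cells)
    {x : E3} (hxs : x ∈ openCell s) (hxt : x ∈ openCell t) : s = t := by
  have key : ∀ s ∈ T.cells, ∀ t ∈ T.cells, x ∈ openCell s → x ∈ openCell t → s ⊆ t := by
    intro s hs t ht hxs hxt a ha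
    by_contra hat
    obtain ⟨l, h1, h2, h3⟩ := T.exists_coord hs ha
    have hsub : closedCell s ∩ closedCell t ⊆ l ⁻¹' {0} := by
      rw [T.conforming s hs t ht]
      refine convexHull_min (fun c hc => h2 c hc.1 ?_) ((convex_singleton 0).affine_preimage _)
      rintro rfl; exact hat hc.2
    have hxo : openCell s ∩ openCell t ∈ 𝓝 x :=
      ((isOpen_openCell s).inter (isOpen_openCell t)).mem_nhds ⟨hxs, hxt⟩
    have hc : Continuous fun θ : ℝ => x + θ • (a - x) := by fun_prop
    have hev : ∀ᶠ θ in 𝓝[>] (0 : ℝ), x + θ • (a - x) ∈ openCell s ∩ openCell t :=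
      (hc.tendsto 0).mono_left nhdsWithin_le_nhds (by simpa using hxo)
    obtain ⟨θ, hθ, hθ0⟩ := (hev.and self_mem_nhdsWithin).exists
    have e0 : l x = 0 := hsub ⟨openCell_subset s hxs, openCell_subset t hxt⟩
    have e1 : l (x + θ • (a - x)) = 0 := hsub ⟨openCell_subset s hθ.1, openCell_subset t hθ.2⟩
    have e2 : l.linear (a - x) = 1 := by
      have := l.linearMap_vsub a x
      simpa [h1, e0] using this
    have e3 := l.map_vadd x (θ • (a - x))
    simp only [vadd_eq_add, map_smul, e2, e0] at e3
    rw [add_comm, e3] at e1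
    have : (0 : ℝ) < θ := hθ0
    simp at e1
    linarith
  exact Finset.Subset.antisymm (key s hs t ht hxs hxt) (key t ht s hs hxt hxs)

namespace Approx
variable {S : SmoothClosedSurface} {δ M h : ℝ} {d : DiscreteData} (A : Approx S δ M d h)
include A

/-- An active tetrahedron has vertices on both sides of the discrete surface. -/
lemma exists_vertex {s : Finset E3} (hs : s ∈ d.active) {e : ℝ} (he : e = 1 ∨ e = -1) :
    ∃ a ∈ s, 0 ≤ e * d.gap S a := by
  have hee : e * e = 1 := by rcases he with rfl | rfl <;> norm_num
  have he0 : e ≠ 0 := by rintro rfl; norm_num at hee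
  obtain ⟨hs1, x₀, hx₀s, hx₀⟩ := id hs
  obtain ⟨K, hK, hxK⟩ := mem_iUnion₂.1 (A.surface.covered hx₀)
  have hne : K.Nonempty := closure_nonempty_iff.1 ⟨x₀, hxK⟩
  have hcl := A.closure_subset_surf hK
  rcases hK with ⟨t, ht, rfl⟩ | ⟨⟨s₁, hs₁, t₁, ht₁, hcard, rfl⟩, hF⟩
  · obtain ⟨x, hx⟩ := hne
    obtain ⟨m, hn, heq, hP⟩ := A.cut_piece ht hx
    have hx₀C := closure_minimal hP.sub hP.closed hxK
    have hx₀c : x₀ ∈ convexHull ℝ ((s : Set E3) ∩ (t : Set E3)) := by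
      rw [← d.mesh.conforming s hs1 t ht.1]; exact ⟨hx₀s, hx₀C.1⟩
    -- By conformity x₀ is a convex combination of common vertices of s and t, so they cannot all
    -- lie strictly on the wrong side of the plane through x₀.
    obtain ⟨v, hv, hvm⟩ : ∃ v ∈ (s : Set E3) ∩ (t : Set E3), 0 ≤ e * inner ℝ m (v - x₀) := by
      by_contra! hcon
      have hcv : Convex ℝ {y : E3 | e * inner ℝ m (y - x₀) < 0} := by
        intro y hy z hz a b ha hb hab
        have hy : e * inner ℝ m (y - x₀) < 0 := hy
        have hz : e * inner ℝ m (z - x₀) < 0 := hz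
        change e * inner ℝ m (a • y + b • z - x₀) < 0
        have : a • y + b • z - x₀ = a • (y - x₀) + b • (z - x₀) := by
          rw [smul_sub, smul_sub, sub_add_sub_comm, ← add_smul, hab, one_smul]
        rw [this, inner_add_right, inner_smul_right, inner_smul_right]
        rcases ha.eq_or_lt with rfl | ha
        · rw [zero_add] at hab; subst hab; linarith
        · nlinarith [mul_nonneg hb (neg_nonneg.2 hz.le)]
      have : e * inner ℝ m (x₀ - x₀) < 0 := convexHull_min (fun v hv => hcon v hv) hcv hx₀c
      simp at this
    refine ⟨v, hv.1, ?_⟩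
    have hvt : v ∈ closedCell t := subset_convexHull ℝ _ hv.2
    rcases hvm.eq_or_lt with h0 | hpos
    · have : v ∈ d.surf := by
        apply hcl; apply hP.closure
        refine ⟨hvt, ?_⟩
        have e1 : inner ℝ m (v - x₀) = 0 := by simpa [he0] using h0.symm
        have e2 : inner ℝ m (x₀ - x) = 0 := hx₀C.2
        change inner ℝ m (v - x) = 0
        rw [← sub_add_sub_cancel v x₀ x, inner_add_right, e1, e2, add_zero]
      rw [A.gap_of_mem this, mul_zero]
    · have hvx : 0 < e * inner ℝ m (v - x) := by
        have e2 : inner ℝ m (x₀ - x) = 0 := hx₀C.2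
        rw [← sub_add_sub_cancel v x₀ x, inner_add_right, e2, add_zero]; exact hpos
      set W := openCell t ∩ {y : E3 | 0 < e * inner ℝ m (y - x)} with hW
      have hWc : Convex ℝ W := by
        refine (convex_openCell t).inter ?_
        intro y hy z hz a b ha hb hab
        simp only [mem_ofPred_eq] at *
        have : a • y + b • z - x = a • (y - x) + b • (z - x) := by
          rw [smul_sub, smul_sub, sub_add_sub_comm, ← add_smul, hab, one_smul]
        rw [this, inner_add_right, inner_smul_right, inner_smul_right]
        rcases ha.eq_or_lt with rfl | ha
        · rw [zero_add] at hab; subst hab; linarith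
        · nlinarith [mul_nonneg hb hz.le]
      have hWt : W ⊆ S.tube δ := fun y hy => A.cell_subset ht (openCell_subset t hy.1)
      have hxt := A.subset_tube hx.2
      -- the gap is positive at some point
      obtain ⟨b, hbW, hb⟩ : ∃ b ∈ W, 0 ≤ e * d.gap S b := by
        have hc : Continuous fun θ : ℝ => x + (θ * e) • S.normal x := by fun_prop
        have hev : ∀ᶠ θ in 𝓝[>] (0 : ℝ), x + (θ * e) • S.normal x ∈ openCell t :=
          (hc.tendsto 0).mono_left nhdsWithin_le_nhds
            (by simpa using (isOpen_openCell t).mem_nhds hx.1)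
        have hev2 : ∀ᶠ θ in 𝓝[>] (0 : ℝ), |S.sdist x + θ * e| < δ := by
          have hc2 : Continuous fun θ : ℝ => |S.sdist x + θ * e| := by fun_prop
          have hl := (hc2.tendsto 0).mono_left (nhdsWithin_le_nhds (s := Ioi 0))
          refine hl.eventually_lt_const ?_
          have : |S.sdist x| < δ := hxt
          simpa using this
        obtain ⟨θ, ⟨hθ1, hθ2⟩, hθ0⟩ := ((hev.and hev2).and self_mem_nhdsWithin).exists
        have hθ0 : (0 : ℝ) < θ := hθ0
        refine ⟨_, ⟨hθ1, ?_⟩, ?_⟩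
        · have := A.half_le_inner hxt hn
          change 0 < e * inner ℝ m (x + (θ * e) • S.normal x - x)
          rw [add_sub_cancel_left, inner_smul_right]
          have : e * (θ * e * inner ℝ m (S.normal x)) = (e * e) * (θ * inner ℝ m (S.normal x)) := by
            ring
          rw [this, hee]; positivity
        · rw [(A.shift hxt hθ2).2.2.2, A.gap_of_mem hx.2]
          have : e * (0 + θ * e) = (e * e) * θ := by ring
          rw [this, hee]; linarith
      -- The part of the open cell strictly on one side of the plane is convex and contains no point
      -- of Γ_h. Hence the gap cannot change sign there, and its sign is known at b.
      have hWpos : ∀ y ∈ W, 0 ≤ e * d.gap S y := by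
        intro y hy
        by_contra! hneg
        obtain ⟨z, hz, hzS⟩ := A.exists_mem_of_sign hWc.isPreconnected hWt hy hbW he0 hneg.le hb
        have : z ∈ openCell t ∩ d.surf := ⟨hz.1, hzS⟩
        rw [heq] at this
        have e1 : inner ℝ m (z - x) = 0 := this.2
        have := hz.2
        simp only [mem_ofPred_eq, e1, mul_zero, lt_irrefl] at this
      have hvtube := A.cell_subset ht hvt
      have hca : ContinuousAt (fun y => e * d.gap S y) v :=
        (A.continuousOn_gap.continuousAt ((S.isOpen_tube δ).mem_nhds hvtube)).const_mul e
      have hc : Continuous fun θ : ℝ => v + θ • (x - v) := by fun_prop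
      -- The vertex is only in the boundary of the cell; it is reached as a limit along the segment
      -- from x.
      have hlim : Tendsto (fun θ : ℝ => e * d.gap S (v + θ • (x - v))) (𝓝[>] 0)
          (𝓝 (e * d.gap S v)) := by
        have h1 : Tendsto (fun θ : ℝ => v + θ • (x - v)) (𝓝[>] 0) (𝓝 v) := by
          have := (hc.tendsto 0).mono_left (nhdsWithin_le_nhds (s := Ioi (0 : ℝ)))
          simpa using this
        exact hca.tendsto.comp h1
      refine ge_of_tendsto hlim ?_
      filter_upwards [Ioo_mem_nhdsGT (zero_lt_one' ℝ)] with θ hθ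
      refine hWpos _ ⟨(convex_closedCell t).add_smul_sub_mem_interior hvt hx.1 ⟨hθ.1, hθ.2.le⟩, ?_⟩
      have : v + θ • (x - v) - x = (1 - θ) • (v - x) := by module
      change 0 < e * inner ℝ m (v + θ • (x - v) - x)
      rw [this, inner_smul_right]
      have : e * ((1 - θ) * inner ℝ m (v - x)) = (1 - θ) * (e * inner ℝ m (v - x)) := by ring
      rw [this]
      exact mul_pos (sub_pos.2 hθ.2) hvx
  · have hx₀C : x₀ ∈ closedCell s₁ ∩ closedCell t₁ :=
      closure_minimal intrinsicInterior_subset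
        ((isClosed_closedCell s₁).inter (isClosed_closedCell t₁)) hxK
    have h1 : x₀ ∈ convexHull ℝ ((s : Set E3) ∩ (s₁ : Set E3)) := by
      rw [← d.mesh.conforming s hs1 s₁ hs₁.1]; exact ⟨hx₀s, hx₀C.1⟩
    have h2 : x₀ ∈ convexHull ℝ ((s₁ : Set E3) ∩ (t₁ : Set E3)) := by
      rw [← d.mesh.conforming s₁ hs₁.1 t₁ ht₁.1]; exact hx₀C
    classical
    -- Affine independence of the vertices of s₁ puts x₀ in the hull of the vertices common to s, s₁
    -- and t₁. So there is such a vertex, and being in the closed face it lies on Γ_h.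
    have h3 : x₀ ∈ convexHull ℝ (((s ∩ s₁ : Finset E3) : Set E3) ∩ ((s₁ ∩ t₁ : Finset E3) : Set E3)) := by
      rw [AffineIndependent.convexHull_inter (s := s₁) (d.mesh.affineIndep s₁ hs₁.1) Finset.inter_subset_right
        Finset.inter_subset_left]
      rw [Finset.coe_inter, Finset.coe_inter]
      exact ⟨h1, h2⟩
    obtain ⟨v, hv1, hv2⟩ := convexHull_nonempty_iff.1 ⟨x₀, h3⟩
    rw [Finset.coe_inter] at hv1 hv2
    refine ⟨v, hv1.1, ?_⟩
    have : v ∈ d.surf := by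
      apply hcl
      apply subset_closure_intrinsicInterior
        ((convex_closedCell s₁).inter (convex_closedCell t₁))
      exact ⟨subset_convexHull ℝ _ hv2.1, subset_convexHull ℝ _ hv2.2⟩
    rw [A.gap_of_mem this, mul_zero]

/-- A ball around a vertex is covered by the tetrahedra with this vertex. -/
lemma mem_star {s : Finset E3} (hs : s ∈ d.mesh.cells) {a : E3} (ha : a ∈ s)
    (hball : Metric.ball a (h / M) ⊆ S.tube δ) {y : E3} (hy : y ∈ Metric.ball a (h / M)) :
    ∃ t ∈ d.mesh.cells, a ∈ t ∧ y ∈ closedCell t := by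
  set star := ⋃ t ∈ d.mesh.cells, ⋃ (_ : a ∈ t), closedCell t
  set other := ⋃ t ∈ d.mesh.cells, ⋃ (_ : a ∉ t), closedCell t
  have hc1 : IsClosed star :=
    isClosed_biUnion_finset fun t _ => isClosed_iUnion_of_finite fun _ => isClosed_closedCell t
  have hc2 : IsClosed other :=
    isClosed_biUnion_finset fun t _ => isClosed_iUnion_of_finite fun _ => isClosed_closedCell t
  by_contra! hcon
  have hcov : Metric.ball a (h / M) ⊆ star ∪ other := by
    intro x hx
    obtain ⟨t, ht, hxt⟩ := mem_iUnion₂.1 (A.cover (hball hx))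
    by_cases hat : a ∈ t
    · exact Or.inl (mem_iUnion₂.2 ⟨t, ht, mem_iUnion.2 ⟨hat, hxt⟩⟩)
    · exact Or.inr (mem_iUnion₂.2 ⟨t, ht, mem_iUnion.2 ⟨hat, hxt⟩⟩)
  have hyo : y ∈ other := by
    refine (hcov hy).resolve_left fun h => ?_
    obtain ⟨t, ht, h⟩ := mem_iUnion₂.1 h
    obtain ⟨hat, h⟩ := mem_iUnion.1 h
    exact hcon t ht hat h
  have hah : 0 < h / M := div_pos A.h_pos A.M_pos
  -- Two closed sets cover the connected ball, so some point lies both in a cell with vertex a and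
  -- in one without. By conformity it is in the hull of vertices other than a, hence at distance at
  -- least h/M from a, outside the ball.
  obtain ⟨x, hxb, hxs, hxo⟩ := isPreconnected_closed_iff.1 (convex_ball a (h / M)).isPreconnected
    star other hc1 hc2 hcov
    ⟨a, Metric.mem_ball_self hah, mem_iUnion₂.2 ⟨s, hs, mem_iUnion.2 ⟨ha, subset_convexHull ℝ _ ha⟩⟩⟩
    ⟨y, hy, hyo⟩
  obtain ⟨t, ht, hxt⟩ := mem_iUnion₂.1 hxs
  obtain ⟨hat, hxt⟩ := mem_iUnion.1 hxt
  obtain ⟨t', ht', hxt'⟩ := mem_iUnion₂.1 hxo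
  obtain ⟨hat', hxt'⟩ := mem_iUnion.1 hxt'
  have hx : x ∈ convexHull ℝ ((t : Set E3) ∩ (t' : Set E3)) := by
    rw [← d.mesh.conforming t ht t' ht']; exact ⟨hxt, hxt'⟩
  obtain ⟨z, hz⟩ := A.ball t ht
  have := d.mesh.le_dist_of_mem ht hat hz inter_subset_left (fun h => hat' h.2) hx
  rw [Metric.mem_ball] at hxb
  linarith

end Approx
end SurfaceFEM
end

/-! ### Balls in active tetrahedra from which the discrete surface is reached through active
tetrahedra -/

noncomputable section
namespace SurfaceFEM

lemma ball_homothety_subset {C : Set E3} (hC : Convex ℝ C) {a z : E3} (ha : a ∈ C) {r l : ℝ}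
    (hz : Metric.ball z r ⊆ C) (hl : l ∈ Ioc (0 : ℝ) 1) :
    Metric.ball (a + l • (z - a)) (l * r) ⊆ C := by
  intro x hx
  have hl0 := hl.1.ne'
  have hw : z + l⁻¹ • (x - (a + l • (z - a))) ∈ C := by
    apply hz
    rw [Metric.mem_ball, dist_eq_norm, add_sub_cancel_left, norm_smul, norm_inv, Real.norm_eq_abs,
      abs_of_pos hl.1, inv_mul_lt_iff₀ hl.1, ← dist_eq_norm]
    exact hx
  have := hC.add_smul_sub_mem ha hw ⟨hl.1.le, hl.2⟩
  have e : a + l • (z + l⁻¹ • (x - (a + l • (z - a))) - a) = x := by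
    rw [smul_sub, smul_add, smul_smul, mul_inv_cancel₀ hl0]; module
  rwa [e] at this

namespace Approx
variable {S : SmoothClosedSurface} {δ M h : ℝ} {d : DiscreteData} (A : Approx S δ M d h)
include A

lemma gap_segment {x w : E3} (hx : x ∈ S.tube δ) (hw : w ∈ segment ℝ x (d.foot S x)) :
    w ∈ S.tube δ ∧ d.foot S w = d.foot S x ∧ S.normal w = S.normal x ∧
      ∃ θ ∈ Icc (0 : ℝ) 1, d.gap S w = (1 - θ) * d.gap S x := by
  rw [segment_eq_image'] at hw
  obtain ⟨θ, hθ, rfl⟩ := hw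
  have e : x + θ • (d.foot S x - x) = x + (-(θ * d.gap S x)) • S.normal x := by
    rw [← neg_sub, A.sub_foot hx]; module
  have hf : |S.sdist (d.foot S x)| < δ := A.subset_tube (A.foot_mem x)
  have hx' : |S.sdist x| < δ := hx
  have hlt : |S.sdist x + -(θ * d.gap S x)| < δ := by
    have : S.sdist x + -(θ * d.gap S x) = (1 - θ) * S.sdist x + θ * S.sdist (d.foot S x) := by
      rw [DiscreteData.gap]; ring
    rw [this]
    rw [abs_lt] at *
    have h1 := hθ.1; have h2 := hθ.2
    rcases h1.eq_or_lt with rfl | h1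
    · constructor <;> linarith
    · constructor <;> nlinarith
  obtain ⟨h1, h2, h3, h4⟩ := A.shift hx hlt
  simp only at hlt ⊢
  rw [e]
  exact ⟨h1, h2, h3, θ, hθ, by rw [h4]; ring⟩

/-- Every active tetrahedron contains a ball from which the feet can be reached through
active tetrahedra. -/
lemma exists_ball {s : Finset E3} (hs : s ∈ d.active) :
    ∃ y, Metric.ball y (h / (256 * M ^ 3)) ⊆ closedCell s ∧
      ∀ x ∈ Metric.ball y (h / (256 * M ^ 3)), |d.gap S x| ≤ h / M ∧
        ∀ w ∈ segment ℝ x (d.foot S x), ∃ t ∈ d.active, w ∈ closedCell t := by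
  obtain ⟨hs1, x₀, hx₀s, hx₀⟩ := id hs
  have hM := A.tube.one_le
  have hM0 := A.M_pos
  have hh := A.h_pos
  have hδ := A.tube.pos
  have hδ1 := A.delta_le
  set ρ := h / (256 * M ^ 3) with hρ
  have hρ0 : 0 < ρ := by positivity
  have hρr : 256 * ρ ≤ h / M := by
    rw [hρ, le_div_iff₀ hM0]
    have : 256 * (h / (256 * M ^ 3)) * M = h / M ^ 2 := by field_simp
    rw [this]
    exact div_le_self hh.le (one_le_pow₀ hM)
  have hrM : h / M ≤ M * h := (div_le_self hh.le hM).trans A.h_le_mul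
  have hMδ := A.mul_le
  have hq : 2 * (M * h ^ 2) ≤ ρ / 1000 := by
    have h1 := A.pow_mul_le' (k := 4) (by norm_num)
    have h2 : M * h ^ 2 = ρ * (256 * (M ^ 4 * h)) := by rw [hρ]; field_simp
    rw [h2]
    have : 256 * (M ^ 4 * h) ≤ 1 / 2000 := by linarith
    have := mul_le_mul_of_nonneg_left this hρ0.le
    linarith
  obtain ⟨z0, hz0⟩ := A.ball s hs1
  have hr0 : 0 < h / M := by positivity
  have hz0s : z0 ∈ closedCell s := hz0 (Metric.mem_ball_self hr0)
  have hz0t := A.cell_subset hs hz0s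
  -- The sign e names the side of Γ_h on which the centre of the inscribed ball lies; the vertex a
  -- below is taken on the other side, in the weak sense.
  obtain ⟨e, he, hez⟩ : ∃ e : ℝ, (e = 1 ∨ e = -1) ∧ 0 ≤ e * d.gap S z0 := by
    rcases le_total 0 (d.gap S z0) with h | h
    · exact ⟨1, Or.inl rfl, by linarith⟩
    · exact ⟨-1, Or.inr rfl, by linarith⟩
  have hee : e * e = 1 := by rcases he with rfl | rfl <;> norm_num
  have heabs : |e| = 1 := by rcases he with rfl | rfl <;> norm_num
  have he0 : e ≠ 0 := by rintro rfl; norm_num at hee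
  obtain ⟨a, ha, hea⟩ := A.exists_vertex hs (e := -e) (by rcases he with rfl | rfl <;> simp)
  have hea : e * d.gap S a ≤ 0 := by linarith
  have has : a ∈ closedCell s := subset_convexHull ℝ _ ha
  have hnear : ∀ t ∈ d.mesh.cells, a ∈ closedCell t → closedCell t ⊆ S.tube δ := by
    intro t ht hat y hy
    refine A.ball_subset hx₀ ?_
    have h1 := A.diam_le t ht y hy a hat
    have h2 := A.diam_le s hs1 a has x₀ hx₀s
    have := dist_triangle y a x₀
    rw [Metric.mem_ball]; linarith
  have hballa : Metric.ball a (h / M) ⊆ S.tube δ := by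
    intro y hy
    refine A.ball_subset hx₀ ?_
    have h2 := A.diam_le s hs1 a has x₀ hx₀s
    have := dist_triangle y a x₀
    rw [Metric.mem_ball] at hy ⊢; linarith
  -- shift the centre
  have hsd : ∀ y ∈ closedCell s, |S.sdist y| ≤ δ / 2 := by
    intro y hy
    have h1 := A.diam_le s hs1 y hy x₀ hx₀s
    have h2 := S.abs_sdist_sub_le y x₀
    have h3 := A.abs_sdist_le hx₀
    have h4 : |S.sdist y| ≤ |S.sdist x₀| + |S.sdist y - S.sdist x₀| := by
      have := abs_add_le (S.sdist x₀) (S.sdist y - S.sdist x₀); simpa using this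
    linarith
  have hshift : ∀ y ∈ closedCell s, ∀ τ : ℝ, |τ| ≤ M * h →
      d.gap S (y + τ • S.normal y) = d.gap S y + τ ∧ dist (y + τ • S.normal y) y = |τ| := by
    intro y hy τ hτ
    have hyt := A.cell_subset hs hy
    have h1 := abs_add_le (S.sdist y) τ
    have h2 := hsd y hy
    refine ⟨(A.shift hyt (by linarith)).2.2.2, ?_⟩
    rw [dist_eq_norm, add_sub_cancel_left, norm_smul, A.tube.norm_normal y hyt, mul_one,
      Real.norm_eq_abs]
  have habs : ∀ τ : ℝ, 0 < τ → |τ * e| = τ := fun τ hτ => by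
    rw [abs_mul, heabs, mul_one, abs_of_pos hτ]
  have hhalf : 0 < h / M / 2 := by positivity
  obtain ⟨hz1, hz2⟩ := hshift z0 hz0s (h / M / 2 * e) (by rw [habs _ hhalf]; linarith)
  rw [habs _ hhalf] at hz2
  set z := z0 + (h / M / 2 * e) • S.normal z0
  have hgz : 0 ≤ e * d.gap S z := by
    have : e * (d.gap S z0 + h / M / 2 * e) = e * d.gap S z0 + (e * e) * (h / M / 2) := by ring
    rw [hz1, this, hee]; linarith
  have hzball : Metric.ball z (h / M / 2) ⊆ closedCell s := by
    refine (Metric.ball_subset_ball' ?_).trans hz0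
    rw [hz2]; linarith
  have hzs : z ∈ closedCell s := hzball (Metric.mem_ball_self hhalf)
  have hza := A.diam_le s hs1 z hzs a has
  -- With this l the point a + l(z - a) is within h/(16M) of a, while the inscribed ball shrunk
  -- towards a by the factor l still has radius 8ρ.
  set l : ℝ := 1 / (16 * M ^ 2) with hl
  have hl0 : 0 < l := by positivity
  have hl1 : l ≤ 1 := by
    rw [hl, div_le_one (by positivity)]; nlinarith
  have hlρ : l * (h / M / 2) = 8 * ρ := by rw [hl, hρ]; field_simp; norm_num
  have hla : l * (M * h) = h / M / 16 := by rw [hl]; field_simp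
  have hcont : Continuous fun θ : ℝ => a + θ • (z - a) := by fun_prop
  have hpath : ∀ θ ∈ Icc (0 : ℝ) 1, a + θ • (z - a) ∈ closedCell s := fun θ hθ =>
    (convex_closedCell s).add_smul_sub_mem has hzs hθ
  have hbig : ∀ θ ∈ Icc l 1, Metric.ball (a + θ • (z - a)) (8 * ρ) ⊆ closedCell s := by
    intro θ hθ
    refine (Metric.ball_subset_ball ?_).trans
      (ball_homothety_subset (convex_closedCell s) has hzball ⟨hl0.trans_le hθ.1, hθ.2⟩)
    rw [← hlρ]; exact mul_le_mul_of_nonneg_right hθ.1 hhalf.le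
  rcases le_or_gt (e * d.gap S (a + l • (z - a))) 0 with hy0 | hy0
  · -- the discrete surface crosses the segment
    obtain ⟨x1, ⟨θ, hθ, rfl⟩, hx1⟩ := A.exists_mem_of_sign
      ((isPreconnected_Icc (a := l) (b := 1)).image _ hcont.continuousOn)
      (by
        rintro _ ⟨θ, hθ, rfl⟩
        exact A.cell_subset hs (hpath θ ⟨hl0.le.trans hθ.1, hθ.2⟩))
      (mem_image_of_mem _ (left_mem_Icc.2 hl1)) (mem_image_of_mem _ (right_mem_Icc.2 hl1))
      he0 hy0 (by simpa using hgz)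
    have hb := hbig θ hθ
    set x1 := a + θ • (z - a)
    refine ⟨x1, (Metric.ball_subset_ball (by linarith)).trans hb, fun x hx => ?_⟩
    have hxt : x ∈ S.tube δ := A.cell_subset hs (hb (Metric.ball_subset_ball (by linarith) hx))
    have h1 := A.abs_gap_sub_le x x1
    rw [A.gap_of_mem hx1, sub_zero] at h1
    rw [Metric.mem_ball] at hx
    refine ⟨by linarith, fun w hw => ⟨s, hs, hb ?_⟩⟩
    have h2 : x ∈ Metric.ball x1 (8 * ρ) := by rw [Metric.mem_ball]; linarith
    have h3 : d.foot S x ∈ Metric.ball x1 (8 * ρ) := by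
      have h4 := A.norm_sub_foot hxt
      rw [← dist_eq_norm, dist_comm] at h4
      have := dist_triangle (d.foot S x) x x1
      rw [Metric.mem_ball]; linarith
    exact (convex_ball x1 (8 * ρ)).segment_subset h2 h3 hw
  -- Otherwise Γ_h crosses the segment close to a. The ball is centred a distance 4ρ off a + l(z -
  -- a), on the e-side, so that its points and their segments to the feet stay on the e-side,
  -- weakly, and within h/M of a. A tetrahedron with vertex a containing a point w of such a segment
  -- has points on both sides, so Γ_h meets it and it is active.
  · obtain ⟨x2, ⟨θ, hθ, rfl⟩, hx2⟩ := A.exists_mem_of_sign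
      ((isPreconnected_Icc (a := 0) (b := l)).image _ hcont.continuousOn)
      (by
        rintro _ ⟨θ, hθ, rfl⟩
        exact A.cell_subset hs (hpath θ ⟨hθ.1, hθ.2.trans hl1⟩))
      (mem_image_of_mem _ (left_mem_Icc.2 hl0.le)) (mem_image_of_mem _ (right_mem_Icc.2 hl0.le))
      he0 (by simpa using hea) hy0.le
    have hdist : ∀ θ ∈ Icc (0 : ℝ) l, dist (a + θ • (z - a)) a ≤ h / M / 16 := by
      intro θ hθ
      rw [dist_eq_norm, add_sub_cancel_left, norm_smul, Real.norm_eq_abs, abs_of_nonneg hθ.1,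
        ← hla, ← dist_eq_norm]
      exact mul_le_mul hθ.2 hza dist_nonneg hl0.le
    have hx2a := hdist θ hθ
    have hy0a := hdist l ⟨hl0.le, le_rfl⟩
    have hb := hbig l ⟨le_rfl, hl1⟩
    have hy0s := hpath l ⟨hl0.le, hl1⟩
    set y0 := a + l • (z - a)
    set x2 := a + θ • (z - a)
    obtain ⟨hy1, hy2⟩ := hshift y0 hy0s (4 * ρ * e) (by rw [habs _ (by linarith)]; linarith)
    rw [habs _ (by linarith)] at hy2
    set y1 := y0 + (4 * ρ * e) • S.normal y0
    have hyb : Metric.ball y1 ρ ⊆ closedCell s := by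
      refine (Metric.ball_subset_ball' ?_).trans hb
      rw [hy2]; linarith
    refine ⟨y1, hyb, fun x hx => ?_⟩
    have hxt : x ∈ S.tube δ := A.cell_subset hs (hyb hx)
    rw [Metric.mem_ball] at hx
    have t1 := dist_triangle x y1 y0
    have t2 := dist_triangle x y0 a
    have t3 := dist_triangle x a x2
    rw [dist_comm a x2] at t3
    have hgx := A.abs_gap_sub_le x x2
    rw [A.gap_of_mem hx2, sub_zero] at hgx
    have hpos : 0 ≤ e * d.gap S x := by
      have h1 := A.abs_gap_sub_le x y1
      have h2 : |e * d.gap S x - e * d.gap S y1| ≤ dist x y1 + 2 * (M * h ^ 2) := by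
        rw [← mul_sub, abs_mul, heabs, one_mul]; exact h1
      have h3 : e * d.gap S y1 = e * d.gap S y0 + 4 * ρ := by
        have : e * (d.gap S y0 + 4 * ρ * e) = e * d.gap S y0 + (e * e) * (4 * ρ) := by ring
        rw [hy1, this, hee, one_mul]
      have := (abs_le.1 h2).1
      linarith
    refine ⟨by linarith, fun w hw => ?_⟩
    obtain ⟨-, -, -, η, hη, hgw⟩ := A.gap_segment hxt hw
    have hwa : w ∈ Metric.ball a (h / M) := by
      have h4 := A.norm_sub_foot hxt
      have h5 : dist w x ≤ |d.gap S x| := by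
        rw [← h4, ← dist_eq_norm, dist_comm x]
        rw [segment_symm] at hw
        have := dist_add_dist_of_mem_segment hw
        linarith [dist_nonneg (x := d.foot S x) (y := w)]
      have := dist_triangle w x a
      rw [Metric.mem_ball]; linarith
    obtain ⟨t, ht, hat, hwt⟩ := A.mem_star hs1 ha hballa hwa
    have hat' : a ∈ closedCell t := subset_convexHull ℝ _ hat
    obtain ⟨x', hx't, hx'⟩ := A.exists_mem_of_sign (convex_closedCell t).isPreconnected
      (hnear t ht hat') hat' hwt he0 hea (by
        rw [hgw]
        have : e * ((1 - η) * d.gap S x) = (1 - η) * (e * d.gap S x) := by ring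
        rw [this]; exact mul_nonneg (sub_nonneg.2 hη.2) hpos)
    exact ⟨t, ⟨ht, x', hx't, hx'⟩, hwt⟩

end Approx
end SurfaceFEM
end

noncomputable section
namespace SurfaceFEM

/-! ### Determinants of maps close to the identity -/

lemma volume_real_ball (x : E3) {r : ℝ} (hr : 0 ≤ r) :
    volume.real (Metric.ball x r) = r ^ 3 * (Real.pi * 4 / 3) := by
  rw [Measure.real, EuclideanSpace.volume_ball_fin_three, ENNReal.toReal_mul, ENNReal.toReal_pow,
    ENNReal.toReal_ofReal hr, ENNReal.toReal_ofReal (by positivity)]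

/-- |det T| is the ratio of the volumes of the image of the unit ball and of the ball, and the image
lies in the ball of radius c. -/
lemma abs_det_le_pow (T : E3 →L[ℝ] E3) {c : ℝ} (hc : ∀ x, ‖T x‖ ≤ c * ‖x‖) :
    |LinearMap.det (T : E3 →ₗ[ℝ] E3)| ≤ c ^ 3 := by
  have hc0 : 0 ≤ c := by
    have := hc (EuclideanSpace.single 0 1)
    simp only [PiLp.norm_single, norm_one, mul_one] at this
    exact (norm_nonneg _).trans this
  have h1 := Measure.addHaar_image_linearMap volume (T : E3 →ₗ[ℝ] E3) (Metric.ball 0 1)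
  have h2 : (T : E3 →ₗ[ℝ] E3) '' Metric.ball 0 1 ⊆ Metric.closedBall 0 c := by
    rintro _ ⟨x, hx, rfl⟩
    rw [mem_closedBall_zero_iff]
    rw [mem_ball_zero_iff] at hx
    exact (hc x).trans (mul_le_of_le_one_right hc0 hx.le)
  have h3 := measure_mono (μ := volume) h2
  rw [h1, Measure.addHaar_closedBall _ _ hc0] at h3
  have hf : Module.finrank ℝ E3 = 3 := by simp
  rw [hf] at h3
  have h4 : volume (Metric.ball (0 : E3) 1) ≠ 0 := (Metric.measure_ball_pos _ _ one_pos).ne'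
  rw [ENNReal.mul_le_mul_iff_left h4 measure_ball_lt_top.ne] at h3
  exact (ENNReal.ofReal_le_ofReal_iff (by positivity)).1 h3

lemma pow_le_abs_det (T : E3 →L[ℝ] E3) {c : ℝ} (hc0 : 0 < c) (hc : ∀ x, c * ‖x‖ ≤ ‖T x‖) :
    c ^ 3 ≤ |LinearMap.det (T : E3 →ₗ[ℝ] E3)| := by
  have h1 := Measure.addHaar_image_linearMap volume (T : E3 →ₗ[ℝ] E3) (Metric.ball 0 1)
  have hinj : Function.Injective (T : E3 →ₗ[ℝ] E3) := by
    rw [injective_iff_map_eq_zero]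
    intro x hx
    have := hc x
    rw [show T x = 0 from hx, norm_zero] at this
    by_contra hne
    have := mul_pos hc0 (norm_pos_iff.2 hne)
    linarith
  have hsurj := LinearMap.injective_iff_surjective.1 hinj
  have h2 : Metric.ball 0 c ⊆ (T : E3 →ₗ[ℝ] E3) '' Metric.ball 0 1 := by
    intro y hy
    obtain ⟨x, rfl⟩ := hsurj y
    refine ⟨x, ?_, rfl⟩
    rw [mem_ball_zero_iff] at hy ⊢
    have := hc x
    have hy : ‖T x‖ < c := hy
    by_contra! hx
    nlinarith
  have h3 := measure_mono (μ := volume) h2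
  rw [h1, Measure.addHaar_ball _ _ hc0.le] at h3
  have hf : Module.finrank ℝ E3 = 3 := by simp
  rw [hf] at h3
  have h4 : volume (Metric.ball (0 : E3) 1) ≠ 0 := (Metric.measure_ball_pos _ _ one_pos).ne'
  rw [ENNReal.mul_le_mul_iff_left h4 measure_ball_lt_top.ne] at h3
  exact (ENNReal.ofReal_le_ofReal_iff (by positivity)).1 h3

/-! ### Functions on segments and balls -/

/-- Serves functions that are Lipschitz on finitely many closed parts of a segment whose arrangement
is unknown. Continuity follows by gluing, and the bound propagates from 0 to the right: some part
accumulates at the current point from the right, and being closed it contains that point. -/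
lemma abs_sub_le_of_closed_cover {ι : Type*} (I : Finset ι) (C : ι → Set ℝ) (hC : ∀ i ∈ I, IsClosed (C i))
    (hcov : Icc 0 1 ⊆ ⋃ i ∈ I, C i) {φ : ℝ → ℝ} {L : ℝ}
    (hφ : ∀ i ∈ I, ∀ s ∈ C i ∩ Icc 0 1, ∀ t ∈ C i ∩ Icc 0 1, |φ s - φ t| ≤ L * |s - t|) :
    |φ 1 - φ 0| ≤ L := by
  have hcont : ContinuousOn φ (Icc 0 1) := by
    have h1 : ∀ i ∈ I, ContinuousOn φ (C i ∩ Icc 0 1) := by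
      intro i hi
      refine LipschitzOnWith.continuousOn (K := Real.toNNReal L)
        (LipschitzOnWith.of_dist_le_mul fun s hs t ht => ?_)
      rw [Real.dist_eq, Real.dist_eq]
      exact (hφ i hi s hs t ht).trans
        (mul_le_mul_of_nonneg_right (Real.le_coe_toNNReal L) (abs_nonneg _))
    have e : Icc (0 : ℝ) 1 = ⋃ i : I, (C i ∩ Icc 0 1) := by
      ext t; constructor
      · intro ht
        obtain ⟨i, hi, hti⟩ := mem_iUnion₂.1 (hcov ht)
        exact mem_iUnion.2 ⟨⟨i, hi⟩, hti, ht⟩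
      · intro ht
        obtain ⟨i, hti⟩ := mem_iUnion.1 ht
        exact hti.2
    rw [e]
    refine LocallyFinite.continuousOn_iUnion (locallyFinite_of_finite _) (fun i => ?_) fun i => ?_
    · exact (hC i i.2).inter isClosed_Icc
    · exact h1 i i.2
  set G := {t | |φ t - φ 0| ≤ L * t} with hG
  have hcl : IsClosed (G ∩ Icc 0 1) := by
    have : G ∩ Icc 0 1 = {t ∈ Icc (0 : ℝ) 1 | |φ t - φ 0| ≤ L * t} := by ext; simp [hG, and_comm]
    rw [this]
    exact isClosed_Icc.isClosed_le (hcont.sub continuousOn_const).abs (by fun_prop)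
  have hsub : Icc (0 : ℝ) 1 ⊆ G := by
    refine hcl.Icc_subset_of_forall_exists_gt (by simp [hG]) ?_
    rintro x ⟨hxG, hx⟩ y hy
    -- some set of the cover accumulates at `x` from the right
    have hfr : ∃ i ∈ I, ∃ᶠ t in 𝓝[>] x, t ∈ C i := by
      by_contra! hcon
      have h1 : ∀ i ∈ I, ∀ᶠ t in 𝓝[>] x, t ∉ C i := hcon
      have h2 := (Finset.eventually_all I).2 h1
      have h3 : ∀ᶠ t in 𝓝[>] x, t ∈ Ioc x 1 := Ioc_mem_nhdsGT hx.2
      obtain ⟨t, ht, ht'⟩ := (h2.and h3).exists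
      obtain ⟨i, hi, hti⟩ := mem_iUnion₂.1 (hcov ⟨hx.1.trans ht'.1.le, ht'.2⟩)
      exact ht i hi hti
    obtain ⟨i, hi, hf⟩ := hfr
    have hxC : x ∈ C i := by
      rw [← (hC i hi).closure_eq, mem_closure_iff_frequently]
      exact hf.filter_mono nhdsWithin_le_nhds
    have h3 : ∀ᶠ t in 𝓝[>] x, t ∈ Ioc x (min y 1) := Ioc_mem_nhdsGT (lt_min hy hx.2)
    obtain ⟨t, htC, ht⟩ := (hf.and_eventually h3).exists
    refine ⟨t, ?_, ht.1, ht.2.trans (min_le_left _ _)⟩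
    have h4 := hφ i hi t ⟨htC, hx.1.trans ht.1.le, ht.2.trans (min_le_right _ _)⟩ x
      ⟨hxC, hx.1, hx.2.le⟩
    rw [abs_of_pos (sub_pos.2 ht.1)] at h4
    have h5 : |φ x - φ 0| ≤ L * x := hxG
    change |φ t - φ 0| ≤ L * t
    calc |φ t - φ 0| ≤ |φ t - φ x| + |φ x - φ 0| := abs_sub_le _ _ _
      _ ≤ L * t := by linarith
  have := hsub (right_mem_Icc.2 zero_le_one)
  simpa [hG] using this

/-- An affine function on a ball controls its gradient. -/
lemma norm_sq_le_integral_ball (g y : E3) (c : ℝ) {r : ℝ} (hr : 0 < r) :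
    r ^ 5 * ‖g‖ ^ 2 ≤ 40 * ∫ x in Metric.ball y r, (inner ℝ g x + c) ^ 2 := by
  rcases eq_or_ne g 0 with rfl | hg
  · simp only [norm_zero]
    have : 0 ≤ ∫ x in Metric.ball y r, (inner ℝ (0 : E3) x + c) ^ 2 :=
      integral_nonneg fun x => sq_nonneg _
    linarith
  set u : E3 := (r / ‖g‖) • g with hu
  have hgn : 0 < ‖g‖ := norm_pos_iff.2 hg
  have hun : ‖u‖ = r := by
    rw [hu, norm_smul, Real.norm_eq_abs, abs_of_pos (by positivity), div_mul_cancel₀ _ hgn.ne']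
  have hgu : inner ℝ g u = r * ‖g‖ := by
    rw [hu, inner_smul_right, real_inner_self_eq_norm_sq]; field_simp
  set f : E3 → ℝ := fun x => (inner ℝ g x + c) ^ 2 with hf
  have hfc : Continuous f := by fun_prop
  have hint : ∀ z ρ, IntegrableOn f (Metric.ball z ρ) := fun z ρ =>
    (hfc.continuousOn.integrableOn_compact (isCompact_closedBall z ρ)).mono_set
      Metric.ball_subset_closedBall
  -- Two disjoint balls inside the given one, translates of each other by u = r g/|g|. At
  -- corresponding points the affine function differs by r |g|, so the two squares add up to at
  -- least (r |g|)²/2.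
  set p := y + (1 / 2 : ℝ) • u with hp
  set q := y - (1 / 2 : ℝ) • u with hq
  have hpq : p - q = u := by rw [hp, hq]; module
  have h1 : Metric.ball p (r / 4) ⊆ Metric.ball y r := by
    apply Metric.ball_subset_ball'
    rw [dist_eq_norm, hp, add_sub_cancel_left, norm_smul, hun, Real.norm_of_nonneg (by norm_num)]
    linarith
  have h2 : Metric.ball q (r / 4) ⊆ Metric.ball y r := by
    apply Metric.ball_subset_ball'
    rw [dist_eq_norm, hq, sub_sub_cancel_left, norm_neg, norm_smul, hun,
      Real.norm_of_nonneg (by norm_num)]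
    linarith
  have hdis : Disjoint (Metric.ball p (r / 4)) (Metric.ball q (r / 4)) := by
    apply Metric.ball_disjoint_ball
    rw [dist_eq_norm, hpq, hun]; linarith
  have h3 : ∫ x in Metric.ball q (r / 4), f x = ∫ x in Metric.ball p (r / 4), f (x - u) := by
    have hmp : MeasurePreserving (fun x : E3 => x - u) volume volume := measurePreserving_sub_right _ u
    have he : MeasurableEmbedding (fun x : E3 => x - u) := (MeasurableEquiv.subRight u).measurableEmbedding
    rw [← hmp.setIntegral_preimage_emb he]
    congr 2
    ext x
    rw [mem_preimage, Metric.mem_ball, Metric.mem_ball, dist_eq_norm, dist_eq_norm]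
    have : x - u - q = x - p := by rw [← hpq]; abel
    rw [this]
  have hc' : Continuous fun x => f x + f (x - u) := by fun_prop
  have h4 : ∫ x in Metric.ball p (r / 4), (r * ‖g‖) ^ 2 / 2
      ≤ ∫ x in Metric.ball p (r / 4), (f x + f (x - u)) := by
    refine setIntegral_mono (integrableOn_const measure_ball_lt_top.ne)
      ((hc'.continuousOn.integrableOn_compact (isCompact_closedBall p (r / 4))).mono_set
      Metric.ball_subset_closedBall) fun x => ?_
    simp only [hf]
    rw [inner_sub_right, hgu]
    nlinarith [sq_nonneg (inner ℝ g x + c + (inner ℝ g x - r * ‖g‖ + c))]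
  have hc'' : Continuous fun x => f (x - u) := by fun_prop
  rw [setIntegral_const, integral_add (hint _ _)
    ((hc''.continuousOn.integrableOn_compact (isCompact_closedBall p (r / 4))).mono_set
      Metric.ball_subset_closedBall), ← h3, ← setIntegral_union hdis Metric.isOpen_ball.measurableSet
      (hint _ _) (hint _ _), volume_real_ball _ (by positivity), smul_eq_mul] at h4
  have h5 : ∫ x in Metric.ball p (r / 4) ∪ Metric.ball q (r / 4), f x ≤ ∫ x in Metric.ball y r, f x :=
    setIntegral_mono_set (hint _ _) (Eventually.of_forall fun x => sq_nonneg _)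
      (union_subset h1 h2).eventuallyLE
  have h6 := Real.pi_gt_three
  have h7 : 0 ≤ r ^ 5 * ‖g‖ ^ 2 := by positivity
  have h8 : (r / 4) ^ 3 * (Real.pi * 4 / 3) * ((r * ‖g‖) ^ 2 / 2)
    = r ^ 5 * ‖g‖ ^ 2 * Real.pi / 96 := by ring
  nlinarith

end SurfaceFEM
end

noncomputable section
namespace SurfaceFEM

/-! ### Control of the gradient on the active mesh -/

namespace DiscreteData
variable (d : DiscreteData)

/-- The gradient of a discrete function on a tetrahedron. -/
def cellGrad (v : E3 → ℝ) (s : Finset E3) : E3 :=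
  Classical.epsilon fun g => ∃ c : ℝ, ∀ x ∈ closedCell s, v x = inner ℝ g x + c

/-- The discrete normal on a tetrahedron. -/
def cellNormal (s : Finset E3) : E3 :=
  Classical.epsilon fun m => ‖m‖ = 1 ∧ (∀ x ∈ openCell s, d.normal x = m) ∧
    (openCell s ∩ d.surf = ∅ → ∃ K ∈ d.elements, (closure K ∩ closedCell s).Nonempty ∧
      ∃ y ∈ K, d.normal y = m)

open Classical in
/-- The active tetrahedra at distance at most `r` from a tetrahedron. -/
def near (r : ℝ) (s : Finset E3) : Finset (Finset E3) :=
  d.finite_active.toFinset.filter fun t => ∃ w ∈ closedCell t, ∃ y ∈ closedCell s, dist w y ≤ r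

variable {d}

lemma mem_near {r : ℝ} {s t : Finset E3} :
    t ∈ d.near r s ↔ t ∈ d.active ∧ ∃ w ∈ closedCell t, ∃ y ∈ closedCell s, dist w y ≤ r := by
  simp [near]

lemma cellGrad_spec {v : E3 → ℝ} (hv : v ∈ d.space) {s : Finset E3} (hs : s ∈ d.active) :
    ∃ c : ℝ, ∀ x ∈ closedCell s, v x = inner ℝ (cellGrad v s) x + c :=
  Classical.epsilon_spec (hv.2.1 s hs)

lemma cellNormal_spec (hd : d.IsDiscreteSurface) {s : Finset E3} (hs : s ∈ d.active) :
    ‖d.cellNormal s‖ = 1 ∧ (∀ x ∈ openCell s, d.normal x = d.cellNormal s) ∧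
    (openCell s ∩ d.surf = ∅ → ∃ K ∈ d.elements, (closure K ∩ closedCell s).Nonempty ∧
      ∃ y ∈ K, d.normal y = d.cellNormal s) := by
  refine Classical.epsilon_spec (p := fun m => ‖m‖ = 1 ∧ (∀ x ∈ openCell s, d.normal x = m) ∧
    (openCell s ∩ d.surf = ∅ → ∃ K ∈ d.elements, (closure K ∩ closedCell s).Nonempty ∧
      ∃ y ∈ K, d.normal y = m)) ?_
  obtain ⟨m, h1, h2, -, h3⟩ := hd.normal_cell s hs
  exact ⟨m, h1, h2, h3⟩

lemma nderiv_eq (hd : d.IsDiscreteSurface) {v : E3 → ℝ} (hv : v ∈ d.space) {s : Finset E3}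
    (hs : s ∈ d.active) {x : E3} (hx : x ∈ openCell s) :
    d.nderiv v x = inner ℝ (d.cellNormal s) (cellGrad v s) := by
  obtain ⟨c, hc⟩ := cellGrad_spec hv hs
  rw [nderiv, gradient_eq_of_mem_openCell hc hx, (cellNormal_spec hd hs).2.1 x hx]

lemma sub_eq_inner {v : E3 → ℝ} (hv : v ∈ d.space) {s : Finset E3} (hs : s ∈ d.active) {x y : E3}
    (hx : x ∈ closedCell s) (hy : y ∈ closedCell s) :
    v x - v y = inner ℝ (cellGrad v s) (x - y) := by
  obtain ⟨c, hc⟩ := cellGrad_spec hv hs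
  rw [hc x hx, hc y hy, inner_sub_right]; ring

lemma surf_subset_closedBulk (hd : d.IsDiscreteSurface) : d.surf ⊆ d.closedBulk := by
  intro x hx
  obtain ⟨K, hK, hxK⟩ := mem_iUnion₂.1 (hd.covered hx)
  obtain ⟨m, s, h⟩ := exists_elem hd hK
  exact mem_iUnion₂.2 ⟨s, h.mem, closure_minimal h.cell (isClosed_closedCell s) hxK⟩

end DiscreteData

namespace Approx
variable {S : SmoothClosedSurface} {δ M h : ℝ} {d : DiscreteData} (A : Approx S δ M d h)
include A

/-- The normal of a cell is that of an element meeting it, or of one whose closure touches it when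
the open cell misses Γ_h; thus it is attained within two cell diameters, where (A) and the Lipschitz
bound for n apply. -/
lemma norm_normal_sub_cellNormal_le {s : Finset E3} (hs : s ∈ d.active) {x w : E3}
    (hx : x ∈ S.tube δ) (hw : w ∈ closedCell s) :
    ‖S.normal x - d.cellNormal s‖ ≤ M * dist x w + 3 * (M ^ 2 * h) := by
  obtain ⟨y, hy, hym, hyw⟩ : ∃ y ∈ d.elementSet, d.normal y = d.cellNormal s ∧
      dist w y ≤ 2 * (M * h) := by
    obtain ⟨-, h2, h3⟩ := DiscreteData.cellNormal_spec A.surface hs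
    have hMh := mul_pos A.M_pos A.h_pos
    rcases (openCell s ∩ d.surf).eq_empty_or_nonempty with he | ⟨y, hy⟩
    · obtain ⟨K, hK, ⟨z, hzK, hzs⟩, y, hyK, hym⟩ := h3 he
      obtain ⟨m, t, ht⟩ := DiscreteData.exists_elem A.surface hK
      refine ⟨y, ⟨K, hK, hyK⟩, hym, ?_⟩
      have h4 := A.diam_le s hs.1 w hw z hzs
      have h5 := A.diam_le t ht.mem.1 z (closure_minimal ht.cell (isClosed_closedCell t) hzK) y
        (ht.cell hyK)
      linarith [dist_triangle w z y]
    · refine ⟨y, ⟨_, Or.inl ⟨s, hs, rfl⟩, hy⟩, h2 y hy.1, ?_⟩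
      have := A.diam_le s hs.1 w hw y (openCell_subset s hy.1)
      linarith
  have h1 := A.normal_le y hy
  rw [hym] at h1
  have h2 := A.tube.normal_lip x hx y (A.elementSet_subset_tube hy)
  have h3 := norm_sub_le_norm_sub_add_norm_sub (S.normal x) (S.normal y) (d.cellNormal s)
  have h4 := dist_triangle x w y
  rw [← dist_eq_norm x y] at h2
  have h5 : M * dist x y ≤ M * (dist x w + 2 * (M * h)) :=
    mul_le_mul_of_nonneg_left (by linarith) A.M_pos.le
  have h6 : M * h ≤ M ^ 2 * h :=
    mul_le_mul_of_nonneg_right (by nlinarith [A.tube.one_le]) A.h_pos.le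
  nlinarith

/-- Packing: the open cells are disjoint, each contains a ball of radius h/M, and all lie in a ball
of radius R. -/
lemma card_mul_le (F : Finset (Finset E3)) (hF : ∀ s ∈ F, s ∈ d.mesh.cells) {c : E3} {R : ℝ}
    (hR : 0 ≤ R) (hFR : ∀ s ∈ F, closedCell s ⊆ Metric.ball c R) :
    F.card * (h / M) ^ 3 ≤ R ^ 3 := by
  have h1 : ∀ s ∈ F, (h / M) ^ 3 * (Real.pi * 4 / 3) ≤ volume.real (openCell s) := by
    intro s hs
    obtain ⟨z, hz⟩ := A.ball s (hF s hs)
    rw [← volume_real_ball z (div_pos A.h_pos A.M_pos).le]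
    refine measureReal_mono (interior_maximal hz Metric.isOpen_ball) ?_
    exact measure_ne_top_of_subset ((openCell_subset s).trans (hFR s hs)) measure_ball_lt_top.ne
  have h2 : volume.real (⋃ s ∈ F, openCell s) = ∑ s ∈ F, volume.real (openCell s) := by
    refine measureReal_biUnion_finset (fun s hs t ht hst => ?_)
      (fun s _ => (isOpen_openCell s).measurableSet) fun s hs => ?_
    · exact Set.disjoint_left.2 fun x hxs hxt => hst (d.mesh.eq_of_ball (hF s hs) (hF t ht) hxs hxt)
    · exact measure_ne_top_of_subset ((openCell_subset s).trans (hFR s hs)) measure_ball_lt_top.ne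
  have h3 : volume.real (⋃ s ∈ F, openCell s) ≤ R ^ 3 * (Real.pi * 4 / 3) := by
    rw [← volume_real_ball c hR]
    exact measureReal_mono (iUnion₂_subset fun s hs => (openCell_subset s).trans (hFR s hs))
      measure_ball_lt_top.ne
  have h4 := Finset.sum_le_sum h1
  rw [Finset.sum_const, nsmul_eq_mul, ← h2, ← mul_assoc] at h4
  have h5 := h4.trans h3
  exact le_of_mul_le_mul_right h5 (by positivity)

lemma card_near_le {t : Finset E3} (ht : t ∈ d.active) : ((d.near (M * h) t).card : ℝ) ≤ 64 * M ^ 6 := by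
  obtain ⟨x, hx, -⟩ := ht.2
  have hMh := mul_pos A.M_pos A.h_pos
  have h1 := A.card_mul_le (d.near (M * h) t) (fun s hs => (DiscreteData.mem_near.1 hs).1.1) (c := x)
    (R := 4 * (M * h)) (by positivity) (by
      intro s hs z hz
      obtain ⟨hsa, w, hw, y, hy, hwy⟩ := DiscreteData.mem_near.1 hs
      have h1 := A.diam_le s hsa.1 z hz w hw
      have h2 := A.diam_le t ht.1 y hy x hx
      have h3 := dist_triangle4 z w y x
      rw [Metric.mem_ball]; linarith)
  have hM := A.M_pos
  have hh := A.h_pos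
  have e1 : (h / M) ^ 3 * (64 * M ^ 6) = (4 * (M * h)) ^ 3 := by field_simp; norm_num
  rw [← e1, mul_comm] at h1
  exact le_of_mul_le_mul_left h1 (by positivity)

/-- The segment from x to its foot has direction n(x) and length at most h/M, and v is affine on
each active tetrahedron it meets. The slope there is n_h·∇v up to an error O(h) |∇v|. -/
lemma sq_sub_foot_le {v : E3 → ℝ} (hv : v ∈ d.space) {s : Finset E3} (hs : s ∈ d.active) {x : E3}
    (hx : x ∈ closedCell s) (hgap : |d.gap S x| ≤ h / M)
    (hseg : ∀ w ∈ segment ℝ x (d.foot S x), ∃ t ∈ d.active, w ∈ closedCell t) :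
    (v x - v (d.foot S x)) ^ 2 ≤ (h / M) ^ 2 * ∑ t ∈ d.near (M * h) s,
      (2 * inner ℝ (d.cellNormal t) (DiscreteData.cellGrad v t) ^ 2
        + 50 * (M ^ 4 * h ^ 2) * ‖DiscreteData.cellGrad v t‖ ^ 2) := by
  have hxt := A.cell_subset hs hx
  have hM := A.tube.one_le
  have hM0 := A.M_pos
  have hh := A.h_pos
  have hhM : h / M ≤ M * h := (div_le_self hh.le hM).trans A.h_le_mul
  set f := d.foot S x with hf
  -- The root of the sum of squares dominates the slope in every cell the segment may meet, and its
  -- square is summable over cells.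
  set L : ℝ := √(∑ t ∈ d.near (M * h) s, inner ℝ (DiscreteData.cellGrad v t) (S.normal x) ^ 2) with hL
  have hwx : ∀ w ∈ segment ℝ x f, dist w x ≤ h / M := by
    intro w hw
    rw [segment_symm] at hw
    have h1 := dist_add_dist_of_mem_segment hw
    have h2 := A.norm_sub_foot hxt
    rw [← dist_eq_norm, dist_comm, ← hf] at h2
    linarith [dist_nonneg (x := f) (y := w)]
  have hpath : ∀ θ ∈ Icc (0 : ℝ) 1, x + θ • (f - x) ∈ segment ℝ x f := by
    intro θ hθ; rw [segment_eq_image']; exact ⟨θ, hθ, rfl⟩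
  have hnear : ∀ w ∈ segment ℝ x f, ∀ t ∈ d.active, w ∈ closedCell t → t ∈ d.near (M * h) s :=
    fun w hw t ht hwt => DiscreteData.mem_near.2 ⟨ht, w, hwt, x, hx, (hwx w hw).trans hhM⟩
  have hfx : f - x = -(d.gap S x • S.normal x) := by rw [← A.sub_foot hxt]; abel
  have hc : Continuous fun θ : ℝ => x + θ • (f - x) := by fun_prop
  have h1 : |v (x + (1 : ℝ) • (f - x)) - v (x + (0 : ℝ) • (f - x))| ≤ L * |d.gap S x| := by
    refine abs_sub_le_of_closed_cover (φ := fun θ => v (x + θ • (f - x))) (d.near (M * h) s)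
      (fun t => (fun θ : ℝ => x + θ • (f - x)) ⁻¹' closedCell t)
      (fun t _ => (isClosed_closedCell t).preimage hc) ?_ ?_
    · intro θ hθ
      obtain ⟨t, ht, hwt⟩ := hseg _ (hpath θ hθ)
      exact mem_iUnion₂.2 ⟨t, hnear _ (hpath θ hθ) t ht hwt, hwt⟩
    · intro t ht θ hθ η hη
      have hta := (DiscreteData.mem_near.1 ht).1
      rw [DiscreteData.sub_eq_inner hv hta hθ.1 hη.1]
      have e : x + θ • (f - x) - (x + η • (f - x)) = -((θ - η) * d.gap S x) • S.normal x := by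
        rw [hfx]; module
      rw [e, inner_smul_right, abs_mul, abs_neg, abs_mul]
      have h2 : |inner ℝ (DiscreteData.cellGrad v t) (S.normal x)| ≤ L := by
        rw [hL]; apply Real.abs_le_sqrt
        exact Finset.single_le_sum (f := fun t => inner ℝ (DiscreteData.cellGrad v t) (S.normal x) ^ 2)
          (fun _ _ => sq_nonneg _) ht
      have := mul_le_mul_of_nonneg_left h2 (mul_nonneg (abs_nonneg (θ - η)) (abs_nonneg (d.gap S x)))
      linarith
  simp only [one_smul, zero_smul, add_zero, add_sub_cancel] at h1
  have hL0 : 0 ≤ L := Real.sqrt_nonneg _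
  have h2 : |v f - v x| ≤ L * (h / M) := h1.trans (mul_le_mul_of_nonneg_left hgap hL0)
  have h3 : (v x - v f) ^ 2 ≤ (L * (h / M)) ^ 2 := by
    rw [← abs_sub_comm, ] at h2
    exact sq_le_sq' (by linarith [(abs_le.1 h2).1]) (by linarith [(abs_le.1 h2).2])
  refine h3.trans ?_
  rw [mul_pow, mul_comm, hL, Real.sq_sqrt (Finset.sum_nonneg fun _ _ => sq_nonneg _)]
  refine mul_le_mul_of_nonneg_left (Finset.sum_le_sum fun t ht => ?_) (by positivity)
  -- compare the normals
  obtain ⟨hta, w, hw, y, hy, hwy⟩ := DiscreteData.mem_near.1 ht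
  have h4 := A.norm_normal_sub_cellNormal_le hta hxt hw
  have h5 : dist x w ≤ 2 * (M * h) := by
    have h6 := A.diam_le s hs.1 x hx y hy
    have := dist_triangle x y w
    rw [dist_comm y w] at this
    linarith
  have h6 : ‖S.normal x - d.cellNormal t‖ ≤ 5 * (M ^ 2 * h) := by
    have := mul_le_mul_of_nonneg_left h5 hM0.le
    nlinarith
  set g := DiscreteData.cellGrad v t
  set p := inner ℝ (d.cellNormal t) g
  have h7 : |inner ℝ (S.normal x - d.cellNormal t) g| ≤ 5 * (M ^ 2 * h) * ‖g‖ :=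
    (abs_real_inner_le_norm _ _).trans (mul_le_mul_of_nonneg_right h6 (norm_nonneg _))
  have h8 : inner ℝ g (S.normal x) = p + inner ℝ (S.normal x - d.cellNormal t) g := by
    rw [inner_sub_left, real_inner_comm g]; ring
  have h9 : inner ℝ (S.normal x - d.cellNormal t) g ^ 2 ≤ (5 * (M ^ 2 * h) * ‖g‖) ^ 2 :=
    sq_le_sq' (by linarith [(abs_le.1 h7).1]) (abs_le.1 h7).2
  rw [h8]
  nlinarith [sq_nonneg (p - inner ℝ (S.normal x - d.cellNormal t) g)]

end Approx
end SurfaceFEM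
end

/-! ### Integrals of discrete normal derivatives, size of |B|, and integration in normal coordinates
-/

noncomputable section
namespace SurfaceFEM

lemma measure_closedCell_lt_top (s : Finset E3) : volume (closedCell s) < ⊤ :=
  (s.finite_toSet.isCompact_convexHull ℝ).measure_lt_top

lemma measure_openCell_ne_top (s : Finset E3) : volume (openCell s) ≠ ⊤ :=
  measure_ne_top_of_subset (openCell_subset s) (measure_closedCell_lt_top s).ne

namespace DiscreteData
variable {d : DiscreteData}

lemma bulk_eq : d.bulk = ⋃ s ∈ d.finite_active.toFinset, openCell s := by simp [bulk]

lemma intT_nderiv_mul (hd : d.IsDiscreteSurface) {v w : E3 → ℝ} (hv : v ∈ d.space) (hw : w ∈ d.space) :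
    d.intT (fun x => d.nderiv v x * d.nderiv w x) = ∑ s ∈ d.finite_active.toFinset,
      volume.real (openCell s) * (inner ℝ (d.cellNormal s) (cellGrad v s)
        * inner ℝ (d.cellNormal s) (cellGrad w s)) := by
  have hcongr : ∀ s ∈ d.active, EqOn (fun x => d.nderiv v x * d.nderiv w x)
      (fun _ => inner ℝ (d.cellNormal s) (cellGrad v s) * inner ℝ (d.cellNormal s) (cellGrad w s))
      (openCell s) := fun s hs x hx => by
    simp only [nderiv_eq hd hv hs hx, nderiv_eq hd hw hs hx]
  rw [intT, bulk_eq, integral_biUnion_finset]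
  · refine Finset.sum_congr rfl fun s hs => ?_
    rw [setIntegral_congr_fun (isOpen_openCell s).measurableSet
      (hcongr s (d.finite_active.mem_toFinset.1 hs)), setIntegral_const, smul_eq_mul]
  · exact fun s _ => (isOpen_openCell s).measurableSet
  · intro s hs t ht hst
    have hs' := (d.finite_active.mem_toFinset.1 hs).1
    have ht' := (d.finite_active.mem_toFinset.1 ht).1
    exact Set.disjoint_left.2 fun x hxs hxt => hst (d.mesh.eq_of_ball hs' ht' hxs hxt)
  · intro s hs
    exact (integrableOn_const (measure_openCell_ne_top s)).congr_fun
      (hcongr s (d.finite_active.mem_toFinset.1 hs)).symm (isOpen_openCell s).measurableSet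

end DiscreteData

namespace SmoothClosedSurface
variable {S : SmoothClosedSurface} {δ : ℝ}

lemma isBounded_tube (S : SmoothClosedSurface) (δ : ℝ) : Bornology.IsBounded (S.tube δ) := by
  refine (S.isCompact_surf.isBounded.thickening (δ := δ)).subset fun x hx => ?_
  have h1 : |S.sdist x| < δ := hx
  rw [S.abs_sdist] at h1
  obtain ⟨y, hy, hxy⟩ := (Metric.infDist_lt_iff S.surf_nonempty).1 h1
  exact Metric.mem_thickening_iff.2 ⟨y, hy, hxy⟩

end SmoothClosedSurface

namespace Approx
variable {S : SmoothClosedSurface} {δ M h : ℝ} {d : DiscreteData} (A : Approx S δ M d h)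
include A

lemma norm_normal_eq_one {y : E3} (hy : y ∈ d.elementSet) : ‖d.normal y‖ = 1 := by
  obtain ⟨K, hK, hy⟩ := hy
  obtain ⟨m, s, h⟩ := DiscreteData.exists_elem A.surface hK
  rw [h.normal y hy, h.norm_eq]

/-- B + n ⊗ m differs from the identity by three terms: projecting along n instead of m, the
curvature term ρκ, and n - m in the normal direction. Each has norm at most Mh. -/
lemma norm_fullB_sub_le {y : E3} (hy : y ∈ d.elementSet) (w : E3) :
    ‖S.fullB (d.normal y) y w - w‖ ≤ 3 * (M * h) * ‖w‖ := by
  have hyt := A.elementSet_subset_tube hy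
  have hm := A.norm_normal_eq_one hy
  have hnm := A.normal_le y hy
  have hn := A.tube.norm_normal y hyt
  set m := d.normal y
  set n := S.normal y
  set p := tangentProj m w with hp
  have hpw : ‖p‖ ≤ ‖w‖ := norm_tangentProj_le hm w
  have e : S.fullB m y w - w = -(inner ℝ (n - m) p • n)
      - tangentProj n (S.sdist y • S.curv y p) + inner ℝ m w • (n - m) := by
    rw [SmoothClosedSurface.fullB_apply]
    have h1 : S.mapB m y w = tangentProj n (p - S.sdist y • S.curv y p) := rfl
    have h2 : tangentProj n p = p - inner ℝ (n - m) p • n := by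
      rw [tangentProj_apply, inner_sub_left, hp, inner_tangentProj hm, sub_zero]
    have h3 : p = w - inner ℝ m w • m := tangentProj_apply m w
    rw [h1, map_sub, h2]
    nth_rewrite 1 [h3]
    rw [smul_sub]; abel
  have hMh := A.mul_le
  have hδ := A.delta_le
  have hM0 := A.M_pos
  have hh := A.h_pos
  have t1 : ‖inner ℝ (n - m) p • n‖ ≤ M * h * ‖w‖ := by
    rw [norm_smul, hn, mul_one]
    exact (norm_inner_le_norm _ _).trans (mul_le_mul hnm hpw (norm_nonneg _) (by positivity))
  have t2 : ‖tangentProj n (S.sdist y • S.curv y p)‖ ≤ M * h * ‖w‖ := by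
    refine (norm_tangentProj_le hn _).trans ?_
    rw [norm_smul, Real.norm_eq_abs]
    have h1 := A.dist_le y (DiscreteData.elementSet_subset A.surface hy)
    have h2 : ‖S.curv y p‖ ≤ M * ‖w‖ :=
      ((S.curv y).le_opNorm p).trans (mul_le_mul (A.tube.curv_le y hyt) hpw (norm_nonneg _) hM0.le)
    have h3 : |S.sdist y| * ‖S.curv y p‖ ≤ M * h ^ 2 * (M * ‖w‖) :=
      mul_le_mul h1 h2 (norm_nonneg _) (by positivity)
    have h4 : M * h ^ 2 * (M * ‖w‖) = M * h * ‖w‖ * (M * h) := by ring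
    rw [h4] at h3
    exact h3.trans (mul_le_of_le_one_right (by positivity) (by linarith))
  have t3 : ‖inner ℝ m w • (n - m)‖ ≤ M * h * ‖w‖ := by
    rw [norm_smul, mul_comm]
    have : ‖inner ℝ m w‖ ≤ ‖w‖ := (norm_inner_le_norm (𝕜 := ℝ) m w).trans (by rw [hm, one_mul])
    exact mul_le_mul hnm this (norm_nonneg _) (by positivity)
  rw [e]
  refine (norm_add_le _ _).trans ?_
  have := norm_sub_le (-(inner ℝ (n - m) p • n)) (tangentProj n (S.sdist y • S.curv y p))
  rw [norm_neg] at this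
  linarith

lemma absDetB_mem {y : E3} (hy : y ∈ d.elementSet) : S.absDetB (d.normal y) y ∈ Icc (1 / 2 : ℝ) 2 := by
  have hMh := A.mul_le
  have hδ := A.delta_le
  have hpos := mul_pos A.M_pos A.h_pos
  rw [SmoothClosedSurface.absDetB_eq]
  have key := fun w => A.norm_fullB_sub_le hy w
  constructor
  · refine le_trans ?_ (pow_le_abs_det (S.fullB (d.normal y) y) (c := 99 / 100) (by norm_num) fun w => ?_)
    · norm_num
    · have h1 := key w
      have h2 := norm_sub_le_norm_sub_add_norm_sub w (S.fullB (d.normal y) y w) 0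
      rw [sub_zero, sub_zero, norm_sub_rev] at h2
      nlinarith [norm_nonneg w]
  · refine (abs_det_le_pow (S.fullB (d.normal y) y) (c := 101 / 100) fun w => ?_).trans (by norm_num)
    have h1 := key w
    have h2 := norm_sub_le_norm_sub_add_norm_sub (S.fullB (d.normal y) y w) w 0
    rw [sub_zero, sub_zero] at h2
    nlinarith [norm_nonneg w]

lemma aemeasurable_absDetB :
    AEMeasurable (fun y => S.absDetB (d.normal y) y) (μHE[2].restrict d.elementSet) := by
  rw [DiscreteData.elementSet_eq]
  refine A.tube.aemeasurable_absDetB d.finite_elements.toFinset id ?_ ?_ ?_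
  · intro K hK
    obtain ⟨m, s, h⟩ := DiscreteData.exists_elem A.surface (d.finite_elements.mem_toFinset.1 hK)
    exact h.measurable
  · exact fun K hK => DiscreteData.isPlanar_of_mem A.surface (d.finite_elements.mem_toFinset.1 hK)
  · intro K hK
    exact (subset_sUnion_of_mem (d.finite_elements.mem_toFinset.1 hK)).trans A.elementSet_subset_tube

lemma integral_weighted (a : E3 → ℝ) : ∫ y, a y ∂(S.weighted d.normal d.elementSet)
    = ∫ y in d.elementSet, S.absDetB (d.normal y) y * a y ∂μHE[2] := by
  rw [SmoothClosedSurface.weighted, integral_withDensity_eq_integral_toReal_smul₀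
    A.aemeasurable_absDetB.ennreal_ofReal (Eventually.of_forall fun _ => ENNReal.ofReal_lt_top)]
  refine integral_congr_ae (Eventually.of_forall fun y => ?_)
  simp only [smul_eq_mul]
  rw [ENNReal.toReal_ofReal]
  rw [SmoothClosedSurface.absDetB]; exact abs_nonneg _

/-- Integration over a layer of a function which is a product in normal coordinates. -/
lemma integral_shell_mul {J : Set ℝ} (hJm : MeasurableSet J) (hJ : J ⊆ Ioo (-δ) δ) {G : E3 → ℝ}
    (hG : AEStronglyMeasurable G (volume.restrict (S.sdist ⁻¹' J))) {a : E3 → ℝ} {b : ℝ → ℝ}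
    (hab : ∀ y ∈ d.elementSet, ∀ t ∈ J, G (S.fiber y t) = a y * b t) :
    ∫ x in S.sdist ⁻¹' J, S.jac x * G x
      = (∫ y in d.elementSet, S.absDetB (d.normal y) y * a y ∂μHE[2]) * ∫ t in J, b t := by
  have hmap := A.map_fiber hJm hJ
  have hsm : MeasurableSet (S.sdist ⁻¹' J) := S.measurable_sdist hJm
  have hjac : AEMeasurable (fun x => ENNReal.ofReal (S.jac x)) (volume.restrict (S.sdist ⁻¹' J)) := by
    refine AEMeasurable.ennreal_ofReal (ContinuousOn.aemeasurable ?_ hsm)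
    exact fun x hx => (A.tube.contDiffAt_jac (shell_subset_tube hJ hx)).continuousAt.continuousWithinAt
  have hfin : IsFiniteMeasure ((μHE[2] : Measure E3).restrict d.elementSet) :=
    ⟨by rw [Measure.restrict_apply_univ]; exact DiscreteData.measure_elementSet_lt_top A.surface⟩
  have hsf : SFinite (S.weighted d.normal d.elementSet) := by
    unfold SmoothClosedSurface.weighted; infer_instance
  have hmem : ∀ᵐ y ∂(S.weighted d.normal d.elementSet), y ∈ d.elementSet :=
    (withDensity_absolutelyContinuous _ _).ae_le
      (ae_restrict_mem (DiscreteData.measurableSet_elementSet A.surface))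
  have hfib := A.tube.aemeasurable_fiber (ν := volume.restrict J)
    (DiscreteData.measurableSet_elementSet A.surface) A.elementSet_subset_tube hmem
  have h1 : ∫ x in S.sdist ⁻¹' J, S.jac x * G x
      = ∫ x, G x ∂((volume.restrict (S.sdist ⁻¹' J)).withDensity
        fun x => ENNReal.ofReal (S.jac x)) := by
    rw [integral_withDensity_eq_integral_toReal_smul₀ hjac
      (Eventually.of_forall fun _ => ENNReal.ofReal_lt_top)]
    refine setIntegral_congr_fun hsm fun x hx => ?_
    have := A.tube.jac_ge x (shell_subset_tube hJ hx)
    simp only [smul_eq_mul]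
    rw [ENNReal.toReal_ofReal (by linarith)]
  rw [h1, ← hmap, integral_map hfib, ← A.integral_weighted, ← integral_prod_mul]
  · refine integral_congr_ae ?_
    have h2 : ∀ᵐ z ∂((S.weighted d.normal d.elementSet).prod (volume.restrict J)),
        z.1 ∈ d.elementSet := Measure.quasiMeasurePreserving_fst.ae hmem
    have h3 : ∀ᵐ z ∂((S.weighted d.normal d.elementSet).prod (volume.restrict J)), z.2 ∈ J :=
      Measure.quasiMeasurePreserving_snd.ae (ae_restrict_mem hJm)
    filter_upwards [h2, h3] with z hz1 hz2 using hab _ hz1 _ hz2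
  · rw [hmap]; exact hG.mono_ac (withDensity_absolutelyContinuous _ _)

end Approx
end SurfaceFEM
end

/-! ### Piecewise continuous integrands and the bound for all cell gradients -/

noncomputable section
namespace SurfaceFEM

namespace DiscreteData
variable {d : DiscreteData}

/-- Functions which are continuous up to the boundary on each surface element. -/
def PiecewiseCont {F : Type*} [TopologicalSpace F] (d : DiscreteData) (φ : E3 → F) : Prop :=
  ∀ K ∈ d.elements, ∃ f : E3 → F, Continuous f ∧ EqOn φ f K

namespace PiecewiseCont
variable {F : Type*} [NormedAddCommGroup F]

lemma add {φ ψ : E3 → F} (hφ : d.PiecewiseCont φ) (hψ : d.PiecewiseCont ψ) :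
    d.PiecewiseCont fun x => φ x + ψ x := fun K hK => by
  obtain ⟨f, hf, hf'⟩ := hφ K hK
  obtain ⟨g, hg, hg'⟩ := hψ K hK
  exact ⟨_, hf.add hg, fun x hx => by simp only [hf' hx, hg' hx, Pi.add_apply]⟩

lemma mul {φ ψ : E3 → ℝ} (hφ : d.PiecewiseCont φ) (hψ : d.PiecewiseCont ψ) :
    d.PiecewiseCont fun x => φ x * ψ x := fun K hK => by
  obtain ⟨f, hf, hf'⟩ := hφ K hK
  obtain ⟨g, hg, hg'⟩ := hψ K hK
  exact ⟨_, hf.mul hg, fun x hx => by simp only [hf' hx, hg' hx, Pi.mul_apply]⟩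

lemma pow {φ : E3 → ℝ} (hφ : d.PiecewiseCont φ) (n : ℕ) : d.PiecewiseCont fun x => φ x ^ n :=
  fun K hK => by
  obtain ⟨f, hf, hf'⟩ := hφ K hK
  exact ⟨_, hf.pow n, fun x hx => by simp only [hf' hx, Pi.pow_apply]⟩

lemma inner [InnerProductSpace ℝ F] {φ ψ : E3 → F} (hφ : d.PiecewiseCont φ) (hψ : d.PiecewiseCont ψ) :
    d.PiecewiseCont fun x => Inner.inner ℝ (φ x) (ψ x) := fun K hK => by
  obtain ⟨f, hf, hf'⟩ := hφ K hK
  obtain ⟨g, hg, hg'⟩ := hψ K hK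
  exact ⟨_, hf.inner hg, fun x hx => by simp only [hf' hx, hg' hx]⟩

lemma norm {φ : E3 → F} (hφ : d.PiecewiseCont φ) : d.PiecewiseCont fun x => ‖φ x‖ := fun K hK => by
  obtain ⟨f, hf, hf'⟩ := hφ K hK
  exact ⟨_, hf.norm, fun x hx => by simp only [hf' hx]⟩

lemma integrableOn (hd : d.IsDiscreteSurface) {φ : E3 → F} (hφ : d.PiecewiseCont φ) :
    IntegrableOn φ d.elementSet μHE[2] := by
  rw [elementSet_eq, integrableOn_finset_iUnion]
  intro K hK
  have hK' := d.finite_elements.mem_toFinset.1 hK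
  obtain ⟨m, s, h⟩ := exists_elem hd hK'
  obtain ⟨f, hf, hf'⟩ := hφ K hK'
  obtain ⟨c, hc⟩ := (s.finite_toSet.isCompact_convexHull ℝ).exists_bound_of_continuousOn hf.continuousOn
  refine IntegrableOn.congr_fun ?_ hf'.symm h.measurable
  refine Measure.integrableOn_of_bounded (M := c) h.measure_lt_top.ne
    hf.aestronglyMeasurable ?_
  filter_upwards [ae_restrict_mem h.measurable] with x hx using hc x (h.cell hx)

end PiecewiseCont

lemma piecewiseCont_of_mem (hd : d.IsDiscreteSurface) {v : E3 → ℝ} (hv : v ∈ d.space) :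
    d.PiecewiseCont v := fun K hK => by
  obtain ⟨m, s, h⟩ := exists_elem hd hK
  obtain ⟨g, c, hgc⟩ := hv.2.1 s h.mem
  exact ⟨fun x => Inner.inner ℝ g x + c, by fun_prop, fun x hx => hgc x (h.cell hx)⟩

lemma piecewiseCont_tgrad (hd : d.IsDiscreteSurface) {v : E3 → ℝ} (hv : v ∈ d.space) :
    d.PiecewiseCont (d.tgrad v) := fun K hK => by
  obtain ⟨m, s, h⟩ := exists_elem hd hK
  obtain ⟨g, c, hgc⟩ := hv.2.1 s h.mem
  exact ⟨fun _ => tangentProj m g, continuous_const, fun x hx => h.tgrad_eq hgc hx⟩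

lemma IsCoefficients.piecewiseCont_α (hc : d.IsCoefficients) : d.PiecewiseCont d.α := fun K hK => by
  obtain ⟨a, ha, h⟩ := hc.regular_α K hK
  exact ⟨a, ha.continuous, h⟩

lemma IsCoefficients.piecewiseCont_β (hc : d.IsCoefficients) : d.PiecewiseCont d.β := fun K hK => by
  obtain ⟨b, hb, h⟩ := hc.regular_β K hK
  exact ⟨b, hb.continuous, h⟩

lemma IsCoefficients.piecewiseCont_stream (hc : d.IsCoefficients) (hd : d.IsDiscreteSurface)
    {v : E3 → ℝ} (hv : v ∈ d.space) : d.PiecewiseCont (d.stream v) :=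
  hc.piecewiseCont_β.inner (piecewiseCont_tgrad hd hv)

/-- The sum of the squares of the gradients. -/
def gradSum (d : DiscreteData) (v : E3 → ℝ) : ℝ :=
  ∑ s ∈ d.finite_active.toFinset, ‖cellGrad v s‖ ^ 2

lemma near_symm {r : ℝ} {s t : Finset E3} (hs : s ∈ d.active) (ht : t ∈ d.near r s) :
    s ∈ d.near r t := by
  obtain ⟨-, w, hw, y, hy, h⟩ := mem_near.1 ht
  exact mem_near.2 ⟨hs, y, hy, w, hw, by rwa [dist_comm]⟩

/-- Nearness of cells is symmetric, so after exchanging the sums each t is counted once for each of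
its at most B neighbours. -/
lemma sum_near_le {r B : ℝ} (hB : ∀ t ∈ d.active, ((d.near r t).card : ℝ) ≤ B) {X : Finset E3 → ℝ}
    (hX : ∀ t, 0 ≤ X t) : ∑ s ∈ d.finite_active.toFinset, ∑ t ∈ d.near r s, X t
      ≤ B * ∑ t ∈ d.finite_active.toFinset, X t := by
  have e : ∑ s ∈ d.finite_active.toFinset, ∑ t ∈ d.near r s, X t
      = ∑ t ∈ d.finite_active.toFinset, ∑ _s ∈ d.near r t, X t := by
    refine Finset.sum_comm' fun s t => ?_
    constructor
    · rintro ⟨hs, ht⟩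
      exact ⟨near_symm (d.finite_active.mem_toFinset.1 hs) ht,
        d.finite_active.mem_toFinset.2 (mem_near.1 ht).1⟩
    · rintro ⟨hs, ht⟩
      exact ⟨d.finite_active.mem_toFinset.2 (mem_near.1 hs).1,
        near_symm (d.finite_active.mem_toFinset.1 ht) hs⟩
  rw [e, Finset.mul_sum]
  refine Finset.sum_le_sum fun t ht => ?_
  rw [Finset.sum_const, nsmul_eq_mul]
  exact mul_le_mul_of_nonneg_right (hB t (d.finite_active.mem_toFinset.1 ht)) (hX t)

end DiscreteData

namespace Approx
variable {S : SmoothClosedSurface} {δ M h : ℝ} {d : DiscreteData} (A : Approx S δ M d h)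
include A

lemma two_h_subset : Ioo (-(2 * h)) (2 * h) ⊆ Ioo (-δ) δ := by
  have := A.h_le; have := A.tube.pos
  exact Ioo_subset_Ioo (by linarith) (by linarith)

lemma continuousOn_comp_foot {v : E3 → ℝ} (hv : v ∈ d.space) :
    ContinuousOn (fun x => v (d.foot S x)) (S.tube δ) :=
  (hv.1.mono (DiscreteData.surf_subset_closedBulk A.surface)).comp A.continuousOn_foot
    fun x _ => A.foot_mem x

lemma foot_fiber {y : E3} (hy : y ∈ d.surf) {t : ℝ} (ht : |t| < δ) :
    d.foot S (S.fiber y t) = y :=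
  A.foot_eq_of_mem hy (A.tube.fiber_mem (A.subset_tube hy) ht).2.1.symm

lemma integrableOn_sq_foot {v : E3 → ℝ} (hv : v ∈ d.space) {E : Set E3} (hE : MeasurableSet E)
    (hEt : E ⊆ S.tube δ) : IntegrableOn (fun x => v (d.foot S x) ^ 2) E := by
  obtain ⟨c, hc⟩ := (A.surface.isCompact.exists_bound_of_continuousOn
    (hv.1.mono (DiscreteData.surf_subset_closedBulk A.surface)))
  have hfin : volume E < ⊤ := ((S.isBounded_tube δ).subset hEt).measure_lt_top
  have : IsFiniteMeasure (volume.restrict E) := ⟨by rwa [Measure.restrict_apply_univ]⟩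
  refine Integrable.of_bound (C := c ^ 2) ?_ ?_
  · exact (((A.continuousOn_comp_foot hv).mono hEt).pow 2).aestronglyMeasurable hE
  · refine Eventually.of_forall fun x => ?_
    have := hc _ (A.foot_mem (d := d) x)
    rw [norm_pow]
    exact pow_le_pow_left₀ (norm_nonneg _) this 2

/-- The integrand is constant along fibres of length 4h, so with the weight `jac` the integral is 4h
times that of |B| v². Removing `jac` and |B| costs a factor 2 each. -/
lemma integral_shell_sq_foot_le {v : E3 → ℝ} (hv : v ∈ d.space) :
    ∫ x in S.sdist ⁻¹' Ioo (-(2 * h)) (2 * h), v (d.foot S x) ^ 2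
      ≤ 16 * h * d.intK (fun y => v y ^ 2) := by
  set J := Ioo (-(2 * h)) (2 * h) with hJ
  have hJδ := A.two_h_subset
  have hsm : MeasurableSet (S.sdist ⁻¹' J) := S.measurable_sdist measurableSet_Ioo
  have hst := shell_subset_tube (S := S) hJδ
  have hh := A.h_pos
  have hcont : ContinuousOn (fun x => v (d.foot S x) ^ 2) (S.tube δ) :=
    (A.continuousOn_comp_foot hv).pow 2
  have h1 := A.integral_shell_mul measurableSet_Ioo hJδ (G := fun x => v (d.foot S x) ^ 2)
    (a := fun y => v y ^ 2) (b := fun _ => 1)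
    ((hcont.mono hst).aestronglyMeasurable hsm) (by
      intro y hy t ht
      rw [A.foot_fiber (DiscreteData.elementSet_subset A.surface hy) (abs_lt.2 (hJδ ht)), mul_one])
  have hv2 : IntegrableOn (fun y => v y ^ 2) d.elementSet μHE[2] :=
    ((DiscreteData.piecewiseCont_of_mem A.surface hv).pow 2).integrableOn A.surface
  have h2 : ∫ x in S.sdist ⁻¹' J, v (d.foot S x) ^ 2
      ≤ ∫ x in S.sdist ⁻¹' J, 2 * (S.jac x * v (d.foot S x) ^ 2) := by
    refine setIntegral_mono_on (A.integrableOn_sq_foot hv hsm hst) ?_ hsm fun x hx => ?_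
    · refine Integrable.const_mul ?_ 2
      refine (A.integrableOn_sq_foot hv hsm hst).bdd_mul (c := 2) ?_ ?_
      · refine ContinuousOn.aestronglyMeasurable ?_ hsm
        exact fun x hx => (A.tube.contDiffAt_jac (hst hx)).continuousAt.continuousWithinAt
      · filter_upwards [ae_restrict_mem hsm] with x hx
        have := A.tube.jac_ge x (hst hx)
        rw [Real.norm_of_nonneg (by linarith)]
        exact A.tube.jac_le x (hst hx)
    · have := A.tube.jac_ge x (hst hx)
      nlinarith [sq_nonneg (v (d.foot S x))]
  have h3 : ∫ y in d.elementSet, S.absDetB (d.normal y) y * v y ^ 2 ∂μHE[2]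
      ≤ 2 * d.intK (fun y => v y ^ 2) := by
    rw [DiscreteData.intK, ← integral_const_mul]
    refine setIntegral_mono_on ?_ (hv2.const_mul 2)
      (DiscreteData.measurableSet_elementSet A.surface) fun y hy => ?_
    · refine hv2.bdd_mul (c := 2) A.aemeasurable_absDetB.aestronglyMeasurable ?_
      filter_upwards [ae_restrict_mem (DiscreteData.measurableSet_elementSet A.surface)] with y hy
      have := A.absDetB_mem hy
      rw [Real.norm_of_nonneg (by linarith [this.1])]; exact this.2
    · exact mul_le_mul_of_nonneg_right (A.absDetB_mem hy).2 (sq_nonneg _)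
  rw [integral_const_mul, h1, setIntegral_const, hJ, Measure.real, Real.volume_Ioo,
    ENNReal.toReal_ofReal (by linarith), smul_eq_mul, mul_one] at h2
  refine h2.trans ?_
  nlinarith

lemma sum_volume_le {X : Finset E3 → ℝ} (hX : ∀ s, 0 ≤ X s) :
    4 * (h / M) ^ 3 * ∑ s ∈ d.finite_active.toFinset, X s
      ≤ ∑ s ∈ d.finite_active.toFinset, volume.real (openCell s) * X s := by
  rw [Finset.mul_sum]
  refine Finset.sum_le_sum fun s hs => mul_le_mul_of_nonneg_right ?_ (hX s)
  obtain ⟨z, hz⟩ := A.ball s (d.finite_active.mem_toFinset.1 hs).1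
  have hpos := div_pos A.h_pos A.M_pos
  have h1 := measureReal_mono (interior_maximal hz Metric.isOpen_ball) (measure_openCell_ne_top s)
  rw [volume_real_ball z hpos.le] at h1
  refine le_trans ?_ h1
  have := pow_pos hpos 3
  nlinarith [Real.pi_gt_three]

/-- On the ball provided by `exists_ball`, v differs from its value at the foot only by normal
derivatives along the connecting segment. Comparing the integral of v² there with that over the
shell bounds each cell gradient. Neighbouring gradients reappear on the right through n - n_h, but
with a relative factor of order (M⁷h)², and are absorbed. -/
theorem gradSum_le {v : E3 → ℝ} (hv : v ∈ d.space) :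
    h ^ 5 * d.gradSum v ≤ 2 ^ 57 * M ^ 19 * (h * d.intK (fun y => v y ^ 2)
      + h ^ 2 * d.intT (fun x => d.nderiv v x ^ 2)) := by
  have hM := A.tube.one_le
  have hM0 := A.M_pos
  have hh := A.h_pos
  set ρ := h / (256 * M ^ 3) with hρ
  have hρ0 : 0 < ρ := by positivity
  set V := d.intK (fun y => v y ^ 2) with hV
  set P := ∑ s ∈ d.finite_active.toFinset,
    inner ℝ (d.cellNormal s) (DiscreteData.cellGrad v s) ^ 2 with hP
  set G := d.gradSum v with hG
  have hG0 : 0 ≤ G := Finset.sum_nonneg fun _ _ => sq_nonneg _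
  have hP0 : 0 ≤ P := Finset.sum_nonneg fun _ _ => sq_nonneg _
  have hball := fun s (hs : s ∈ d.active) => A.exists_ball hs
  choose! c hc1 hc2 using hball
  set B : Finset E3 → Set E3 := fun s => Metric.ball (c s) ρ with hB
  set X : Finset E3 → ℝ := fun t => 2 * inner ℝ (d.cellNormal t) (DiscreteData.cellGrad v t) ^ 2
        + 50 * (M ^ 4 * h ^ 2) * ‖DiscreteData.cellGrad v t‖ ^ 2 with hX
  have hX0 : ∀ t, 0 ≤ X t := fun t => by positivity
  have hBt : ∀ s ∈ d.active, B s ⊆ S.tube δ := fun s hs => (hc1 s hs).trans (A.cell_subset hs)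
  -- the bound on one ball
  have hone : ∀ s ∈ d.active, ρ ^ 5 * ‖DiscreteData.cellGrad v s‖ ^ 2
      ≤ 80 * (∫ x in B s, v (d.foot S x) ^ 2) + 400 * (ρ ^ 3 * (h / M) ^ 2) * ∑ t ∈ d.near (M * h) s, X t := by
    intro s hs
    obtain ⟨k, hk⟩ := DiscreteData.cellGrad_spec hv hs
    have h1 := norm_sq_le_integral_ball (DiscreteData.cellGrad v s) (c s) k hρ0
    set Y := ∑ t ∈ d.near (M * h) s, X t with hY
    have hI := A.integrableOn_sq_foot hv (E := B s) Metric.isOpen_ball.measurableSet (hBt s hs)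
    have h2 : ∫ x in B s, (inner ℝ (DiscreteData.cellGrad v s) x + k) ^ 2
        ≤ ∫ x in B s, (2 * v (d.foot S x) ^ 2 + 2 * ((h / M) ^ 2 * Y)) := by
      refine setIntegral_mono_on ?_ ((hI.const_mul 2).add (integrableOn_const measure_ball_lt_top.ne))
        Metric.isOpen_ball.measurableSet fun x hx => ?_
      · have : Continuous fun x : E3 => (inner ℝ (DiscreteData.cellGrad v s) x + k) ^ 2 := by fun_prop
        exact (this.continuousOn.integrableOn_compact (isCompact_closedBall (c s) ρ)).mono_set
          Metric.ball_subset_closedBall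
      · obtain ⟨h3, h4⟩ := hc2 s hs x hx
        have h5 := A.sq_sub_foot_le hv hs (hc1 s hs hx) h3 h4
        rw [← hk x (hc1 s hs hx)]
        nlinarith [sq_nonneg (v x - 2 * v (d.foot S x))]
    rw [integral_add (hI.const_mul 2) (integrableOn_const measure_ball_lt_top.ne), setIntegral_const,
      integral_const_mul, volume_real_ball _ hρ0.le, smul_eq_mul] at h2
    have hY0 : 0 ≤ Y := Finset.sum_nonneg fun t _ => hX0 t
    have h6 : ρ ^ 3 * (Real.pi * 4 / 3) * (2 * ((h / M) ^ 2 * Y)) ≤ 10 * (ρ ^ 3 * (h / M) ^ 2) * Y := by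
      have h7 : 0 ≤ ρ ^ 3 * ((h / M) ^ 2 * Y) := by positivity
      nlinarith [Real.pi_lt_d2]
    linarith
  -- summation
  have hU : ∑ s ∈ d.finite_active.toFinset, ∫ x in B s, v (d.foot S x) ^ 2 ≤ 16 * h * V := by
    rw [← integral_biUnion_finset _ (fun s _ => Metric.isOpen_ball.measurableSet)]
    · refine (setIntegral_mono_set (A.integrableOn_sq_foot hv
        (S.measurable_sdist measurableSet_Ioo) (shell_subset_tube A.two_h_subset))
        (Eventually.of_forall fun x => sq_nonneg _)
        (LE.le.eventuallyLE (iUnion₂_subset fun s hs x hx => ?_))).trans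
        (A.integral_shell_sq_foot_le hv)
      have hs' := d.finite_active.mem_toFinset.1 hs
      have h3 := (hc2 s hs' x hx).1
      have h4 := A.dist_le _ (A.foot_mem (d := d) x)
      have h5 : h / M ≤ h := div_le_self hh.le hM
      have h6 : M * h ^ 2 < h := by
        have h7 := A.mul_le
        have h8 := A.delta_le
        have : M * h ^ 2 = M * h * h := by ring
        rw [this]
        nlinarith
      rw [DiscreteData.gap] at h3
      rw [abs_le] at h3 h4
      exact ⟨by linarith, by linarith⟩
    · intro s hs t ht hst
      have hs' := d.finite_active.mem_toFinset.1 hs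
      have ht' := d.finite_active.mem_toFinset.1 ht
      exact Set.disjoint_left.2 fun x hxs hxt => hst (d.mesh.eq_of_ball hs'.1 ht'.1
        (interior_maximal (hc1 s hs') Metric.isOpen_ball hxs)
        (interior_maximal (hc1 t ht') Metric.isOpen_ball hxt))
    · exact fun s hs => A.integrableOn_sq_foot hv Metric.isOpen_ball.measurableSet
        (hBt s (d.finite_active.mem_toFinset.1 hs))
  have hN := DiscreteData.sum_near_le (d := d) (fun t ht => A.card_near_le ht) hX0
  have hXs : ∑ t ∈ d.finite_active.toFinset, X t = 2 * P + 50 * (M ^ 4 * h ^ 2) * G := by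
    rw [hX, Finset.sum_add_distrib, ← Finset.mul_sum, ← Finset.mul_sum]; rfl
  have hsum := Finset.sum_le_sum fun s hs => hone s (d.finite_active.mem_toFinset.1 hs)
  rw [← Finset.mul_sum, Finset.sum_add_distrib, ← Finset.mul_sum, ← Finset.mul_sum] at hsum
  have hsum' : ρ ^ 5 * G ≤ 1280 * (h * V)
      + 25600 * (ρ ^ 3 * h ^ 2 * M ^ 4) * (2 * P + 50 * (M ^ 4 * h ^ 2) * G) := by
    have h3 : 0 ≤ 400 * (ρ ^ 3 * (h / M) ^ 2) := by positivity
    have h4 := mul_le_mul_of_nonneg_left hN h3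
    rw [hXs] at h4
    have h5 : 400 * (ρ ^ 3 * (h / M) ^ 2) * (64 * M ^ 6 * (2 * P + 50 * (M ^ 4 * h ^ 2) * G))
        = 25600 * (ρ ^ 3 * h ^ 2 * M ^ 4) * (2 * P + 50 * (M ^ 4 * h ^ 2) * G) := by
      field_simp; ring
    rw [h5] at h4
    have h6 : ρ ^ 5 * G ≤ _ := hsum
    linarith
  -- absorption
  have habs : 1280000 * (ρ ^ 3 * h ^ 4 * M ^ 8) ≤ ρ ^ 5 / 2 := by
    -- Since ρ = h/(256 M³), relative to ρ⁵ the coefficient of the reappearing gradients is a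
    -- constant times (M⁷h)².
    have e1 : ρ ^ 3 * h ^ 4 * M ^ 8 = ρ ^ 5 * (65536 * (M ^ 7 * h) ^ 2) := by
      rw [hρ]; field_simp; norm_num
    have h4 := A.pow_mul_le' (k := 7) (by norm_num)
    have h5 : M ^ 7 * h ≤ 1 / 1000000000 := by linarith [A.delta_le]
    have h6 : (M ^ 7 * h) ^ 2 ≤ (1 / 1000000000) ^ 2 := pow_le_pow_left₀ (by positivity) h5 2
    rw [e1]
    have h7 := (pow_pos hρ0 5).le
    have := mul_le_mul_of_nonneg_left h6 h7
    norm_num at this ⊢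
    linarith
  have habs' := mul_le_mul_of_nonneg_right habs hG0
  have hPT : ρ ^ 3 * P ≤ d.intT (fun x => d.nderiv v x ^ 2) := by
    have h4 := A.sum_volume_le (X := fun s => inner ℝ (d.cellNormal s) (DiscreteData.cellGrad v s) ^ 2)
      fun _ => sq_nonneg _
    have h5 := DiscreteData.intT_nderiv_mul A.surface hv hv
    simp only [← sq] at h5
    rw [h5]
    refine le_trans ?_ h4
    refine mul_le_mul_of_nonneg_right ?_ hP0
    have h6 : ρ ≤ h / M := by
      rw [hρ]; apply div_le_div_of_nonneg_left hh.le hM0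
      nlinarith [le_self_pow₀ hM (n := 3) (by norm_num)]
    have h7 := pow_le_pow_left₀ hρ0.le h6 3
    nlinarith [pow_pos hρ0 3]
  set T := d.intT (fun x => d.nderiv v x ^ 2) with hT
  have hfin : ρ ^ 5 * G ≤ 2560 * (h * V) + 102400 * (h ^ 2 * M ^ 4) * T := by
    have h4 := mul_le_mul_of_nonneg_left hPT (show 0 ≤ h ^ 2 * M ^ 4 by positivity)
    nlinarith
  have hV0 : 0 ≤ V := integral_nonneg fun _ => sq_nonneg _
  have hT0 : 0 ≤ T := integral_nonneg fun _ => sq_nonneg _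
  have e5 : h ^ 5 * G = 2 ^ 40 * M ^ 15 * (ρ ^ 5 * G) := by rw [hρ]; field_simp; norm_num
  rw [e5]
  have h8 := mul_le_mul_of_nonneg_left hfin (show 0 ≤ 2 ^ 40 * M ^ 15 by positivity)
  refine h8.trans ?_
  have h9 : M ^ 15 * (h * V) ≤ M ^ 19 * (h * V) :=
    mul_le_mul_of_nonneg_right (pow_le_pow_right₀ hM (by norm_num)) (by positivity)
  have h10 : 0 ≤ M ^ 19 * (h * V) := by positivity
  have h11 : 0 ≤ M ^ 19 * (h ^ 2 * T) := by positivity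
  have e6 : 2 ^ 40 * M ^ 15 * (2560 * (h * V) + 102400 * (h ^ 2 * M ^ 4) * T)
    = 2 ^ 40 * 2560 * (M ^ 15 * (h * V)) + 2 ^ 40 * 102400 * (M ^ 19 * (h ^ 2 * T)) := by ring
  have e7 : 2 ^ 57 * M ^ 19 * (h * V + h ^ 2 * T)
    = 2 ^ 57 * (M ^ 19 * (h * V)) + 2 ^ 57 * (M ^ 19 * (h ^ 2 * T)) := by ring
  rw [e6, e7]
  have f1 : (2 : ℝ) ^ 40 * 2560 * (M ^ 15 * (h * V)) ≤ 2 ^ 57 * (M ^ 19 * (h * V)) := by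
    nlinarith
  have f2 : (2 : ℝ) ^ 40 * 102400 * (M ^ 19 * (h ^ 2 * T)) ≤ 2 ^ 57 * (M ^ 19 * (h ^ 2 * T)) :=
    mul_le_mul_of_nonneg_right (by norm_num) h11
  linarith

end Approx
end SurfaceFEM
end

/-! ### The inverse estimate for the tangential gradient -/

noncomputable section
namespace SurfaceFEM
namespace Approx
variable {S : SmoothClosedSurface} {δ M h : ℝ} {d : DiscreteData} (A : Approx S δ M d h)
include A

/-- An area bound from volume: the fibres of length 4h over the part of Γ_h in s fill a set within a
ball of radius 5Mh, so h times the area is at most of order (Mh)³. -/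
lemma measure_elementSet_inter_le {s : Finset E3} (hs : s ∈ d.active) :
    μHE[2].real (d.elementSet ∩ closedCell s) ≤ 2 ^ 10 * M ^ 3 * h ^ 2 := by
  obtain ⟨z, hz, -⟩ := hs.2
  have hh := A.h_pos
  have hM := A.tube.one_le
  have hM0 := A.M_pos
  set J := Ioo (-(2 * h)) (2 * h) with hJ
  have hJδ := A.two_h_subset
  have hsm : MeasurableSet (S.sdist ⁻¹' J) := S.measurable_sdist measurableSet_Ioo
  have hst := shell_subset_tube (S := S) hJδ
  have hem := DiscreteData.measurableSet_elementSet A.surface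
  have hcm := (isClosed_closedCell s).measurableSet
  set I : E3 → ℝ := (closedCell s).indicator 1 with hI
  have hIm : Measurable I := measurable_one.indicator hcm
  have hI0 : ∀ x, 0 ≤ I x := fun x => indicator_nonneg (fun _ _ => zero_le_one) x
  have h1 := A.integral_shell_mul measurableSet_Ioo hJδ (G := fun x => I (d.foot S x))
    (a := I) (b := fun _ => 1)
    ((hIm.comp_aemeasurable ((A.continuousOn_foot.mono hst).aemeasurable hsm)).aestronglyMeasurable)
    (by
      intro y hy t ht
      rw [A.foot_fiber (DiscreteData.elementSet_subset A.surface hy) (abs_lt.2 (hJδ ht)), mul_one])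
  have h2 : ∫ x in S.sdist ⁻¹' J, S.jac x * I (d.foot S x)
      ≤ ∫ x in S.sdist ⁻¹' J, (Metric.ball z (5 * (M * h))).indicator (fun _ => (2 : ℝ)) x := by
    refine integral_mono_of_nonneg ?_ ?_ ?_
    · filter_upwards [ae_restrict_mem hsm] with x hx
      have := A.tube.jac_ge x (hst hx)
      exact mul_nonneg (by linarith) (hI0 _)
    · exact ((integrable_indicator_iff Metric.isOpen_ball.measurableSet).2
        (integrableOn_const measure_ball_lt_top.ne)).integrableOn
    · filter_upwards [ae_restrict_mem hsm] with x hx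
      by_cases hf : d.foot S x ∈ closedCell s
      · have hxb : x ∈ Metric.ball z (5 * (M * h)) := by
          have h3 := A.norm_sub_foot (hst hx)
          rw [← dist_eq_norm] at h3
          have h4 := A.diam_le s hs.1 _ hf z hz
          have h5 := A.abs_sdist_le (A.foot_mem (d := d) x)
          have h6 : |S.sdist x| < 2 * h := abs_lt.2 hx
          have h7 := abs_sub (S.sdist x) (S.sdist (d.foot S x))
          have h8 := A.h_le_mul
          have h9 := dist_triangle x (d.foot S x) z
          have h10 := mul_pos hM0 hh
          rw [DiscreteData.gap] at h3
          rw [Metric.mem_ball]; linarith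
        rw [indicator_of_mem hxb, hI, indicator_of_mem hf, Pi.one_apply, mul_one]
        exact A.tube.jac_le x (hst hx)
      · rw [hI, indicator_of_notMem hf, mul_zero]
        exact indicator_nonneg (fun _ _ => zero_le_two) x
  have h3 : ∫ x in S.sdist ⁻¹' J, (Metric.ball z (5 * (M * h))).indicator (fun _ => (2 : ℝ)) x
      ≤ 2 * ((5 * (M * h)) ^ 3 * (Real.pi * 4 / 3)) := by
    rw [← volume_real_ball z (by positivity : 0 ≤ 5 * (M * h))]
    have hint : Integrable ((Metric.ball z (5 * (M * h))).indicator (fun _ => (2 : ℝ))) :=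
      (integrable_indicator_iff Metric.isOpen_ball.measurableSet).2
        (integrableOn_const measure_ball_lt_top.ne)
    refine (setIntegral_le_integral hint
      (Eventually.of_forall fun x => indicator_nonneg (fun _ _ => zero_le_two) x)).trans ?_
    rw [integral_indicator Metric.isOpen_ball.measurableSet, setIntegral_const, smul_eq_mul, mul_comm]
  have hIint : IntegrableOn I d.elementSet μHE[2] := by
    refine Measure.integrableOn_of_bounded (M := 1)
      (DiscreteData.measure_elementSet_lt_top A.surface).ne hIm.aestronglyMeasurable
      (Eventually.of_forall fun x => ?_)
    rw [Real.norm_of_nonneg (hI0 x)]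
    exact indicator_le_self' (fun _ _ => zero_le_one) x
  have h4 : 1 / 2 * μHE[2].real (d.elementSet ∩ closedCell s)
      ≤ ∫ y in d.elementSet, S.absDetB (d.normal y) y * I y ∂μHE[2] := by
    have h5 : μHE[2].real (d.elementSet ∩ closedCell s) = ∫ y in d.elementSet, I y ∂μHE[2] := by
      rw [hI, integral_indicator_one hcm, measureReal_restrict_apply hcm, inter_comm]
    rw [h5, ← integral_const_mul]
    refine setIntegral_mono_on (hIint.const_mul _) ?_ hem fun y hy =>
      mul_le_mul_of_nonneg_right (A.absDetB_mem hy).1 (hI0 y)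
    refine hIint.bdd_mul (c := 2) A.aemeasurable_absDetB.aestronglyMeasurable ?_
    filter_upwards [ae_restrict_mem hem] with y hy
    have := A.absDetB_mem hy
    rw [Real.norm_of_nonneg (by linarith [this.1])]; exact this.2
  rw [h1, setIntegral_const, hJ, Measure.real, Real.volume_Ioo,
    ENNReal.toReal_ofReal (by linarith), smul_eq_mul, mul_one] at h2
  have h5 := h2.trans h3
  set m := μHE[2].real (d.elementSet ∩ closedCell s)
  set q := ∫ y in d.elementSet, S.absDetB (d.normal y) y * I y ∂μHE[2]
  have h6 : 2 * h * m ≤ 2 * h * (2 ^ 10 * M ^ 3 * h ^ 2) := by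
    have h7 : 2 * h * m ≤ q * (2 * h - -(2 * h)) := by nlinarith
    refine h7.trans (h5.trans ?_)
    have h8 : 0 ≤ M ^ 3 * h ^ 3 := by positivity
    nlinarith [Real.pi_lt_four]
  exact le_of_mul_le_mul_left h6 (by positivity)

/-- The tangential gradient is controlled by the function and its normal derivative. -/
theorem intK_tgrad_le {v : E3 → ℝ} (hv : v ∈ d.space) :
    h ^ 2 * d.intK (fun y => ‖d.tgrad v y‖ ^ 2) ≤ 2 ^ 67 * M ^ 22 *
      (d.intK (fun y => v y ^ 2) + h * d.intT (fun x => d.nderiv v x ^ 2)) := by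
  have hh := A.h_pos
  have hM0 := A.M_pos
  have hem := DiscreteData.measurableSet_elementSet A.surface
  -- An element may be a face belonging to several closed cells; summing over all closed cells that
  -- contain a point avoids assigning it to one of them.
  set I : Finset E3 → E3 → ℝ := fun s => (closedCell s).indicator
    (fun _ => ‖DiscreteData.cellGrad v s‖ ^ 2) with hI
  have hI0 : ∀ s x, 0 ≤ I s x := fun s x => indicator_nonneg (fun _ _ => sq_nonneg _) x
  have hIint : ∀ s, IntegrableOn (I s) d.elementSet μHE[2] := fun s => by
    have : IntegrableOn (fun _ : E3 => ‖DiscreteData.cellGrad v s‖ ^ 2) d.elementSet μHE[2] :=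
      integrableOn_const (DiscreteData.measure_elementSet_lt_top A.surface).ne
    exact Integrable.indicator this (isClosed_closedCell s).measurableSet
  have h1 : d.intK (fun y => ‖d.tgrad v y‖ ^ 2)
      ≤ ∫ y in d.elementSet, ∑ s ∈ d.finite_active.toFinset, I s y ∂μHE[2] := by
    refine setIntegral_mono_on
      (((DiscreteData.piecewiseCont_tgrad A.surface hv).norm.pow 2).integrableOn A.surface)
      (integrable_finsetSum _ fun s _ => hIint s) hem ?_
    rintro y ⟨K, hK, hy⟩
    obtain ⟨m, s, hE⟩ := DiscreteData.exists_elem A.surface hK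
    obtain ⟨c, hc⟩ := DiscreteData.cellGrad_spec hv hE.mem
    have h2 : ‖d.tgrad v y‖ ^ 2 ≤ I s y := by
      rw [hE.tgrad_eq hc hy, hI]
      simp only
      rw [indicator_of_mem (hE.cell hy)]
      exact pow_le_pow_left₀ (norm_nonneg _) (norm_tangentProj_le hE.norm_eq _) 2
    exact h2.trans (Finset.single_le_sum (f := fun s => I s y) (fun s _ => hI0 s y)
      (d.finite_active.mem_toFinset.2 hE.mem))
  rw [integral_finsetSum _ fun s _ => hIint s] at h1
  have h2 : ∑ s ∈ d.finite_active.toFinset, ∫ y in d.elementSet, I s y ∂μHE[2]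
      ≤ 2 ^ 10 * M ^ 3 * h ^ 2 * d.gradSum v := by
    rw [DiscreteData.gradSum, Finset.mul_sum]
    refine Finset.sum_le_sum fun s hs => ?_
    rw [hI]
    simp only
    rw [integral_indicator (isClosed_closedCell s).measurableSet,
      Measure.restrict_restrict (isClosed_closedCell s).measurableSet, setIntegral_const, smul_eq_mul,
      inter_comm]
    exact mul_le_mul_of_nonneg_right
      (A.measure_elementSet_inter_le (d.finite_active.mem_toFinset.1 hs)) (sq_nonneg _)
  have h3 := A.gradSum_le hv
  set V := d.intK (fun y => v y ^ 2)
  set T := d.intT (fun x => d.nderiv v x ^ 2)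
  set Q := d.intK (fun y => ‖d.tgrad v y‖ ^ 2)
  set G := d.gradSum v
  have h4 : h ^ 3 * Q ≤ 2 ^ 10 * M ^ 3 * (h ^ 5 * G) := by
    have := mul_le_mul_of_nonneg_left (h1.trans h2) (pow_pos hh 3).le
    calc h ^ 3 * Q ≤ h ^ 3 * (2 ^ 10 * M ^ 3 * h ^ 2 * G) := this
      _ = _ := by ring
  have h5 := mul_le_mul_of_nonneg_left h3 (show 0 ≤ 2 ^ 10 * M ^ 3 by positivity)
  refine le_of_mul_le_mul_left (a := h) ?_ hh
  calc h * (h ^ 2 * Q) = h ^ 3 * Q := by ring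
    _ ≤ _ := h4.trans h5
    _ = _ := by ring

end Approx
end SurfaceFEM
end

noncomputable section
namespace SurfaceFEM

/-! ### Transport along the extended coefficient field -/

/-- The divergence of a vector field. -/
def divergence (Y : E3 → E3) (x : E3) : ℝ := LinearMap.trace ℝ E3 (fderiv ℝ Y x : E3 →ₗ[ℝ] E3)

lemma divergence_eq_sum (Y : E3 → E3) (x : E3) : divergence Y x
    = ∑ i, inner ℝ (EuclideanSpace.basisFun (Fin 3) ℝ i)
      (fderiv ℝ Y x (EuclideanSpace.basisFun (Fin 3) ℝ i)) := by
  rw [divergence, LinearMap.trace_eq_sum_inner _ (EuclideanSpace.basisFun (Fin 3) ℝ)]; rfl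

/-- Only f being Lipschitz is needed, by Rademacher's theorem, so kinks of f across cell interfaces
cause no extra terms. The identity is assembled from integration by parts in the coordinate
directions. -/
lemma integral_divergence_mul {Y : E3 → E3} (hY : ContDiff ℝ 1 Y) (hYc : HasCompactSupport Y)
    {f : E3 → ℝ} {C : NNReal} (hf : LipschitzWith C f) (hfc : HasCompactSupport f) :
    Integrable (fun x => fderiv ℝ f x (Y x)) ∧ Integrable (fun x => divergence Y x * f x) ∧
    ∫ x, fderiv ℝ f x (Y x) = - ∫ x, divergence Y x * f x := by
  set b := EuclideanSpace.basisFun (Fin 3) ℝ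
  set Z : Fin 3 → E3 → ℝ := fun i x => inner ℝ (b i) (Y x) with hZ
  have hZc : ∀ i, ContDiff ℝ 1 (Z i) := fun i => contDiff_const.inner ℝ hY
  have hZs : ∀ i, HasCompactSupport (Z i) := fun i =>
    hYc.mono' fun x hx => subset_tsupport _ fun h => hx (by simp [hZ, h])
  have hZd : ∀ i x w, fderiv ℝ (Z i) x w = inner ℝ (b i) (fderiv ℝ Y x w) := by
    intro i x w
    have h1 : HasFDerivAt (Z i) ((innerSL ℝ (b i)).comp (fderiv ℝ Y x)) x :=
      (innerSL ℝ (b i)).hasFDerivAt.comp x (hY.differentiable (by norm_num) x).hasFDerivAt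
    rw [h1.fderiv]; rfl
  have hdiff := hf.ae_differentiableAt (μ := volume)
  have hdivc : Continuous (divergence Y) := by
    have h1 : divergence Y = fun x => ∑ i, inner ℝ (b i) (fderiv ℝ Y x (b i)) :=
      funext fun x => divergence_eq_sum Y x
    rw [h1]
    have := hY.continuous_fderiv (by norm_num)
    fun_prop
  have hint2 : Integrable (fun x => divergence Y x * f x) :=
    (hdivc.mul hf.continuous).integrable_of_hasCompactSupport hfc.mul_left
  have hlip : ∀ i, ∃ D, LipschitzWith D (Z i) := fun i =>
    ContDiff.lipschitzWith_of_hasCompactSupport (hZs i) (hZc i) (by norm_num)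
  have hI : ∀ i, Integrable (fun x => fderiv ℝ f x (b i) * Z i x) := by
    intro i
    have h1 : Integrable (Z i) := (hZc i).continuous.integrable_of_hasCompactSupport (hZs i)
    refine h1.bdd_mul (c := C * ‖b i‖) (measurable_fderiv_apply_const ℝ f (b i)).aestronglyMeasurable
      (Eventually.of_forall fun x => ?_)
    exact ((fderiv ℝ f x).le_opNorm _).trans
      (mul_le_mul_of_nonneg_right (norm_fderiv_le_of_lipschitz ℝ hf) (norm_nonneg _))
  have hsum : ∀ x, fderiv ℝ f x (Y x) = ∑ i, fderiv ℝ f x (b i) * Z i x := by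
    intro x
    nth_rewrite 1 [← b.sum_repr' (Y x)]
    rw [map_sum]
    refine Finset.sum_congr rfl fun i _ => ?_
    rw [map_smul, smul_eq_mul, mul_comm]
  have hint1 : Integrable (fun x => fderiv ℝ f x (Y x)) := by
    simp only [hsum]; exact integrable_finsetSum _ fun i _ => hI i
  refine ⟨hint1, hint2, ?_⟩
  have key : ∀ i, ∫ x, fderiv ℝ f x (b i) * Z i x = - ∫ x, fderiv ℝ (Z i) x (b i) * f x := by
    intro i
    obtain ⟨D, hD⟩ := hlip i
    have h1 := hD.integral_lineDeriv_mul_eq (μ := volume) hf hfc (b i)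
    have h2 : ∫ x, lineDeriv ℝ (Z i) x (b i) * f x = ∫ x, fderiv ℝ (Z i) x (b i) * f x := by
      refine integral_congr_ae (Eventually.of_forall fun x => ?_)
      simp only
      rw [((hZc i).differentiable (by norm_num) x).lineDeriv_eq_fderiv]
    have h3 : ∫ x, lineDeriv ℝ f x (-(b i)) * Z i x = - ∫ x, fderiv ℝ f x (b i) * Z i x := by
      rw [← integral_neg]
      refine integral_congr_ae ?_
      filter_upwards [hdiff] with x hx
      rw [hx.lineDeriv_eq_fderiv, map_neg, neg_mul]
    rw [h2, h3] at h1
    rw [h1, neg_neg]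
  simp only [hsum]
  rw [integral_finsetSum _ fun i _ => hI i, Finset.sum_congr rfl fun i _ => key i,
    Finset.sum_neg_distrib, ← integral_finsetSum]
  · congr 1
    refine integral_congr_ae (Eventually.of_forall fun x => ?_)
    simp only [divergence_eq_sum, Finset.sum_mul, hZd]; rfl
  · intro i _
    have h1 : Continuous fun x => fderiv ℝ (Z i) x (b i) :=
      ((hZc i).continuous_fderiv (by norm_num)).clm_apply continuous_const
    exact (h1.mul hf.continuous).integrable_of_hasCompactSupport hfc.mul_left

namespace SmoothClosedSurface
variable {S : SmoothClosedSurface} {δ δ₀ : ℝ} {α : E3 → ℝ} {β : E3 → E3}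

/-- A vector field which extends the coefficient `β` such that its flow preserves the layers and
commutes with the closest point map. -/
structure TransportField (S : SmoothClosedSurface) (δ α₀ : ℝ) (α : E3 → ℝ) (β : E3 → E3) (Y : E3 → E3) :
    Prop where
  contDiff : ContDiff ℝ 1 Y
  compact : HasCompactSupport Y
  eq : ∀ x ∈ S.tube δ,
    Y x = S.jac x • (β (S.proj x) + S.sdist x • S.curv (S.proj x) (β (S.proj x)))
  div_le : ∀ x ∈ S.tube δ, divergence Y x ≤ S.jac x * (2 * α (S.proj x) - α₀)

lemma TransportField.mono {δ' α₀ : ℝ} {Y : E3 → E3} (h : S.TransportField δ α₀ α β Y) (hδ : δ' ≤ δ) :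
    S.TransportField δ' α₀ α β Y where
  contDiff := h.contDiff
  compact := h.compact
  eq x hx := h.eq x (S.tube_mono hδ hx)
  div_le x hx := h.div_le x (S.tube_mono hδ hx)

/-- Besides D(β∘p), the derivative of Y on Γ has the terms κβ ⊗ n and β ⊗ ∇jac. Their traces vanish,
as κβ is orthogonal to n and `jac` is constant on Γ, to which β is tangent. The normal correction in
`surfDiv` vanishes too, β∘p being constant along normals. -/
lemma TubeReg.divergence_field (hT : S.TubeReg δ) (hβ : ∀ x ∈ S.tube δ, ContDiffAt ℝ 1 (β ∘ S.proj) x)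
    (htan : ∀ x ∈ S.surf, inner ℝ (S.normal x) (β x) = 0) {Y : E3 → E3} {y : E3} (hy : y ∈ S.surf)
    (hY : Y =ᶠ[𝓝 y] fun x =>
      S.jac x • ((β ∘ S.proj) x + S.sdist x • (S.curv ∘ S.proj) x ((β ∘ S.proj) x))) :
    divergence Y y = S.surfDiv β y := by
  have hyt : y ∈ S.tube δ := S.surf_subset_tube hT.pos hy
  have hpy : S.proj y = y := S.proj_of_mem hy
  have hsy : S.sdist y = 0 := S.sdist_of_mem hy
  have hb := ((hβ y hyt).differentiableAt (by norm_num)).hasFDerivAt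
  have hjac := ((hT.contDiffAt_jac hyt).differentiableAt (by norm_num)).hasFDerivAt
  have hk : DifferentiableAt ℝ (fun x => (S.curv ∘ S.proj) x ((β ∘ S.proj) x)) y := by
    have h1 : DifferentiableAt ℝ (S.curv ∘ S.proj) y :=
      DifferentiableAt.comp y ((hT.contDiffAt_curv (hT.proj_mem_tube y)).differentiableAt (by norm_num))
        (hT.differentiableAt_proj hyt)
    exact h1.clm_apply hb.differentiableAt
  have hρ := (hT.differentiableAt_sdist hyt).hasFDerivAt
  have hd := hjac.smul (hb.add (hρ.smul hk.hasFDerivAt))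
  have hd' : fderiv ℝ Y y = _ := hY.fderiv_eq.trans hd.fderiv
  have hj1 : S.jac y = 1 := jac_of_mem hy
  -- the derivative of the Jacobian in tangential directions vanishes
  have hjt : fderiv ℝ S.jac y (β y) = 0 := by
    have e1 : (S.jac ∘ S.proj) =ᶠ[𝓝 y] fun _ => (1 : ℝ) := Eventually.of_forall fun x =>
      jac_of_mem (S.proj_mem_surf x)
    have e2 : HasFDerivAt (S.jac ∘ S.proj) _ y :=
      HasFDerivAt.comp y (by rw [hpy]; exact hjac) (hT.differentiableAt_proj hyt).hasFDerivAt
    have e3 := (e2.congr_of_eventuallyEq e1.symm).unique (hasFDerivAt_const (1 : ℝ) y)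
    have e4 := congrArg (fun L => L (β y)) e3
    simp only [ContinuousLinearMap.comp_apply, zero_apply] at e4
    rwa [hT.fderiv_proj hyt, htan y hy, hsy, zero_smul, zero_smul, sub_zero, sub_zero] at e4
  -- the extension of `β` is constant in the normal direction
  have hbn : fderiv ℝ (β ∘ S.proj) y (S.normal y) = 0 := by
    have h1 : HasDerivAt (fun t : ℝ => y + t • S.normal y) (S.normal y) 0 := by
      have := ((hasDerivAt_id (0 : ℝ)).smul_const (S.normal y)).const_add y
      rwa [one_smul] at this
    have h2 : HasDerivAt ((β ∘ S.proj) ∘ fun t : ℝ => y + t • S.normal y)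
        (fderiv ℝ (β ∘ S.proj) y (S.normal y)) 0 := by
      refine HasFDerivAt.comp_hasDerivAt 0 ?_ h1
      rw [zero_smul, add_zero]; exact hb
    have h3 : ((β ∘ S.proj) ∘ fun t : ℝ => y + t • S.normal y) =ᶠ[𝓝 0] fun _ => β y := by
      have : ∀ᶠ t in 𝓝 (0 : ℝ), |t| < δ := by
        have := Metric.ball_mem_nhds (0 : ℝ) hT.pos
        filter_upwards [this] with t ht
        simpa using ht
      filter_upwards [this] with t ht
      simp only [Function.comp_apply]
      rw [hT.proj_add y hy t ht]
    exact (h2.congr_of_eventuallyEq h3.symm).unique (hasDerivAt_const 0 (β y))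
  have happ : ∀ w, fderiv ℝ Y y w = fderiv ℝ (β ∘ S.proj) y w
      + inner ℝ (S.normal y) w • S.curv y (β y) + fderiv ℝ S.jac y w • β y := by
    intro w
    rw [hd']
    simp only [add_apply, ContinuousLinearMap.smulRight_apply, Function.comp_apply, hpy,
      hsy, hj1, zero_smul, one_smul, add_zero, zero_add, Pi.add_apply, Pi.smul_apply', TubeReg.fderiv_sdist_apply]
  rw [divergence_eq_sum, surfDiv, hbn, inner_zero_right, sub_zero,
    LinearMap.trace_eq_sum_inner _ (EuclideanSpace.basisFun (Fin 3) ℝ)]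
  simp only [happ, inner_add_right, inner_smul_right, Finset.sum_add_distrib]
  set b := EuclideanSpace.basisFun (Fin 3) ℝ
  have s1 : ∑ i, inner ℝ (S.normal y) (b i) * inner ℝ (b i) (S.curv y (β y)) = 0 := by
    rw [b.sum_inner_mul_inner, hT.inner_normal_curv hyt]
  have s2 : ∑ i, fderiv ℝ S.jac y (b i) * inner ℝ (b i) (β y) = 0 := by
    rw [← hjt]
    nth_rewrite 2 [← b.sum_repr' (β y)]
    rw [map_sum]
    refine Finset.sum_congr rfl fun i _ => ?_
    rw [map_smul, smul_eq_mul, mul_comm]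
  rw [s1, s2, add_zero, add_zero]
  rfl

/-- On Γ the Jacobian is 1 and div Y = div_Γ β ≤ 2α - 2α₀ < 2α - α₀; continuity carries the strict
inequality to a thin tube. The cutoff in ρ serves only to make Y globally C¹ with compact support,
and equals 1 on that tube. -/
theorem exists_transportField (hT : S.TubeReg δ) (hδ : δ ≤ δ₀) (hc : IsCoefficients S δ₀ α β) :
    ∃ δ' α₀ : ℝ, ∃ Y, 0 < δ' ∧ δ' ≤ δ ∧ 0 < α₀ ∧ S.TransportField δ' α₀ α β Y := by
  obtain ⟨α₀, hα₀, hco⟩ := hc.coercive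
  have hβ : ∀ x ∈ S.tube δ, ContDiffAt ℝ 1 (β ∘ S.proj) x := fun x hx =>
    ((hc.smooth_β.contDiffAt ((S.isOpen_tube δ₀).mem_nhds (S.tube_mono hδ hx)))).of_le
      (by exact_mod_cast le_top)
  have hαc : ContinuousOn (α ∘ S.proj) (S.tube δ) := hc.smooth_α.continuousOn.mono (S.tube_mono hδ)
  let θ : ContDiffBump (0 : ℝ) := ⟨δ / 3, 2 * δ / 3, by linarith [hT.pos], by linarith [hT.pos]⟩
  set X : E3 → E3 := fun x =>
    S.jac x • ((β ∘ S.proj) x + S.sdist x • (S.curv ∘ S.proj) x ((β ∘ S.proj) x)) with hX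
  set Y : E3 → E3 := fun x => θ (S.sdist x) • X x with hY
  have hXc : ∀ x ∈ S.tube δ, ContDiffAt ℝ 1 X x := by
    intro x hx
    have h1 : ContDiffAt ℝ 1 (S.curv ∘ S.proj) x :=
      ((hT.contDiffAt_curv (hT.proj_mem_tube x)).of_le (by norm_num)).comp x
        ((hT.contDiffAt_proj hx).of_le (by norm_num))
    exact ((hT.contDiffAt_jac hx).of_le (by norm_num)).smul
      ((hβ x hx).add (((hT.smooth x hx).of_le (by norm_num)).smul (h1.clm_apply (hβ x hx))))
  have hYc : ContDiff ℝ 1 Y := by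
    rw [contDiff_iff_contDiffAt]
    intro x
    by_cases hx : x ∈ S.tube δ
    · exact (θ.contDiff.contDiffAt.comp x ((hT.smooth x hx).of_le (by norm_num))).smul (hXc x hx)
    · have hx' : 2 * δ / 3 < |S.sdist x| := by
        have : ¬ |S.sdist x| < δ := hx
        linarith [hT.pos]
      have hev : Y =ᶠ[𝓝 x] fun _ => 0 := by
        filter_upwards [(continuous_abs.comp S.continuous_sdist).continuousAt.eventually_const_lt hx']
          with z hz
        have : θ (S.sdist z) = 0 := by
          apply θ.zero_of_le_dist
          rw [Real.dist_eq, sub_zero]; exact hz.le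
        rw [hY]; simp only; rw [this, zero_smul]
      exact contDiffAt_const.congr_of_eventuallyEq hev
  have hYs : HasCompactSupport Y := by
    refine HasCompactSupport.intro (S.isCompact_closedTube (2 * δ / 3)) fun x hx => ?_
    have : θ (S.sdist x) = 0 := by
      apply θ.zero_of_le_dist
      rw [Real.dist_eq, sub_zero]; exact (not_le.1 hx).le
    rw [hY]; simp only; rw [this, zero_smul]
  have hYX : ∀ x ∈ S.tube (δ / 3), Y x = X x := by
    intro x hx
    have : θ (S.sdist x) = 1 := by
      apply θ.one_of_mem_closedBall
      rw [Metric.mem_closedBall, Real.dist_eq, sub_zero]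
      exact (show |S.sdist x| < δ / 3 from hx).le
    rw [hY]; simp only; rw [this, one_smul]
  have h3 : 0 < δ / 3 := by linarith [hT.pos]
  set q : E3 → ℝ := fun x => S.jac x * (2 * (α ∘ S.proj) x - α₀) - divergence Y x with hq
  have hqc : ContinuousOn q (S.tube δ) := by
    have hj : ContinuousOn S.jac (S.tube δ) := fun x hx =>
      (hT.contDiffAt_jac hx).continuousAt.continuousWithinAt
    have hd : Continuous (divergence Y) := by
      have h1 : divergence Y = fun x => ∑ i, inner ℝ (EuclideanSpace.basisFun (Fin 3) ℝ i)
          (fderiv ℝ Y x (EuclideanSpace.basisFun (Fin 3) ℝ i)) := funext fun x => divergence_eq_sum Y x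
      rw [h1]
      have := hYc.continuous_fderiv (by norm_num)
      fun_prop
    exact (hj.mul ((hαc.const_smul (2 : ℝ)).sub continuousOn_const)).sub hd.continuousOn
  have hqo : IsOpen (S.tube δ ∩ q ⁻¹' Ioi 0) := hqc.isOpen_inter_preimage (S.isOpen_tube δ) isOpen_Ioi
  have hqs : S.surf ⊆ S.tube δ ∩ q ⁻¹' Ioi 0 := by
    intro y hy
    refine ⟨S.surf_subset_tube hT.pos hy, ?_⟩
    have hpy : S.proj y = y := S.proj_of_mem hy
    have hsy : S.sdist y = 0 := S.sdist_of_mem hy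
    have hj1 : S.jac y = 1 := jac_of_mem hy
    have h1 : divergence Y y = S.surfDiv β y := hT.divergence_field hβ hc.tangential hy (by
      filter_upwards [(S.isOpen_tube _).mem_nhds (S.surf_subset_tube h3 hy)] with x hx using hYX x hx)
    have h2 := hco y hy
    change 0 < q y
    simp only [hq, Function.comp_apply, hpy, hj1, h1]
    linarith
  obtain ⟨δ', hδ', hsub⟩ := S.exists_tube_subset hqo hqs
  refine ⟨min δ' (δ / 3), α₀, Y, lt_min hδ' h3, (min_le_right _ _).trans (by linarith), hα₀, hYc, hYs,
    fun x hx => hYX x (S.tube_mono (min_le_right _ _) hx), fun x hx => ?_⟩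
  have : 0 < q x := (hsub (S.tube_mono (min_le_left _ _) hx)).2
  simp only [hq, Function.comp_apply] at this
  linarith

end SmoothClosedSurface
end SurfaceFEM
end

noncomputable section
namespace SurfaceFEM

/-! ### Integration by parts on the discrete surface -/

lemma SmoothClosedSurface.TubeBound.norm_proj_sub_le {S : SmoothClosedSurface} {δ M : ℝ}
    (hT : S.TubeBound δ M) (hδ : δ ≤ 1) {x y : E3} (hx : x ∈ S.tube δ) (hy : y ∈ S.tube δ) :
    ‖S.proj x - S.proj y‖ ≤ (2 + M) * ‖x - y‖ := by
  have e : S.proj x - S.proj y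
      = (x - y) - ((S.sdist x - S.sdist y) • S.normal x + S.sdist y • (S.normal x - S.normal y)) := by
    rw [hT.proj_eq _ hx, hT.proj_eq _ hy]; module
  have h1 := S.abs_sdist_sub_le x y
  rw [dist_eq_norm] at h1
  have h2 := hT.normal_lip x hx y hy
  have h3 : |S.sdist y| ≤ 1 := (show |S.sdist y| < δ from hy).le.trans hδ
  have h4 := mul_le_mul h3 h2 (norm_nonneg _) zero_le_one
  rw [e]
  refine (norm_sub_le _ _).trans ?_
  have h5 := norm_add_le ((S.sdist x - S.sdist y) • S.normal x) (S.sdist y • (S.normal x - S.normal y))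
  rw [norm_smul, norm_smul, hT.norm_normal x hx, mul_one, Real.norm_eq_abs, Real.norm_eq_abs] at h5
  linarith

/-- The lift of the vector field `β` to the tangent planes of the discrete surface. -/
def DiscreteData.lift (d : DiscreteData) (S : SmoothClosedSurface) (β : E3 → E3) (y : E3) : E3 :=
  Classical.epsilon fun w => S.fullB (d.normal y) y w = β (S.proj y)

namespace Approx
variable {S : SmoothClosedSurface} {δ M h : ℝ} {d : DiscreteData} (A : Approx S δ M d h)
include A

lemma half_norm_le_fullB {y : E3} (hy : y ∈ d.elementSet) (w : E3) :
    1 / 2 * ‖w‖ ≤ ‖S.fullB (d.normal y) y w‖ := by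
  have h1 := A.norm_fullB_sub_le hy w
  have h2 := norm_sub_le_norm_sub_add_norm_sub w (S.fullB (d.normal y) y w) 0
  rw [sub_zero, sub_zero, norm_sub_rev] at h2
  have hMh := A.mul_le
  have hδ := A.delta_le
  nlinarith [norm_nonneg w]

lemma fullB_lift {y : E3} (hy : y ∈ d.elementSet) (β : E3 → E3) :
    S.fullB (d.normal y) y (d.lift S β y) = β (S.proj y) := by
  have hinj : Function.Injective (S.fullB (d.normal y) y : E3 →ₗ[ℝ] E3) := by
    rw [injective_iff_map_eq_zero]
    intro x hx
    have := A.half_norm_le_fullB hy x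
    rw [show S.fullB (d.normal y) y x = 0 from hx, norm_zero] at this
    rw [← norm_eq_zero]
    linarith [norm_nonneg x]
  exact Classical.epsilon_spec (LinearMap.injective_iff_surjective.1 hinj (β (S.proj y)))

/-- Pairing the defining equation with n leaves only m·w, since both β∘p and the range of B are
orthogonal to n. -/
lemma inner_lift {y : E3} (hy : y ∈ d.elementSet) {β : E3 → E3}
    (hβ : ∀ x ∈ S.surf, inner ℝ (S.normal x) (β x) = 0) :
    inner ℝ (d.normal y) (d.lift S β y) = 0 := by
  have hyt := A.elementSet_subset_tube hy
  have h1 := congrArg (inner ℝ (S.normal y)) (A.fullB_lift hy β)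
  rw [← A.tube.normal_proj y hyt, hβ _ (S.proj_mem_surf y), A.tube.normal_proj y hyt,
    SmoothClosedSurface.fullB_apply, inner_add_right, inner_smul_right, real_inner_self_eq_norm_sq,
    A.tube.norm_normal y hyt] at h1
  have h2 : inner ℝ (S.normal y) (S.mapB (d.normal y) y (d.lift S β y)) = 0 :=
    inner_tangentProj (A.tube.norm_normal y hyt) _
  rw [h2] at h1
  linarith

/-- On the plane of the element p deviates from the identity by at most half the distance, so its
inverse there is 2-Lipschitz. -/
lemma norm_sub_le_norm_proj_sub {K : Set E3} (hK : K ∈ d.elements) {a b : E3} (ha : a ∈ closure K)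
    (hb : b ∈ closure K) : ‖a - b‖ ≤ 2 * ‖S.proj a - S.proj b‖ := by
  have hne : K.Nonempty := closure_nonempty_iff.1 ⟨_, ha⟩
  obtain ⟨C, m, c, hP⟩ := A.exists_piece hK hne
  obtain ⟨x₀, hx₀⟩ := hne
  have hKC := closure_minimal hP.sub hP.closed
  have hn := A.normal_le x₀ ⟨K, hK, hx₀⟩
  rw [hP.normal x₀ hx₀] at hn
  have hMh := mul_pos A.M_pos A.h_pos
  have hd : ∀ q ∈ C, dist q x₀ ≤ 2 * (M * h) := fun q hq => by
    have := A.diam_le c hP.mem.1 q (hP.cell hq) x₀ (hP.cell (hP.sub hx₀))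
    linarith
  have h2 := A.norm_proj_sub_le (hP.surf hx₀) hn (hd a (hKC ha)) (hd b (hKC hb))
    (hP.planar a (hKC ha) b (hKC hb))
  have h3 := norm_sub_le_norm_sub_add_norm_sub (a - b) (S.proj a - S.proj b) 0
  rw [sub_zero, sub_zero, norm_sub_rev (a - b)] at h3
  linarith

/-- As long as the feet stay in one closed element, the foot is Lipschitz and v affine. A segment
splits into finitely many closed parts of this kind, and since v is single valued on their overlaps
the bounds add up along it. The constant may depend on v and the mesh, because only the Lipschitz
property is used later. -/
lemma exists_lipschitz_comp_foot {v : E3 → ℝ} (hv : v ∈ d.space) : ∃ L : ℝ, 0 ≤ L ∧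
    ∀ z r, Metric.ball z r ⊆ S.tube δ → ∀ x ∈ Metric.ball z r, ∀ y ∈ Metric.ball z r,
      |v (d.foot S x) - v (d.foot S y)| ≤ L * ‖x - y‖ := by
  set G := ∑ s ∈ d.finite_active.toFinset, ‖DiscreteData.cellGrad v s‖ with hG
  have hG0 : 0 ≤ G := Finset.sum_nonneg fun _ _ => norm_nonneg _
  have hM0 := A.M_pos
  refine ⟨2 * G * (2 + M), by positivity, fun z r hr x hx y hy => ?_⟩
  set γ : ℝ → E3 := fun s => y + s • (x - y) with hγ
  have hγb : ∀ s ∈ Icc (0 : ℝ) 1, γ s ∈ S.tube δ := fun s hs =>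
    hr ((convex_ball z r).add_smul_sub_mem hy hx hs)
  have hγc : Continuous γ := by fun_prop
  have hfc : ContinuousOn (fun s => d.foot S (γ s)) (Icc 0 1) :=
    A.continuousOn_foot.comp hγc.continuousOn hγb
  have h1 := abs_sub_le_of_closed_cover (φ := fun s => v (d.foot S (γ s))) (L := 2 * G * (2 + M) * ‖x - y‖)
    d.finite_elements.toFinset (fun K => Icc 0 1 ∩ (fun s => d.foot S (γ s)) ⁻¹' closure K)
    (fun K _ => hfc.preimage_isClosed_of_isClosed isClosed_Icc isClosed_closure)
    (by
      intro s hs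
      obtain ⟨K, hK, hsK⟩ := mem_iUnion₂.1 (A.surface.covered (A.foot_mem (γ s)))
      exact mem_iUnion₂.2 ⟨K, d.finite_elements.mem_toFinset.2 hK, hs, hsK⟩)
    (by
      rintro K hK s ⟨⟨hs, hsK⟩, -⟩ t ⟨⟨ht, htK⟩, -⟩
      have hK := d.finite_elements.mem_toFinset.1 hK
      simp only [mem_preimage] at hsK htK
      have hne : K.Nonempty := closure_nonempty_iff.1 ⟨_, hsK⟩
      obtain ⟨C, m, c, hP⟩ := A.exists_piece hK hne
      have hKC := closure_minimal hP.sub hP.closed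
      set a := d.foot S (γ s)
      set b := d.foot S (γ t)
      have h3 := A.norm_sub_le_norm_proj_sub hK hsK htK
      have h4 : ‖S.proj a - S.proj b‖ ≤ (2 + M) * (|s - t| * ‖x - y‖) := by
        rw [A.proj_foot, A.proj_foot]
        refine (A.tube.norm_proj_sub_le A.delta_le (hγb s hs) (hγb t ht)).trans (le_of_eq ?_)
        have : γ s - γ t = (s - t) • (x - y) := by simp only [hγ]; module
        rw [this, norm_smul, Real.norm_eq_abs]
      have h5 : |v a - v b| ≤ G * ‖a - b‖ := by
        rw [DiscreteData.sub_eq_inner hv hP.mem (hP.cell (hKC hsK)) (hP.cell (hKC htK))]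
        refine (abs_real_inner_le_norm _ _).trans (mul_le_mul_of_nonneg_right ?_ (norm_nonneg _))
        exact Finset.single_le_sum (f := fun s => ‖DiscreteData.cellGrad v s‖)
          (fun _ _ => norm_nonneg _) (d.finite_active.mem_toFinset.2 hP.mem)
      calc |v a - v b| ≤ G * ‖a - b‖ := h5
        _ ≤ G * (2 * ((2 + M) * (|s - t| * ‖x - y‖))) :=
          mul_le_mul_of_nonneg_left (h3.trans (by linarith)) hG0
        _ = _ := by ring)
  simpa [hγ] using h1

/-- The square of a discrete function, extended constantly along the normals and cut off. -/
lemma exists_lipschitz_cutoff {v : E3 → ℝ} (hv : v ∈ d.space) :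
    ∃ C : NNReal, LipschitzWith C fun x => max 0 (δ / 2 - |S.sdist x|) * v (d.foot S x) ^ 2 := by
  obtain ⟨L, hL0, hL⟩ := A.exists_lipschitz_comp_foot hv
  obtain ⟨c, hc⟩ := (A.surface.isCompact.exists_bound_of_continuousOn
    (hv.1.mono (DiscreteData.surf_subset_closedBulk A.surface)))
  have hcu : ∀ x, |v (d.foot S x)| ≤ c := fun x => hc _ (A.foot_mem x)
  have hc0 : 0 ≤ c := (abs_nonneg _).trans (hcu 0)
  have hδ := A.tube.pos
  have hδ1 := A.delta_le
  set ψ : E3 → ℝ := fun x => max 0 (δ / 2 - |S.sdist x|) with hψ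
  have hψ0 : ∀ x, 0 ≤ ψ x := fun x => le_max_left _ _
  have hψ1 : ∀ x, ψ x ≤ δ / 2 := fun x => max_le (by linarith) (by linarith [abs_nonneg (S.sdist x)])
  have hψL : ∀ x y, |ψ x - ψ y| ≤ ‖x - y‖ := by
    intro x y
    have h1 := abs_max_sub_max_le_abs (δ / 2 - |S.sdist x|) (δ / 2 - |S.sdist y|) 0
    rw [max_comm _ (0 : ℝ), max_comm _ (0 : ℝ)] at h1
    refine h1.trans ?_
    have h2 := abs_abs_sub_abs_le_abs_sub (S.sdist x) (S.sdist y)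
    have h3 := S.abs_sdist_sub_le x y
    rw [dist_eq_norm] at h3
    rw [sub_sub_sub_cancel_left, abs_sub_comm]
    exact h2.trans h3
  have hsq : ∀ x, v (d.foot S x) ^ 2 ≤ c ^ 2 := fun x => sq_le_sq' (by linarith [(abs_le.1 (hcu x)).1])
    (abs_le.1 (hcu x)).2
  have key : ∀ x y, x ∈ S.tube (δ / 2) →
      |ψ x * v (d.foot S x) ^ 2 - ψ y * v (d.foot S y) ^ 2| ≤ (2 * c ^ 2 + 2 * c * L) * ‖x - y‖ := by
    intro x y hx
    have hxy := norm_nonneg (x - y)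
    set p := v (d.foot S x) with hp
    set q := v (d.foot S y) with hq
    have hp1 := abs_le.1 (hcu x)
    have hq1 := abs_le.1 (hcu y)
    rcases lt_or_ge ‖x - y‖ (δ / 2) with hlt | hge
    · have hr : Metric.ball x (δ / 2) ⊆ S.tube δ := S.ball_subset_tube (by
        have : |S.sdist x| < δ / 2 := hx
        linarith)
      have h1 := hL x (δ / 2) hr x (Metric.mem_ball_self (by linarith)) y (by
        rw [Metric.mem_ball, dist_eq_norm, norm_sub_rev]; exact hlt)
      have e : ψ x * p ^ 2 - ψ y * q ^ 2 = (ψ x - ψ y) * p ^ 2 + ψ y * ((p - q) * (p + q)) := by ring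
      rw [e]
      refine (abs_add_le _ _).trans ?_
      rw [abs_mul, abs_mul, abs_mul, abs_of_nonneg (sq_nonneg p), abs_of_nonneg (hψ0 y)]
      have h2 : |p + q| ≤ 2 * c := abs_le.2 ⟨by linarith, by linarith⟩
      have h3 : |p - q| * |p + q| ≤ L * ‖x - y‖ * (2 * c) := mul_le_mul h1 h2 (abs_nonneg _) (by positivity)
      have h4 : |ψ x - ψ y| * p ^ 2 ≤ ‖x - y‖ * c ^ 2 := mul_le_mul (hψL x y) (hsq x) (sq_nonneg _) hxy
      have h5 : ψ y * (|p - q| * |p + q|) ≤ 1 * (L * ‖x - y‖ * (2 * c)) :=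
        mul_le_mul ((hψ1 y).trans (by linarith)) h3 (by positivity) zero_le_one
      have h6 : 0 ≤ ‖x - y‖ * c ^ 2 := by positivity
      linarith
    -- For distant points no regularity is needed: each value is at most c² δ/2, and δ/2 ≤ |x - y|.
    · have h1 : 0 ≤ ψ x * p ^ 2 := mul_nonneg (hψ0 x) (sq_nonneg _)
      have h2 : 0 ≤ ψ y * q ^ 2 := mul_nonneg (hψ0 y) (sq_nonneg _)
      have h3 : ψ x * p ^ 2 ≤ δ / 2 * c ^ 2 := mul_le_mul (hψ1 x) (hsq x) (sq_nonneg _) (by linarith)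
      have h4 : ψ y * q ^ 2 ≤ δ / 2 * c ^ 2 := mul_le_mul (hψ1 y) (hsq y) (sq_nonneg _) (by linarith)
      have h5 : δ / 2 * c ^ 2 ≤ ‖x - y‖ * c ^ 2 := mul_le_mul_of_nonneg_right hge (sq_nonneg _)
      have h6 : 0 ≤ c * L * ‖x - y‖ := by positivity
      rw [abs_le]
      constructor <;> nlinarith
  have hK0 : 0 ≤ 2 * c ^ 2 + 2 * c * L := by positivity
  refine ⟨⟨_, hK0⟩, LipschitzWith.of_dist_le_mul fun x y => ?_⟩
  rw [Real.dist_eq, dist_eq_norm]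
  change _ ≤ (2 * c ^ 2 + 2 * c * L) * ‖x - y‖
  by_cases hx : x ∈ S.tube (δ / 2)
  · exact key x y hx
  by_cases hy : y ∈ S.tube (δ / 2)
  · rw [abs_sub_comm, norm_sub_rev]; exact key y x hy
  · have h1 : ∀ z, z ∉ S.tube (δ / 2) → ψ z = 0 := fun z hz => by
      have : ¬ |S.sdist z| < δ / 2 := hz
      exact max_eq_left (by linarith)
    change |ψ x * _ - ψ y * _| ≤ _
    rw [h1 x hx, h1 y hy, zero_mul, zero_mul, sub_zero, abs_zero]
    positivity

end Approx
end SurfaceFEM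
end

/-! ### Integration by parts through the tube -/

noncomputable section
namespace SurfaceFEM

namespace Approx
variable {S : SmoothClosedSurface} {δ M h : ℝ} {d : DiscreteData} (A : Approx S δ M d h)
include A

lemma fderiv_proj_lift {y : E3} (hy : y ∈ d.elementSet) {β : E3 → E3}
    (hβ : ∀ x ∈ S.surf, inner ℝ (S.normal x) (β x) = 0) :
    fderiv ℝ S.proj y (d.lift S β y) = β (S.proj y) := by
  have h1 := A.inner_lift hy hβ
  have h2 := A.fullB_lift hy β
  rw [SmoothClosedSurface.fullB_apply, h1, zero_smul, add_zero,
    A.tube.mapB_apply (A.elementSet_subset_tube hy), tangentProj_of_inner h1] at h2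
  exact h2

/-- Moving y along the lift moves p(y) with velocity β(p(y)), and the point at height t on its
normal with velocity β + tκβ, which is the direction of Y. -/
lemma hasDerivAt_fiber_lift {y : E3} (hy : y ∈ d.elementSet) {β : E3 → E3}
    (hβ : ∀ x ∈ S.surf, inner ℝ (S.normal x) (β x) = 0) (t : ℝ) :
    HasDerivAt (fun s : ℝ => S.fiber (y + s • d.lift S β y) t)
      (β (S.proj y) + t • S.curv (S.proj y) (β (S.proj y))) 0 := by
  have hyt := A.elementSet_subset_tube hy
  set w := d.lift S β y with hw
  have hγ : HasDerivAt (fun s : ℝ => y + s • w) w 0 := by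
    simpa using ((hasDerivAt_id (0 : ℝ)).smul_const w).const_add y
  have hγ0 : y + (0 : ℝ) • w = y := by simp
  have h1 : HasDerivAt (fun s : ℝ => S.proj (y + s • w)) (β (S.proj y)) 0 := by
    have := (A.tube.differentiableAt_proj (x := y + (0 : ℝ) • w) (by rwa [hγ0])).hasFDerivAt.comp_hasDerivAt
      (0 : ℝ) hγ
    rw [hγ0, hw, A.fderiv_proj_lift hy hβ] at this
    exact this
  have h2 : HasDerivAt (fun s : ℝ => S.normal (S.proj (y + s • w))) (S.curv (S.proj y) (β (S.proj y))) 0 := by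
    have := (A.tube.differentiableAt_normal (x := S.proj (y + (0 : ℝ) • w))
      (A.tube.proj_mem_tube _)).hasFDerivAt.comp_hasDerivAt (0 : ℝ) h1
    rw [hγ0] at this
    exact this
  refine (h1.add (h2.const_smul t)).congr_of_eventuallyEq ?_
  have h3 : ∀ᶠ s : ℝ in 𝓝 0, y + s • w ∈ S.tube δ := by
    refine hγ.continuousAt.eventually ((S.isOpen_tube δ).mem_nhds ?_)
    change y + (0 : ℝ) • w ∈ S.tube δ
    rwa [hγ0]
  filter_upwards [h3] with s hs
  simp only [Pi.add_apply, Pi.smul_apply]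
  rw [SmoothClosedSurface.fiber, A.tube.normal_proj _ hs]

/-- The derivative of an extended discrete function along the extended coefficient field. -/
lemma fderiv_extension {y : E3} (hy : y ∈ d.elementSet) {β : E3 → E3}
    (hβ : ∀ x ∈ S.surf, inner ℝ (S.normal x) (β x) = 0) {v : E3 → ℝ} (hv : v ∈ d.space) {t : ℝ}
    (ht : |t| < δ) {ψ : ℝ → ℝ} {f : E3 → ℝ} (hf : ∀ x, f x = ψ (S.sdist x) * v (d.foot S x) ^ 2)
    (hfd : DifferentiableAt ℝ f (S.fiber y t)) :
    fderiv ℝ f (S.fiber y t) (β (S.proj y) + t • S.curv (S.proj y) (β (S.proj y)))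
      = ψ t * (2 * v y * inner ℝ (d.tgrad v y) (d.lift S β y)) := by
  have hlift := A.inner_lift hy hβ
  have hc := A.hasDerivAt_fiber_lift hy hβ t
  set w := d.lift S β y with hw
  obtain ⟨K, hK, hyK⟩ := hy
  obtain ⟨C, m, s, hP⟩ := A.exists_piece hK ⟨y, hyK⟩
  obtain ⟨g, c, hg⟩ := hv.2.1 s hP.mem
  rw [hP.elem.tgrad_eq hg hyK]
  rw [hP.normal y hyK] at hlift
  have h0 : S.fiber (y + (0 : ℝ) • w) t = S.fiber y t := by simp
  have h1 : HasDerivAt (fun r : ℝ => f (S.fiber (y + r • w) t)) _ 0 :=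
    HasFDerivAt.comp_hasDerivAt (0 : ℝ) (by rw [h0]; exact hfd.hasFDerivAt) hc
  obtain ⟨ε, hε, hball⟩ := hP.rel_open y hyK
  have hγ : Continuous fun r : ℝ => y + r • w := by fun_prop
  have h2 : ∀ᶠ r : ℝ in 𝓝 0, y + r • w ∈ Metric.ball y ε := by
    refine hγ.continuousAt.eventually (Metric.isOpen_ball.mem_nhds ?_)
    simpa using hε
  have hl : HasDerivAt (fun r : ℝ => inner ℝ g y + c + r * inner ℝ g w) (inner ℝ g w) 0 := by
    simpa using ((hasDerivAt_id (0 : ℝ)).mul_const (inner ℝ g w)).const_add (inner ℝ g y + c)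
  have h3 : HasDerivAt (fun r : ℝ => ψ t * (inner ℝ g y + c + r * inner ℝ g w) ^ 2)
      (ψ t * (2 * (inner ℝ g y + c) * inner ℝ g w)) 0 := by
    simpa using (hl.pow 2).const_mul (ψ t)
  -- The lift is tangent to the plane of K, so a short step along it stays in K, where v is given by
  -- one affine expression.
  have h4 : (fun r : ℝ => f (S.fiber (y + r • w) t))
      =ᶠ[𝓝 0] fun r : ℝ => ψ t * (inner ℝ g y + c + r * inner ℝ g w) ^ 2 := by
    filter_upwards [h2] with r hr
    have hz : y + r • w ∈ K := hball _ hr (by rw [add_sub_cancel_left, inner_smul_right, hlift, mul_zero])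
    have hzs := hP.surf hz
    rw [hf, (A.tube.fiber_mem (A.subset_tube hzs) ht).1, A.foot_fiber hzs ht,
      hg _ (hP.cell (hP.sub hz)), inner_add_right, inner_smul_right]
    ring
  have h5 := h1.unique (h3.congr_of_eventuallyEq h4)
  rw [h5, hg _ (hP.cell (hP.sub hyK)), ← inner_tangentProj_comm m g w,
    tangentProj_of_inner hlift]

/-- Integration by parts on the discrete surface for the lifted coefficients, without edge terms. -/
theorem integral_lift_nonneg {α₀ : ℝ} {α : E3 → ℝ} {β Y : E3 → E3} (hY : S.TransportField δ α₀ α β Y)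
    (hβ : ∀ x ∈ S.surf, inner ℝ (S.normal x) (β x) = 0) (hα : ContinuousOn (α ∘ S.proj) (S.tube δ))
    {v : E3 → ℝ} (hv : v ∈ d.space) :
    0 ≤ d.intK (fun y => S.absDetB (d.normal y) y * (2 * v y * inner ℝ (d.tgrad v y) (d.lift S β y)))
      + d.intK (fun y => S.absDetB (d.normal y) y * ((2 * α (S.proj y) - α₀) * v y ^ 2)) := by
  obtain ⟨C, hLip⟩ := A.exists_lipschitz_cutoff hv
  have hδ := A.tube.pos
  set ψ : ℝ → ℝ := fun t => max 0 (δ / 2 - |t|) with hψ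
  set f : E3 → ℝ := fun x => ψ (S.sdist x) * v (d.foot S x) ^ 2 with hf
  have hLip : LipschitzWith C f := hLip
  set J := Ioo (-(δ / 2)) (δ / 2) with hJ
  have hJm : MeasurableSet J := measurableSet_Ioo
  have hJδ : J ⊆ Ioo (-δ) δ := Ioo_subset_Ioo (by linarith) (by linarith)
  have hsm : MeasurableSet (S.sdist ⁻¹' J) := S.measurable_sdist hJm
  have hst : S.sdist ⁻¹' J ⊆ S.tube δ := shell_subset_tube hJδ
  have hf0 : ∀ x, 0 ≤ f x := fun x => mul_nonneg (le_max_left _ _) (sq_nonneg _)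
  have hfz : ∀ x ∉ S.sdist ⁻¹' J, f x = 0 := by
    intro x hx
    have : ¬ |S.sdist x| < δ / 2 := fun h' => hx (abs_lt.1 h')
    have e : ψ (S.sdist x) = 0 := max_eq_left (by linarith)
    simp only [hf, e, zero_mul]
  have hfc : HasCompactSupport f := by
    refine HasCompactSupport.intro (S.isCompact_closedTube (δ / 2)) fun x hx => hfz x fun h' => hx ?_
    exact (abs_lt.2 h').le
  -- Outside the shell the nonnegative function f vanishes, hence has a minimum; so `fderiv` is zero
  -- there, be it as a derivative or as the default value.
  have hfd0 : ∀ x ∉ S.sdist ⁻¹' J, fderiv ℝ f x = 0 := by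
    intro x hx
    refine IsLocalMin.fderiv_eq_zero (Eventually.of_forall fun z => ?_)
    rw [hfz x hx]; exact hf0 z
  obtain ⟨hi1, hi2, hibp⟩ := integral_divergence_mul hY.contDiff hY.compact hLip hfc
  set G : E3 → ℝ := fun x => (2 * v (d.foot S x)
    * inner ℝ (d.tgrad v (d.foot S x)) (d.lift S β (d.foot S x))) * ψ (S.sdist x) with hG
  have hae : ∀ᵐ x ∂(volume.restrict (S.sdist ⁻¹' J)), fderiv ℝ f x (Y x) = S.jac x * G x := by
    rw [Measure.restrict_congr_set (A.shell_ae_eq_layer hJm hJδ)]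
    have hml : NullMeasurableSet (S.layer d.elementSet J) :=
      hsm.nullMeasurableSet.congr (A.shell_ae_eq_layer hJm hJδ)
    filter_upwards [ae_restrict_of_ae hLip.ae_differentiableAt, ae_restrict_mem₀ hml] with x hx hxl
    obtain ⟨⟨y, t⟩, ⟨hy, ht⟩, rfl⟩ := hxl
    simp only at hy ht hx ⊢
    have htδ : |t| < δ := abs_lt.2 (hJδ ht)
    have hys := DiscreteData.elementSet_subset A.surface hy
    obtain ⟨e1, e2, e3, e4⟩ := A.tube.fiber_mem (A.subset_tube hys) htδ
    rw [hY.eq _ e4, map_smul, smul_eq_mul, e1, e2,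
      A.fderiv_extension hy hβ hv htδ (ψ := ψ) (fun _ => rfl) hx]
    simp only [hG, e1, A.foot_fiber hys htδ]
    ring
  have hjac : AEStronglyMeasurable S.jac (volume.restrict (S.sdist ⁻¹' J)) := by
    refine ContinuousOn.aestronglyMeasurable ?_ hsm
    exact fun x hx => (A.tube.contDiffAt_jac (hst hx)).continuousAt.continuousWithinAt
  -- Measurability of G is inherited from Df(Y), with which it agrees almost everywhere up to the
  -- positive factor `jac`.
  have hGm : AEStronglyMeasurable G (volume.restrict (S.sdist ⁻¹' J)) := by
    have h1 : AEStronglyMeasurable (fun x => (S.jac x)⁻¹ * fderiv ℝ f x (Y x))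
        (volume.restrict (S.sdist ⁻¹' J)) :=
      (hjac.aemeasurable.inv.aestronglyMeasurable).mul hi1.aestronglyMeasurable.restrict
    refine h1.congr ?_
    filter_upwards [hae, ae_restrict_mem hsm] with x hx hxs
    have := A.tube.jac_ge x (hst hxs)
    rw [hx, inv_mul_cancel_left₀ (by linarith)]
  have hE1 : ∫ x, fderiv ℝ f x (Y x) = ∫ x in S.sdist ⁻¹' J, S.jac x * G x := by
    rw [← integral_congr_ae hae, setIntegral_eq_integral_of_forall_compl_eq_zero]
    intro x hx
    rw [hfd0 x hx]; rfl
  set G2 : E3 → ℝ := fun x => ((2 * α (S.proj x) - α₀) * v (d.foot S x) ^ 2) * ψ (S.sdist x) with hG2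
  have hG2c : ContinuousOn G2 (S.tube δ) := by
    have h1 : Continuous ψ := by fun_prop
    exact (((hα.const_smul (2 : ℝ)).sub continuousOn_const).mul
      ((A.continuousOn_comp_foot hv).pow 2)).mul (h1.comp S.continuous_sdist).continuousOn
  have hjG2 : IntegrableOn (fun x => S.jac x * G2 x) (S.sdist ⁻¹' J) := by
    have hsub : {x | |S.sdist x| ≤ δ / 2} ⊆ S.tube δ := fun x hx => lt_of_le_of_lt (show |S.sdist x| ≤ δ / 2 from hx) (half_lt_self hδ)
    have h1 : IntegrableOn (fun x => S.jac x * G2 x) {x | |S.sdist x| ≤ δ / 2} := by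
      refine ContinuousOn.integrableOn_compact (S.isCompact_closedTube (δ / 2)) ?_
      refine ContinuousOn.mul ?_ (hG2c.mono hsub)
      exact fun x hx => (A.tube.contDiffAt_jac (hsub hx)).continuousAt.continuousWithinAt
    exact h1.mono_set fun x hx => (abs_lt.2 hx).le
  have hE2 : ∫ x, divergence Y x * f x ≤ ∫ x in S.sdist ⁻¹' J, S.jac x * G2 x := by
    rw [← setIntegral_eq_integral_of_forall_compl_eq_zero (s := S.sdist ⁻¹' J)]
    · refine setIntegral_mono_on hi2.integrableOn hjG2 hsm fun x hx => ?_
      have := mul_le_mul_of_nonneg_right (hY.div_le x (hst hx)) (hf0 x)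
      refine this.trans (le_of_eq ?_)
      simp only [hG2, hf]; ring
    · intro x hx
      rw [hfz x hx, mul_zero]
  have hS1 := A.integral_shell_mul hJm hJδ hGm
    (a := fun y => 2 * v y * inner ℝ (d.tgrad v y) (d.lift S β y)) (b := ψ) (by
      intro y hy t ht
      have hys := DiscreteData.elementSet_subset A.surface hy
      have htδ : |t| < δ := abs_lt.2 (hJδ ht)
      simp only [hG, (A.tube.fiber_mem (A.subset_tube hys) htδ).1, A.foot_fiber hys htδ])
  have hS2 := A.integral_shell_mul hJm hJδ ((hG2c.mono hst).aestronglyMeasurable hsm)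
    (a := fun y => (2 * α (S.proj y) - α₀) * v y ^ 2) (b := ψ) (by
      intro y hy t ht
      have hys := DiscreteData.elementSet_subset A.surface hy
      have htδ : |t| < δ := abs_lt.2 (hJδ ht)
      have := A.tube.fiber_mem (A.subset_tube hys) htδ
      simp only [hG2, this.1, this.2.1, A.foot_fiber hys htδ])
  have hψ1 : 0 < ∫ t in J, ψ t := by
    rw [hJ, ← integral_Ioc_eq_integral_Ioo, ← intervalIntegral.integral_of_le (by linarith)]
    refine intervalIntegral.intervalIntegral_pos_of_pos_on ?_ ?_ (by linarith)
    · exact Continuous.intervalIntegrable (by fun_prop) _ _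
    · intro t ht
      have := abs_lt.2 ht
      exact lt_max_of_lt_right (by linarith)
  have hfin : 0 ≤ (d.intK (fun y => S.absDetB (d.normal y) y * (2 * v y * inner ℝ (d.tgrad v y) (d.lift S β y)))
      + d.intK (fun y => S.absDetB (d.normal y) y * ((2 * α (S.proj y) - α₀) * v y ^ 2)))
        * ∫ t in J, ψ t := by
    rw [add_mul]
    unfold DiscreteData.intK
    rw [← hS1, ← hS2]
    linarith
  exact nonneg_of_mul_nonneg_left hfin hψ1

end Approx
end SurfaceFEM
end

/-! ### From the lifted coefficients to the discrete coefficients -/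

noncomputable section
namespace SurfaceFEM

namespace DiscreteData
variable {d : DiscreteData}

lemma PiecewiseCont.const_mul {φ : E3 → ℝ} (hφ : d.PiecewiseCont φ) (c : ℝ) :
    d.PiecewiseCont fun x => c * φ x := fun K hK => by
  obtain ⟨f, hf, hf'⟩ := hφ K hK
  exact ⟨_, hf.const_mul c, fun x hx => by simp only [hf' hx]⟩

lemma intK_add (hd : d.IsDiscreteSurface) {φ ψ : E3 → ℝ} (hφ : d.PiecewiseCont φ)
    (hψ : d.PiecewiseCont ψ) : d.intK (fun x => φ x + ψ x) = d.intK φ + d.intK ψ :=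
  integral_add (hφ.integrableOn hd) (hψ.integrableOn hd)

lemma intK_const_mul (c : ℝ) (φ : E3 → ℝ) : d.intK (fun x => c * φ x) = c * d.intK φ :=
  integral_const_mul c φ

lemma intK_mono (hd : d.IsDiscreteSurface) {φ ψ : E3 → ℝ} (hφ : d.PiecewiseCont φ)
    (hψ : d.PiecewiseCont ψ) (h : ∀ x ∈ d.elementSet, φ x ≤ ψ x) : d.intK φ ≤ d.intK ψ :=
  setIntegral_mono_on (hφ.integrableOn hd) (hψ.integrableOn hd) (measurableSet_elementSet hd) h

lemma intK_nonneg {φ : E3 → ℝ} (h : ∀ x, 0 ≤ φ x) : 0 ≤ d.intK φ := integral_nonneg h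

end DiscreteData

namespace Approx
variable {S : SmoothClosedSurface} {δ M h : ℝ} {d : DiscreteData} (A : Approx S δ M d h)
include A

lemma aestronglyMeasurable_of_elements {F : Type*} [TopologicalSpace F]
    [TopologicalSpace.PseudoMetrizableSpace F] [SecondCountableTopology F] {φ : E3 → F}
    (h : ∀ K ∈ d.elements, ContinuousOn φ K) :
    AEStronglyMeasurable φ (μHE[2].restrict d.elementSet) := by
  borelize F
  rw [DiscreteData.elementSet_eq, show (⋃ K ∈ d.finite_elements.toFinset, K)
    = ⋃ K : d.finite_elements.toFinset, (K : Set E3) by ext; simp]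
  refine (AEMeasurable.iUnion fun K => ?_).aestronglyMeasurable
  have hK := d.finite_elements.mem_toFinset.1 K.2
  obtain ⟨m, s, hE⟩ := DiscreteData.exists_elem A.surface hK
  exact (h _ hK).aemeasurable hE.measurable

lemma norm_lift_le {y : E3} (hy : y ∈ d.elementSet) (β : E3 → E3) :
    ‖d.lift S β y‖ ≤ 2 * ‖β (S.proj y)‖ := by
  have := A.half_norm_le_fullB hy (d.lift S β y)
  rw [A.fullB_lift hy] at this
  linarith

/-- The uniform bound |w| ≤ 2 |(B + n ⊗ m) w| turns continuity of the map and of β∘p into continuity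
of the solution. -/
lemma continuousOn_lift {β : E3 → E3} (hβ : ContinuousOn (β ∘ S.proj) (S.tube δ)) {K : Set E3}
    (hK : K ∈ d.elements) : ContinuousOn (d.lift S β) K := by
  obtain ⟨m, s, hE⟩ := DiscreteData.exists_elem A.surface hK
  have hKe : K ⊆ d.elementSet := subset_sUnion_of_mem hK
  have hKt := hKe.trans A.elementSet_subset_tube
  intro y₀ hy₀
  have h1 : Tendsto (fun y => 2 * ‖β (S.proj y) - S.fullB m y (d.lift S β y₀)‖) (𝓝[K] y₀) (𝓝 0) := by
    have h2 : ContinuousOn (fun y => 2 * ‖β (S.proj y) - S.fullB m y (d.lift S β y₀)‖) K := by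
      have := ((A.tube.continuousOn_fullB m).mono hKt).clm_apply (continuousOn_const (c := d.lift S β y₀))
      exact continuousOn_const.mul ((hβ.mono hKt).sub this).norm
    have h3 := h2 y₀ hy₀
    have h4 := A.fullB_lift (hKe hy₀) β
    rw [hE.normal y₀ hy₀] at h4
    rw [ContinuousWithinAt, h4, sub_self, norm_zero, mul_zero] at h3
    exact h3
  rw [ContinuousWithinAt, tendsto_iff_norm_sub_tendsto_zero]
  refine squeeze_zero' (Eventually.of_forall fun _ => norm_nonneg _) ?_ h1
  filter_upwards [self_mem_nhdsWithin] with y hy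
  have h5 := A.half_norm_le_fullB (hKe hy) (d.lift S β y - d.lift S β y₀)
  rw [map_sub, A.fullB_lift (hKe hy), hE.normal y hy] at h5
  linarith

/-- The completed map sends |B| w - β_h to |B| times the consistency error of β. One factor 2 is
from |B| ≤ 2, the other from the inverse. -/
lemma norm_absDetB_smul_lift_sub_le {y : E3} (hy : y ∈ d.elementSet) {β : E3 → E3} {N : ℝ}
    (hc : d.IsCoefficients)
    (hN : ‖β (S.proj y) - (S.absDetB (d.normal y) y)⁻¹ • S.mapB (d.normal y) y (d.β y)‖ ≤ N) :
    ‖S.absDetB (d.normal y) y • d.lift S β y - d.β y‖ ≤ 4 * N := by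
  obtain ⟨hB1, hB2⟩ := A.absDetB_mem hy
  set b := S.absDetB (d.normal y) y
  have hb0 : 0 < b := by linarith
  have hm := A.norm_normal_eq_one hy
  have ht : inner ℝ (d.normal y) (d.β y) = 0 := by
    rw [← hc.tangential y hy, inner_tangentProj hm]
  have e : S.fullB (d.normal y) y (b • d.lift S β y - d.β y)
      = b • (β (S.proj y) - b⁻¹ • S.mapB (d.normal y) y (d.β y)) := by
    rw [map_sub, map_smul, A.fullB_lift hy, SmoothClosedSurface.fullB_apply, ht, zero_smul, add_zero,
      smul_sub, smul_inv_smul₀ hb0.ne']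
  have h1 := A.half_norm_le_fullB hy (b • d.lift S β y - d.β y)
  rw [e, norm_smul, Real.norm_eq_abs, abs_of_pos hb0] at h1
  have h2 := mul_le_mul hB2 hN (norm_nonneg _) zero_le_two
  linarith

/-- Coercivity of the convection and reaction terms up to terms of second order. -/
theorem le_convection_add_reaction {α₀ N : ℝ} {α : E3 → ℝ} {β Y : E3 → E3} (hα₀ : 0 < α₀)
    (hY : S.TransportField δ α₀ α β Y)
    (hβ : ∀ x ∈ S.surf, inner ℝ (S.normal x) (β x) = 0)
    (hαc : ContinuousOn (α ∘ S.proj) (S.tube δ)) (hβc : ContinuousOn (β ∘ S.proj) (S.tube δ))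
    (hc : d.IsCoefficients)
    (hNβ : ∀ y ∈ d.elementSet,
      ‖β (S.proj y) - (S.absDetB (d.normal y) y)⁻¹ • S.mapB (d.normal y) y (d.β y)‖ ≤ N)
    (hNα : ∀ y ∈ d.elementSet, |α (S.proj y) - (S.absDetB (d.normal y) y)⁻¹ * d.α y| ≤ N)
    {v : E3 → ℝ} (hv : v ∈ d.space) :
    α₀ / 4 * d.intK (fun y => v y ^ 2) ≤ d.intK (fun y => d.stream v y * v y)
      + d.intK (fun y => d.α y * v y * v y)
      + 4 * N * d.intK (fun y => ‖v y‖ * ‖d.tgrad v y‖) + 2 * N * d.intK (fun y => v y ^ 2) := by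
  have hibp := A.integral_lift_nonneg hY hβ hαc hv
  have hd := A.surface
  have hem := DiscreteData.measurableSet_elementSet hd
  have hpv := DiscreteData.piecewiseCont_of_mem hd hv
  have hpg := DiscreteData.piecewiseCont_tgrad hd hv
  have hps := hc.piecewiseCont_stream hd hv
  have hiV := (hpv.pow 2).integrableOn hd
  have hiC := (hpv.norm.mul hpg.norm).integrableOn hd
  have hiS := (hps.mul hpv).integrableOn hd
  have hiR := ((hc.piecewiseCont_α.mul hpv).mul hpv).integrableOn hd
  have hsub := DiscreteData.elementSet_subset hd
  obtain ⟨cα, hcα⟩ := hd.isCompact.exists_bound_of_continuousOn (hαc.mono A.subset_tube)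
  obtain ⟨cβ, hcβ⟩ := hd.isCompact.exists_bound_of_continuousOn (hβc.mono A.subset_tube)
  have hmeas : ∀ {F : Type} [NormedAddCommGroup F] {φ : E3 → F}, d.PiecewiseCont φ →
      AEStronglyMeasurable φ (μHE[2].restrict d.elementSet) := fun h => (h.integrableOn hd).aestronglyMeasurable
  have hlm : AEStronglyMeasurable (d.lift S β) (μHE[2].restrict d.elementSet) :=
    A.aestronglyMeasurable_of_elements fun K hK => A.continuousOn_lift hβc hK
  have hαm : AEStronglyMeasurable (α ∘ S.proj) (μHE[2].restrict d.elementSet) :=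
    (hαc.mono A.elementSet_subset_tube).aestronglyMeasurable hem
  have hBm := A.aemeasurable_absDetB.aestronglyMeasurable
  have hi1 : IntegrableOn (fun y => S.absDetB (d.normal y) y
      * (2 * v y * inner ℝ (d.tgrad v y) (d.lift S β y))) d.elementSet μHE[2] := by
    refine Integrable.mono' (hiC.const_mul (8 * cβ)) ?_ ?_
    · exact hBm.mul (((hmeas hpv).const_mul 2).mul ((hmeas hpg).inner hlm))
    · filter_upwards [ae_restrict_mem hem] with y hy
      obtain ⟨h1, h2⟩ := A.absDetB_mem hy
      have h3 : ‖β (S.proj y)‖ ≤ cβ := hcβ y (hsub hy)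
      have h4 := A.norm_lift_le hy β
      have h5 := norm_inner_le_norm (𝕜 := ℝ) (d.tgrad v y) (d.lift S β y)
      rw [norm_mul, norm_mul, norm_mul, Real.norm_eq_abs, abs_of_nonneg (by linarith), Real.norm_two]
      have h6 : ‖inner ℝ (d.tgrad v y) (d.lift S β y)‖ ≤ ‖d.tgrad v y‖ * (2 * cβ) :=
        h5.trans (mul_le_mul_of_nonneg_left (by linarith) (norm_nonneg _))
      have h7 : 2 * ‖v y‖ * ‖inner ℝ (d.tgrad v y) (d.lift S β y)‖
          ≤ 2 * ‖v y‖ * (‖d.tgrad v y‖ * (2 * cβ)) := mul_le_mul_of_nonneg_left h6 (by positivity)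
      calc _ ≤ 2 * (2 * ‖v y‖ * (‖d.tgrad v y‖ * (2 * cβ))) := mul_le_mul h2 h7 (by positivity) zero_le_two
        _ = _ := by ring
  have hi2 : IntegrableOn (fun y => S.absDetB (d.normal y) y
      * ((2 * α (S.proj y) - α₀) * v y ^ 2)) d.elementSet μHE[2] := by
    refine Integrable.mono' (hiV.const_mul (2 * (2 * cα + α₀))) ?_ ?_
    · exact hBm.mul (((hαm.const_mul 2).sub aestronglyMeasurable_const).mul (hmeas (hpv.pow 2)))
    · filter_upwards [ae_restrict_mem hem] with y hy
      obtain ⟨h1, h2⟩ := A.absDetB_mem hy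
      have h3 : |α (S.proj y)| ≤ cα := hcα y (hsub hy)
      have h4 := abs_le.1 h3
      rw [norm_mul, norm_mul, Real.norm_eq_abs, abs_of_nonneg (by linarith), Real.norm_eq_abs,
        Real.norm_eq_abs, abs_of_nonneg (sq_nonneg (v y)), mul_assoc]
      refine mul_le_mul h2 (mul_le_mul_of_nonneg_right ?_ (sq_nonneg _)) (by positivity) zero_le_two
      exact abs_le.2 ⟨by linarith, by linarith⟩
  have hpt : ∀ y ∈ d.elementSet, S.absDetB (d.normal y) y
        * (2 * v y * inner ℝ (d.tgrad v y) (d.lift S β y))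
      + S.absDetB (d.normal y) y * ((2 * α (S.proj y) - α₀) * v y ^ 2)
      ≤ 2 * (d.stream v y * v y) + 2 * (d.α y * v y * v y) + 8 * N * (‖v y‖ * ‖d.tgrad v y‖)
        + (4 * N - α₀ / 2) * v y ^ 2 := by
    intro y hy
    obtain ⟨h1, h2⟩ := A.absDetB_mem hy
    have h3 := A.norm_absDetB_smul_lift_sub_le hy hc (hNβ y hy)
    have h4 := hNα y hy
    set b := S.absDetB (d.normal y) y
    have hb0 : 0 < b := by linarith
    have e1 : b * (2 * v y * inner ℝ (d.tgrad v y) (d.lift S β y)) = 2 * (d.stream v y * v y)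
        + 2 * (v y * inner ℝ (d.tgrad v y) (b • d.lift S β y - d.β y)) := by
      rw [DiscreteData.stream, real_inner_comm (d.tgrad v y) (d.β y), inner_sub_right, inner_smul_right]; ring
    have e2 : v y * inner ℝ (d.tgrad v y) (b • d.lift S β y - d.β y) ≤ ‖v y‖ * (‖d.tgrad v y‖ * (4 * N)) := by
      refine (le_abs_self _).trans ?_
      rw [abs_mul]
      refine mul_le_mul_of_nonneg_left ?_ (abs_nonneg _)
      exact (abs_real_inner_le_norm _ _).trans (mul_le_mul_of_nonneg_left h3 (norm_nonneg _))
    have e3 : b * α (S.proj y) ≤ d.α y + 2 * N := by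
      have : b * α (S.proj y) = d.α y + b * (α (S.proj y) - b⁻¹ * d.α y) := by
        field_simp; ring
      rw [this]
      have h5 := (le_abs_self _).trans h4
      have h6 : 0 ≤ N := (abs_nonneg _).trans h4
      have h7 := mul_le_mul_of_nonneg_left h5 hb0.le
      have h8 := mul_le_mul_of_nonneg_right h2 h6
      linarith
    -- The bound |B| ≥ 1/2 costs half of α₀; the overall factor 2 of the integrated identity then
    -- leads to α₀/4.
    have e4 : b * ((2 * α (S.proj y) - α₀) * v y ^ 2) ≤ (2 * (d.α y + 2 * N) - α₀ / 2) * v y ^ 2 := by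
      rw [← mul_assoc]
      refine mul_le_mul_of_nonneg_right ?_ (sq_nonneg _)
      have := mul_le_mul_of_nonneg_right h1 hα₀.le
      linarith
    rw [e1]
    nlinarith
  have hint := setIntegral_mono_on (hi1.add hi2) ((((hiS.const_mul 2).add (hiR.const_mul 2)).add
    (hiC.const_mul (8 * N))).add (hiV.const_mul (4 * N - α₀ / 2))) hem hpt
  have hl : ∫ y in d.elementSet, (S.absDetB (d.normal y) y
        * (2 * v y * inner ℝ (d.tgrad v y) (d.lift S β y))
      + S.absDetB (d.normal y) y * ((2 * α (S.proj y) - α₀) * v y ^ 2)) ∂μHE[2] = _ :=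
    integral_add hi1 hi2
  have hr : ∫ y in d.elementSet, (2 * (d.stream v y * v y) + 2 * (d.α y * v y * v y)
      + 8 * N * (‖v y‖ * ‖d.tgrad v y‖) + (4 * N - α₀ / 2) * v y ^ 2) ∂μHE[2]
      = 2 * d.intK (fun y => d.stream v y * v y) + 2 * d.intK (fun y => d.α y * v y * v y)
        + 8 * N * d.intK (fun y => ‖v y‖ * ‖d.tgrad v y‖)
        + (4 * N - α₀ / 2) * d.intK (fun y => v y ^ 2) := by
    have p1 := (hps.mul hpv).const_mul 2
    have p2 := ((hc.piecewiseCont_α.mul hpv).mul hpv).const_mul 2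
    have p3 := (hpv.norm.mul hpg.norm).const_mul (8 * N)
    have p4 := (hpv.pow 2).const_mul (4 * N - α₀ / 2)
    rw [← DiscreteData.intK_const_mul, ← DiscreteData.intK_const_mul, ← DiscreteData.intK_const_mul,
      ← DiscreteData.intK_const_mul, ← DiscreteData.intK_add hd p1 p2,
      ← DiscreteData.intK_add hd (p1.add p2) p3, ← DiscreteData.intK_add hd ((p1.add p2).add p3) p4]
    rfl
  have hfin : (0 : ℝ) ≤ _ := hibp.trans ((le_of_eq hl.symm).trans (hint.trans (le_of_eq hr)))
  linarith

end Approx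
end SurfaceFEM
end

noncomputable section
namespace SurfaceFEM

/-! ### Coercivity -/

lemma tauOne_pos {cτ b ε h : ℝ} (hc : 0 < cτ) (hb : 0 < b) (hh : 0 < h) : 0 < tauOne cτ b ε h := by
  rw [tauOne]
  split_ifs with h1
  · positivity
  · have : 0 < ε := (mul_pos hb hh).trans (not_le.1 h1)
    positivity

lemma tauOne_le {cτ b ε h : ℝ} (hc : 0 < cτ) (hb : 0 < b) (hh : 0 < h) :
    tauOne cτ b ε h ≤ cτ * b⁻¹ := by
  rw [tauOne]
  split_ifs with h1
  · exact le_rfl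
  · have h2 := not_le.1 h1
    have h3 : ε⁻¹ ≤ (b * h)⁻¹ := inv_anti₀ (mul_pos hb hh) h2.le
    calc cτ * h * ε⁻¹ ≤ cτ * h * (b * h)⁻¹ := mul_le_mul_of_nonneg_left h3 (by positivity)
      _ = cτ * b⁻¹ := by field_simp

namespace DiscreteData
variable {d : DiscreteData}

lemma form_self (hd : d.IsDiscreteSurface) (hc : d.IsCoefficients) {v : E3 → ℝ} (hv : v ∈ d.space)
    (h γ ε τ₁ τ₂ : ℝ) : d.form h γ ε τ₁ τ₂ v v
      = d.intK (fun x => d.stream v x * v x) + d.intK (fun x => d.α x * v x * v x)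
        + ε * d.intK (fun x => ‖d.tgrad v x‖ ^ 2)
        + τ₁ * h * (d.intK (fun x => d.stream v x ^ 2) + d.intK (fun x => d.α x * v x * d.stream v x))
        + τ₂ * h ^ γ * d.intT (fun x => d.nderiv v x ^ 2) := by
  have hps := hc.piecewiseCont_stream hd hv
  have hpa := hc.piecewiseCont_α.mul (piecewiseCont_of_mem hd hv)
  have e1 : ∀ x, inner ℝ (d.tgrad v x) (d.tgrad v x) = ‖d.tgrad v x‖ ^ 2 := fun x =>
    real_inner_self_eq_norm_sq _
  rw [form, formA, formS1, formS2, ← intK_add hd (hps.pow 2) (hpa.mul hps)]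
  simp only [e1, add_mul, ← pow_two]

lemma intT_nderiv_nonneg (v : E3 → ℝ) : 0 ≤ d.intT (fun x => d.nderiv v x ^ 2) :=
  integral_nonneg fun _ => sq_nonneg _

lemma normSq_nonneg {h γ ε τ₁ τ₂ : ℝ} (hh : 0 < h) (hε : 0 ≤ ε) (hτ₁ : 0 ≤ τ₁) (hτ₂ : 0 ≤ τ₂)
    (v : E3 → ℝ) : 0 ≤ d.normSq h γ ε τ₁ τ₂ v := by
  have h1 : 0 ≤ d.intK (fun x => v x ^ 2) := intK_nonneg fun x => sq_nonneg _
  have h2 : 0 ≤ d.intK (fun x => ‖d.tgrad v x‖ ^ 2) := intK_nonneg fun x => sq_nonneg _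
  have h3 : 0 ≤ d.intK (fun x => d.stream v x ^ 2) := intK_nonneg fun x => sq_nonneg _
  have h4 := d.intT_nderiv_nonneg v
  have h5 := Real.rpow_nonneg hh.le γ
  rw [normSq]; positivity

lemma intK_mul_le (hd : d.IsDiscreteSurface) {φ ψ : E3 → ℝ} (hφ : d.PiecewiseCont φ)
    (hψ : d.PiecewiseCont ψ) {c : ℝ} (hc : 0 < c) :
    d.intK (fun x => φ x * ψ x)
      ≤ c / 2 * d.intK (fun x => φ x ^ 2) + 1 / (2 * c) * d.intK (fun x => ψ x ^ 2) := by
  rw [← intK_const_mul, ← intK_const_mul,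
    ← intK_add hd ((hφ.pow 2).const_mul (c / 2)) ((hψ.pow 2).const_mul (1 / (2 * c)))]
  refine intK_mono hd (hφ.mul hψ)
    (((hφ.pow 2).const_mul (c / 2)).add ((hψ.pow 2).const_mul (1 / (2 * c)))) fun x _ => ?_
  have e : c / 2 * φ x ^ 2 + 1 / (2 * c) * ψ x ^ 2 - φ x * ψ x = 1 / (2 * c) * (c * φ x - ψ x) ^ 2 := by
    field_simp; ring
  have : 0 ≤ 1 / (2 * c) * (c * φ x - ψ x) ^ 2 := by positivity
  linarith

lemma neg_intK_mul_le (hd : d.IsDiscreteSurface) {φ ψ : E3 → ℝ} (hφ : d.PiecewiseCont φ)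
    (hψ : d.PiecewiseCont ψ) {c : ℝ} (hc : 0 < c) :
    -d.intK (fun x => φ x * ψ x)
      ≤ c / 2 * d.intK (fun x => φ x ^ 2) + 1 / (2 * c) * d.intK (fun x => ψ x ^ 2) := by
  have := intK_mul_le hd (hφ.const_mul (-1)) hψ hc
  have e1 : d.intK (fun x => -1 * φ x * ψ x) = -d.intK (fun x => φ x * ψ x) := by
    rw [← neg_one_mul (d.intK _), ← intK_const_mul]; congr 1; funext x; ring
  have e2 : (fun x => (-1 * φ x) ^ 2) = fun x => φ x ^ 2 := by funext x; ring
  rwa [e1, e2] at this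

/-- The form is bounded from below by the norm, with a constant depending on the mesh size. -/
lemma neg_mul_normSq_le_form (hd : d.IsDiscreteSurface) (hc : d.IsCoefficients) {cs : ℝ} (hcs : 0 ≤ cs)
    (hst : ∀ x ∈ d.elementSet, |d.α x| ≤ cs ∧ ‖d.β x‖ ≤ cs) {cτ b h l H γ ε τ₂ : ℝ} (hcτ : 0 < cτ)
    (hb : 0 < b) (hl : 0 < l) (hlh : l ≤ h) (hH : h ≤ H) (hε : 0 ≤ ε) (hτ₂ : 0 ≤ τ₂)
    {v : E3 → ℝ} (hv : v ∈ d.space) :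
    -((1 + cs + cτ * b⁻¹ * H * cs ^ 2 + b / (cτ * l) + cs ^ 2 / (b * l))
        * d.normSq h γ ε (tauOne cτ b ε h) τ₂ v)
      ≤ d.form h γ ε (tauOne cτ b ε h) τ₂ v v := by
  have hh : 0 < h := hl.trans_le hlh
  have hτ0 := tauOne_pos (ε := ε) hcτ hb hh
  have hτ1 := tauOne_le (ε := ε) hcτ hb hh
  have hpv := piecewiseCont_of_mem hd hv
  have hpg := piecewiseCont_tgrad hd hv
  have hps := hc.piecewiseCont_stream hd hv
  have hpa := hc.piecewiseCont_α.mul hpv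
  rw [form_self hd hc hv, normSq]
  set τ := tauOne cτ b ε h with hτ
  set V := d.intK (fun x => v x ^ 2) with hV
  set Q := d.intK (fun x => ‖d.tgrad v x‖ ^ 2) with hQ
  set D := d.intK (fun x => d.stream v x ^ 2) with hD
  set T := d.intT (fun x => d.nderiv v x ^ 2) with hT
  have hV0 : 0 ≤ V := intK_nonneg fun x => sq_nonneg _
  have hQ0 : 0 ≤ Q := intK_nonneg fun x => sq_nonneg _
  have hD0 : 0 ≤ D := intK_nonneg fun x => sq_nonneg _
  have hT0 : 0 ≤ τ₂ * h ^ γ * T :=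
    mul_nonneg (mul_nonneg hτ₂ (Real.rpow_nonneg hh.le γ)) (d.intT_nderiv_nonneg v)
  have hR : -(cs * V) ≤ d.intK (fun x => d.α x * v x * v x) := by
    rw [hV, ← neg_mul, ← intK_const_mul]
    refine intK_mono hd ((hpv.pow 2).const_mul _) (hpa.mul hpv) fun x hx => ?_
    have := (abs_le.1 (hst x hx).1).1
    rw [mul_assoc, ← pow_two]
    exact mul_le_mul_of_nonneg_right this (sq_nonneg _)
  have hA : d.intK (fun x => (d.α x * v x) ^ 2) ≤ cs ^ 2 * V := by
    rw [hV, ← intK_const_mul]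
    refine intK_mono hd (hpa.pow 2) ((hpv.pow 2).const_mul _) fun x hx => ?_
    rw [mul_pow]
    exact mul_le_mul_of_nonneg_right (sq_le_sq.2 (by rw [abs_of_nonneg hcs]; exact (hst x hx).1))
      (sq_nonneg _)
  have hDQ : D ≤ cs ^ 2 * Q := by
    rw [hQ, ← intK_const_mul]
    refine intK_mono hd (hps.pow 2) ((hpg.norm.pow 2).const_mul _) fun x hx => ?_
    rw [← mul_pow]
    refine sq_le_sq.2 ?_
    rw [abs_of_nonneg (mul_nonneg hcs (norm_nonneg _))]
    exact (abs_real_inner_le_norm _ _).trans (mul_le_mul_of_nonneg_right (hst x hx).2 (norm_nonneg _))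
  have hZ := neg_intK_mul_le hd hpa hps (c := 1) one_pos
  have hX := neg_intK_mul_le hd hps hpv (c := 1) one_pos
  have hZ2 : -(τ * h * cs ^ 2 * V) ≤ τ * h * (D + d.intK (fun x => d.α x * v x * d.stream v x)) := by
    have h1 : -(cs ^ 2 * V) ≤ D + d.intK (fun x => d.α x * v x * d.stream v x) := by
      have : 0 ≤ cs ^ 2 * V := by positivity
      linarith
    have := mul_le_mul_of_nonneg_left h1 (mul_pos hτ0 hh).le
    linarith
  have hτh : τ * h * cs ^ 2 * V ≤ cτ * b⁻¹ * H * cs ^ 2 * V := by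
    have := mul_le_mul hτ1 hH hh.le (by positivity)
    gcongr
  -- The unweighted streamline derivative is bounded uniformly in ε: if ε ≤ β_∞ h, then τ₁h is
  -- bounded below; otherwise ε ≥ β_∞ l and the diffusion term controls the gradient.
  have hS : D ≤ b / (cτ * l) * (τ * h * D) + cs ^ 2 / (b * l) * (ε * Q) := by
    by_cases hcase : ε ≤ b * h
    · have e1 : τ = cτ * b⁻¹ := by rw [hτ, tauOne, if_pos hcase]
      have h1 : 1 ≤ b / (cτ * l) * (τ * h) := by
        rw [e1, show b / (cτ * l) * (cτ * b⁻¹ * h) = h / l by field_simp]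
        exact (one_le_div hl).2 hlh
      have h2 := mul_le_mul_of_nonneg_right h1 hD0
      have h3 : 0 ≤ cs ^ 2 / (b * l) * (ε * Q) := by positivity
      linarith
    · have h1 : 1 ≤ ε / (b * l) := by
        rw [one_le_div (by positivity)]
        exact (mul_le_mul_of_nonneg_left hlh hb.le).trans (not_le.1 hcase).le
      have h2 := mul_le_mul_of_nonneg_right h1 (mul_nonneg (sq_nonneg cs) hQ0)
      have h3 : 0 ≤ b / (cτ * l) * (τ * h * D) := by positivity
      have h4 : ε / (b * l) * (cs ^ 2 * Q) = cs ^ 2 / (b * l) * (ε * Q) := by ring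
      linarith
  have k1 : 0 ≤ ε * Q := mul_nonneg hε hQ0
  have k2 : 0 ≤ τ * h * D := by positivity
  set c1 := cτ * b⁻¹ * H * cs ^ 2 with hc1
  set c2 := b / (cτ * l) with hc2
  set c3 := cs ^ 2 / (b * l) with hc3
  have hH0 : 0 ≤ H := hh.le.trans hH
  have p1 : 0 ≤ c1 := by positivity
  have p2 : 0 ≤ c2 := by positivity
  have p3 : 0 ≤ c3 := by positivity
  have q1 : (1 + cs + c1 + c2 + c3) * (V + ε * Q + τ * h * D + τ₂ * h ^ γ * T)
      ≥ (1 + cs + c1) * V + c2 * (τ * h * D) + c3 * (ε * Q) := by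
    have r1 := mul_nonneg (add_nonneg p2 p3) hV0
    have r2 := mul_nonneg (show 0 ≤ 1 + cs + c1 + c2 by positivity) k1
    have r3 := mul_nonneg (show 0 ≤ 1 + cs + c1 + c3 by positivity) k2
    have r4 := mul_nonneg (show 0 ≤ 1 + cs + c1 + c2 + c3 by positivity) hT0
    linarith
  linarith

end DiscreteData

namespace Approx
variable {S : SmoothClosedSurface} {δ M h : ℝ} {d : DiscreteData} (A : Approx S δ M d h)
include A

/-- Coercivity for small mesh sizes. -/
theorem mul_normSq_le_form {α₀ c cs cτ b γ ε τ₂ t₀ : ℝ} {α : E3 → ℝ} {β Y : E3 → E3} (hα₀ : 0 < α₀)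
    (hY : S.TransportField δ α₀ α β Y)
    (hβ : ∀ x ∈ S.surf, inner ℝ (S.normal x) (β x) = 0)
    (hαc : ContinuousOn (α ∘ S.proj) (S.tube δ)) (hβc : ContinuousOn (β ∘ S.proj) (S.tube δ))
    (hc : d.IsCoefficients) (hc0 : 0 ≤ c)
    (hNβ : ∀ y ∈ d.elementSet,
      ‖β (S.proj y) - (S.absDetB (d.normal y) y)⁻¹ • S.mapB (d.normal y) y (d.β y)‖ ≤ c * h ^ 2)
    (hNα : ∀ y ∈ d.elementSet, |α (S.proj y) - (S.absDetB (d.normal y) y)⁻¹ * d.α y| ≤ c * h ^ 2)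
    (hcs : 0 ≤ cs) (hst : ∀ x ∈ d.elementSet, |d.α x| ≤ cs ∧ ‖d.β x‖ ≤ cs)
    (hcτ : 0 < cτ) (hb : 0 < b) (hε : 0 ≤ ε) (ht₀ : 0 < t₀) (hτ₂ : t₀ ≤ τ₂)
    (hs1 : (2 * c * (2 + 2 ^ 67 * M ^ 22) + cτ * b⁻¹ * cs ^ 2) * h ≤ α₀ / 8)
    (hs2 : 2 * c * (2 ^ 67 * M ^ 22) * h ^ (2 - γ) ≤ t₀ / 2)
    {v : E3 → ℝ} (hv : v ∈ d.space) :
    min (α₀ / 8) (1 / 2) * d.normSq h γ ε (tauOne cτ b ε h) τ₂ v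
      ≤ d.form h γ ε (tauOne cτ b ε h) τ₂ v v := by
  have hd := A.surface
  have hh := A.h_pos
  have hM := A.M_pos
  have hh1 : h ≤ 1 := by have := A.h_le; have := A.delta_le; linarith
  have hτ0 := tauOne_pos (ε := ε) hcτ hb hh
  have hτ1 := tauOne_le (ε := ε) hcτ hb hh
  have hpv := DiscreteData.piecewiseCont_of_mem hd hv
  have hpg := DiscreteData.piecewiseCont_tgrad hd hv
  have hps := hc.piecewiseCont_stream hd hv
  have hpa := hc.piecewiseCont_α.mul hpv
  have hmain := A.le_convection_add_reaction hα₀ hY hβ hαc hβc hc hNβ hNα hv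
  have hinv := A.intK_tgrad_le hv
  rw [DiscreteData.form_self hd hc hv, DiscreteData.normSq]
  -- The weight h⁻¹ gives h² ∫|v||∇v| ≤ (h/2)‖v‖² + (h/2) h²‖∇v‖², to which the inverse estimate
  -- applies directly.
  have hW := DiscreteData.intK_mul_le hd hpv.norm hpg.norm (c := h⁻¹) (inv_pos.2 hh)
  have e1 : (fun x => ‖v x‖ ^ 2) = fun x => v x ^ 2 := by funext x; simp
  rw [e1] at hW
  have hZ := DiscreteData.neg_intK_mul_le hd hpa hps (c := 1) one_pos
  set τ := tauOne cτ b ε h with hτ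
  set V := d.intK (fun x => v x ^ 2) with hV
  set Q := d.intK (fun x => ‖d.tgrad v x‖ ^ 2) with hQ
  set D := d.intK (fun x => d.stream v x ^ 2) with hD
  set T := d.intT (fun x => d.nderiv v x ^ 2) with hT
  set W := d.intK (fun x => ‖v x‖ * ‖d.tgrad v x‖) with hWd
  set K : ℝ := 2 ^ 67 * M ^ 22 with hK
  have hK0 : 0 ≤ K := by positivity
  have hV0 : 0 ≤ V := DiscreteData.intK_nonneg fun x => sq_nonneg _
  have hQ0 : 0 ≤ Q := DiscreteData.intK_nonneg fun x => sq_nonneg _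
  have hD0 : 0 ≤ D := DiscreteData.intK_nonneg fun x => sq_nonneg _
  have hT0 : 0 ≤ T := d.intT_nderiv_nonneg v
  have hA : d.intK (fun x => (d.α x * v x) ^ 2) ≤ cs ^ 2 * V := by
    rw [hV, ← DiscreteData.intK_const_mul]
    refine DiscreteData.intK_mono hd (hpa.pow 2) ((hpv.pow 2).const_mul _) fun x hx => ?_
    rw [mul_pow]
    exact mul_le_mul_of_nonneg_right (sq_le_sq.2 (by rw [abs_of_nonneg hcs]; exact (hst x hx).1))
      (sq_nonneg _)
  have hW2 : 4 * (c * h ^ 2) * W ≤ 2 * c * (1 + K) * h * V + 2 * c * K * h ^ 2 * T := by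
    have h1 : h ^ 2 * W ≤ h / 2 * V + h / 2 * (K * (V + h * T)) := by
      calc h ^ 2 * W ≤ h ^ 2 * (h⁻¹ / 2 * V + 1 / (2 * h⁻¹) * Q) :=
            mul_le_mul_of_nonneg_left hW (by positivity)
        _ = h / 2 * V + h / 2 * (h ^ 2 * Q) := by field_simp
        _ ≤ _ := by
          have := mul_le_mul_of_nonneg_left hinv (show 0 ≤ h / 2 by positivity)
          linarith
    have h2 := mul_le_mul_of_nonneg_left h1 (show 0 ≤ 4 * c by positivity)
    calc 4 * (c * h ^ 2) * W = 4 * c * (h ^ 2 * W) := by ring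
      _ ≤ _ := h2
      _ = _ := by ring
  have hN : 2 * (c * h ^ 2) * V ≤ 2 * c * h * V := by
    have h1 : h ^ 2 ≤ h := by nlinarith
    have := mul_le_mul_of_nonneg_left h1 (show 0 ≤ 2 * c * V by positivity)
    linarith
  -- This is where γ < 2 matters: h² = h^(2-γ) h^γ, and the small factor lets half of the normal
  -- stabilization absorb the term.
  have hT2 : 2 * c * K * h ^ 2 * T ≤ 1 / 2 * (τ₂ * h ^ γ * T) := by
    have h1 : h ^ 2 = h ^ (2 - γ) * h ^ γ := by
      rw [← Real.rpow_add hh, sub_add_cancel, Real.rpow_two]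
    have h2 : 0 ≤ h ^ γ := Real.rpow_nonneg hh.le γ
    have h3 : 2 * c * K * h ^ (2 - γ) ≤ τ₂ / 2 := hs2.trans (by linarith)
    have h4 := mul_le_mul_of_nonneg_right h3 (mul_nonneg h2 hT0)
    rw [h1]
    linarith
  -- Half of the streamline term absorbs the cross term with α_h v; as τ₁ ≤ c_τ/β_∞, what is left is
  -- O(h) ‖v‖².
  have hZ2 : -(cτ * b⁻¹ * cs ^ 2 * h * V) + τ * h * D / 2
      ≤ τ * h * (D + d.intK (fun x => d.α x * v x * d.stream v x)) := by
    have h1 : -(cs ^ 2 * V) + D / 2 ≤ D + d.intK (fun x => d.α x * v x * d.stream v x) := by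
      have : 0 ≤ cs ^ 2 * V := by positivity
      linarith
    have h2 := mul_le_mul_of_nonneg_left h1 (mul_pos hτ0 hh).le
    have h3 := mul_le_mul_of_nonneg_right hτ1 (show 0 ≤ h * (cs ^ 2 * V) by positivity)
    linarith
  have hVs := mul_le_mul_of_nonneg_right hs1 hV0
  have hsum : α₀ / 8 * V + ε * Q + τ * h * D / 2 + 1 / 2 * (τ₂ * h ^ γ * T)
      ≤ d.intK (fun x => d.stream v x * v x) + d.intK (fun x => d.α x * v x * v x) + ε * Q
        + τ * h * (D + d.intK (fun x => d.α x * v x * d.stream v x)) + τ₂ * h ^ γ * T := by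
    linarith
  refine le_trans ?_ hsum
  have m1 : min (α₀ / 8) (1 / 2) ≤ α₀ / 8 := min_le_left _ _
  have m2 : min (α₀ / 8) (1 / 2) ≤ 1 / 2 := min_le_right _ _
  have k1 : 0 ≤ ε * Q := mul_nonneg hε hQ0
  have k2 : 0 ≤ τ * h * D := by positivity
  have k3 : 0 ≤ τ₂ * h ^ γ * T :=
    mul_nonneg (mul_nonneg (ht₀.le.trans hτ₂) (Real.rpow_nonneg hh.le γ)) hT0
  have n1 := mul_le_mul_of_nonneg_right m1 hV0
  have n2 := mul_le_mul_of_nonneg_right m2 k1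
  have n3 := mul_le_mul_of_nonneg_right m2 k2
  have n4 := mul_le_mul_of_nonneg_right m2 k3
  linarith

end Approx
end SurfaceFEM
end

noncomputable section
namespace SurfaceFEM

/-! ### The discrete problem -/

namespace DiscreteData
variable (d : DiscreteData)

/-- The space of continuous piecewise linear functions as a linear subspace. -/
def spaceSubmodule : Submodule ℝ (E3 → ℝ) where
  carrier := d.space
  zero_mem' := ⟨continuousOn_const, fun s _ => ⟨0, 0, fun x _ => by simp⟩, fun x _ => rfl⟩
  add_mem' := by
    rintro v w ⟨hv1, hv2, hv3⟩ ⟨hw1, hw2, hw3⟩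
    refine ⟨hv1.add hw1, fun s hs => ?_, fun x hx => by simp [hv3 x hx, hw3 x hx]⟩
    obtain ⟨g, c, hg⟩ := hv2 s hs
    obtain ⟨g', c', hg'⟩ := hw2 s hs
    refine ⟨g + g', c + c', fun x hx => ?_⟩
    rw [Pi.add_apply, hg x hx, hg' x hx, inner_add_left]; ring
  smul_mem' := by
    rintro r v ⟨hv1, hv2, hv3⟩
    refine ⟨hv1.const_smul r, fun s hs => ?_, fun x hx => by simp [hv3 x hx]⟩
    obtain ⟨g, c, hg⟩ := hv2 s hs
    refine ⟨r • g, r * c, fun x hx => ?_⟩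
    rw [Pi.smul_apply, hg x hx, real_inner_smul_left, smul_eq_mul]; ring

/-- A discrete function is determined by its values at the finitely many vertices of active
tetrahedra. -/
instance : FiniteDimensional ℝ d.spaceSubmodule := by
  classical
  set X : Finset E3 := d.finite_active.toFinset.biUnion id with hX
  let L : d.spaceSubmodule →ₗ[ℝ] (X → ℝ) :=
    { toFun := fun v x => v.1 x
      map_add' := fun _ _ => rfl
      map_smul' := fun _ _ => rfl }
  refine FiniteDimensional.of_injective L ((injective_iff_map_eq_zero L).2 fun v hv => ?_)
  obtain ⟨v, hv1, hv2, hv3⟩ := v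
  refine Subtype.ext (funext fun x => ?_)
  by_cases hx : x ∈ d.closedBulk
  · obtain ⟨s, hs, hxs⟩ := mem_iUnion₂.1 hx
    obtain ⟨g, c, hg⟩ := hv2 s hs
    have hz : ∀ y ∈ s, inner ℝ g y + c = 0 := fun y hy => by
      rw [← hg y (subset_convexHull ℝ _ hy)]
      exact congrFun hv ⟨y, Finset.mem_biUnion.2 ⟨s, d.finite_active.mem_toFinset.2 hs, hy⟩⟩
    have hconv : Convex ℝ {y : E3 | inner ℝ g y + c = 0} := by
      intro y hy z hz p q _ _ hpq
      simp only [mem_ofPred_eq] at hy hz ⊢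
      rw [inner_add_right, inner_smul_right, inner_smul_right]
      linear_combination p * hy + q * hz - c * hpq
    have := convexHull_min (fun y hy => hz y hy) hconv hxs
    change v x = 0
    rw [hg x hxs]; exact this
  · exact hv3 x hx

variable {d}

lemma tgrad_add (hd : d.IsDiscreteSurface) {v w : E3 → ℝ} (hv : v ∈ d.space) (hw : w ∈ d.space)
    {x : E3} (hx : x ∈ d.elementSet) : d.tgrad (v + w) x = d.tgrad v x + d.tgrad w x := by
  obtain ⟨K, hK, hxK⟩ := hx
  obtain ⟨m, s, hE⟩ := exists_elem hd hK
  obtain ⟨g, c, hg⟩ := hv.2.1 s hE.mem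
  obtain ⟨g', c', hg'⟩ := hw.2.1 s hE.mem
  rw [hE.tgrad_eq hg hxK, hE.tgrad_eq hg' hxK, hE.tgrad_eq (g := g + g') (c := c + c') ?_ hxK, map_add]
  intro y hy
  rw [Pi.add_apply, hg y hy, hg' y hy, inner_add_left]; ring

lemma tgrad_smul (hd : d.IsDiscreteSurface) {v : E3 → ℝ} (hv : v ∈ d.space) (r : ℝ)
    {x : E3} (hx : x ∈ d.elementSet) : d.tgrad (r • v) x = r • d.tgrad v x := by
  obtain ⟨K, hK, hxK⟩ := hx
  obtain ⟨m, s, hE⟩ := exists_elem hd hK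
  obtain ⟨g, c, hg⟩ := hv.2.1 s hE.mem
  rw [hE.tgrad_eq hg hxK, hE.tgrad_eq (g := r • g) (c := r * c) ?_ hxK, map_smul]
  intro y hy
  rw [Pi.smul_apply, hg y hy, real_inner_smul_left, smul_eq_mul]; ring

lemma stream_add (hd : d.IsDiscreteSurface) {v w : E3 → ℝ} (hv : v ∈ d.space) (hw : w ∈ d.space)
    {x : E3} (hx : x ∈ d.elementSet) : d.stream (v + w) x = d.stream v x + d.stream w x := by
  rw [stream, tgrad_add hd hv hw hx, inner_add_right]; rfl

lemma stream_smul (hd : d.IsDiscreteSurface) {v : E3 → ℝ} (hv : v ∈ d.space) (r : ℝ)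
    {x : E3} (hx : x ∈ d.elementSet) : d.stream (r • v) x = r * d.stream v x := by
  rw [stream, tgrad_smul hd hv r hx, inner_smul_right]; rfl

lemma nderiv_add {v w : E3 → ℝ} (hv : v ∈ d.space) (hw : w ∈ d.space)
    {x : E3} (hx : x ∈ d.bulk) : d.nderiv (v + w) x = d.nderiv v x + d.nderiv w x := by
  obtain ⟨s, hs, hxs⟩ := mem_iUnion₂.1 hx
  obtain ⟨g, c, hg⟩ := hv.2.1 s hs
  obtain ⟨g', c', hg'⟩ := hw.2.1 s hs
  rw [nderiv, nderiv, nderiv, gradient_eq_of_mem_openCell hg hxs, gradient_eq_of_mem_openCell hg' hxs,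
    gradient_eq_of_mem_openCell (g := g + g') (c := c + c') ?_ hxs, inner_add_right]
  intro y hy
  rw [Pi.add_apply, hg y hy, hg' y hy, inner_add_left]; ring

lemma nderiv_smul {v : E3 → ℝ} (hv : v ∈ d.space) (r : ℝ)
    {x : E3} (hx : x ∈ d.bulk) : d.nderiv (r • v) x = r * d.nderiv v x := by
  obtain ⟨s, hs, hxs⟩ := mem_iUnion₂.1 hx
  obtain ⟨g, c, hg⟩ := hv.2.1 s hs
  rw [nderiv, nderiv, gradient_eq_of_mem_openCell hg hxs,
    gradient_eq_of_mem_openCell (g := r • g) (c := r * c) ?_ hxs, inner_smul_right]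
  intro y hy
  rw [Pi.smul_apply, hg y hy, real_inner_smul_left, smul_eq_mul]; ring

lemma measurableSet_bulk : MeasurableSet d.bulk := by
  rw [bulk_eq]
  exact Finset.measurableSet_biUnion _ fun s _ => (isOpen_openCell s).measurableSet

lemma integrableOn_nderiv_mul (hd : d.IsDiscreteSurface) {v w : E3 → ℝ} (hv : v ∈ d.space)
    (hw : w ∈ d.space) : IntegrableOn (fun x => d.nderiv v x * d.nderiv w x) d.bulk := by
  rw [bulk_eq, integrableOn_finset_iUnion]
  intro s hs
  have hs := d.finite_active.mem_toFinset.1 hs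
  refine (integrableOn_const (measure_openCell_ne_top s)
    (C := inner ℝ (d.cellNormal s) (cellGrad v s) * inner ℝ (d.cellNormal s) (cellGrad w s))).congr_fun
    (fun x hx => ?_) (isOpen_openCell s).measurableSet
  simp only [nderiv_eq hd hv hs hx, nderiv_eq hd hw hs hx]

lemma intK_congr (hd : d.IsDiscreteSurface) {φ ψ : E3 → ℝ} (h : ∀ x ∈ d.elementSet, φ x = ψ x) :
    d.intK φ = d.intK ψ := setIntegral_congr_fun (measurableSet_elementSet hd) h

/-- The integrand of the form on the discrete surface. -/
def integrand (h ε τ₁ : ℝ) (v w : E3 → ℝ) (x : E3) : ℝ :=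
  d.stream v x * w x + d.α x * v x * w x + ε * inner ℝ (d.tgrad v x) (d.tgrad w x)
    + τ₁ * h * ((d.stream v x + d.α x * v x) * d.stream w x)

lemma piecewiseCont_integrand (hd : d.IsDiscreteSurface) (hc : d.IsCoefficients) (h ε τ₁ : ℝ)
    {v w : E3 → ℝ} (hv : v ∈ d.space) (hw : w ∈ d.space) :
    d.PiecewiseCont (integrand (d := d) h ε τ₁ v w) := by
  have pv := piecewiseCont_of_mem hd hv
  have pw := piecewiseCont_of_mem hd hw
  have gv := piecewiseCont_tgrad hd hv
  have gw := piecewiseCont_tgrad hd hw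
  have sv := hc.piecewiseCont_stream hd hv
  have sw := hc.piecewiseCont_stream hd hw
  have pa := hc.piecewiseCont_α.mul pv
  exact (((sv.mul pw).add (pa.mul pw)).add ((gv.inner gw).const_mul ε)).add
    (((sv.add pa).mul sw).const_mul (τ₁ * h))

/-- Collecting all surface terms under one integral reduces bilinearity to a pointwise identity on
the elements. -/
lemma form_eq (hd : d.IsDiscreteSurface) (hc : d.IsCoefficients) (h γ ε τ₁ τ₂ : ℝ)
    {v w : E3 → ℝ} (hv : v ∈ d.space) (hw : w ∈ d.space) :
    d.form h γ ε τ₁ τ₂ v w = d.intK (integrand (d := d) h ε τ₁ v w)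
      + τ₂ * h ^ γ * d.intT (fun x => d.nderiv v x * d.nderiv w x) := by
  have pv := piecewiseCont_of_mem hd hv
  have pw := piecewiseCont_of_mem hd hw
  have gv := piecewiseCont_tgrad hd hv
  have gw := piecewiseCont_tgrad hd hw
  have sv := hc.piecewiseCont_stream hd hv
  have sw := hc.piecewiseCont_stream hd hw
  have pa := hc.piecewiseCont_α.mul pv
  have p1 := (sv.mul pw).add (pa.mul pw)
  have p2 := (gv.inner gw).const_mul ε
  have p3 := ((sv.add pa).mul sw).const_mul (τ₁ * h)
  rw [form, formA, formS1, formS2, ← intK_add hd (sv.mul pw) (pa.mul pw), ← intK_const_mul,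
    ← intK_add hd p1 p2, ← intK_const_mul, ← intK_add hd (p1.add p2) p3]
  rfl

/-- The form as a bilinear map on the discrete space. -/
def bilin (hd : d.IsDiscreteSurface) (hc : d.IsCoefficients) (h γ ε τ₁ τ₂ : ℝ) :
    d.spaceSubmodule →ₗ[ℝ] d.spaceSubmodule →ₗ[ℝ] ℝ :=
  LinearMap.mk₂ ℝ (fun v w => d.form h γ ε τ₁ τ₂ v.1 w.1)
    (by
      intro v v' w
      have hvw := integrableOn_nderiv_mul hd v.2 w.2
      have hvw' := integrableOn_nderiv_mul hd v'.2 w.2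
      rw [form_eq hd hc _ _ _ _ _ (v + v').2 w.2, form_eq hd hc _ _ _ _ _ v.2 w.2,
        form_eq hd hc _ _ _ _ _ v'.2 w.2]
      have e1 := intK_add hd (piecewiseCont_integrand hd hc h ε τ₁ v.2 w.2)
        (piecewiseCont_integrand hd hc h ε τ₁ v'.2 w.2)
      have e2 : d.intT (fun x => d.nderiv (v + v').1 x * d.nderiv w.1 x) = _ :=
        (setIntegral_congr_fun measurableSet_bulk fun x hx => by
          rw [Submodule.coe_add, nderiv_add v.2 v'.2 hx, add_mul]).trans (integral_add hvw hvw')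
      rw [e2, intK_congr hd (ψ := fun x => integrand (d := d) h ε τ₁ v.1 w.1 x
        + integrand (d := d) h ε τ₁ v'.1 w.1 x) ?_, e1]
      · simp only [intT]; ring
      · intro x hx
        rw [Submodule.coe_add, integrand, stream_add hd v.2 v'.2 hx, tgrad_add hd v.2 v'.2 hx,
          Pi.add_apply, inner_add_left, integrand, integrand]
        ring)
    (by
      intro r v w
      rw [form_eq hd hc _ _ _ _ _ (r • v).2 w.2, form_eq hd hc _ _ _ _ _ v.2 w.2]
      have e2 : d.intT (fun x => d.nderiv (r • v).1 x * d.nderiv w.1 x) = _ :=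
        (setIntegral_congr_fun measurableSet_bulk fun x hx => by
          rw [Submodule.coe_smul, nderiv_smul v.2 r hx, mul_assoc]).trans
        (integral_const_mul r (fun x => d.nderiv v.1 x * d.nderiv w.1 x))
      rw [e2, intK_congr hd (ψ := fun x => r * integrand (d := d) h ε τ₁ v.1 w.1 x) ?_, intK_const_mul]
      · simp only [intT, smul_eq_mul]; ring
      · intro x hx
        rw [Submodule.coe_smul, integrand, stream_smul hd v.2 r hx, tgrad_smul hd v.2 r hx,
          Pi.smul_apply, real_inner_smul_left, integrand, smul_eq_mul]
        ring)
    (by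
      intro v w w'
      have hvw := integrableOn_nderiv_mul hd v.2 w.2
      have hvw' := integrableOn_nderiv_mul hd v.2 w'.2
      rw [form_eq hd hc _ _ _ _ _ v.2 (w + w').2, form_eq hd hc _ _ _ _ _ v.2 w.2,
        form_eq hd hc _ _ _ _ _ v.2 w'.2]
      have e1 := intK_add hd (piecewiseCont_integrand hd hc h ε τ₁ v.2 w.2)
        (piecewiseCont_integrand hd hc h ε τ₁ v.2 w'.2)
      have e2 : d.intT (fun x => d.nderiv v.1 x * d.nderiv (w + w').1 x) = _ :=
        (setIntegral_congr_fun measurableSet_bulk fun x hx => by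
          rw [Submodule.coe_add, nderiv_add w.2 w'.2 hx, mul_add]).trans (integral_add hvw hvw')
      rw [e2, intK_congr hd (ψ := fun x => integrand (d := d) h ε τ₁ v.1 w.1 x
        + integrand (d := d) h ε τ₁ v.1 w'.1 x) ?_, e1]
      · simp only [intT]; ring
      · intro x hx
        rw [Submodule.coe_add, integrand, stream_add hd w.2 w'.2 hx, tgrad_add hd w.2 w'.2 hx,
          Pi.add_apply, inner_add_right, integrand, integrand]
        ring)
    (by
      intro r v w
      rw [form_eq hd hc _ _ _ _ _ v.2 (r • w).2, form_eq hd hc _ _ _ _ _ v.2 w.2]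
      have e2 : d.intT (fun x => d.nderiv v.1 x * d.nderiv (r • w).1 x) = _ :=
        (setIntegral_congr_fun measurableSet_bulk fun x hx => by
          rw [Submodule.coe_smul, nderiv_smul w.2 r hx, mul_left_comm]).trans
        (integral_const_mul r (fun x => d.nderiv v.1 x * d.nderiv w.1 x))
      rw [e2, intK_congr hd (ψ := fun x => r * integrand (d := d) h ε τ₁ v.1 w.1 x) ?_, intK_const_mul]
      · simp only [intT, smul_eq_mul]; ring
      · intro x hx
        rw [Submodule.coe_smul, integrand, stream_smul hd w.2 r hx, tgrad_smul hd w.2 r hx,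
          Pi.smul_apply, inner_smul_right, integrand, smul_eq_mul]
        ring)

/-- A coercive discrete problem is uniquely solvable. -/
theorem existsUnique_form_eq (hd : d.IsDiscreteSurface) (hc : d.IsCoefficients) {h γ ε τ₁ τ₂ : ℝ}
    (hpos : ∀ v ∈ d.space, d.form h γ ε τ₁ τ₂ v v = 0 → v = 0) (L : d.spaceSubmodule →ₗ[ℝ] ℝ) :
    ∃! u : E3 → ℝ, u ∈ d.space ∧ ∀ w, ∀ hw : w ∈ d.space, d.form h γ ε τ₁ τ₂ u w = L ⟨w, hw⟩ := by
  set B := bilin hd hc h γ ε τ₁ τ₂ with hB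
  have hinj : Function.Injective B := (injective_iff_map_eq_zero B).2 fun v hv => by
    have := congrArg (fun l => l v) hv
    exact Subtype.ext (hpos v.1 v.2 this)
  have hsurj : Function.Surjective B :=
    (LinearMap.injective_iff_surjective_of_finrank_eq_finrank
      (Subspace.dual_finrank_eq (K := ℝ) (V := d.spaceSubmodule)).symm).1 hinj
  obtain ⟨u, hu⟩ := hsurj L
  refine ⟨u.1, ⟨u.2, fun w hw => congrArg (fun l => l ⟨w, hw⟩) hu⟩, ?_⟩
  rintro u' ⟨hu', hL⟩
  have : B ⟨u', hu'⟩ = B u := by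
    rw [hu]
    exact LinearMap.ext fun w => hL w.1 w.2
  exact congrArg Subtype.val (hinj this)

end DiscreteData
end SurfaceFEM
end

/-! ### The right-hand side and unique solvability -/

noncomputable section
namespace SurfaceFEM

namespace DiscreteData
variable {d : DiscreteData}

lemma PiecewiseCont.memLp (hd : d.IsDiscreteSurface) {φ : E3 → ℝ} (hφ : d.PiecewiseCont φ) :
    MemLp φ 2 (μHE[2].restrict d.elementSet) :=
  (memLp_two_iff_integrable_sq (hφ.integrableOn hd).aestronglyMeasurable).2 ((hφ.pow 2).integrableOn hd)

/-- The right hand side as a linear functional on the discrete space. -/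
def rhsFunctional (hd : d.IsDiscreteSurface) (hc : d.IsCoefficients) (h τ₁ : ℝ) {fe : E3 → ℝ}
    (hf : MemLp fe 2 (μHE[2].restrict d.elementSet)) : d.spaceSubmodule →ₗ[ℝ] ℝ where
  toFun w := d.rhs h τ₁ fe w.1
  map_add' := by
    intro v w
    have i1 := hf.integrable_mul ((piecewiseCont_of_mem hd v.2).memLp hd)
    have i2 := hf.integrable_mul ((piecewiseCont_of_mem hd w.2).memLp hd)
    have i3 := hf.integrable_mul ((hc.piecewiseCont_stream hd v.2).memLp hd)
    have i4 := hf.integrable_mul ((hc.piecewiseCont_stream hd w.2).memLp hd)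
    have e1 : d.intK (fun x => fe x * (v + w).1 x) = _ :=
      (intK_congr hd (ψ := fun x => fe x * v.1 x + fe x * w.1 x) fun x _ => by
        rw [Submodule.coe_add, Pi.add_apply, mul_add]).trans (integral_add i1 i2)
    have e2 : d.intK (fun x => fe x * d.stream (v + w).1 x) = _ :=
      (intK_congr hd (ψ := fun x => fe x * d.stream v.1 x + fe x * d.stream w.1 x) fun x hx => by
        rw [Submodule.coe_add, stream_add hd v.2 w.2 hx, mul_add]).trans (integral_add i3 i4)
    rw [rhs, rhs, rhs, e1, e2]
    simp only [intK]; ring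
  map_smul' := by
    intro r v
    have e1 : d.intK (fun x => fe x * (r • v).1 x) = _ :=
      (intK_congr hd (ψ := fun x => r * (fe x * v.1 x)) fun x _ => by
        rw [Submodule.coe_smul, Pi.smul_apply, smul_eq_mul, mul_left_comm]).trans (intK_const_mul r _)
    have e2 : d.intK (fun x => fe x * d.stream (r • v).1 x) = _ :=
      (intK_congr hd (ψ := fun x => r * (fe x * d.stream v.1 x)) fun x hx => by
        rw [Submodule.coe_smul, stream_smul hd v.2 r hx, mul_left_comm]).trans (intK_const_mul r _)
    rw [rhs, rhs, e1, e2, RingHom.id_apply, smul_eq_mul]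
    ring

end DiscreteData

namespace Approx
variable {S : SmoothClosedSurface} {δ M h : ℝ} {d : DiscreteData} (A : Approx S δ M d h)
include A

/-- On an element the inverse of p is 2-Lipschitz, so it enlarges two dimensional Hausdorff measure
by at most the factor 4. -/
lemma measure_inter_preimage_le {K : Set E3} (hK : K ∈ d.elements) (Z : Set E3) :
    μHE[2] (K ∩ S.proj ⁻¹' Z) ≤ 4 * μHE[2] (Z ∩ S.surf) := by
  have hKs : K ⊆ d.surf := subset_closure.trans (A.closure_subset_surf hK)
  have hlip : LipschitzOnWith 2 (d.foot S) (S.proj '' (K ∩ S.proj ⁻¹' Z)) := by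
    refine LipschitzOnWith.of_dist_le_mul ?_
    rintro _ ⟨a, ha, rfl⟩ _ ⟨b, hb, rfl⟩
    rw [A.foot_eq_of_mem (hKs ha.1) (SmoothClosedSurface.TubeReg.proj_proj a).symm, A.foot_eq_of_mem (hKs hb.1) (SmoothClosedSurface.TubeReg.proj_proj b).symm,
      dist_eq_norm, dist_eq_norm]
    exact A.norm_sub_le_norm_proj_sub hK (subset_closure ha.1) (subset_closure hb.1)
  have h1 := hlip.hausdorffMeasure_image_le (d := 2) zero_le_two
  have h2 : d.foot S '' (S.proj '' (K ∩ S.proj ⁻¹' Z)) = K ∩ S.proj ⁻¹' Z := by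
    rw [image_image]
    refine (image_congr fun a ha => ?_).trans (image_id _)
    rw [A.foot_eq_of_mem (hKs ha.1) (SmoothClosedSurface.TubeReg.proj_proj a).symm, id]
  rw [h2] at h1
  have h3 : S.proj '' (K ∩ S.proj ⁻¹' Z) ⊆ Z ∩ S.surf := by
    rintro _ ⟨a, ha, rfl⟩
    exact ⟨ha.2, S.proj_mem_surf a⟩
  have h4 := h1.trans (mul_le_mul_right (measure_mono h3) _)
  have e : ((2 : NNReal) : ℝ≥0∞) ^ (2 : ℝ) = 4 := by
    rw [ENNReal.coe_ofNat, ENNReal.rpow_ofNat]; norm_num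
  rw [e] at h4
  rw [Measure.euclideanHausdorffMeasure_def, Measure.smul_apply, Measure.smul_apply, mul_smul_comm]
  exact smul_le_smul_of_nonneg_left (by exact_mod_cast h4) zero_le

/-- Used to transfer square integrability from Γ to Γ_h. The constant grows with the number of
elements, but only its finiteness matters. -/
lemma map_proj_le : ∃ C : ℝ≥0∞, C ≠ ⊤ ∧
    (μHE[2].restrict d.elementSet).map S.proj ≤ C • μHE[2].restrict S.surf := by
  have hem := DiscreteData.measurableSet_elementSet A.surface
  have hp : AEMeasurable S.proj (μHE[2].restrict d.elementSet) :=
    (A.tube.continuousOn_proj.mono A.elementSet_subset_tube).aemeasurable hem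
  refine ⟨d.finite_elements.toFinset.card * 4, ENNReal.mul_ne_top (ENNReal.natCast_ne_top _) (by simp),
    Measure.le_iff.2 fun Z hZ => ?_⟩
  rw [Measure.map_apply_of_aemeasurable hp hZ, Measure.restrict_apply₀ (hp.nullMeasurableSet_preimage hZ),
    Measure.smul_apply, Measure.restrict_apply hZ, smul_eq_mul, mul_assoc, DiscreteData.elementSet_eq,
    inter_iUnion₂]
  refine (measure_biUnion_finset_le _ _).trans ?_
  rw [← nsmul_eq_mul]
  refine Finset.sum_le_card_nsmul _ _ _ fun K hK => ?_
  rw [inter_comm]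
  exact A.measure_inter_preimage_le (d.finite_elements.mem_toFinset.1 hK) Z

lemma memLp_comp_proj {f : E3 → ℝ} (hf : MemLp f 2 (μHE[2].restrict S.surf)) :
    MemLp (f ∘ S.proj) 2 (μHE[2].restrict d.elementSet) := by
  obtain ⟨C, hC, hle⟩ := A.map_proj_le
  exact (hf.of_measure_le_smul hC hle).comp_of_map
    ((A.tube.continuousOn_proj.mono A.elementSet_subset_tube).aemeasurable
      (DiscreteData.measurableSet_elementSet A.surface))

/-- Vanishing almost everywhere on the elements is transported to the tube, where the normal
extension of v is continuous on an open set and therefore vanishes identically. This also reaches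
points of Γ_h outside the elements. -/
lemma eq_zero_on_surf {v : E3 → ℝ} (hv : v ∈ d.space) (hV : d.intK (fun x => v x ^ 2) = 0) :
    ∀ y ∈ d.surf, v y = 0 := by
  have hd := A.surface
  have hem := DiscreteData.measurableSet_elementSet hd
  have hJ : Ioo (-δ) δ ⊆ Ioo (-δ) δ := Subset.rfl
  have htube : S.sdist ⁻¹' Ioo (-δ) δ = S.tube δ := by
    ext x; exact abs_lt.symm
  have hc := A.continuousOn_comp_foot hv
  have hsm : MeasurableSet (S.tube δ) := (S.isOpen_tube δ).measurableSet
  have h1 := A.integral_shell_mul measurableSet_Ioo hJ (G := fun x => v (d.foot S x) ^ 2)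
    (by rw [htube]; exact (hc.pow 2).aestronglyMeasurable hsm) (a := fun y => v y ^ 2)
    (b := fun _ => 1) (by
      intro y hy t ht
      simp only [A.foot_fiber (DiscreteData.elementSet_subset hd hy) (abs_lt.2 ht), mul_one])
  have h2 : (fun y => v y ^ 2) =ᵐ[μHE[2].restrict d.elementSet] 0 :=
    (integral_eq_zero_iff_of_nonneg (fun y => sq_nonneg _)
      (((DiscreteData.piecewiseCont_of_mem hd hv).pow 2).integrableOn hd)).1 hV
  have h3 : ∫ y in d.elementSet, S.absDetB (d.normal y) y * v y ^ 2 ∂μHE[2] = 0 := by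
    refine integral_eq_zero_of_ae ?_
    filter_upwards [h2] with y hy
    have : v y ^ 2 = 0 := hy
    rw [this, mul_zero]; rfl
  rw [h3, zero_mul, htube] at h1
  have hjac : ContinuousOn S.jac (S.tube δ) := fun x hx =>
    (A.tube.contDiffAt_jac hx).continuousAt.continuousWithinAt
  have h4 : IntegrableOn (fun x => S.jac x * v (d.foot S x) ^ 2) (S.tube δ) := by
    refine (A.integrableOn_sq_foot hv hsm Subset.rfl).bdd_mul (c := 2) (hjac.aestronglyMeasurable hsm) ?_
    filter_upwards [ae_restrict_mem hsm] with x hx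
    have := A.tube.jac_ge x hx
    rw [Real.norm_eq_abs, abs_of_nonneg (by linarith)]
    exact A.tube.jac_le x hx
  have h5 : (fun x => S.jac x * v (d.foot S x) ^ 2) =ᵐ[volume.restrict (S.tube δ)] fun _ => 0 := by
    refine (integral_eq_zero_iff_of_nonneg_ae ?_ h4).1 h1
    filter_upwards [ae_restrict_mem hsm] with x hx
    exact mul_nonneg ((by norm_num : (0 : ℝ) ≤ 1 / 2).trans (A.tube.jac_ge x hx)) (sq_nonneg _)
  have h6 := Measure.eqOn_open_of_ae_eq h5 (S.isOpen_tube δ) (hjac.mul (hc.pow 2)) continuousOn_const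
  intro y hy
  have h7 := h6 (A.subset_tube hy)
  have := A.tube.jac_ge y (A.subset_tube hy)
  simp only [A.foot_of_mem hy] at h7
  rcases mul_eq_zero.1 h7 with h8 | h8
  · linarith
  · exact pow_eq_zero_iff (two_ne_zero) |>.1 h8

/-- A discrete function whose `L²` norm and normal gradient vanish is zero. -/
lemma eq_zero_of_intK_eq_zero {v : E3 → ℝ} (hv : v ∈ d.space) (hV : d.intK (fun x => v x ^ 2) = 0)
    (hT : d.intT (fun x => d.nderiv v x ^ 2) = 0) : v = 0 := by
  have h1 := A.gradSum_le hv
  rw [hV, hT, mul_zero, mul_zero, add_zero, mul_zero] at h1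
  have h2 : d.gradSum v ≤ 0 := nonpos_of_mul_nonpos_right h1 (pow_pos A.h_pos 5)
  have h3 : ∀ s ∈ d.active, DiscreteData.cellGrad v s = 0 := by
    intro s hs
    have := (Finset.single_le_sum (f := fun s => ‖DiscreteData.cellGrad v s‖ ^ 2)
      (fun _ _ => sq_nonneg _) (d.finite_active.mem_toFinset.2 hs)).trans h2
    exact norm_eq_zero.1 (pow_eq_zero_iff (two_ne_zero) |>.1 (le_antisymm this (sq_nonneg _)))
  funext x
  by_cases hx : x ∈ d.closedBulk
  · obtain ⟨s, hs, hxs⟩ := mem_iUnion₂.1 hx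
    obtain ⟨y, hy, hys⟩ := hs.2
    have h4 := DiscreteData.sub_eq_inner hv hs hxs hy
    rw [h3 s hs, inner_zero_left, A.eq_zero_on_surf hv hV y hys, sub_zero] at h4
    exact h4
  · exact hv.2.2 x hx

/-- Unique solvability of the discrete problem. -/
theorem existsUnique_solution (hc : d.IsCoefficients) {γ ε τ₁ τ₂ c : ℝ} (hc0 : 0 < c) (hε : 0 ≤ ε)
    (hτ₁ : 0 ≤ τ₁) (hτ₂ : 0 < τ₂)
    (hcoer : ∀ v ∈ d.space, c * d.normSq h γ ε τ₁ τ₂ v ≤ d.form h γ ε τ₁ τ₂ v v)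
    {f : E3 → ℝ} (hf : MemLp f 2 (μHE[2].restrict S.surf)) :
    ∃! u : E3 → ℝ, u ∈ d.space ∧ ∀ w ∈ d.space,
      d.form h γ ε τ₁ τ₂ u w = d.rhs h τ₁ (f ∘ S.proj) w := by
  refine DiscreteData.existsUnique_form_eq A.surface hc (fun v hv h0 => ?_)
    (DiscreteData.rhsFunctional A.surface hc h τ₁ (A.memLp_comp_proj hf))
  have h1 := hcoer v hv
  rw [h0] at h1
  have hn := nonpos_of_mul_nonpos_right h1 hc0
  have hh := A.h_pos
  have k1 : 0 ≤ d.intK (fun x => v x ^ 2) := DiscreteData.intK_nonneg fun x => sq_nonneg _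
  have k2 : 0 ≤ d.intK (fun x => ‖d.tgrad v x‖ ^ 2) := DiscreteData.intK_nonneg fun x => sq_nonneg _
  have k3 : 0 ≤ d.intK (fun x => d.stream v x ^ 2) := DiscreteData.intK_nonneg fun x => sq_nonneg _
  have k4 := d.intT_nderiv_nonneg v
  have k5 := mul_pos hτ₂ (Real.rpow_pos_of_pos hh γ)
  rw [DiscreteData.normSq] at hn
  have m2 := mul_nonneg hε k2
  have m3 := mul_nonneg (mul_nonneg hτ₁ hh.le) k3
  have m4 := mul_nonneg k5.le k4
  refine A.eq_zero_of_intK_eq_zero hv (by linarith) (le_antisymm ?_ k4)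
  exact nonpos_of_mul_nonpos_right (by linarith) k5

end Approx
end SurfaceFEM
end

noncomputable section
namespace SurfaceFEM

/-! ### The family of discrete problems -/

lemma SmoothClosedSurface.TubeBound.mono_right {S : SmoothClosedSurface} {δ M M' : ℝ}
    (hT : S.TubeBound δ M) (h : M ≤ M') : S.TubeBound δ M' where
  toTubeReg := hT.toTubeReg
  one_le := hT.one_le.trans h
  normal_lip x hx y hy :=
    (hT.normal_lip x hx y hy).trans (mul_le_mul_of_nonneg_right h (norm_nonneg _))
  curv_le x hx := (hT.curv_le x hx).trans h
  jac_ge := hT.jac_ge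
  jac_le := hT.jac_le

lemma exists_mul_rpow_le (K : ℝ) {p e : ℝ} (hp : 0 < p) (he : 0 < e) :
    ∃ r > 0, ∀ h ∈ Ioc (0 : ℝ) r, K * h ^ p ≤ e := by
  have h1 : Tendsto (fun h : ℝ => K * h ^ p) (𝓝 0) (𝓝 0) := by
    have := ((Real.continuousAt_rpow_const (0 : ℝ) p (Or.inr hp.le)).const_mul K).tendsto
    rwa [Real.zero_rpow hp.ne', mul_zero] at this
  obtain ⟨r, hr, h2⟩ := Metric.eventually_nhds_iff.1 (h1.eventually (gt_mem_nhds he))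
  refine ⟨r / 2, half_pos hr, fun h hh => (h2 ?_).le⟩
  rw [Real.dist_eq, sub_zero, abs_of_pos hh.1]
  linarith [hh.2]

lemma IsCoefficients.supNorm_pos {S : SmoothClosedSurface} {δ : ℝ} (hδ : 0 < δ) {α : E3 → ℝ}
    {β : E3 → E3} (hc : IsCoefficients S δ α β) : 0 < S.supNorm β := by
  have h1 : ContinuousOn β S.surf :=
    (hc.smooth_β.continuousOn.mono (S.surf_subset_tube hδ)).congr fun x hx => by
      rw [Function.comp_apply, S.proj_of_mem hx]
  obtain ⟨x, hx, hne⟩ := hc.nonzero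
  exact (norm_pos_iff.2 hne).trans_le
    (le_csSup (S.isCompact_surf.image_of_continuousOn h1.norm).bddAbove ⟨x, hx, rfl⟩)

/-- For small h the bound |ρ| ≲ h² places Γ_h in the smaller tube on which all geometric bounds
hold, and a single M majorises every constant of the assumptions. -/
lemma exists_approx {S : SmoothClosedSurface} {δ₀ δ M₀ : ℝ} (hT : S.TubeBound δ M₀) (hδ : δ ≤ δ₀)
    (hδ1 : δ ≤ 1) {Ω₀ : Set E3} (htube : S.tube δ₀ ⊆ Ω₀) {hmax : ℝ} {d : ℝ → DiscreteData}
    (hpart : ∀ h ∈ Set.Ioc 0 hmax, (d h).mesh.Partitions Ω₀)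
    (hshape : ShapeRegular (fun h => (d h).mesh) hmax)
    (hquasi : QuasiUniform (fun h => (d h).mesh) hmax)
    (hsurf : ∀ h ∈ Set.Ioc 0 hmax, (d h).IsDiscreteSurface)
    (hA : AssumptionA S δ₀ d hmax) :
    ∃ M r : ℝ, 0 < r ∧ ∀ h ∈ Ioc 0 hmax, h ≤ r → Approx S δ M (d h) h := by
  obtain ⟨σ, hσ, hball⟩ := hshape
  obtain ⟨c₁, c₂, hc₁, hc₂, hdiam⟩ := hquasi
  obtain ⟨cd, hcd⟩ := hA.dist_le
  obtain ⟨cn, hcn⟩ := hA.normal_le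
  have hM₀ := hT.one_le
  -- The last bound serves the inscribed balls: their radius is at least σ c₁ h ≥ h/M.
  obtain ⟨M, hMM₀, hMd, hMn, hMc, hMσ⟩ : ∃ M, M₀ ≤ M ∧ cd ≤ M ∧ cn ≤ M ∧ c₂ ≤ M ∧ 1 / (σ * c₁) ≤ M :=
    ⟨max (max (max M₀ cd) (max cn c₂)) (1 / (σ * c₁)), by simp, by simp, by simp, by simp,
      le_max_right _ _⟩
  have hM1 : 1 ≤ M := hM₀.trans hMM₀
  have hM0 : 0 < M := zero_lt_one.trans_le hM1
  have hδ0 := hT.pos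
  refine ⟨M, δ / (1000000000 * M ^ 8), by positivity, fun h hh hr => ?_⟩
  have hh0 : 0 < h := hh.1
  have hsmall : 1000000000 * M ^ 8 * h ≤ δ := by
    rwa [le_div_iff₀ (by positivity), mul_comm] at hr
  have hM8 : 1 ≤ M ^ 8 := one_le_pow₀ hM1
  have hMM : M ≤ M ^ 8 := le_self_pow₀ hM1 (by norm_num)
  have hdist : ∀ x ∈ (d h).surf, |S.sdist x| ≤ M * h ^ 2 := fun x hx =>
    (hcd h hh x hx).trans (mul_le_mul_of_nonneg_right hMd (sq_nonneg _))
  have hle : ∀ s ∈ (d h).mesh.cells, ∀ x ∈ closedCell s, ∀ y ∈ closedCell s, dist x y ≤ M * h := by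
    intro s hs x hx y hy
    have hb : Bornology.IsBounded (closedCell s) := (s.finite_toSet.isCompact_convexHull ℝ).isBounded
    refine (Metric.dist_le_diam_of_mem hb hx hy).trans ((hdiam h hh s hs).2.trans ?_)
    exact mul_le_mul_of_nonneg_right hMc hh0.le
  refine ⟨hT.mono_right hMM₀, hδ1, hh0, hsmall, hsurf h hh, fun x hx => ?_,
    hA.bijOn h hh, hdist, fun x hx => ?_, hle, fun s hs => ?_, ?_⟩
  · have h1 := mul_le_mul_of_nonneg_right hMM hh0.le
    have h2 : h ≤ M ^ 8 * h := le_mul_of_one_le_left hh0.le hM8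
    have h3 : M * h ^ 2 ≤ M * h := by
      have : h ^ 2 ≤ h := by nlinarith
      exact mul_le_mul_of_nonneg_left this hM0.le
    have h4 := hdist x hx
    change |S.sdist x| < δ
    linarith
  · exact (hcn h hh x hx).trans (mul_le_mul_of_nonneg_right hMn hh0.le)
  · obtain ⟨z, hz⟩ := hball h hh s hs
    refine ⟨z, (Metric.ball_subset_ball ?_).trans hz⟩
    have h1 := (div_le_iff₀ (mul_pos hσ hc₁)).1 hMσ
    rw [div_le_iff₀ hM0]
    have h2 := mul_le_mul_of_nonneg_left (hdiam h hh s hs).1 (mul_nonneg hσ.le hM0.le)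
    have h3 := mul_le_mul_of_nonneg_right h1 hh0.le
    linarith
  · have h1 := hpart h hh
    rw [TetMesh.Partitions] at h1
    rw [h1]
    exact (S.tube_mono hδ).trans (htube.trans subset_closure)

end SurfaceFEM
end

/-! ### Choice of the constants and proof of the theorem -/

open SurfaceFEM
theorem mainTheorem3
    -- the surface, its tubular neighbourhood, and the coefficients
    (S : SmoothClosedSurface) (δ₀ : ℝ) (hδ₀ : 0 < δ₀) (hproj : S.UniqueProj δ₀)
    (α : E3 → ℝ) (β : E3 → E3) (hcoeff : IsCoefficients S δ₀ α β)
    -- the family of meshes, discrete surfaces and discrete coefficients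
    (Ω₀ : Set E3) (hΩ₀ : IsOpen Ω₀) (hΩ₀c : IsConnected Ω₀) (htube : S.tube δ₀ ⊆ Ω₀)
    (hmax : ℝ) (hmax_pos : 0 < hmax) (d : ℝ → DiscreteData)
    (hpart : ∀ h ∈ Set.Ioc 0 hmax, (d h).mesh.Partitions Ω₀)
    (hshape : ShapeRegular (fun h => (d h).mesh) hmax)
    (hquasi : QuasiUniform (fun h => (d h).mesh) hmax)
    (hsurf : ∀ h ∈ Set.Ioc 0 hmax, (d h).IsDiscreteSurface)
    (hA : AssumptionA S δ₀ d hmax)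
    (a : ℝ) (hB : AssumptionB d hmax a)
    (hC : AssumptionC S α β d hmax)
    -- the parameters of the method
    (cτ : ℝ) (hcτ : 0 < cτ) (γ : ℝ) (hγ : γ < 2) (t₀ : ℝ) (ht₀ : 0 < t₀) :
    ∃ C D c : ℝ, 0 < C ∧ 0 < D ∧ 0 < c ∧
      -- coercivity
      (∀ h₀ ∈ Set.Ioc 0 hmax, ∀ h ∈ Set.Ioc 0 h₀, ∀ ε : ℝ, 0 ≤ ε → ∀ τ₂ : ℝ, t₀ ≤ τ₂ →
        ∀ v ∈ (d h).space,
          c * (min 1 (min (a - C * h₀) (1 - D * h₀ ^ (2 - γ))) *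
              (d h).normSq h γ ε (tauOne cτ (S.supNorm β) ε h) τ₂ v)
            ≤ (d h).form h γ ε (tauOne cτ (S.supNorm β) ε h) τ₂ v v) ∧
      ∃ h₁ ∈ Set.Ioc 0 hmax,
        -- positivity of the coercivity constant
        (∀ h₀ ∈ Set.Ioc 0 h₁, 0 < min 1 (min (a - C * h₀) (1 - D * h₀ ^ (2 - γ)))) ∧
        -- existence and uniqueness of the discrete solution
        ∀ h ∈ Set.Ioc 0 h₁, ∀ ε : ℝ, 0 ≤ ε → ∀ τ₂ : ℝ, t₀ ≤ τ₂ →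
          ∀ f : E3 → ℝ, MeasureTheory.MemLp f 2
              ((MeasureTheory.Measure.euclideanHausdorffMeasure 2).restrict S.surf) →
            ∃! u : E3 → ℝ, u ∈ (d h).space ∧ ∀ w ∈ (d h).space,
              (d h).form h γ ε (tauOne cτ (S.supNorm β) ε h) τ₂ u w
                = (d h).rhs h (tauOne cτ (S.supNorm β) ε h) (f ∘ S.proj) w := by
  obtain ⟨δ₁, hδ₁, hT₁⟩ := S.exists_tubeReg δ₀ hδ₀
  obtain ⟨δ₂, M₀, hδ₂, hT₂⟩ := hT₁.exists_bound
  obtain ⟨δ₃, α₀, Y, hδ₃, hδ₃', hα₀, hY⟩ :=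
    SmoothClosedSurface.exists_transportField hT₂.toTubeReg (hδ₂.trans hδ₁) hcoeff
  set δ := min δ₃ 1 with hδ
  have hδpos : 0 < δ := lt_min hδ₃ one_pos
  have hδle : δ ≤ δ₂ := (min_le_left _ _).trans hδ₃'
  have hδ0 : δ ≤ δ₀ := hδle.trans (hδ₂.trans hδ₁)
  have hY := hY.mono (min_le_left δ₃ 1)
  obtain ⟨M, r₀, hr₀, hApprox⟩ := exists_approx (hT₂.mono hδpos hδle) hδ0 (min_le_right _ _) htube
    hpart hshape hquasi hsurf hA
  have hαc := hcoeff.smooth_α.continuousOn.mono (S.tube_mono hδ0)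
  have hβc := hcoeff.smooth_β.continuousOn.mono (S.tube_mono hδ0)
  have hb := hcoeff.supNorm_pos hδ₀
  set b := S.supNorm β with hbd
  obtain ⟨cs', hcs'⟩ := hC.stable
  obtain ⟨cβ, hcβ⟩ := hC.approx_β
  obtain ⟨cα, hcα⟩ := hC.approx_α
  set cs := |cs'| with hcs
  set k := |cβ| + |cα| with hk
  have hk0 : 0 ≤ k := by positivity
  have hcs0 : 0 ≤ cs := abs_nonneg _
  have hst : ∀ h ∈ Set.Ioc 0 hmax, ∀ x ∈ (d h).elementSet, |(d h).α x| ≤ cs ∧ ‖(d h).β x‖ ≤ cs :=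
    fun h hh x hx => ⟨(hcs' h hh x hx).1.trans (le_abs_self _), (hcs' h hh x hx).2.trans (le_abs_self _)⟩
  obtain ⟨r₁, hr₁, hs₁⟩ := exists_mul_rpow_le
    (2 * k * (2 + 2 ^ 67 * M ^ 22) + cτ * b⁻¹ * cs ^ 2) one_pos (show 0 < α₀ / 8 by positivity)
  obtain ⟨r₂, hr₂, hs₂⟩ := exists_mul_rpow_le (2 * k * (2 ^ 67 * M ^ 22)) (sub_pos.2 hγ)
    (half_pos ht₀)
  obtain ⟨r₃, hr₃, hs₃⟩ := exists_mul_rpow_le 1 (sub_pos.2 hγ) (show (0 : ℝ) < 1 / 2 by norm_num)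
  -- Below H the geometric assumptions hold with constant M, and the O(h) and O(h^(2-γ)) errors are
  -- small enough for genuine coercivity with constant c.
  set H := min (min hmax r₀) (min r₁ r₂) with hH
  have hH0 : 0 < H := lt_min (lt_min hmax_pos hr₀) (lt_min hr₁ hr₂)
  set c := min (α₀ / 8) (1 / 2) with hc
  have hc0 : 0 < c := lt_min (by positivity) (by norm_num)
  have hsmall : ∀ h ∈ Set.Ioc 0 H, h ∈ Set.Ioc 0 hmax ∧ Approx S δ M (d h) h ∧
      ∀ ε : ℝ, 0 ≤ ε → ∀ τ₂ : ℝ, t₀ ≤ τ₂ → ∀ v ∈ (d h).space,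
        c * (d h).normSq h γ ε (tauOne cτ b ε h) τ₂ v ≤ (d h).form h γ ε (tauOne cτ b ε h) τ₂ v v := by
    intro h hh
    have hhm : h ∈ Set.Ioc 0 hmax := ⟨hh.1, hh.2.trans ((min_le_left _ _).trans (min_le_left _ _))⟩
    have A := hApprox h hhm (hh.2.trans ((min_le_left _ _).trans (min_le_right _ _)))
    refine ⟨hhm, A, fun ε hε τ₂ hτ₂ v hv => ?_⟩
    have e1 := hs₁ h ⟨hh.1, hh.2.trans ((min_le_right _ _).trans (min_le_left _ _))⟩
    have e2 := hs₂ h ⟨hh.1, hh.2.trans ((min_le_right _ _).trans (min_le_right _ _))⟩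
    rw [Real.rpow_one] at e1
    refine A.mul_normSq_le_form hα₀ hY hcoeff.tangential hαc hβc (hC.coeff h hhm) hk0
      (fun y hy => (hcβ h hhm y hy).trans ?_) (fun y hy => (hcα h hhm y hy).trans ?_) hcs0
      (hst h hhm) hcτ hb hε ht₀ hτ₂ e1 e2 hv
    · exact mul_le_mul_of_nonneg_right (by linarith [le_abs_self cβ, abs_nonneg cα]) (sq_nonneg h)
    · exact mul_le_mul_of_nonneg_right (by linarith [le_abs_self cα, abs_nonneg cβ]) (sq_nonneg h)
  set N := 1 + cs + cτ * b⁻¹ * hmax * cs ^ 2 + b / (cτ * H) + cs ^ 2 / (b * H) with hN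
  have hN0 : 0 < N := by positivity
  have ha := hB.pos
  -- Chosen so that a - C h₀ ≤ -N/c whenever h₀ ≥ H. For h > H the claim then reduces to the crude
  -- lower bound with constant N.
  set C := (a + N / c) / H with hCd
  have hC0 : 0 < C := by positivity
  refine ⟨C, 1, c, hC0, one_pos, hc0, ?_, ?_⟩
  · intro h₀ hh₀ h hh ε hε τ₂ hτ₂ v hv
    have hnn := (d h).normSq_nonneg (γ := γ) hh.1 hε (tauOne_pos (ε := ε) hcτ hb hh.1).le
      (ht₀.le.trans hτ₂) v
    have hhm : h ∈ Set.Ioc 0 hmax := ⟨hh.1, hh.2.trans hh₀.2⟩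
    rw [← mul_assoc]
    -- For h ≤ H the minimum is at most 1 and only weakens true coercivity; for h > H also h₀ > H,
    -- and the minimum is negative enough.
    rcases le_or_gt h H with hle | hlt
    · refine le_trans (mul_le_mul_of_nonneg_right ?_ hnn) ((hsmall h ⟨hh.1, hle⟩).2.2 ε hε τ₂ hτ₂ v hv)
      exact mul_le_of_le_one_right hc0.le (min_le_left _ _)
    · refine le_trans ?_ (DiscreteData.neg_mul_normSq_le_form (hsurf h hhm) (hC.coeff h hhm) hcs0
        (hst h hhm) hcτ hb hH0 hlt.le hhm.2 hε (ht₀.le.trans hτ₂) hv)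
      rw [← neg_mul]
      refine mul_le_mul_of_nonneg_right ?_ hnn
      have h1 : min 1 (min (a - C * h₀) (1 - 1 * h₀ ^ (2 - γ))) ≤ a - C * h₀ :=
        (min_le_right _ _).trans (min_le_left _ _)
      have h2 : C * H ≤ C * h₀ := mul_le_mul_of_nonneg_left (hlt.le.trans hh.2) hC0.le
      have h3 : C * H = a + N / c := div_mul_cancel₀ _ hH0.ne'
      calc c * min 1 (min (a - C * h₀) (1 - 1 * h₀ ^ (2 - γ))) ≤ c * (-(N / c)) :=
            mul_le_mul_of_nonneg_left (by linarith) hc0.le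
        _ = -N := by field_simp
  -- The bound a/(2C) gives C h₀ ≤ a/2, and r₃ gives h₀^(2-γ) ≤ 1/2, so both entries of the minimum
  -- are positive.
  · have hr : 0 < min H (min (a / (2 * C)) r₃) := lt_min hH0 (lt_min (by positivity) hr₃)
    refine ⟨min H (min (a / (2 * C)) r₃), ⟨hr, (min_le_left _ _).trans
      ((min_le_left _ _).trans (min_le_left _ _))⟩, ?_, ?_⟩
    · intro h₀ hh₀
      have h1 := hs₃ h₀ ⟨hh₀.1, hh₀.2.trans ((min_le_right _ _).trans (min_le_right _ _))⟩
      have h2 : h₀ ≤ a / (2 * C) := hh₀.2.trans ((min_le_right _ _).trans (min_le_left _ _))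
      rw [le_div_iff₀ (by positivity)] at h2
      exact lt_min one_pos (lt_min (by linarith) (by linarith))
    · intro h hh ε hε τ₂ hτ₂ f hf
      obtain ⟨hhm, A, hcoer⟩ := hsmall h ⟨hh.1, hh.2.trans (min_le_left _ _)⟩
      exact A.existsUnique_solution (hC.coeff h hhm) hc0 hε (tauOne_pos (ε := ε) hcτ hb hh.1).le
        (ht₀.trans_le hτ₂) (hcoer ε hε τ₂ hτ₂) hf
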